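/- Conventions. Let $(M,\omega_{-1})$ be a Kähler manifold of complex dimension $n$; in every holomorphic chart $\omega_{-1}=i g_{kl}\,dz^k\wedge d\bar z^l$ with $(g_{kl})$ Hermitian positive definite, $(g^{lk})$ is the inverse matrix, and summation over repeated indices is understood. The Poisson bracket is $\{f,h\}=i g^{lk}(\partial_k f\,\bar\partial_l h-\bar\partial_l f\,\partial_k h)$. Let $\mathcal F=C^\infty(M)[\nu^{-1},\nu]]$ be the formal functions (Laurent series in $\nu$ with finite principal part). A star-product on $(M,\omega_{-1})$ is an associative product $\ast$ on $\mathcal F$ with unit $1$ that is the $\mathbb C[\nu^{-1},\nu]]$-bilinear, $\nu$-adically continuous extension of $f\ast h=\sum_{r\ge0}\nu^rC_r(f,h)$, $f,h\in C^\infty(M)$, where the $C_r$ are bidifferential operators, $C_0(f,h)=fh$ and $C_1(f,h)-C_1(h,f)=i\{f,h\}$; being given by bidifferential operators, it restricts to open subsets $U$, and $L^\ast_u$, $R^\ast_u$ denote left and right star-multiplication by a formal function $u$ on $U$. It has separation of variables if in every holomorphic chart each $C_r$ acts on the first argument by antiholomorphic and on the second one by holomorphic derivatives. A formal deformation of $\frac1\nu\omega_{-1}$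 is a series $\omega=\frac1\nu\omega_{-1}+\omega_0+\nu\omega_1+\cdots$ of closed $(1,1)$-forms. A star-product $\ast$ with separation of variables corresponds to $\omega$ if on every holomorphic chart $(U,\{z^k\})$ and for every formal potential $\Phi=\frac1\nu\Phi_{-1}+\Phi_0+\nu\Phi_1+\cdots$ of $\omega$ on $U$ (that is, $\omega=i\partial\bar\partial\Phi$) one has, as operators on the formal functions on $U$, $$L^\ast_{z^k}=z^k,\quad L^\ast_{\partial\Phi/\partial z^k}=\frac{\partial\Phi}{\partial z^k}+\frac{\partial}{\partial z^k},\quad R^\ast_{\bar z^l}=\bar z^l,\quad R^\ast_{\partial\Phi/\partial\bar z^l}=\frac{\partial\Phi}{\partial\bar z^l}+\frac{\partial}{\partial\bar z^l}.$$ The Fedosov construction of Wick type. Let $\mathcal W$ be the space of global sections $w=\sum_{r\ge r_0}\nu^r\sum_{\alpha,\beta}w_{r,\alpha,\beta}\zeta^\alpha\bar\zeta^\beta$ of the bundle of formal series in $\nu$ (with finite principal part) and in the fibre coordinates $\zeta^k,\bar\zeta^l$ of $TM$; the coefficients $w_{r,\alpha,\beta}$ are covariant tensor fields. Let $\Lambda$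 be the differential forms on $M$. The fibrewise Wick product $$a\circ b=\sum_{j\ge0}\frac{\nu^j}{j!}g^{l_1k_1}\cdots g^{l_jk_j}\frac{\partial^ja}{\partial\bar\zeta^{l_1}\cdots\partial\bar\zeta^{l_j}}\frac{\partial^jb}{\partial\zeta^{k_1}\cdots\partial\zeta^{k_j}}$$ together with the wedge product makes $\mathcal W\otimes\Lambda$ an algebra, with graded commutator $\mathrm{ad}_{Wick}$. Let $\Pi w=w|_{\zeta=\bar\zeta=0}$, let $\delta=dz^k\,\partial/\partial\zeta^k+d\bar z^l\,\partial/\partial\bar\zeta^l$, and let $\delta^{-1}$ be $(p+q)^{-1}(\zeta^k i(\partial/\partial z^k)+\bar\zeta^l i(\partial/\partial\bar z^l))$ on $q$-forms of degree $p$ in $\zeta,\bar\zeta$ if $p+q>0$, and $0$ if $p+q=0$. Let $\nabla=d-\Gamma_{ki}^s\zeta^i\frac{\partial}{\partial\zeta^s}dz^k-\Gamma_{lj}^t\bar\zeta^j\frac{\partial}{\partial\bar\zeta^t}d\bar z^l$ be the Kähler connection, with $\Gamma_{ki}^s=g^{ls}\partial g_{kl}/\partial z^i$ and $\Gamma_{lj}^t=g^{tk}\partial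 g_{kl}/\partial\bar z^j$, and let $R=(-g^{ts}\partial g_{kt}\wedge\bar\partial g_{sl}+\partial\bar\partial g_{kl})\zeta^k\bar\zeta^l$. Theorem. (1) There is exactly one $r\in\mathcal W\otimes\Lambda^1$ which contains only non-negative powers of $\nu$, has only terms of total degree $2\deg_\nu+\deg_\zeta+\deg_{\bar\zeta}\ge2$, and satisfies $\delta^{-1}r=0$ and $\delta r=R+\nabla r+\frac1\nu r\circ r$. (2) Let $D=-\delta+\nabla+\frac1\nu\mathrm{ad}_{Wick}(r)$ and $\mathcal W_D=\mathcal W\cap\mathrm{Ker}\,D$. Then $\mathcal W_D$ is closed under $\circ$, and $\Pi:\mathcal W_D\to\mathcal F$ is a bijection. Let $\ast$ be the product on $\mathcal F$ transferred from $(\mathcal W_D,\circ)$ by this bijection (the Fedosov star-product of Wick type of Bordemann and Waldmann). (3) $\ast$ is a star-product with separation of variables on $(M,\omega_{-1})$, and it corresponds to the trivial deformation $\omega=\frac1\nu\omega_{-1}$. It is the only one: if $\ast'$ is a star-product with separation of variables on $(M,\omega_{-1})$ and every point of $M$ lies in some holomorphic chart on which $\frac1\nu\omega_{-1}$ has a formal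 potential $\Phi$ such that the four relations above hold there for $\ast'$ and $\Phi$, then $\ast'=\ast$. -/

import Mathlib

open scoped Manifold ContDiff Topology ComplexOrder

noncomputable section

namespace FedosovWick

/-! ### Charts, functions and Wirtinger derivatives -/

/-- Indices of the real coordinate directions of a complex chart in complexified form:
`Sum.inl k` stands for `z^k` (or `ζ^k`), `Sum.inr l` for its conjugate. -/
abbrev Idx (n : ℕ) : Type := Fin n ⊕ Fin n

/-- All holomorphic charts (coordinate systems on open subsets) of a complex manifold: the elements
of its maximal holomorphic atlas. The chart domain is `e.1.source`. -/
abbrev HolChart (n : ℕ) (M : Type*) [TopologicalSpace M] [ChartedSpace (Fin n → ℂ) M] : Type _ :=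
  {e : OpenPartialHomeomorph M (Fin n → ℂ) //
    e ∈ IsManifold.maximalAtlas 𝓘(ℂ, Fin n → ℂ) ω M}

/-- Smooth (real `C^∞`) complex valued functions on `M`. -/
abbrev SmoothFun (n : ℕ) (M : Type*) [TopologicalSpace M] [ChartedSpace (Fin n → ℂ) M] : Type _ :=
  C^∞⟮𝓘(ℝ, Fin n → ℂ), M; 𝓘(ℝ, ℂ), ℂ⟯

/-- Multiplication of complex numbers is smooth over the reals, so that `SmoothFun n M` is a ring
under pointwise operations. -/
instance : ContMDiffRing 𝓘(ℝ, ℂ) ∞ ℂ where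
  contMDiff_mul := by
    rw [contMDiff_iff]
    refine ⟨continuous_mul, fun x y => ?_⟩
    simp only [mfld_simps, chartAt_self_eq]
    exact contDiff_mul.contDiffOn

/-- Formal functions on `M`: formal Laurent series in `ν` with finite principal part whose
coefficients are smooth functions. -/
abbrev FormalFun (n : ℕ) (M : Type*) [TopologicalSpace M] [ChartedSpace (Fin n → ℂ) M] : Type _ :=
  LaurentSeries (SmoothFun n M)

section Basic

variable {n : ℕ} {M : Type*} [TopologicalSpace M] [ChartedSpace (Fin n → ℂ) M]

/-- `f` is smooth (real `C^∞`) on the subset `U` of `M`. -/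
def SmoothOn (n : ℕ) {M : Type*} [TopologicalSpace M] [ChartedSpace (Fin n → ℂ) M]
    (f : M → ℂ) (U : Set M) : Prop :=
  ContMDiffOn 𝓘(ℝ, Fin n → ℂ) 𝓘(ℝ, ℂ) ∞ f U

/-- The Wirtinger derivatives in the chart `e`: `pd e (inl k) f = ∂f/∂z^k` and
`pd e (inr l) f = ∂f/∂z̄^l`. (Meaningful on the chart domain only.) -/
def pd (e : HolChart n M) (I : Idx n) : ZeroHom (M → ℂ) (M → ℂ) where
  toFun f x :=
    let D : (Fin n → ℂ) → ℂ := fderiv ℝ (fun z => f (e.1.symm z)) (e.1 x)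
    match I with
    | Sum.inl k => (D (Pi.single k 1) - Complex.I * D (Pi.single k Complex.I)) / 2
    | Sum.inr l => (D (Pi.single l 1) + Complex.I * D (Pi.single l Complex.I)) / 2
  map_zero' := by
    funext x
    cases I <;> simp

/-- Iterated Wirtinger derivatives. -/
def pdList (e : HolChart n M) (L : List (Idx n)) (f : M → ℂ) : M → ℂ :=
  L.foldr (fun I h => pd e I h) f

/-- The coordinate functions `z^k` and `z̄^l` of a chart. -/
def coord (e : HolChart n M) (I : Idx n) : M → ℂ :=
  match I with
  | Sum.inl k => fun x => e.1 x k
  | Sum.inr l => fun x => (starRingEnd ℂ) (e.1 x l)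

/-- The (complexified) Jacobian matrix `∂(z', z̄')^I / ∂(z, z̄)^J` of a change of charts, where
`(z, z̄)` are the coordinates of `e` and `(z', z̄')` those of `e'`. -/
def jac (e e' : HolChart n M) (I J : Idx n) : M → ℂ := pd e J (coord e' I)

/-! ### Closed (1,1)-forms and Kähler forms -/

/-- The functions `h_{kl}`, given in every chart, are the components of a globally defined smooth
closed `(1,1)`-form `i h_{kl} dz^k ∧ dz̄^l`. -/
structure IsClosedOneOneForm (h : HolChart n M → Fin n → Fin n → M → ℂ) : Prop where
  smooth : ∀ e k l, SmoothOn n (h e k l) e.1.source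
  transform : ∀ e e' k l, ∀ x ∈ e.1.source ∩ e'.1.source,
    h e k l x = ∑ p, ∑ q,
      jac e e' (Sum.inl p) (Sum.inl k) x * jac e e' (Sum.inr q) (Sum.inr l) x * h e' p q x
  closed_hol : ∀ e i k l, ∀ x ∈ e.1.source,
    pd e (Sum.inl i) (h e k l) x = pd e (Sum.inl k) (h e i l) x
  closed_antihol : ∀ e j k l, ∀ x ∈ e.1.source,
    pd e (Sum.inr j) (h e k l) x = pd e (Sum.inr l) (h e k j) x

/-- A Kähler form `ω₋₁ = i g_{kl} dz^k ∧ dz̄^l` on `M`: a closed `(1,1)`-form whose component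
matrices are Hermitian and positive definite. -/
structure KahlerForm (n : ℕ) (M : Type*) [TopologicalSpace M] [ChartedSpace (Fin n → ℂ) M] where
  g : HolChart n M → Fin n → Fin n → M → ℂ
  isClosedForm : IsClosedOneOneForm g
  posDef : ∀ e : HolChart n M, ∀ x ∈ e.1.source, (Matrix.of fun k l => g e k l x).PosDef

/-- The inverse matrix `g^{lk}`, so that `∑_l g_{kl} g^{lk'} = δ_k^{k'}`. -/
def KahlerForm.ginv (K : KahlerForm n M) (e : HolChart n M) (l k : Fin n) : M → ℂ :=
  fun x => (Matrix.of fun a b => K.g e a b x)⁻¹ l k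

/-- The Poisson bracket `{f, h} = i g^{lk} (∂_k f ∂̄_l h - ∂̄_l f ∂_k h)` of the Kähler form. -/
def KahlerForm.poisson (K : KahlerForm n M) (e : HolChart n M) (f h : M → ℂ) : M → ℂ :=
  fun x => Complex.I * ∑ l, ∑ k, K.ginv e l k x *
    (pd e (Sum.inl k) f x * pd e (Sum.inr l) h x - pd e (Sum.inr l) f x * pd e (Sum.inl k) h x)

/-- Christoffel symbols. `christoffel e (inl k) (inl i) (inl s) = Γ_{ki}^s = g^{ls} ∂_i g_{kl}` and
`christoffel e (inr l) (inr j) (inr t) = Γ_{lj}^t = g^{tk} ∂̄_j g_{kl}`; the symbols with indices of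
mixed type are zero. -/
def KahlerForm.christoffel (K : KahlerForm n M) (e : HolChart n M) : Idx n → Idx n → Idx n → M → ℂ
  | Sum.inl k, Sum.inl i, Sum.inl s => fun x => ∑ l, K.ginv e l s x * pd e (Sum.inl i) (K.g e k l) x
  | Sum.inr l, Sum.inr j, Sum.inr t => fun x => ∑ k, K.ginv e t k x * pd e (Sum.inr j) (K.g e k l) x
  | _, _, _ => 0

/-! ### Sections of the bundle of formal Wick algebras -/

/-- Local expressions of sections of the bundle of formal Wick algebras: series
`∑ ν^r w_{r,α,β} ζ^α ζ̄^β` with finite principal part in `ν`, with functions as coefficients. -/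
abbrev WLoc (n : ℕ) (M : Type*) : Type _ := LaurentSeries (MvPowerSeries (Idx n) (M → ℂ))

/-- The coefficient function of `ν^r ζ^m`, where `m` is a multi-index in all of `ζ, ζ̄`. -/
def wcoeff (a : WLoc n M) (r : ℤ) (m : Idx n →₀ ℕ) : M → ℂ :=
  MvPowerSeries.coeff m (a.coeff r)

/-- Two local expressions have the same coefficients at all points of `U`. -/
def EqOver (U : Set M) (a b : WLoc n M) : Prop :=
  ∀ r m, ∀ x ∈ U, wcoeff a r m x = wcoeff b r m x

/-- The formal power series in `ζ, ζ̄` obtained by evaluating the coefficients at a point. -/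
def evalAt (x : M) : MvPowerSeries (Idx n) (M → ℂ) →+* MvPowerSeries (Idx n) ℂ :=
  MvPowerSeries.map (Pi.evalRingHom (fun _ : M => ℂ) x)

/-- The action on fibres of a change of charts: substitution of
`ζ'^I = ∑_J (∂z'^I/∂z^J) ζ^J` (with `I`, `J` running over both kinds of indices). -/
def pullback (e e' : HolChart n M) (x : M) (a : MvPowerSeries (Idx n) ℂ) :
    MvPowerSeries (Idx n) ℂ :=
  MvPowerSeries.subst
    (fun I : Idx n => ∑ J, MvPowerSeries.C (jac e e' I J x) * MvPowerSeries.X J) a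

/-- Global sections over `M` of the bundle of formal Wick algebras, given by their expressions in
all charts (extended by zero outside the chart domain, which makes them unique). -/
@[ext]
structure WSection (n : ℕ) (M : Type*) [TopologicalSpace M] [ChartedSpace (Fin n → ℂ) M] where
  loc : HolChart n M → WLoc n M
  bounded : ∃ N : ℤ, ∀ e, ∀ r < N, (loc e).coeff r = 0
  smooth : ∀ e r m, SmoothOn n (wcoeff (loc e) r m) e.1.source
  zero_off : ∀ e r m, ∀ x ∉ e.1.source, wcoeff (loc e) r m x = 0
  transform : ∀ e e', ∀ x ∈ e.1.source ∩ e'.1.source, ∀ r,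
    evalAt x ((loc e).coeff r) = pullback e e' x (evalAt x ((loc e').coeff r))

/-- Global one-forms on `M` with values in the bundle of formal Wick algebras,
`a = a_k dz^k + a_l̄ dz̄^l`, given by their components in all charts. -/
@[ext]
structure WOneForm (n : ℕ) (M : Type*) [TopologicalSpace M] [ChartedSpace (Fin n → ℂ) M] where
  loc : HolChart n M → Idx n → WLoc n M
  bounded : ∃ N : ℤ, ∀ e I, ∀ r < N, (loc e I).coeff r = 0
  smooth : ∀ e I r m, SmoothOn n (wcoeff (loc e I) r m) e.1.source
  zero_off : ∀ e I r m, ∀ x ∉ e.1.source, wcoeff (loc e I) r m x = 0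
  transform : ∀ e e', ∀ x ∈ e.1.source ∩ e'.1.source, ∀ J r,
    evalAt x ((loc e J).coeff r) =
      ∑ I, MvPowerSeries.C (jac e e' I J x) * pullback e e' x (evalAt x ((loc e' I).coeff r))

/-! ### Operations on local expressions -/

/-- The formal derivative `∂/∂ζ^k` (`I = inl k`) or `∂/∂ζ̄^l` (`I = inr l`). -/
def dfib (I : Idx n) (a : WLoc n M) : WLoc n M :=
  a.map (MvPowerSeries.pderiv (M → ℂ) I)

/-- The derivative `∂/∂z^k` or `∂/∂z̄^l` of all coefficients. -/
def dbase (e : HolChart n M) (I : Idx n) (a : WLoc n M) : WLoc n M :=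
  a.map (⟨fun p m => pd e I (MvPowerSeries.coeff m p), by funext m; simp; rfl⟩ :
    ZeroHom (MvPowerSeries (Idx n) (M → ℂ)) (MvPowerSeries (Idx n) (M → ℂ)))

/-- The fibre coordinate `ζ^k` or `ζ̄^l`. -/
def fibX (I : Idx n) : WLoc n M := HahnSeries.C (MvPowerSeries.X I)

/-- A function on the base as a local expression. -/
def baseC (f : M → ℂ) : WLoc n M := HahnSeries.C (MvPowerSeries.C f)

/-- `ν⁻¹`. -/
def nuInv : WLoc n M := HahnSeries.single (-1) 1

/-- `g^{l₁k₁} ⋯ g^{l_jk_j} (∂^j a / ∂ζ̄^{l₁} ⋯ ∂ζ̄^{l_j}) (∂^j b / ∂ζ^{k₁} ⋯ ∂ζ^{k_j})`. -/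
def wickTerm (K : KahlerForm n M) (e : HolChart n M) : ℕ → WLoc n M → WLoc n M → WLoc n M
  | 0, a, b => a * b
  | j + 1, a, b => ∑ l, ∑ k,
      baseC (K.ginv e l k) * wickTerm K e j (dfib (Sum.inr l) a) (dfib (Sum.inl k) b)

theorem coeff_mul_eq_zero {R : Type*} [Semiring R] {a b : LaurentSeries R} {p q : ℤ}
    (ha : ∀ r < p, a.coeff r = 0) (hb : ∀ r < q, b.coeff r = 0) :
    ∀ r < p + q, (a * b).coeff r = 0 := by
  intro r hr
  rw [HahnSeries.coeff_mul]
  refine Finset.sum_eq_zero fun ij hij => ?_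
  rw [Finset.mem_antidiagonal] at hij
  by_cases h : ij.1 < p
  · rw [ha _ h, zero_mul]
  · rw [hb ij.2 (by omega), mul_zero]

theorem coeff_wickTerm_eq_zero (K : KahlerForm n M) (e : HolChart n M) (j : ℕ) :
    ∀ (a b : WLoc n M) (p q : ℤ), (∀ r < p, a.coeff r = 0) → (∀ r < q, b.coeff r = 0) →
      ∀ r < p + q, (wickTerm K e j a b).coeff r = 0 := by
  induction j with
  | zero => intro a b p q ha hb; exact coeff_mul_eq_zero ha hb
  | succ j ih =>
    intro a b p q ha hb r hr
    simp only [wickTerm, HahnSeries.coeff_sum]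
    refine Finset.sum_eq_zero fun l _ => Finset.sum_eq_zero fun k _ => ?_
    rw [baseC, HahnSeries.C_apply, HahnSeries.coeff_single_zero_mul,
      ih _ _ p q (fun r hr => by simp [dfib, ha r hr]) (fun r hr => by simp [dfib, hb r hr]) r hr,
      mul_zero]

/-- The fibrewise Wick product `a ∘ b = ∑_j ν^j/j! g^{l₁k₁} ⋯ g^{l_jk_j}
(∂^j a / ∂ζ̄^{l₁} ⋯ ∂ζ̄^{l_j}) (∂^j b / ∂ζ^{k₁} ⋯ ∂ζ^{k_j})`. For each power of `ν` only finitely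
many `j` contribute. -/
def wick (K : KahlerForm n M) (e : HolChart n M) (a b : WLoc n M) : WLoc n M :=
  HahnSeries.ofSuppBddBelow
    (fun r => ∑ᶠ j : ℕ, ((j.factorial : ℂ)⁻¹) • (wickTerm K e j a b).coeff (r - j)) (by
      refine ⟨a.order + b.order, fun r hr => ?_⟩
      by_contra h
      refine hr (finsum_eq_zero_of_forall_eq_zero fun j => ?_)
      rw [coeff_wickTerm_eq_zero K e j a b a.order b.order
        (fun _ => HahnSeries.coeff_eq_zero_of_lt_order)
        (fun _ => HahnSeries.coeff_eq_zero_of_lt_order) _ (by omega), smul_zero])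

/-- The components `∇_I = ∂/∂z^I - Γ_{IA}^S ζ^A ∂/∂ζ^S` of the Kähler connection on sections of
the bundle of formal Wick algebras. -/
def nabla (K : KahlerForm n M) (e : HolChart n M) (I : Idx n) (a : WLoc n M) : WLoc n M :=
  dbase e I a - ∑ A, ∑ S, baseC (K.christoffel e I A S) * fibX A * dfib S a

/-- The components of the curvature element
`R = (-g^{ts} ∂g_{kt} ∧ ∂̄g_{sl} + ∂∂̄g_{kl}) ζ^k ζ̄^l`, that is `R = ½ R_{IJ} dz^I ∧ dz^J` with
`R_{IJ}` antisymmetric. -/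
def KahlerForm.curv (K : KahlerForm n M) (e : HolChart n M) : Idx n → Idx n → WLoc n M
  | Sum.inl p, Sum.inr q => curvPQ p q
  | Sum.inr q, Sum.inl p => -curvPQ p q
  | _, _ => 0
where
  curvPQ (p q : Fin n) : WLoc n M := ∑ k, ∑ l,
    baseC (-(∑ t, ∑ s, K.ginv e t s * pd e (Sum.inl p) (K.g e k t) * pd e (Sum.inr q) (K.g e s l))
      + pd e (Sum.inl p) (pd e (Sum.inr q) (K.g e k l))) * fibX (Sum.inl k) * fibX (Sum.inr l)

/-- Fedosov's operator `δ⁻¹` on one-forms `a = a_I dz^I`: on the part of degree `p` in `ζ, ζ̄` it is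
`(p+1)⁻¹ ζ^I a_I`. -/
def deltaInv (a : Idx n → WLoc n M) : WLoc n M :=
  (∑ I, fibX I * a I).map
    (⟨fun p m => ((m.degree : ℂ)⁻¹) • MvPowerSeries.coeff m p, by funext m; simp; rfl⟩ :
      ZeroHom (MvPowerSeries (Idx n) (M → ℂ)) (MvPowerSeries (Idx n) (M → ℂ)))

/-- The components of `δa`, where `a = a_I dz^I` is a one-form and `δ = dz^I ∂/∂ζ^I`. -/
def delta₁ (a : Idx n → WLoc n M) (I J : Idx n) : WLoc n M := dfib I (a J) - dfib J (a I)

/-- The components of `∇a` for a one-form `a = a_I dz^I`. -/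
def nabla₁ (K : KahlerForm n M) (e : HolChart n M) (a : Idx n → WLoc n M) (I J : Idx n) :
    WLoc n M :=
  nabla K e I (a J) - nabla K e J (a I)

/-- The components of `a ∘ a` for a one-form `a = a_I dz^I`. -/
def wickSq₁ (K : KahlerForm n M) (e : HolChart n M) (a : Idx n → WLoc n M) (I J : Idx n) :
    WLoc n M :=
  wick K e (a I) (a J) - wick K e (a J) (a I)

/-- The components of `Dw = -δw + ∇w + (1/ν) ad_Wick(r) w` for a section `w`. -/
def fedosovD (K : KahlerForm n M) (e : HolChart n M) (r : Idx n → WLoc n M) (I : Idx n)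
    (w : WLoc n M) : WLoc n M :=
  -dfib I w + nabla K e I w + nuInv * (wick K e (r I) w - wick K e w (r I))

/-! ### The Fedosov star-product of Wick type -/

/-- The element `r` that defines the Fedosov connection: `δ⁻¹r = 0`,
`δr = R + ∇r + (1/ν) r ∘ r`, only non-negative powers of `ν` occur in `r`, and all terms of `r` have
total degree `Deg = 2 deg_ν + deg_s` at least two. -/
structure IsFedosovElement (K : KahlerForm n M) (r : WOneForm n M) : Prop where
  nonneg : ∀ e I, ∀ k < 0, (r.loc e I).coeff k = 0
  degree : ∀ e I (k : ℤ) (m : Idx n →₀ ℕ), 2 * k + m.degree < 2 → wcoeff (r.loc e I) k m = 0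
  deltaInv_eq : ∀ e, EqOver e.1.source (deltaInv (r.loc e)) 0
  delta_eq : ∀ e I J, EqOver e.1.source (delta₁ (r.loc e) I J)
    (K.curv e I J + nabla₁ K e (r.loc e) I J + nuInv * wickSq₁ K e (r.loc e) I J)

/-- `w` belongs to the Fedosov algebra: `Dw = 0`. -/
def IsFlat (K : KahlerForm n M) (r : WOneForm n M) (w : WSection n M) : Prop :=
  ∀ e I, EqOver e.1.source (fedosovD K e (r.loc e) I (w.loc e)) 0

/-- `f = Π w`, the part of `w` that does not contain `ζ, ζ̄`. -/
def IsSymbol (w : WSection n M) (f : FormalFun n M) : Prop :=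
  ∀ e : HolChart n M, ∀ k, ∀ x ∈ e.1.source, wcoeff (w.loc e) k 0 x = f.coeff k x

/-- `w = u ∘ v`, the fibrewise Wick product of sections. -/
def IsWickProduct (K : KahlerForm n M) (u v w : WSection n M) : Prop :=
  ∀ e : HolChart n M, EqOver e.1.source (w.loc e) (wick K e (u.loc e) (v.loc e))

/-- `Π` is a bijection from the Fedosov algebra `Ker D` of the connection defined by `r` onto the
formal functions, `Ker D` is closed under the Wick product, and `star` is the product that is
transferred from `Ker D` to the formal functions by `Π`. -/
structure IsFedosovProduct (K : KahlerForm n M) (r : WOneForm n M)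
    (star : FormalFun n M → FormalFun n M → FormalFun n M) : Prop where
  symbol : ∀ w, IsFlat K r w → ∃! f, IsSymbol w f
  lift : ∀ f, ∃! w, IsFlat K r w ∧ IsSymbol w f
  mul : ∀ u v f h, IsFlat K r u → IsFlat K r v → IsSymbol u f → IsSymbol v h →
    ∃ w, IsFlat K r w ∧ IsWickProduct K u v w ∧ IsSymbol w (star f h)

/-! ### Star-products and separation of variables -/

/-- `C` is a bidifferential operator with smooth coefficients of the form
`C(f, h) = ∑ c_{a,b} ∂^a f ∂^b h` in every chart, where the derivatives on the first (second)
argument are only in directions from the range of `p` (of `q`). -/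
def IsBidifferential {ι κ : Type} (p : ι → Idx n) (q : κ → Idx n)
    (C : SmoothFun n M → SmoothFun n M → SmoothFun n M) : Prop :=
  ∃ (S : Finset (List ι)) (T : Finset (List κ)), ∀ e : HolChart n M,
    ∃ c : List ι → List κ → M → ℂ, (∀ a b, SmoothOn n (c a b) e.1.source) ∧
      ∀ (f h : SmoothFun n M), ∀ x ∈ e.1.source,
        C f h x = ∑ a ∈ S, ∑ b ∈ T,
          c a b x * pdList e (a.map p) f x * pdList e (b.map q) h x

/-- The operators `C_r` of a product `f ∗ h = ∑ ν^r C_r(f, h)`. -/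
def cochain (star : FormalFun n M → FormalFun n M → FormalFun n M) (r : ℕ)
    (f h : SmoothFun n M) : SmoothFun n M :=
  (star (HahnSeries.C f) (HahnSeries.C h)).coeff r

/-- Star-products on `(M, ω₋₁)`. The field `expansion` says that the product is the bilinear,
`ν`-adically continuous extension of `f ∗ h = ∑ ν^r C_r(f, h)`. -/
structure IsStarProduct (K : KahlerForm n M)
    (star : FormalFun n M → FormalFun n M → FormalFun n M) : Prop where
  bidifferential : ∀ r, IsBidifferential (id : Idx n → Idx n) id (cochain star r)
  expansion : ∀ f h m, (star f h).coeff m =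
    ∑ᶠ p : ℕ × ℤ, cochain star p.1 (f.coeff p.2) (h.coeff (m - p.1 - p.2))
  cochain_zero : ∀ f h, cochain star 0 f h = f * h
  cochain_one : ∀ (f h : SmoothFun n M) (e : HolChart n M), ∀ x ∈ e.1.source,
    cochain star 1 f h x - cochain star 1 h f x = Complex.I * K.poisson e f h x
  assoc : ∀ f h k, star (star f h) k = star f (star h k)
  one_mul : ∀ f, star 1 f = f
  mul_one : ∀ f, star f 1 = f

/-- Separation of variables: in every holomorphic chart the operators `C_r` act on the first
argument by antiholomorphic derivatives and on the second one by holomorphic derivatives. -/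
def HasSeparationOfVariables (star : FormalFun n M → FormalFun n M → FormalFun n M) : Prop :=
  ∀ r, IsBidifferential (Sum.inr : Fin n → Idx n) (Sum.inl : Fin n → Idx n) (cochain star r)

/-! ### Localization and Karabegov's parametrization -/

/-- The formal function `F` coincides with `f` in a neighbourhood of `x`. -/
def AgreeNear (F : FormalFun n M) (f : LaurentSeries (M → ℂ)) (x : M) : Prop :=
  ∀ᶠ y in 𝓝 x, ∀ k, F.coeff k y = f.coeff k y

/-- All coefficients of the local formal function `f` are smooth on `U`. -/
def FormalSmoothOn (n : ℕ) {M : Type*} [TopologicalSpace M] [ChartedSpace (Fin n → ℂ) M]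
    (f : LaurentSeries (M → ℂ)) (U : Set M) : Prop :=
  ∀ k, SmoothOn n (f.coeff k) U

/-- `t = f ∗ h` on the open set `U` for formal functions `f`, `h` on `U`, where `∗` is localized to
`U`: the value at `x ∈ U` is computed from any globally defined formal functions that coincide with
`f` and `h` near `x`. -/
def IsLocalProduct (star : FormalFun n M → FormalFun n M → FormalFun n M) (U : Set M)
    (f h t : LaurentSeries (M → ℂ)) : Prop :=
  ∀ x ∈ U, ∀ F H, AgreeNear F f x → AgreeNear H h x → ∀ k, (star F H).coeff k x = t.coeff k x

/-- `L_u = T`: the left star-multiplication by `u` on the formal functions on `U` is `T`. -/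
def LeftMulEq (star : FormalFun n M → FormalFun n M → FormalFun n M) (U : Set M)
    (u : LaurentSeries (M → ℂ)) (T : LaurentSeries (M → ℂ) → LaurentSeries (M → ℂ)) : Prop :=
  ∀ f, FormalSmoothOn n f U → IsLocalProduct star U u f (T f)

/-- `R_u = T`: the right star-multiplication by `u` on the formal functions on `U` is `T`. -/
def RightMulEq (star : FormalFun n M → FormalFun n M → FormalFun n M) (U : Set M)
    (u : LaurentSeries (M → ℂ)) (T : LaurentSeries (M → ℂ) → LaurentSeries (M → ℂ)) : Prop :=
  ∀ f, FormalSmoothOn n f U → IsLocalProduct star U f u (T f)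

/-- The derivative `∂/∂z^k` or `∂/∂z̄^l` of a local formal function. -/
def pdF (e : HolChart n M) (I : Idx n) (f : LaurentSeries (M → ℂ)) : LaurentSeries (M → ℂ) :=
  f.map (pd e I)

/-- Formal deformations `ω = (1/ν) ω₋₁ + ω₀ + ν ω₁ + ⋯` of the form `(1/ν) ω₋₁`, where all `ω_r`
are closed `(1,1)`-forms; `form e k l` are the components, `ω = i ω_{kl} dz^k ∧ dz̄^l`. -/
structure FormalDeformation (K : KahlerForm n M) where
  form : HolChart n M → Fin n → Fin n → LaurentSeries (M → ℂ)
  coeff_lt : ∀ e k l, ∀ r < -1, (form e k l).coeff r = 0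
  coeff_neg_one : ∀ e k l, ∀ x ∈ e.1.source, (form e k l).coeff (-1) x = K.g e k l x
  closed : ∀ r, IsClosedOneOneForm fun e k l => (form e k l).coeff r

theorem isClosedOneOneForm_zero :
    IsClosedOneOneForm (fun (_ : HolChart n M) (_ _ : Fin n) => (0 : M → ℂ)) where
  smooth _ _ _ := contMDiffOn_const
  transform := by intros; simp
  closed_hol := by intros; simp
  closed_antihol := by intros; simp

/-- The trivial deformation `ω = (1/ν) ω₋₁`. -/
def trivialDeformation (K : KahlerForm n M) : FormalDeformation K where
  form e k l := HahnSeries.single (-1) (K.g e k l)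
  coeff_lt e k l r hr := HahnSeries.coeff_single_of_ne (ne_of_lt hr)
  coeff_neg_one e k l x _ := by rw [HahnSeries.coeff_single_same]
  closed r := by
    by_cases h : r = -1
    · subst h
      simpa only [HahnSeries.coeff_single_same] using K.isClosedForm
    · simpa only [HahnSeries.coeff_single_of_ne h] using isClosedOneOneForm_zero

/-- `Φ = (1/ν) Φ₋₁ + Φ₀ + ν Φ₁ + ⋯` is a formal potential of `ω` on the domain of the chart `e`:
`ω = i ∂∂̄Φ` there. -/
structure IsFormalPotential {K : KahlerForm n M} (Ω : FormalDeformation K) (e : HolChart n M)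
    (Φ : LaurentSeries (M → ℂ)) : Prop where
  smooth : FormalSmoothOn n Φ e.1.source
  coeff_lt : ∀ r < -1, Φ.coeff r = 0
  potential : ∀ k l r, ∀ x ∈ e.1.source,
    (pdF e (Sum.inl k) (pdF e (Sum.inr l) Φ)).coeff r x = (Ω.form e k l).coeff r x

/-- The relations that determine the star-product with separation of variables on the domain of the
chart `e` by the potential `Φ`:
`L_{z^k} = z^k`, `L_{∂Φ/∂z^k} = ∂Φ/∂z^k + ∂/∂z^k`,
`R_{z̄^l} = z̄^l`, `R_{∂Φ/∂z̄^l} = ∂Φ/∂z̄^l + ∂/∂z̄^l`. -/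
structure KarabegovRelations (star : FormalFun n M → FormalFun n M → FormalFun n M)
    (e : HolChart n M) (Φ : LaurentSeries (M → ℂ)) : Prop where
  left_coord : ∀ k, LeftMulEq star e.1.source (HahnSeries.C (coord e (Sum.inl k)))
    fun f => HahnSeries.C (coord e (Sum.inl k)) * f
  left_potential : ∀ k, LeftMulEq star e.1.source (pdF e (Sum.inl k) Φ)
    fun f => pdF e (Sum.inl k) Φ * f + pdF e (Sum.inl k) f
  right_coord : ∀ l, RightMulEq star e.1.source (HahnSeries.C (coord e (Sum.inr l)))
    fun f => HahnSeries.C (coord e (Sum.inr l)) * f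
  right_potential : ∀ l, RightMulEq star e.1.source (pdF e (Sum.inr l) Φ)
    fun f => pdF e (Sum.inr l) Φ * f + pdF e (Sum.inr l) f

/-- `star` is a star-product with separation of variables on `(M, ω₋₁)` that corresponds to the
formal deformation `ω` of `(1/ν) ω₋₁`. -/
structure CorrespondsTo {K : KahlerForm n M} (Ω : FormalDeformation K)
    (star : FormalFun n M → FormalFun n M → FormalFun n M) : Prop where
  isStarProduct : IsStarProduct K star
  separation : HasSeparationOfVariables star
  relations : ∀ e Φ, IsFormalPotential Ω e Φ → KarabegovRelations star e Φ

end Basic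

end FedosovWick

end

open FedosovWick

open scoped Manifold ContDiff Topology ComplexOrder

noncomputable section

namespace FedosovWick

/-! ### Formal series in `ν` and in fibre variables over an arbitrary coefficient ring -/

/-! ### Laurent series in ν: orders and coefficientwise maps. -/

section LaurentLift

variable {A A' : Type*}

/-! Everything is reduced to algebra over the ring of smooth functions on an open subset of a chart
domain; the local results are then glued by uniqueness.

Over such a ring a section of the Wick bundle is a series in ν and the fibre variables (`Ser`),
filtered by the total degree 2 deg_ν + deg_s. The Wick product `wk` is associative because both
bracketings of three factors expand the exponential of one and the same sum of three commuting
contractions (`wtriple_eq`). The metric is parallel, so ∇ is a derivation of `wk`, and its curvature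
is the adjoint action of R divided by ν. Contraction with ζ inverts δ up to the Euler operator and
raises the total degree by one, while ∇ and ν⁻¹ ad(r), with r of degree at least two, do not lower
it. Hence the equation for r, and Dw = 0 with prescribed symbol, become fixed-point equations of
contractions. Their solutions satisfy the full equations, since the Bianchi identity, respectively
D² = 0, forces the defect to move up in the filtration until it vanishes (`FData.exists_isFed`,
`FData.IsFed.exists_flat`).

Uniqueness makes r and the flat lift τ natural under restriction and change of charts
(`KHom.oneForm_fed`, `KHom.P_tau`), so the local pieces glue.

The product ∘ differentiates its left factor only along ζ̄ and its right factor only along ζ.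
Therefore terms of the left factor that contain ζ, and terms of the right factor that contain ζ̄, do
not reach the symbol of a product. The iteration for r preserves the order conditions `Sep`; with
them the part of τ(f) without ζ is built from antiholomorphic derivatives of f, and the part without
ζ̄ from holomorphic ones (`df_of_flat`), which gives separation of variables. For u = ∂Φ/∂z^k, with
Φ a potential of the trivial deformation, τ(u) equals u + ν⁻¹ g_{kl} ζ̄^l modulo terms with ζ, and
multiplying by this element yields u + ∂/∂z^k (`KData.star_potential_left`).

For the uniqueness of the star-product one inducts on the order of the cochains. Associativity,
applied to f ∗ h ∗ ∂Φ/∂z̄^l, shows that the difference of the r-th cochains of two products, as a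
functional of h at a point, is multiplicative over the functions ∂Φ₋₁/∂z̄^l. By separation of
variables it sees only a finite holomorphic jet of h. On such jets these functions serve as
coordinates, because ∂_k ∂̄_l Φ₋₁ = g_{kl} is invertible. As the functional vanishes on 1, it
vanishes (`functional_eq_zero`, `cochain_eq_of_relations`). -/

/-- Coefficientwise application of an additive map to a Laurent series. -/
def liftL [AddCommGroup A] [AddCommGroup A'] (f : A →+ A') :
    LaurentSeries A →+ LaurentSeries A' where
  toFun a := a.map f
  map_zero' := by ext; simp
  map_add' a b := by ext; simp

@[simp]
theorem coeff_liftL [AddCommGroup A] [AddCommGroup A'] (f : A →+ A') (a : LaurentSeries A) (k : ℤ) :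
    (liftL f a).coeff k = f (a.coeff k) := rfl

/-- All terms of `a` have order at least `p` in `ν`. -/
def Van [Zero A] (p : ℤ) (a : LaurentSeries A) : Prop := ∀ r < p, a.coeff r = 0

theorem Van.mono [Zero A] {p q : ℤ} {a : LaurentSeries A} (h : Van p a) (hq : q ≤ p) : Van q a :=
  fun r hr => h r (hr.trans_le hq)

theorem van_order [Zero A] (a : LaurentSeries A) : Van a.order a :=
  fun _ => HahnSeries.coeff_eq_zero_of_lt_order

theorem van_zero [Zero A] (p : ℤ) : Van p (0 : LaurentSeries A) := fun _ _ => rfl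

theorem Van.add [AddCommGroup A] {p : ℤ} {a b : LaurentSeries A} (ha : Van p a) (hb : Van p b) :
    Van p (a + b) := fun r hr => by simp [ha r hr, hb r hr]

theorem Van.sub [AddCommGroup A] {p : ℤ} {a b : LaurentSeries A} (ha : Van p a) (hb : Van p b) :
    Van p (a - b) := fun r hr => by simp [ha r hr, hb r hr]

theorem Van.neg [AddCommGroup A] {p : ℤ} {a : LaurentSeries A} (ha : Van p a) :
    Van p (-a) := fun r hr => by simp [ha r hr]

theorem Van.sum [AddCommGroup A] {p : ℤ} {κ : Type*} {s : Finset κ} {a : κ → LaurentSeries A}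
    (ha : ∀ i ∈ s, Van p (a i)) : Van p (∑ i ∈ s, a i) := fun r hr => by
  rw [HahnSeries.coeff_sum]
  exact Finset.sum_eq_zero fun i hi => ha i hi r hr

theorem Van.mul [Ring A] {p q : ℤ} {a b : LaurentSeries A} (ha : Van p a) (hb : Van q b) :
    Van (p + q) (a * b) := coeff_mul_eq_zero ha hb

theorem Van.liftL [AddCommGroup A] [AddCommGroup A'] (f : A →+ A') {p : ℤ} {a : LaurentSeries A}
    (ha : Van p a) : Van p (liftL f a) := fun r hr => by simp [ha r hr]

theorem van_C [Ring A] (x : A) : Van 0 (HahnSeries.C x : LaurentSeries A) := fun _ hr =>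
  HahnSeries.coeff_single_of_ne hr.ne

theorem van_single [Zero A] (k : ℤ) (x : A) : Van k (HahnSeries.single k x : LaurentSeries A) :=
  fun _ hr => HahnSeries.coeff_single_of_ne hr.ne

theorem eq_zero_of_forall_van [Zero A] {a : LaurentSeries A} (h : ∀ p, Van p a) : a = 0 := by
  ext r
  exact h (r + 1) r (by omega)

/-- The antidiagonal in `HahnSeries.coeff_mul` depends on the supports of both factors. A range that
depends on lower bounds only can be shared by several products, which is what termwise comparison
needs. -/
theorem coeff_mul_of_van [Ring A] {p q : ℤ} {a b : LaurentSeries A} (ha : Van p a) (hb : Van q b)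
    (k : ℤ) : (a * b).coeff k = ∑ i ∈ Finset.Icc p (k - q), a.coeff i * b.coeff (k - i) := by
  rw [HahnSeries.coeff_mul]
  refine Finset.sum_bij_ne_zero (fun ij _ _ => ij.1) ?_ ?_ ?_ ?_
  · intro ij hij h
    rw [Finset.mem_antidiagonal] at hij
    rw [Finset.mem_Icc]
    constructor
    · by_contra hlt
      exact h (by rw [ha _ (by omega), zero_mul])
    · by_contra hlt
      exact h (by rw [hb ij.2 (by omega), mul_zero])
  · intro ij hij _ ij' hij' _ h
    rw [Finset.mem_antidiagonal] at hij hij'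
    ext <;> simp_all
    omega
  · intro i _ h
    refine ⟨(i, k - i), ?_, h, rfl⟩
    rw [Finset.mem_antidiagonal]
    refine ⟨fun h0 => h ?_, fun h0 => h ?_, by simp⟩
    · rw [h0, zero_mul]
    · rw [h0, mul_zero]
  · intro ij hij _
    rw [Finset.mem_antidiagonal] at hij
    rw [show k - ij.1 = ij.2 by omega]

theorem liftL_leibniz [Ring A] (f : A →+ A) (hf : ∀ x y, f (x * y) = f x * y + x * f y)
    (a b : LaurentSeries A) : liftL f (a * b) = liftL f a * b + a * liftL f b := by
  ext k
  rw [coeff_liftL, HahnSeries.coeff_add, coeff_mul_of_van (van_order a) (van_order b),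
    coeff_mul_of_van ((van_order a).liftL f) (van_order b),
    coeff_mul_of_van (van_order a) ((van_order b).liftL f), map_sum, ← Finset.sum_add_distrib]
  exact Finset.sum_congr rfl fun i _ => hf _ _

theorem liftL_mul [Ring A] [Ring A'] (f : A →+* A') (a b : LaurentSeries A) :
    liftL (f : A →+ A') (a * b) = liftL (f : A →+ A') a * liftL (f : A →+ A') b := by
  ext k
  rw [coeff_liftL, coeff_mul_of_van (van_order a) (van_order b),
    coeff_mul_of_van ((van_order a).liftL _) ((van_order b).liftL _), map_sum]
  exact Finset.sum_congr rfl fun i _ => map_mul f _ _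

theorem liftL_C [Ring A] [Ring A'] (f : A →+ A') (x : A) :
    liftL f (HahnSeries.C x) = HahnSeries.C (f x) := by
  ext k
  by_cases h : k = 0
  · subst h; simp [HahnSeries.C_apply]
  · simp [HahnSeries.C_apply, HahnSeries.coeff_single_of_ne h]

theorem liftL_single_mul [Ring A] [Ring A'] (f : A →+ A') (k : ℤ) (a : LaurentSeries A) :
    liftL f (HahnSeries.single k 1 * a) = HahnSeries.single k 1 * liftL f a := by
  ext r
  simp [HahnSeries.coeff_single_mul]

end LaurentLift

/-! ### Fibre variables, their derivatives, and derivations of the base. -/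

section Series

variable {ι B : Type*} [CommRing B]

/-- Formal Laurent series in `ν` whose coefficients are power series in the fibre variables. -/
abbrev Ser (ι B : Type*) [CommRing B] : Type _ := LaurentSeries (MvPowerSeries ι B)

/-- The coefficient of `ν^k ζ^m`. -/
def cf (a : Ser ι B) (k : ℤ) (m : ι →₀ ℕ) : B := MvPowerSeries.coeff m (a.coeff k)

theorem ser_ext {a b : Ser ι B} (h : ∀ k m, cf a k m = cf b k m) : a = b :=
  HahnSeries.ext (funext fun k => MvPowerSeries.ext fun m => h k m)

@[simp] theorem cf_zero (k : ℤ) (m : ι →₀ ℕ) : cf (0 : Ser ι B) k m = 0 := rfl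

@[simp] theorem cf_add (a b : Ser ι B) (k : ℤ) (m : ι →₀ ℕ) :
    cf (a + b) k m = cf a k m + cf b k m := rfl

@[simp] theorem cf_sub (a b : Ser ι B) (k : ℤ) (m : ι →₀ ℕ) :
    cf (a - b) k m = cf a k m - cf b k m := by simp [cf]

@[simp] theorem cf_neg (a : Ser ι B) (k : ℤ) (m : ι →₀ ℕ) : cf (-a) k m = -cf a k m := by
  simp [cf]

@[simp] theorem cf_sum {κ : Type*} (s : Finset κ) (a : κ → Ser ι B) (k : ℤ) (m : ι →₀ ℕ) :
    cf (∑ i ∈ s, a i) k m = ∑ i ∈ s, cf (a i) k m := by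
  simp [cf, HahnSeries.coeff_sum]

theorem cf_mul [DecidableEq ι] {p q : ℤ} {a b : Ser ι B} (ha : Van p a) (hb : Van q b)
    (k : ℤ) (m : ι →₀ ℕ) : cf (a * b) k m =
      ∑ i ∈ Finset.Icc p (k - q), ∑ x ∈ Finset.HasAntidiagonal.antidiagonal m, cf a i x.1 * cf b (k - i) x.2 := by
  simp only [cf, coeff_mul_of_van ha hb, map_sum, MvPowerSeries.coeff_mul]

/-- A function on the base as a series. -/
def bC : B →+* Ser ι B := HahnSeries.C.comp MvPowerSeries.C

/-- The fibre variable. -/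
def fX (I : ι) : Ser ι B := HahnSeries.C (MvPowerSeries.X I)

/-- Powers of `ν`. -/
def nu (k : ℤ) : Ser ι B := HahnSeries.single k 1

@[simp] theorem nu_zero : (nu 0 : Ser ι B) = 1 := rfl

theorem nu_mul_nu (k l : ℤ) : (nu k * nu l : Ser ι B) = nu (k + l) := by simp [nu]

theorem nu_mul_nu_mul (k l : ℤ) (a : Ser ι B) : nu k * (nu l * a) = nu (k + l) * a := by
  rw [← mul_assoc, nu_mul_nu]

@[simp] theorem coeff_nu_mul (k r : ℤ) (a : Ser ι B) : (nu k * a).coeff r = a.coeff (r - k) := by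
  simp [nu, HahnSeries.coeff_single_mul]

@[simp] theorem cf_nu_mul (k r : ℤ) (m : ι →₀ ℕ) (a : Ser ι B) :
    cf (nu k * a) r m = cf a (r - k) m := by simp [cf]

@[simp] theorem cf_bC_mul (f : B) (a : Ser ι B) (k : ℤ) (m : ι →₀ ℕ) :
    cf (bC f * a) k m = f * cf a k m := by
  simp only [cf, bC, RingHom.comp_apply, HahnSeries.C_apply, HahnSeries.coeff_single_zero_mul,
    MvPowerSeries.coeff_C_mul]

theorem cf_bC (f : B) [DecidableEq ι] (k : ℤ) (m : ι →₀ ℕ) :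
    cf (bC f) k m = if k = 0 ∧ m = 0 then f else 0 := by
  simp only [cf, bC, RingHom.comp_apply, HahnSeries.C_apply]
  by_cases h : k = 0
  · subst h; simp [MvPowerSeries.coeff_C]
  · simp [HahnSeries.coeff_single_of_ne h, h]

theorem cf_fX_mul [DecidableEq ι] (I : ι) (a : Ser ι B) (k : ℤ) (m : ι →₀ ℕ) :
    cf (fX I * a) k m = if m I = 0 then 0 else cf a k (m - Finsupp.single I 1) := by
  simp only [cf, fX, HahnSeries.C_apply, HahnSeries.coeff_single_zero_mul, MvPowerSeries.X,
    MvPowerSeries.coeff_monomial_mul, one_mul, Finsupp.single_le_iff]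
  by_cases h : m I = 0
  · simp [h]
  · simp [h, Nat.one_le_iff_ne_zero]

theorem van_nu (k : ℤ) : Van k (nu k : Ser ι B) := van_single _ _

theorem Van.nu_mul {p k : ℤ} {a : Ser ι B} (ha : Van p a) : Van (k + p) (nu k * a) :=
  (van_nu k).mul ha

theorem van_bC (f : B) : Van 0 (bC f : Ser ι B) := van_C _

theorem van_fX (I : ι) : Van 0 (fX I : Ser ι B) := van_C _

theorem Van.bC_mul {p : ℤ} {a : Ser ι B} (ha : Van p a) (f : B) : Van p (bC f * a) :=
  ((van_bC f).mul ha).mono (by simp)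

theorem Van.fX_mul {p : ℤ} {a : Ser ι B} (ha : Van p a) (I : ι) : Van p (fX I * a) :=
  ((van_fX I).mul ha).mono (by simp)

/-- The formal derivative in a fibre direction. -/
def dF (I : ι) : Ser ι B →+ Ser ι B :=
  liftL (MvPowerSeries.pderiv B I : MvPowerSeries ι B →ₗ[B] MvPowerSeries ι B).toAddMonoidHom

theorem dF_mul (I : ι) (a b : Ser ι B) : dF I (a * b) = dF I a * b + a * dF I b :=
  liftL_leibniz _ (fun x y => by simp [mul_comm, add_comm]) a b

theorem cf_dF (I : ι) (a : Ser ι B) (k : ℤ) (m : ι →₀ ℕ) :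
    cf (dF I a) k m = (m I + 1) * cf a k (m + Finsupp.single I 1) := by
  simp only [cf, dF, coeff_liftL]
  exact (MvPowerSeries.coeff_pderiv _ _).trans (mul_comm _ _)

theorem dF_comm (I J : ι) (a : Ser ι B) : dF I (dF J a) = dF J (dF I a) := by
  classical
  refine ser_ext fun k m => ?_
  simp only [cf_dF, add_right_comm m (Finsupp.single I 1)]
  by_cases h : I = J
  · subst h; rfl
  · simp [h, Ne.symm h]; ring

@[simp] theorem dF_bC (I : ι) (f : B) : dF I (bC f : Ser ι B) = 0 := by
  rw [dF, bC, RingHom.comp_apply, liftL_C]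
  simp

@[simp] theorem dF_nu (I : ι) (k : ℤ) : dF I (nu k : Ser ι B) = 0 := by
  have := liftL_single_mul (MvPowerSeries.pderiv B I :
    MvPowerSeries ι B →ₗ[B] MvPowerSeries ι B).toAddMonoidHom k (1 : Ser ι B)
  rw [mul_one] at this
  rw [nu, dF, this, ← HahnSeries.C_one, liftL_C]
  simp

theorem dF_fX [DecidableEq ι] (I J : ι) : dF I (fX J : Ser ι B) = if I = J then 1 else 0 := by
  rw [dF, fX, liftL_C]
  by_cases h : I = J
  · subst h; simp
  · simp [h, MvPowerSeries.pderiv_X_of_ne (Ne.symm h)]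

@[simp] theorem dF_bC_mul (I : ι) (f : B) (a : Ser ι B) : dF I (bC f * a) = bC f * dF I a := by
  simp [dF_mul]

@[simp] theorem dF_nu_mul (I : ι) (k : ℤ) (a : Ser ι B) : dF I (nu k * a) = nu k * dF I a := by
  simp [dF_mul]

theorem Van.dF {p : ℤ} {a : Ser ι B} (ha : Van p a) (I : ι) : Van p (dF I a) := ha.liftL _

/-- The action of a derivation of the base on the coefficients. -/
def dB (d : B →+ B) : Ser ι B →+ Ser ι B :=
  liftL
    { toFun := fun p m => d (MvPowerSeries.coeff m p)
      map_zero' := by ext m; exact map_zero d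
      map_add' := fun p q => by ext m; exact map_add d _ _ }

@[simp] theorem cf_dB (d : B →+ B) (a : Ser ι B) (k : ℤ) (m : ι →₀ ℕ) :
    cf (dB d a) k m = d (cf a k m) := rfl

theorem Van.dB {p : ℤ} {a : Ser ι B} (ha : Van p a) (d : B →+ B) : Van p (dB d a) := ha.liftL _

theorem dB_mul (d : B →+ B) (hd : ∀ x y, d (x * y) = d x * y + x * d y) (a b : Ser ι B) :
    dB d (a * b) = dB d a * b + a * dB d b := by
  classical
  refine liftL_leibniz _ (fun x y => ?_) a b
  ext m
  simp only [AddMonoidHom.coe_mk, map_add, MvPowerSeries.coeff_mul]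
  change d (MvPowerSeries.coeff m (x * y)) = _
  rw [MvPowerSeries.coeff_mul, map_sum, ← Finset.sum_add_distrib]
  exact Finset.sum_congr rfl fun i _ => hd _ _

theorem dB_bC (d : B →+ B) (f : B) : dB d (bC f : Ser ι B) = bC (d f) := by
  classical
  refine ser_ext fun k m => ?_
  rw [cf_dB, cf_bC, cf_bC]
  split_ifs <;> simp

theorem dB_fX (d : B →+ B) (h1 : d 1 = 0) (I : ι) : dB d (fX I : Ser ι B) = 0 := by
  classical
  refine ser_ext fun k m => ?_
  rw [cf_dB, ← mul_one (fX I), cf_fX_mul, ← map_one bC, cf_bC]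
  split_ifs <;> simp [h1]

theorem dB_nu_mul (d : B →+ B) (k : ℤ) (a : Ser ι B) : dB d (nu k * a) = nu k * dB d a := by
  refine ser_ext fun r m => ?_
  simp

theorem dB_dF (d : B →+ B) (I : ι) (a : Ser ι B) : dB d (dF I a) = dF I (dB d a) := by
  refine ser_ext fun k m => ?_
  rw [cf_dB, cf_dF, cf_dF, cf_dB, ← Nat.cast_succ, ← nsmul_eq_mul, ← nsmul_eq_mul, map_nsmul]

/-! ### The fibrewise Wick product -/

variable [Fintype ι] (Λ : ι → ι → B)

/-- The `j`-th term of the Wick product (without `ν^j / j!`). -/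
def wterm : ℕ → Ser ι B → Ser ι B → Ser ι B
  | 0, a, b => a * b
  | j + 1, a, b => ∑ I, ∑ J, bC (Λ I J) * wterm j (dF I a) (dF J b)

theorem wterm_add_left (j : ℕ) : ∀ a a' b : Ser ι B,
    wterm Λ j (a + a') b = wterm Λ j a b + wterm Λ j a' b := by
  induction j with
  | zero => intro a a' b; exact add_mul _ _ _
  | succ j ih => intro a a' b; simp only [wterm, map_add, ih, mul_add, Finset.sum_add_distrib]

theorem wterm_add_right (j : ℕ) : ∀ a b b' : Ser ι B,
    wterm Λ j a (b + b') = wterm Λ j a b + wterm Λ j a b' := by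
  induction j with
  | zero => intro a a' b; exact mul_add _ _ _
  | succ j ih => intro a a' b; simp only [wterm, map_add, ih, mul_add, Finset.sum_add_distrib]

/-- The terms of the Wick product as biadditive maps. -/
def wtermHom (j : ℕ) : Ser ι B →+ Ser ι B →+ Ser ι B :=
  AddMonoidHom.mk' (fun a => AddMonoidHom.mk' (wterm Λ j a) (wterm_add_right Λ j a))
    (fun a a' => AddMonoidHom.ext fun b => wterm_add_left Λ j a a' b)

theorem wtermHom_apply (j : ℕ) (a b : Ser ι B) : wtermHom Λ j a b = wterm Λ j a b := rfl

theorem wterm_zero_left (j : ℕ) (b : Ser ι B) : wterm Λ j 0 b = 0 := by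
  rw [← wtermHom_apply]; simp

theorem wterm_sum_left {κ : Type*} (s : Finset κ) (j : ℕ) (a : κ → Ser ι B) (b : Ser ι B) :
    wterm Λ j (∑ i ∈ s, a i) b = ∑ i ∈ s, wterm Λ j (a i) b := by
  simp only [← wtermHom_apply, map_sum, AddMonoidHom.finsetSum_apply]

theorem wterm_sum_right {κ : Type*} (s : Finset κ) (j : ℕ) (a : Ser ι B) (b : κ → Ser ι B) :
    wterm Λ j a (∑ i ∈ s, b i) = ∑ i ∈ s, wterm Λ j a (b i) := by
  simp only [← wtermHom_apply, map_sum]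

theorem wterm_mul_left {z : Ser ι B} (hz : ∀ I, dF I z = 0) (j : ℕ) : ∀ a b : Ser ι B,
    wterm Λ j (z * a) b = z * wterm Λ j a b := by
  induction j with
  | zero => intro a b; exact mul_assoc _ _ _
  | succ j ih =>
    intro a b
    simp only [wterm, dF_mul, hz, zero_mul, zero_add, ih, Finset.mul_sum, mul_left_comm z]

theorem wterm_mul_right {z : Ser ι B} (hz : ∀ I, dF I z = 0) (j : ℕ) : ∀ a b : Ser ι B,
    wterm Λ j a (z * b) = z * wterm Λ j a b := by
  induction j with
  | zero => intro a b; exact mul_left_comm _ _ _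
  | succ j ih =>
    intro a b
    simp only [wterm, dF_mul, hz, zero_mul, zero_add, ih, Finset.mul_sum, mul_left_comm z]

theorem Van.wterm {p q : ℤ} (j : ℕ) : ∀ {a b : Ser ι B}, Van p a → Van q b →
    Van (p + q) (wterm Λ j a b) := by
  induction j with
  | zero => intro a b ha hb; exact ha.mul hb
  | succ j ih =>
    intro a b ha hb
    exact Van.sum fun I _ => Van.sum fun J _ => (ih (ha.dF I) (hb.dF J)).bC_mul _

theorem wterm_swap (j : ℕ) : ∀ a b : Ser ι B,
    wterm (fun I J => Λ J I) j a b = wterm Λ j b a := by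
  induction j with
  | zero => intro a b; exact mul_comm _ _
  | succ j ih =>
    intro a b
    simp only [wterm, ih]
    exact Finset.sum_comm

/-- A map that differentiates the product and acts on `Λ` in the same way as on the fibre
derivatives differentiates all terms of the Wick product. -/
theorem wterm_derivation (t : Ser ι B →+ Ser ι B)
    (hmul : ∀ a b, t (a * b) = t a * b + a * t b) (Λ' : ι → ι → B) (c : ι → ι → B)
    (hb : ∀ I J, t (bC (Λ I J)) = bC (Λ' I J))
    (hcomm : ∀ I a, t (dF I a) = dF I (t a) + ∑ S, bC (c I S) * dF S a)
    (hΛ : ∀ I J, Λ' I J + (∑ S, c S I * Λ S J) + ∑ S, c S J * Λ I S = 0) (j : ℕ) :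
    ∀ a b : Ser ι B, t (wterm Λ j a b) = wterm Λ j (t a) b + wterm Λ j a (t b) := by
  induction j with
  | zero => exact hmul
  | succ j ih =>
    intro a b
    have key : ∀ I J, t (bC (Λ I J) * wterm Λ j (dF I a) (dF J b)) =
        bC (Λ I J) * wterm Λ j (dF I (t a)) (dF J b) +
        bC (Λ I J) * wterm Λ j (dF I a) (dF J (t b)) +
        (bC (Λ' I J) * wterm Λ j (dF I a) (dF J b) +
        (∑ S, bC (c I S * Λ I J) * wterm Λ j (dF S a) (dF J b)) +
        ∑ S, bC (c J S * Λ I J) * wterm Λ j (dF I a) (dF S b)) := by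
      intro I J
      simp only [hmul, hb, ih, hcomm, wterm_add_left, wterm_add_right, wterm_sum_left,
        wterm_sum_right, wterm_mul_left Λ (fun K => dF_bC K _),
        wterm_mul_right Λ (fun K => dF_bC K _), map_mul, mul_add, Finset.mul_sum]
      have h1 : ∀ S, bC (Λ I J) * (bC (c I S) * wterm Λ j (dF S a) (dF J b)) =
        bC (c I S) * bC (Λ I J) * wterm Λ j (dF S a) (dF J b) := fun S => by ring
      have h2 : ∀ S, bC (Λ I J) * (bC (c J S) * wterm Λ j (dF I a) (dF S b)) =
        bC (c J S) * bC (Λ I J) * wterm Λ j (dF I a) (dF S b) := fun S => by ring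
      simp only [h1, h2]
      abel
    simp only [wterm, map_sum, key, Finset.sum_add_distrib]
    rw [add_eq_left]
    -- After renaming `I ↔ S` in one error sum and `J ↔ S` in the other, all error terms contain the
    -- same product `wterm Λ j (dF I a) (dF J b)`, with the left side of `hΛ` as coefficient.
    have sw1 : ∀ g : ι → ι → ι → Ser ι B,
        (∑ I, ∑ J, ∑ S, g I J S) = ∑ I, ∑ J, ∑ S, g S J I := fun g => by
      rw [Finset.sum_comm, Finset.sum_comm (f := fun I J => ∑ S, g S J I)]
      exact Finset.sum_congr rfl fun J _ => Finset.sum_comm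
    have sw2 : ∀ g : ι → ι → ι → Ser ι B,
        (∑ I, ∑ J, ∑ S, g I J S) = ∑ I, ∑ J, ∑ S, g I S J := fun g =>
      Finset.sum_congr rfl fun I _ => Finset.sum_comm
    rw [sw1 fun I J S => bC (c I S * Λ I J) * wterm Λ j (dF S a) (dF J b),
      sw2 fun I J S => bC (c J S * Λ I J) * wterm Λ j (dF I a) (dF S b)]
    simp only [← Finset.sum_add_distrib, ← Finset.sum_mul, ← add_mul, ← map_sum, ← map_add, hΛ]
    simp

theorem dF_wterm (K : ι) (j : ℕ) (a b : Ser ι B) :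
    dF K (wterm Λ j a b) = wterm Λ j (dF K a) b + wterm Λ j a (dF K b) :=
  wterm_derivation Λ (dF K) (dF_mul K) 0 0 (fun I J => by simp)
    (fun I a => by simp [dF_comm K I]) (fun I J => by simp) j a b

/-- The triple products that occur in `(a ∘ b) ∘ c`, in total order `N`. -/
def wtriple (N : ℕ) (a b c : Ser ι B) : Ser ι B :=
  ∑ x ∈ Finset.HasAntidiagonal.antidiagonal N, N.choose x.1 • wterm Λ x.1 (wterm Λ x.2 a b) c

/-- The triple products that occur in `a ∘ (b ∘ c)`, in total order `N`. -/
def wtriple' (N : ℕ) (a b c : Ser ι B) : Ser ι B :=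
  ∑ x ∈ Finset.HasAntidiagonal.antidiagonal N, N.choose x.1 • wterm Λ x.1 a (wterm Λ x.2 b c)

theorem sum_choose_snd {V : Type*} [AddCommMonoid V] (N : ℕ) (f : ℕ × ℕ → V) :
    (∑ x ∈ Finset.HasAntidiagonal.antidiagonal N, N.choose x.2 • f x) =
      ∑ x ∈ Finset.HasAntidiagonal.antidiagonal N, N.choose x.1 • f x := by
  refine Finset.sum_congr rfl fun x hx => ?_
  rw [Nat.choose_symm_of_eq_add (Finset.HasAntidiagonal.mem_antidiagonal.1 hx).symm]

/-- Let P₁₂, P₁₃, P₂₃ be the contractions of two of the three factors. They commute, and by the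
Leibniz rule contracting a product of the first two factors with the third one is P₁₃ + P₂₃. So
`wtriple` is (P₁₂ + P₁₃ + P₂₃)^N expanded by the binomial theorem, and Pascal's rule splits off one
factor of this power. -/
theorem wtriple_succ (N : ℕ) (a b c : Ser ι B) : wtriple Λ (N + 1) a b c = ∑ I, ∑ J, bC (Λ I J) *
    (wtriple Λ N (dF I a) b (dF J c) + wtriple Λ N a (dF I b) (dF J c) +
      wtriple Λ N (dF I a) (dF J b) c) := by
  rw [wtriple, Finset.sum_antidiagonal_choose_succ_nsmul
    (fun i j => wterm Λ i (wterm Λ j a b) c), add_comm, sum_choose_snd]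
  simp only [wterm, dF_wterm, wterm_add_left, wterm_sum_left,
    wterm_mul_left Λ (fun K => dF_bC K _), wtriple, mul_add, Finset.mul_sum, Finset.smul_sum,
    Finset.sum_add_distrib, smul_add]
  simp only [mul_smul_comm]
  have sw : ∀ f : ℕ × ℕ → ι → ι → Ser ι B, (∑ x ∈ Finset.HasAntidiagonal.antidiagonal N, ∑ I, ∑ J, f x I J) =
      ∑ I, ∑ J, ∑ x ∈ Finset.HasAntidiagonal.antidiagonal N, f x I J := by
    intro f
    rw [Finset.sum_comm]
    exact Finset.sum_congr rfl fun I _ => Finset.sum_comm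
  simp only [sw]

/-- The same power of P₁₂ + P₁₃ + P₂₃, now grouped as P₂₃ and P₁₂ + P₁₃; the recursion coincides
with that of `wtriple`, so the two families agree by induction. -/
theorem wtriple'_succ (N : ℕ) (a b c : Ser ι B) : wtriple' Λ (N + 1) a b c = ∑ I, ∑ J, bC (Λ I J) *
    (wtriple' Λ N (dF I a) b (dF J c) + wtriple' Λ N a (dF I b) (dF J c) +
      wtriple' Λ N (dF I a) (dF J b) c) := by
  rw [wtriple', Finset.sum_antidiagonal_choose_succ_nsmul
    (fun i j => wterm Λ i a (wterm Λ j b c)), add_comm, sum_choose_snd]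
  simp only [wterm, dF_wterm, wterm_add_right, wterm_sum_right,
    wterm_mul_right Λ (fun K => dF_bC K _), wtriple', mul_add, Finset.mul_sum, Finset.smul_sum,
    Finset.sum_add_distrib, smul_add]
  simp only [mul_smul_comm]
  have sw : ∀ f : ℕ × ℕ → ι → ι → Ser ι B, (∑ x ∈ Finset.HasAntidiagonal.antidiagonal N, ∑ I, ∑ J, f x I J) =
      ∑ I, ∑ J, ∑ x ∈ Finset.HasAntidiagonal.antidiagonal N, f x I J := by
    intro f
    rw [Finset.sum_comm]
    exact Finset.sum_congr rfl fun I _ => Finset.sum_comm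
  simp only [sw]
  abel

theorem wtriple_eq (N : ℕ) : ∀ a b c : Ser ι B, wtriple Λ N a b c = wtriple' Λ N a b c := by
  induction N with
  | zero => intro a b c; simp [wtriple, wtriple', wterm, mul_assoc]
  | succ N ih => intro a b c; simp only [wtriple_succ, wtriple'_succ, ih]

end Series

end FedosovWick

end

open scoped Manifold ContDiff Topology ComplexOrder

noncomputable section

namespace FedosovWick

/-! ### The Wick product as a ν-adically convergent sum, its associativity and its bracket. -/

section Wick

variable {ι B : Type*} [CommRing B] [Algebra ℂ B] [Fintype ι] (Λ : ι → ι → B)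

-- Complex scalars become multiplication by base constants, which all fibre derivatives ignore;
-- linearity over ℂ then follows from linearity over the base.
omit [Fintype ι] in
theorem smul_eq_bC_mul (c : ℂ) (a : Ser ι B) : c • a = bC (algebraMap ℂ B c) * a := by
  refine ser_ext fun k m => ?_
  rw [cf_bC_mul, ← Algebra.smul_def]
  rfl

instance : IsScalarTower ℂ (Ser ι B) (Ser ι B) :=
  ⟨fun c a b => by simp only [smul_eq_mul, smul_eq_bC_mul, mul_assoc]⟩

instance : SMulCommClass ℂ (Ser ι B) (Ser ι B) :=
  ⟨fun c a b => by simp only [smul_eq_mul, smul_eq_bC_mul]; ring⟩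

omit [Fintype ι] in
theorem dF_smul (I : ι) (c : ℂ) (a : Ser ι B) : dF I (c • a) = c • dF I a := by
  rw [smul_eq_bC_mul, dF_bC_mul, smul_eq_bC_mul]

theorem wterm_smul_left (j : ℕ) (c : ℂ) : ∀ a b : Ser ι B,
    wterm Λ j (c • a) b = c • wterm Λ j a b := by
  induction j with
  | zero => intro a b; exact smul_mul_assoc _ _ _
  | succ j ih => intro a b; simp only [wterm, dF_smul, ih, mul_smul_comm, Finset.smul_sum]

/-- The fibrewise Wick product over an arbitrary coefficient ring. -/
def wk (a b : Ser ι B) : Ser ι B :=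
  HahnSeries.ofSuppBddBelow
    (fun r => ∑ᶠ j : ℕ, ((j.factorial : ℂ)⁻¹) • (wterm Λ j a b).coeff (r - j)) (by
      refine ⟨a.order + b.order, fun r hr => ?_⟩
      by_contra h
      refine hr (finsum_eq_zero_of_forall_eq_zero fun j => ?_)
      rw [((van_order a).wterm Λ j (van_order b)) _ (by omega), smul_zero])

/-- The `j`-th term carries ν^j and so has order at least `p + q + j`; from `j = M` on nothing
contributes to ν^r. -/
theorem coeff_wk {p q : ℤ} {a b : Ser ι B} (ha : Van p a) (hb : Van q b) (r : ℤ) (M : ℕ)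
    (hM : r < p + q + M) : (wk Λ a b).coeff r =
      ∑ j ∈ Finset.range M, ((j.factorial : ℂ)⁻¹) • (wterm Λ j a b).coeff (r - j) := by
  refine finsum_eq_sum_of_support_subset _ fun j hj => ?_
  simp only [Finset.coe_range, Set.mem_Iio]
  by_contra h
  exact hj (by beta_reduce; rw [(ha.wterm Λ j hb) _ (by omega), smul_zero])

/-- Partial sums of the Wick product. -/
def wkTr (M : ℕ) (a b : Ser ι B) : Ser ι B :=
  ∑ j ∈ Finset.range M, ((j.factorial : ℂ)⁻¹) • (nu j * wterm Λ j a b)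

theorem van_wk_sub_wkTr {p q : ℤ} {a b : Ser ι B} (ha : Van p a) (hb : Van q b) (M : ℕ) :
    Van (p + q + M) (wk Λ a b - wkTr Λ M a b) := by
  intro r hr
  rw [HahnSeries.coeff_sub, coeff_wk Λ ha hb r M hr, wkTr, HahnSeries.coeff_sum, sub_eq_zero]
  simp

/-- To compare two series with convergent families of approximations it suffices to compare the
approximations. -/
theorem eq_of_van_sub {A : Type*} [AddCommGroup A] {x y : LaurentSeries A} {p : ℤ}
    {f : ℕ → LaurentSeries A} (hx : ∀ M : ℕ, Van (p + M) (x - f M))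
    (hy : ∀ M : ℕ, Van (p + M) (y - f M)) : x = y := by
  rw [← sub_eq_zero]
  refine eq_zero_of_forall_van fun q => ?_
  have := (hx (q - p).toNat).sub (hy (q - p).toNat)
  rw [sub_sub_sub_cancel_right] at this
  exact this.mono (by omega)

theorem Van.wkTr {p q : ℤ} {a b : Ser ι B} (ha : Van p a) (hb : Van q b) (M : ℕ) :
    Van (p + q) (wkTr Λ M a b) := Van.sum fun j _ r hr => by
  rw [HahnSeries.coeff_smul, coeff_nu_mul, (ha.wterm Λ j hb) _ (by omega), smul_zero]

theorem Van.wk {p q : ℤ} {a b : Ser ι B} (ha : Van p a) (hb : Van q b) :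
    Van (p + q) (wk Λ a b) := by
  have := ((van_wk_sub_wkTr Λ ha hb 0).mono (by simp)).add (ha.wkTr Λ hb 0)
  rwa [sub_add_cancel] at this

theorem wkTr_add_left (M : ℕ) (a a' b : Ser ι B) :
    wkTr Λ M (a + a') b = wkTr Λ M a b + wkTr Λ M a' b := by
  simp only [wkTr, wterm_add_left, mul_add, smul_add, Finset.sum_add_distrib]

theorem wkTr_add_right (M : ℕ) (a b b' : Ser ι B) :
    wkTr Λ M a (b + b') = wkTr Λ M a b + wkTr Λ M a b' := by
  simp only [wkTr, wterm_add_right, mul_add, smul_add, Finset.sum_add_distrib]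

omit [Algebra ℂ B] [Fintype ι] in
theorem exists_van (a b c d : Ser ι B) : ∃ p, Van p a ∧ Van p b ∧ Van p c ∧ Van p d := by
  refine ⟨min (min a.order b.order) (min c.order d.order), (van_order a).mono ?_,
    (van_order b).mono ?_, (van_order c).mono ?_, (van_order d).mono ?_⟩ <;> omega

theorem wk_add_left (a a' b : Ser ι B) : wk Λ (a + a') b = wk Λ a b + wk Λ a' b := by
  obtain ⟨p, ha, ha', hb, -⟩ := exists_van a a' b b
  refine eq_of_van_sub (fun M => van_wk_sub_wkTr Λ (ha.add ha') hb M) fun M => ?_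
  rw [wkTr_add_left, add_sub_add_comm]
  exact (van_wk_sub_wkTr Λ ha hb M).add (van_wk_sub_wkTr Λ ha' hb M)

theorem wk_add_right (a b b' : Ser ι B) : wk Λ a (b + b') = wk Λ a b + wk Λ a b' := by
  obtain ⟨p, ha, hb, hb', -⟩ := exists_van a b b' b
  refine eq_of_van_sub (fun M => van_wk_sub_wkTr Λ ha (hb.add hb') M) fun M => ?_
  rw [wkTr_add_right, add_sub_add_comm]
  exact (van_wk_sub_wkTr Λ ha hb M).add (van_wk_sub_wkTr Λ ha hb' M)

/-- The Wick product as a biadditive map. -/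
def wkHom : Ser ι B →+ Ser ι B →+ Ser ι B :=
  AddMonoidHom.mk' (fun a => AddMonoidHom.mk' (wk Λ a) (wk_add_right Λ a))
    (fun a a' => AddMonoidHom.ext fun b => wk_add_left Λ a a' b)

theorem wkHom_apply (a b : Ser ι B) : wkHom Λ a b = wk Λ a b := rfl

theorem wk_sub_left (a a' b : Ser ι B) : wk Λ (a - a') b = wk Λ a b - wk Λ a' b := by
  simp only [← wkHom_apply, map_sub, AddMonoidHom.sub_apply]

theorem wk_sub_right (a b b' : Ser ι B) : wk Λ a (b - b') = wk Λ a b - wk Λ a b' := by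
  simp only [← wkHom_apply, map_sub]

theorem wk_neg_left (a b : Ser ι B) : wk Λ (-a) b = -wk Λ a b := by
  simp only [← wkHom_apply, map_neg, AddMonoidHom.neg_apply]

theorem wk_neg_right (a b : Ser ι B) : wk Λ a (-b) = -wk Λ a b := by
  simp only [← wkHom_apply, map_neg]

theorem wk_zero_left (b : Ser ι B) : wk Λ 0 b = 0 := by
  simp only [← wkHom_apply, map_zero, AddMonoidHom.zero_apply]

theorem wk_zero_right (b : Ser ι B) : wk Λ b 0 = 0 := by
  simp only [← wkHom_apply, map_zero]

theorem wk_sum_left {κ : Type*} (s : Finset κ) (a : κ → Ser ι B) (b : Ser ι B) :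
    wk Λ (∑ i ∈ s, a i) b = ∑ i ∈ s, wk Λ (a i) b := by
  simp only [← wkHom_apply, map_sum, AddMonoidHom.finsetSum_apply]

theorem wk_sum_right {κ : Type*} (s : Finset κ) (a : Ser ι B) (b : κ → Ser ι B) :
    wk Λ a (∑ i ∈ s, b i) = ∑ i ∈ s, wk Λ a (b i) := by
  simp only [← wkHom_apply, map_sum]

/-- An element without fibre variables passes through all contractions. This covers base functions
and powers of ν at once. -/
theorem wk_mul_left {z : Ser ι B} (hz : ∀ I, dF I z = 0) (a b : Ser ι B) :
    wk Λ (z * a) b = z * wk Λ a b := by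
  obtain ⟨p, ha, hb, hz', -⟩ := exists_van a b z b
  refine eq_of_van_sub (p := p + p + p) (f := fun M => z * wkTr Λ M a b) (fun M => ?_) fun M => ?_
  · have : wkTr Λ M (z * a) b = z * wkTr Λ M a b := by
      simp only [wkTr, Finset.mul_sum, wterm_mul_left Λ hz, mul_smul_comm, mul_left_comm z]
    rw [← this]
    exact (van_wk_sub_wkTr Λ (hz'.mul ha) hb M)
  · rw [← mul_sub]
    exact (hz'.mul (van_wk_sub_wkTr Λ ha hb M)).mono (by omega)

theorem wk_swap (a b : Ser ι B) : wk (fun I J => Λ J I) a b = wk Λ b a := by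
  refine HahnSeries.ext (funext fun r => ?_)
  exact finsum_congr fun j => by rw [wterm_swap]

theorem wk_mul_right {z : Ser ι B} (hz : ∀ I, dF I z = 0) (a b : Ser ι B) :
    wk Λ a (z * b) = z * wk Λ a b := by
  rw [← wk_swap, wk_mul_left _ hz, wk_swap]

theorem wk_nu_left (k : ℤ) (a b : Ser ι B) : wk Λ (nu k * a) b = nu k * wk Λ a b :=
  wk_mul_left Λ (fun _ => dF_nu _ _) a b

theorem wk_nu_right (k : ℤ) (a b : Ser ι B) : wk Λ a (nu k * b) = nu k * wk Λ a b :=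
  wk_mul_right Λ (fun _ => dF_nu _ _) a b

theorem wk_bC_left (f : B) (a b : Ser ι B) : wk Λ (bC f * a) b = bC f * wk Λ a b :=
  wk_mul_left Λ (fun _ => dF_bC _ _) a b

theorem wk_bC_right (f : B) (a b : Ser ι B) : wk Λ a (bC f * b) = bC f * wk Λ a b :=
  wk_mul_right Λ (fun _ => dF_bC _ _) a b

theorem wk_const_left {z : Ser ι B} (hz : ∀ I, dF I z = 0) (b : Ser ι B) : wk Λ z b = z * b := by
  have h : ∀ j, wterm Λ (j + 1) z b = 0 := fun j => by simp [wterm, hz, wterm_zero_left]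
  obtain ⟨p, hb, hz', -⟩ := exists_van b z b b
  refine eq_of_van_sub (p := p + p) (f := fun M => wkTr Λ M z b) (fun M => van_wk_sub_wkTr Λ hz' hb M)
    fun M => ?_
  cases M with
  | zero => simpa [wkTr] using hz'.mul hb
  | succ M =>
    rw [wkTr, Finset.sum_range_succ']
    simp only [h]
    simp [wterm, van_zero]

theorem wk_const_right {z : Ser ι B} (hz : ∀ I, dF I z = 0) (b : Ser ι B) : wk Λ b z = z * b := by
  rw [← wk_swap, wk_const_left _ hz]

theorem wk_one_left (b : Ser ι B) : wk Λ 1 b = b := by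
  rw [wk_const_left Λ fun I => ?_, one_mul]
  rw [← map_one bC, dF_bC]

theorem wk_one_right (b : Ser ι B) : wk Λ b 1 = b := by
  rw [← wk_swap, wk_one_left]

/-- A truncated double exponential series runs over a square; only the triangle below the
antidiagonal matters, and it is summed along antidiagonals to match `wtriple`. -/
theorem sum_range_sum_range_eq {V : Type*} [AddCommMonoid V] (M : ℕ) (F : ℕ → ℕ → V)
    (hF : ∀ i j, M ≤ i + j → F i j = 0) : ∑ i ∈ Finset.range M, ∑ j ∈ Finset.range M, F i j =
      ∑ N ∈ Finset.range M, ∑ x ∈ Finset.HasAntidiagonal.antidiagonal N, F x.1 x.2 := by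
  rw [← Finset.sum_product', Finset.sum_sigma']
  refine Finset.sum_bij_ne_zero (fun x _ _ => ⟨x.1 + x.2, x⟩) ?_ ?_ ?_ ?_
  · intro x _ h
    simp only [Finset.mem_sigma, Finset.mem_range, Finset.HasAntidiagonal.mem_antidiagonal, and_true]
    by_contra h'
    exact h (hF _ _ (by omega))
  · intro x _ _ y _ _ h
    exact eq_of_heq (Sigma.mk.inj h).2
  · rintro ⟨N, x⟩ hx h
    simp only [Finset.mem_sigma, Finset.mem_range, Finset.HasAntidiagonal.mem_antidiagonal] at hx
    obtain ⟨hN, rfl⟩ := hx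
    exact ⟨x, by simp only [Finset.mem_product, Finset.mem_range]; omega, h, rfl⟩
  · intro x _ _; rfl

theorem inv_factorial_mul (i j : ℕ) : ((i.factorial : ℂ)⁻¹) * ((j.factorial : ℂ)⁻¹) =
    (((i + j).factorial : ℂ)⁻¹) * ((i + j).choose i : ℂ) := by
  have h := Nat.add_choose_mul_factorial_mul_factorial i j
  rw [← Nat.choose_symm_add] at h
  have h' : ((i + j).choose i : ℂ) * i.factorial * j.factorial = (i + j).factorial := by
    exact_mod_cast h
  rw [← h']
  have hi : (i.factorial : ℂ) ≠ 0 := by exact_mod_cast i.factorial_ne_zero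
  have hj : (j.factorial : ℂ) ≠ 0 := by exact_mod_cast j.factorial_ne_zero
  have hc : ((i + j).choose i : ℂ) ≠ 0 := by
    exact_mod_cast (Nat.choose_pos (Nat.le_add_right i j)).ne'
  field_simp

/-- The product of the two exponential series is collected by total order `N`; the coefficients
`1/(i! j!)` become binomial coefficients over `N!`, which is the weight built into `wtriple`. -/
theorem coeff_wk_wk_left {p : ℤ} {a b c : Ser ι B} (ha : Van p a) (hb : Van p b) (hc : Van p c)
    (r : ℤ) (M : ℕ) (hM : r < p + p + p + M) : (wk Λ (wk Λ a b) c).coeff r =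
      ∑ N ∈ Finset.range M, ((N.factorial : ℂ)⁻¹) • (wtriple Λ N a b c).coeff (r - N) := by
  rw [coeff_wk Λ (ha.wk Λ hb) hc r M hM]
  have h1 : ∀ i ∈ Finset.range M, ((i.factorial : ℂ)⁻¹) • (wterm Λ i (wk Λ a b) c).coeff (r - i) =
      ∑ j ∈ Finset.range M, (((i.factorial : ℂ)⁻¹) * ((j.factorial : ℂ)⁻¹)) •
        (wterm Λ i (wterm Λ j a b) c).coeff (r - (i + j : ℕ)) := by
    intro i _
    -- The inner product may be replaced by its partial sum: the remainder has order at least `p + p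
    -- + M`, too high to reach the coefficient in question.
    rw [← sub_add_cancel (wk Λ a b) (wkTr Λ M a b), wterm_add_left, HahnSeries.coeff_add,
      ((van_wk_sub_wkTr Λ ha hb M).wterm Λ i hc) _ (by omega), zero_add, wkTr, wterm_sum_left,
      HahnSeries.coeff_sum, Finset.smul_sum]
    refine Finset.sum_congr rfl fun j _ => ?_
    rw [wterm_smul_left, wterm_mul_left Λ (fun _ => dF_nu _ _), HahnSeries.coeff_smul,
      coeff_nu_mul, smul_smul, Nat.cast_add, sub_sub]
  rw [Finset.sum_congr rfl h1, sum_range_sum_range_eq]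
  · refine Finset.sum_congr rfl fun N _ => ?_
    rw [wtriple, HahnSeries.coeff_sum, Finset.smul_sum]
    refine Finset.sum_congr rfl fun x hx => ?_
    rw [Finset.HasAntidiagonal.mem_antidiagonal] at hx
    rw [inv_factorial_mul, hx, mul_smul, Nat.cast_smul_eq_nsmul, HahnSeries.coeff_smul]
  · intro i j hij
    rw [(((ha.wterm Λ j hb)).wterm Λ i hc) _ (by omega), smul_zero]

omit [Algebra ℂ B] in
theorem wtriple_swap (N : ℕ) (a b c : Ser ι B) :
    wtriple (fun I J => Λ J I) N c b a = wtriple' Λ N a b c := by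
  simp only [wtriple, wtriple', wterm_swap]

/-- Passing to the transposed tensor reverses the order of the factors, so one expansion of
left-nested products serves for both bracketings. -/
theorem wk_assoc (a b c : Ser ι B) : wk Λ (wk Λ a b) c = wk Λ a (wk Λ b c) := by
  obtain ⟨p, ha, hb, hc, -⟩ := exists_van a b c c
  refine HahnSeries.ext (funext fun r => ?_)
  have hM : r < p + p + p + (r - (p + p + p) + 1).toNat := by omega
  rw [← wk_swap Λ (wk Λ b c) a, ← wk_swap Λ c b, coeff_wk_wk_left Λ ha hb hc r _ hM,
    coeff_wk_wk_left _ hc hb ha r _ hM]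
  refine Finset.sum_congr rfl fun N _ => ?_
  rw [wtriple_swap, wtriple_eq]

/-- The Wick product `ν⁻¹ (a ∘ b - b ∘ a)`. -/
def br (a b : Ser ι B) : Ser ι B := nu (-1) * (wk Λ a b - wk Λ b a)

theorem br_add_left (a a' b : Ser ι B) : br Λ (a + a') b = br Λ a b + br Λ a' b := by
  simp only [br, wk_add_left, wk_add_right]; ring

theorem br_add_right (a b b' : Ser ι B) : br Λ a (b + b') = br Λ a b + br Λ a b' := by
  simp only [br, wk_add_left, wk_add_right]; ring

/-- The bracket as a biadditive map. -/
def brHom : Ser ι B →+ Ser ι B →+ Ser ι B :=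
  AddMonoidHom.mk' (fun a => AddMonoidHom.mk' (br Λ a) (br_add_right Λ a))
    (fun a a' => AddMonoidHom.ext fun b => br_add_left Λ a a' b)

theorem brHom_apply (a b : Ser ι B) : brHom Λ a b = br Λ a b := rfl

theorem br_skew (a b : Ser ι B) : br Λ a b = -br Λ b a := by
  simp only [br]; ring

theorem br_wk (a b c : Ser ι B) : br Λ a (wk Λ b c) = wk Λ (br Λ a b) c + wk Λ b (br Λ a c) := by
  simp only [br, wk_nu_left, wk_nu_right, wk_sub_left, wk_sub_right, wk_assoc]
  ring

theorem br_jacobi (a b c : Ser ι B) :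
    br Λ a (br Λ b c) = br Λ (br Λ a b) c + br Λ b (br Λ a c) := by
  have h : ∀ x y : Ser ι B, br Λ x y = nu (-1) * wk Λ x y - nu (-1) * wk Λ y x := fun x y => by
    rw [br, mul_sub]
  simp only [h, wk_nu_left, wk_nu_right, wk_sub_left, wk_sub_right, wk_assoc]
  ring

theorem coeff_wk_le {p q : ℤ} {a b : Ser ι B} (ha : Van p a) (hb : Van q b) :
    Van (p + q + 1) (wk Λ a b - a * b) := by
  simpa [wkTr, wterm] using van_wk_sub_wkTr Λ ha hb 1

/-- Modulo ν the Wick product is the commutative product, so the commutator is divisible by ν and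
the factor ν⁻¹ in the bracket costs nothing. -/
theorem Van.br {p q : ℤ} {a b : Ser ι B} (ha : Van p a) (hb : Van q b) :
    Van (p + q) (br Λ a b) := by
  have h := (coeff_wk_le Λ ha hb).sub ((coeff_wk_le Λ hb ha).mono (by omega : p + q + 1 ≤ _))
  rw [mul_comm b a, sub_sub_sub_cancel_right] at h
  exact (h.nu_mul (k := -1)).mono (by omega)

/-- A coefficientwise map that differentiates all terms differentiates the Wick product. -/
theorem wk_derivation (t : Ser ι B →+ Ser ι B) (ht : ∀ p a, Van p a → Van p (t a))
    (hnu : ∀ (k : ℤ) a, t (nu k * a) = nu k * t a) (hsm : ∀ (c : ℂ) a, t (c • a) = c • t a)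
    (h : ∀ j a b, t (wterm Λ j a b) = wterm Λ j (t a) b + wterm Λ j a (t b)) (a b : Ser ι B) :
    t (wk Λ a b) = wk Λ (t a) b + wk Λ a (t b) := by
  obtain ⟨p, ha, hb, -⟩ := exists_van a b b b
  refine eq_of_van_sub (p := p + p) (f := fun M => t (wkTr Λ M a b)) (fun M => ?_) fun M => ?_
  · rw [← map_sub]
    exact ht _ _ (van_wk_sub_wkTr Λ ha hb M)
  · have : t (wkTr Λ M a b) = wkTr Λ M (t a) b + wkTr Λ M a (t b) := by
      simp only [wkTr, map_sum, hsm, hnu, h, mul_add, smul_add, Finset.sum_add_distrib]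
    rw [this, add_sub_add_comm]
    exact (van_wk_sub_wkTr Λ (ht _ _ ha) hb M).add (van_wk_sub_wkTr Λ ha (ht _ _ hb) M)

theorem dF_wk (I : ι) (a b : Ser ι B) : dF I (wk Λ a b) = wk Λ (dF I a) b + wk Λ a (dF I b) :=
  wk_derivation Λ (dF I) (fun _ _ h => h.dF I) (dF_nu_mul I) (dF_smul I) (dF_wterm Λ I) a b

theorem dF_br (I : ι) (a b : Ser ι B) : dF I (br Λ a b) = br Λ (dF I a) b + br Λ a (dF I b) := by
  simp only [br, dF_nu_mul, map_sub, dF_wk]; ring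

end Wick

end FedosovWick

end

open scoped Manifold ContDiff Topology ComplexOrder

noncomputable section

namespace FedosovWick

/-! ### Weights, the filtration by total degree, fixed points of contractions, the Euler operator.
-/

section Filtration

variable {ι B : Type*} [CommRing B] [Fintype ι]

/-- The weight of `ν^k ζ^m`, where `ν` has weight `c` and `ζ^I` has weight `w I`. -/
def wt (c : ℤ) (w : ι → ℤ) (k : ℤ) (m : ι →₀ ℕ) : ℤ := c * k + ∑ I, w I * (m I : ℤ)

theorem wt_add (c : ℤ) (w : ι → ℤ) (k l : ℤ) (m m' : ι →₀ ℕ) :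
    wt c w (k + l) (m + m') = wt c w k m + wt c w l m' := by
  simp only [wt, Finsupp.add_apply, Nat.cast_add, mul_add, Finset.sum_add_distrib]
  ring

theorem wt_single [DecidableEq ι] (c : ℤ) (w : ι → ℤ) (I : ι) :
    wt c w 0 (Finsupp.single I 1) = w I := by
  simp [wt, Finsupp.single_apply]

theorem wt_nu (c : ℤ) (w : ι → ℤ) (k : ℤ) : wt c w k 0 = c * k := by simp [wt]

/-- All terms of `a` have weight at least `p`. -/
def WF (c : ℤ) (w : ι → ℤ) (p : ℤ) (a : Ser ι B) : Prop := ∀ k m, wt c w k m < p → cf a k m = 0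

variable {c : ℤ} {w : ι → ℤ} {p q : ℤ} {a b : Ser ι B}

theorem WF.mono (h : WF c w p a) (hq : q ≤ p) : WF c w q a :=
  fun k m hk => h k m (hk.trans_le hq)

theorem wf_zero : WF c w p (0 : Ser ι B) := fun _ _ _ => rfl

theorem WF.add (ha : WF c w p a) (hb : WF c w p b) : WF c w p (a + b) := fun k m h => by
  rw [cf_add, ha k m h, hb k m h, add_zero]

theorem WF.sub (ha : WF c w p a) (hb : WF c w p b) : WF c w p (a - b) := fun k m h => by
  rw [cf_sub, ha k m h, hb k m h, sub_zero]

theorem WF.neg (ha : WF c w p a) : WF c w p (-a) := fun k m h => by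
  rw [cf_neg, ha k m h, neg_zero]

theorem WF.sum {κ : Type*} {s : Finset κ} {a : κ → Ser ι B} (ha : ∀ i ∈ s, WF c w p (a i)) :
    WF c w p (∑ i ∈ s, a i) := fun k m h => by
  rw [cf_sum]; exact Finset.sum_eq_zero fun i hi => ha i hi k m h

theorem WF.bC_mul (ha : WF c w p a) (f : B) : WF c w p (bC f * a) := fun k m h => by
  rw [cf_bC_mul, ha k m h, mul_zero]

theorem WF.nu_mul (ha : WF c w p a) (l : ℤ) : WF c w (c * l + p) (nu l * a) := fun k m h => by
  rw [cf_nu_mul]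
  refine ha _ m ?_
  have := wt_add c w (k - l) l m 0
  rw [sub_add_cancel, add_zero, wt_nu] at this
  omega

theorem WF.dB (ha : WF c w p a) (d : B →+ B) : WF c w p (dB d a) := fun k m h => by
  rw [cf_dB, ha k m h, map_zero]

theorem WF.fX_mul (ha : WF c w p a) (I : ι) : WF c w (w I + p) (fX I * a) := fun k m h => by
  classical
  rw [cf_fX_mul]
  split_ifs with h0
  · rfl
  · refine ha _ _ ?_
    have := wt_add c w k 0 (m - Finsupp.single I 1) (Finsupp.single I 1)
    rw [tsub_add_cancel_of_le (by rw [Finsupp.single_le_iff]; omega), wt_single, add_zero] at this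
    omega

theorem WF.dF (ha : WF c w p a) (I : ι) : WF c w (p - w I) (dF I a) := fun k m h => by
  classical
  rw [cf_dF, ha, mul_zero]
  have := wt_add c w k 0 m (Finsupp.single I 1)
  rw [wt_single, add_zero] at this
  omega

theorem WF.mul (ha : WF c w p a) (hb : WF c w q b) : WF c w (p + q) (a * b) := fun k m h => by
  classical
  rw [cf_mul (van_order a) (van_order b)]
  refine Finset.sum_eq_zero fun i _ => Finset.sum_eq_zero fun x hx => ?_
  rw [Finset.HasAntidiagonal.mem_antidiagonal] at hx
  have := wt_add c w i (k - i) x.1 x.2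
  rw [hx, add_sub_cancel] at this
  by_cases h1 : wt c w i x.1 < p
  · rw [ha _ _ h1, zero_mul]
  · rw [hb _ _ (by omega), mul_zero]

/-- All terms of `a` have total degree `2 deg_ν + deg_s` at least `d`. -/
abbrev Fil (d : ℤ) (a : Ser ι B) : Prop := WF 2 1 d a

/-- The filtration starts at twice the ν-order because fibre degrees are non-negative. This anchors
all inductions over the filtration. -/
theorem Van.fil {N : ℤ} (ha : Van N a) : Fil (2 * N) a := fun k m h => by
  rw [cf, ha k, map_zero]
  simp only [wt, Pi.one_apply, one_mul] at h
  have : (0 : ℤ) ≤ ∑ I, (m I : ℤ) := Finset.sum_nonneg fun _ _ => by positivity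
  omega

theorem eq_zero_of_forall_fil (N : ℤ) (h : ∀ n : ℕ, Fil (N + n) a) : a = 0 :=
  ser_ext fun k m => h (wt 2 1 k m - N + 1).toNat k m (by omega)

/-- A family that moves up in the filtration vanishes. -/
theorem fil_induction {κ : Type*} (A : κ → Ser ι B) (N : ℤ) (hA : ∀ i, Van N (A i))
    (h : ∀ d, (∀ i, Fil d (A i)) → ∀ i, Fil (d + 1) (A i)) (i : κ) : A i = 0 := by
  have : ∀ (n : ℕ) i, Fil (2 * N + n) (A i) := by
    intro n
    induction n with
    | zero => intro i; simpa using (hA i).fil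
    | succ n ih => intro i; exact (h _ ih i).mono (by push_cast; omega)
  exact eq_zero_of_forall_fil (2 * N) fun n => this n i

/-- Banach's fixed-point argument in the complete filtered space of series: the iterates of 0 form a
Cauchy sequence because `T` gains one degree on differences. The set `S` carries the bounds under
which this gain holds, as well as any closed condition that the solution should inherit. -/
theorem exists_fixed_point {κ : Type*} (T : (κ → Ser ι B) → κ → Ser ι B)
    (S : (κ → Ser ι B) → Prop) (N : ℤ) (h0 : S 0) (hT : ∀ a, S a → S (T a))
    (hN : ∀ a, S a → ∀ i, Van N (a i))
    (hcl : ∀ a, (∀ d, ∃ b, S b ∧ ∀ i, Fil d (a i - b i)) → S a)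
    (hcon : ∀ a b d, S a → S b → (∀ i, Fil d (a i - b i)) → ∀ i, Fil (d + 1) (T a i - T b i)) :
    ∃ a, S a ∧ T a = a := by
  set u : ℕ → κ → Ser ι B := fun n => T^[n] 0 with hu
  have hu' : ∀ n, u (n + 1) = T (u n) := fun n => Function.iterate_succ_apply' T n 0
  have hS : ∀ n, S (u n) := fun n => by
    induction n with
    | zero => exact h0
    | succ n ih => rw [hu']; exact hT _ ih
  have step : ∀ (n : ℕ) i, Fil (2 * N + n) (u (n + 1) i - u n i) := by
    intro n
    induction n with
    | zero => intro i; simpa using ((hN _ (hS 1) i).sub (hN _ (hS 0) i)).fil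
    | succ n ih =>
      intro i
      rw [hu', hu' n]
      exact (hcon _ _ _ (hT _ (hS n)) (hS n) (by simpa only [hu'] using ih) i).mono
        (by push_cast; omega)
  have cauchy : ∀ (n j : ℕ) i, Fil (2 * N + n) (u (n + j) i - u n i) := by
    intro n j i
    induction j with
    | zero => simpa using wf_zero
    | succ j ih =>
      have := ((step (n + j) i).mono (by push_cast; omega : 2 * N + n ≤ _)).add ih
      rwa [sub_add_sub_cancel] at this
  -- Consecutive iterates `u n`, `u (n + 1)` agree below degree `2 * N + n`. A coefficient of weight
  -- `wt` is therefore final from the iterate number `wt - 2 * N + 1` on, and the limit reads it off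
  -- there.
  set v : κ → Ser ι B := fun i => HahnSeries.ofSuppBddBelow
    (fun k m => cf (u (wt 2 1 k m - 2 * N + 1).toNat i) k m) ⟨N, fun k hk => by
      by_contra hlt
      refine hk (funext fun m => ?_)
      change cf _ _ _ = 0
      rw [cf, hN _ (hS _) i k (not_le.1 hlt), map_zero]⟩ with hv
  have hcf : ∀ i k m, cf (v i) k m = cf (u (wt 2 1 k m - 2 * N + 1).toNat i) k m :=
    fun i k m => rfl
  have lim : ∀ (n : ℕ) i, Fil (2 * N + n) (v i - u n i) := by
    intro n i k m hk
    rw [cf_sub, hcf]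
    set n' := (wt 2 1 k m - 2 * N + 1).toNat
    rw [← cf_sub]
    rcases le_total n n' with h | h
    · obtain ⟨j, hj⟩ := Nat.exists_eq_add_of_le h
      rw [hj]
      exact cauchy n j i k m hk
    · obtain ⟨j, hj⟩ := Nat.exists_eq_add_of_le h
      have := cauchy n' j i k m (by omega)
      rw [← hj] at this
      rw [← neg_sub, cf_neg, this, neg_zero]
  have hSv : S v := hcl v fun d => ⟨u (d - 2 * N).toNat, hS _, fun i => (lim _ i).mono (by omega)⟩
  refine ⟨v, hSv, funext fun i => sub_eq_zero.1 (eq_zero_of_forall_fil (2 * N) fun n => ?_)⟩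
  have h1 := (hcon _ _ _ hSv (hS n) (lim n) i).mono (by omega : 2 * N + n ≤ _)
  have h2 := (lim (n + 1) i).mono (by push_cast; omega : 2 * N + n ≤ _)
  rw [hu'] at h2
  have := h1.sub h2
  rwa [sub_sub_sub_cancel_right] at this

variable [Algebra ℂ B]

/-- Weight bounds are conditions on single coefficients, and each coefficient of the Wick product is
a finite sum of coefficients of its terms. -/
theorem wf_wk_of_wterm (Λ : ι → ι → B) (h : ∀ j : ℕ, WF c w p (nu j * wterm Λ j a b)) :
    WF c w p (wk Λ a b) := fun k m hk => by
  rw [cf, coeff_wk Λ (van_order a) (van_order b) k (k - a.order - b.order + 1).toNat (by omega),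
    map_sum]
  refine Finset.sum_eq_zero fun j _ => ?_
  have := h j k m hk
  rw [cf_nu_mul, cf] at this
  have h2 := (MvPowerSeries.coeff m).map_smul_of_tower (R := ℂ) ((j.factorial : ℂ)⁻¹)
    ((wterm Λ j a b).coeff (k - j))
  rw [h2, this, smul_zero]

-- Each contraction removes two fibre variables. The factor ν^j of weight `2 * j` restores the loss,
-- so that `wk` respects the total degree.
omit [Algebra ℂ B] in
theorem Fil.wterm (Λ : ι → ι → B) (j : ℕ) : ∀ {p q : ℤ} {a b : Ser ι B}, Fil p a → Fil q b →
    Fil (p + q - 2 * j) (wterm Λ j a b) := by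
  induction j with
  | zero => intro p q a b ha hb; simpa [FedosovWick.wterm] using ha.mul hb
  | succ j ih =>
    intro p q a b ha hb
    refine WF.sum fun I _ => WF.sum fun J _ => WF.bC_mul ?_ _
    exact (ih (ha.dF I) (hb.dF J)).mono (by simp only [Pi.one_apply]; push_cast; omega)

theorem Fil.wk (Λ : ι → ι → B) (ha : Fil p a) (hb : Fil q b) : Fil (p + q) (wk Λ a b) :=
  wf_wk_of_wterm Λ fun j => ((Fil.wterm Λ j ha hb).nu_mul j).mono (by omega)

/-- The loss of two is the weight of ν⁻¹. It is harmless when one argument has degree at least two,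
which is the reason for the degree condition on r. -/
theorem Fil.br (Λ : ι → ι → B) (ha : Fil p a) (hb : Fil q b) : Fil (p + q - 2) (br Λ a b) :=
  (((Fil.wk Λ ha hb).sub ((Fil.wk Λ hb ha).mono (by omega))).nu_mul (-1)).mono (by omega)

/-- The Euler operator in the fibre variables. -/
def euler (a : Ser ι B) : Ser ι B := ∑ I, fX I * dF I a

omit [Algebra ℂ B] in
theorem cf_euler (a : Ser ι B) (k : ℤ) (m : ι →₀ ℕ) :
    cf (euler a) k m = (m.degree : B) * cf a k m := by
  classical
  rw [euler, cf_sum, Finsupp.degree_eq_sum, Nat.cast_sum, Finset.sum_mul]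
  refine Finset.sum_congr rfl fun I _ => ?_
  rw [cf_fX_mul]
  split_ifs with h
  · simp [h]
  · rw [cf_dF, tsub_add_cancel_of_le (by rw [Finsupp.single_le_iff]; omega)]
    congr 1
    have : m I = (m - Finsupp.single I 1 : ι →₀ ℕ) I + 1 := by
      simp only [Finsupp.tsub_apply, Finsupp.single_eq_same]; omega
    rw [this]; push_cast; rfl

/-- Division of the part of degree `p` in the fibre variables by `p + c` (by convention the result
is zero where `p + c = 0`). -/
def eulerInv (c : ℕ) : Ser ι B →+ Ser ι B :=
  liftL
    { toFun := fun p m => ((m.degree + c : ℂ)⁻¹) • MvPowerSeries.coeff m p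
      map_zero' := by ext m; exact smul_zero _
      map_add' := fun p q => by ext m; exact smul_add _ _ _ }

omit [Fintype ι] in
theorem cf_eulerInv (c : ℕ) (a : Ser ι B) (k : ℤ) (m : ι →₀ ℕ) :
    cf (eulerInv c a) k m = ((m.degree + c : ℂ)⁻¹) • cf a k m := rfl

omit [Fintype ι] in
theorem Van.eulerInv (ha : Van p a) (n : ℕ) : Van p (eulerInv n a) := ha.liftL _

theorem WF.eulerInv (ha : WF c w p a) (n : ℕ) : WF c w p (eulerInv n a) := fun k m h => by
  rw [cf_eulerInv, ha k m h, smul_zero]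

omit [Fintype ι] in
theorem nat_inv_smul {n : ℕ} (hn : n ≠ 0) (x : B) : ((n : ℂ)⁻¹) • ((n : B) * x) = x := by
  have h2 : (n : ℂ) ≠ 0 := by exact_mod_cast hn
  rw [← nsmul_eq_mul, ← Nat.cast_smul_eq_nsmul ℂ, smul_smul, inv_mul_cancel₀ h2, one_smul]

omit [Fintype ι] in
theorem add_nsmul_eulerInv_aux (c : ℕ) (hc : c ≠ 0) (m : ι →₀ ℕ) (x : B) :
    (m.degree : B) * ((m.degree + c : ℂ)⁻¹ • x) + c * ((m.degree + c : ℂ)⁻¹ • x) = x := by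
  have := nat_inv_smul (n := m.degree + c) (by omega) x
  push_cast at this
  rw [← add_mul, mul_smul_comm, this]

theorem euler_eulerInv (c : ℕ) (hc : c ≠ 0) (a : Ser ι B) :
    euler (eulerInv c a) + (c : Ser ι B) * eulerInv c a = a := by
  refine ser_ext fun k m => ?_
  have : (c : Ser ι B) = bC (c : B) := by simp
  rw [this, cf_add, cf_euler, cf_bC_mul, cf_eulerInv, add_nsmul_eulerInv_aux c hc]

/-- On fibre degree `p` the Euler operator is multiplication by `p`, so adding `c > 0` makes it
invertible on all degrees. Here `c` will be the form degree, and `eulerInv c` after contraction with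
ζ is Fedosov's δ⁻¹. -/
theorem eulerInv_unique {c : ℕ} (hc : c ≠ 0) {a b : Ser ι B}
    (h : euler a + (c : Ser ι B) * a = b) : a = eulerInv c b := by
  refine ser_ext fun k m => ?_
  have h1 : cf (euler a + (c : Ser ι B) * a) k m = cf b k m := by rw [h]
  have : (c : Ser ι B) = bC (c : B) := by simp
  rw [this, cf_add, cf_euler, cf_bC_mul] at h1
  have h2 := nat_inv_smul (n := m.degree + c) (by omega) (cf a k m)
  push_cast at h2
  rw [cf_eulerInv, ← h1, ← add_mul, h2]

/-- Where the Euler operator vanishes only the constant part survives. -/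
theorem cf_eq_zero_of_euler {a : Ser ι B} {k : ℤ} {m : ι →₀ ℕ} (hm : m ≠ 0)
    (h : cf (euler a) k m = 0) : cf a k m = 0 := by
  rw [cf_euler] at h
  have hd : m.degree ≠ 0 := by rwa [Ne, Finsupp.degree_eq_zero_iff]
  rw [← nat_inv_smul hd (cf a k m), h, smul_zero]

end Filtration

end FedosovWick

end

open scoped Manifold ContDiff Topology ComplexOrder

noncomputable section

namespace FedosovWick

/-! ### Covariant derivatives and Fedosov's equation for r over an arbitrary base. -/

section Abstract

variable {ι B : Type*} [CommRing B] [Algebra ℂ B] [Fintype ι]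

/-- The covariant derivative `∂_I - Γ_{IA}^S ζ^A ∂/∂ζ^S`. -/
def nab (d : ι → Derivation ℂ B B) (Γ : ι → ι → ι → B) (I : ι) : Ser ι B →+ Ser ι B :=
  dB ((d I : B →ₗ[ℂ] B).toAddMonoidHom) -
    ∑ A, ∑ S, (AddMonoidHom.mulLeft (bC (Γ I A S) * fX A)).comp (dF S)

section Nab

variable (d : ι → Derivation ℂ B B) (Γ : ι → ι → ι → B)

theorem nab_apply (I : ι) (a : Ser ι B) : nab d Γ I a =
    dB ((d I : B →ₗ[ℂ] B).toAddMonoidHom) a - ∑ A, ∑ S, bC (Γ I A S) * fX A * dF S a := by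
  simp [nab]

omit [Fintype ι] in
theorem dBd_mul (I : ι) (a b : Ser ι B) : dB ((d I : B →ₗ[ℂ] B).toAddMonoidHom) (a * b) =
    dB ((d I : B →ₗ[ℂ] B).toAddMonoidHom) a * b + a * dB ((d I : B →ₗ[ℂ] B).toAddMonoidHom) b :=
  dB_mul _ (fun x y => by
    change d I (x * y) = d I x * y + x * d I y
    rw [Derivation.leibniz, smul_eq_mul, smul_eq_mul]; ring) a b

omit [Fintype ι] in
theorem dBd_bC (I : ι) (f : B) :
    dB ((d I : B →ₗ[ℂ] B).toAddMonoidHom) (bC f : Ser ι B) = bC (d I f) := dB_bC _ _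

omit [Fintype ι] in
theorem dBd_fX (I J : ι) : dB ((d I : B →ₗ[ℂ] B).toAddMonoidHom) (fX J : Ser ι B) = 0 :=
  dB_fX _ (d I).map_one_eq_zero _

theorem nab_mul (I : ι) (a b : Ser ι B) :
    nab d Γ I (a * b) = nab d Γ I a * b + a * nab d Γ I b := by
  simp only [nab_apply, dBd_mul, dF_mul, mul_add, Finset.sum_add_distrib, sub_mul, mul_sub,
    Finset.sum_mul, Finset.mul_sum]
  have h1 : ∀ A S, bC (Γ I A S) * fX A * (dF S a * b) = bC (Γ I A S) * fX A * dF S a * b :=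
    fun A S => by ring
  have h2 : ∀ A S, bC (Γ I A S) * fX A * (a * dF S b) = a * (bC (Γ I A S) * fX A * dF S b) :=
    fun A S => by ring
  simp only [h1, h2]
  abel

theorem nab_bC (I : ι) (f : B) : nab d Γ I (bC f) = bC (d I f) := by
  simp [nab_apply, dBd_bC]

theorem nab_fX (I J : ι) : nab d Γ I (fX J) = -∑ A, bC (Γ I A J) * fX A := by
  classical
  simp [nab_apply, dBd_fX, dF_fX]

theorem nab_nu_mul (I : ι) (k : ℤ) (a : Ser ι B) :
    nab d Γ I (nu k * a) = nu k * nab d Γ I a := by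
  simp only [nab_apply, dB_nu_mul, dF_nu_mul, mul_sub, Finset.mul_sum, mul_left_comm (nu k)]

theorem nab_smul (I : ι) (z : ℂ) (a : Ser ι B) : nab d Γ I (z • a) = z • nab d Γ I a := by
  simp only [smul_eq_bC_mul, nab_mul, nab_bC, Derivation.map_algebraMap, map_zero, zero_mul,
    zero_add]

/-- The extra term comes from ∂_J hitting the explicit ζ^A in the connection. It disappears after
antisymmetrization when `Γ` is symmetric, which makes δ and ∇ anticommute. -/
theorem nab_dF (I J : ι) (a : Ser ι B) :
    nab d Γ I (dF J a) = dF J (nab d Γ I a) + ∑ S, bC (Γ I J S) * dF S a := by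
  classical
  have h : ∀ A S, dF J (bC (Γ I A S) * fX A * dF S a) =
      (if J = A then bC (Γ I A S) * dF S a else 0) + bC (Γ I A S) * fX A * dF S (dF J a) := by
    intro A S
    rw [dF_mul, dF_bC_mul, dF_fX, dF_comm J S]
    split_ifs <;> simp
  simp only [nab_apply, map_sub, map_sum, h, Finset.sum_add_distrib, dB_dF]
  simp
  abel

theorem Van.nab {p : ℤ} {a : Ser ι B} (ha : Van p a) (I : ι) : Van p (nab d Γ I a) := by
  rw [nab_apply]
  refine (ha.dB _).sub (Van.sum fun A _ => Van.sum fun S _ => ?_)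
  rw [mul_assoc]
  exact ((ha.dF S).fX_mul A).bC_mul _

/-- The operator ζ^A ∂/∂ζ^S shifts the weight by `w A - w S`; only nonzero Christoffel symbols need
to be controlled. -/
theorem WF.nab {c p : ℤ} {w : ι → ℤ} {a : Ser ι B} (ha : WF c w p a) (I : ι)
    (h : ∀ A S, Γ I A S ≠ 0 → w S ≤ w A) : WF c w p (nab d Γ I a) := by
  rw [nab_apply]
  refine (ha.dB _).sub (WF.sum fun A _ => WF.sum fun S _ => ?_)
  by_cases hΓ : Γ I A S = 0
  · simpa [hΓ] using wf_zero
  · rw [mul_assoc]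
    exact (((ha.dF S).fX_mul A).bC_mul _).mono (by linarith [h A S hΓ])

theorem Fil.nab {p : ℤ} {a : Ser ι B} (ha : Fil p a) (I : ι) : Fil p (nab d Γ I a) :=
  WF.nab d Γ ha I fun _ _ _ => le_rfl

end Nab

/-- The algebraic data on which Fedosov's construction depends: derivations of the base, a (not
necessarily symmetric) contravariant tensor `Λ`, a torsion-free connection which preserves it, and
an element `R` which represents the curvature. -/
structure FData (ι B : Type*) [CommRing B] [Algebra ℂ B] [Fintype ι] where
  d : ι → Derivation ℂ B B
  Λ : ι → ι → B
  Γ : ι → ι → ι → B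
  R : ι → ι → Ser ι B
  d_comm : ∀ I J f, d I (d J f) = d J (d I f)
  Γ_symm : ∀ I J S, Γ I J S = Γ J I S
  Λ_parallel : ∀ K I J,
    d K (Λ I J) + (∑ S, Γ K S I * Λ S J) + ∑ S, Γ K S J * Λ I S = 0
  R_van : ∀ I J, Van 0 (R I J)
  R_fil : ∀ I J, Fil 2 (R I J)
  R_skew : ∀ I J, R I J = -R J I
  R_delta : ∀ I J K, dF K (R I J) + dF I (R J K) + dF J (R K I) = 0
  R_nab : ∀ I J K, nab d Γ K (R I J) + nab d Γ I (R J K) + nab d Γ J (R K I) = 0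
  nab_comm : ∀ I J a, nab d Γ I (nab d Γ J a) - nab d Γ J (nab d Γ I a) = br Λ (R I J) a

namespace FData

variable (F : FData ι B)

/-- The covariant derivative. -/
abbrev N (I : ι) : Ser ι B →+ Ser ι B := nab F.d F.Γ I

/-- The error terms left over in the Leibniz rule add up to the covariant derivative of the tensor
`Λ`, which is zero. -/
theorem N_wk (I : ι) (a b : Ser ι B) :
    F.N I (wk F.Λ a b) = wk F.Λ (F.N I a) b + wk F.Λ a (F.N I b) :=
  wk_derivation F.Λ (F.N I) (fun _ _ h => h.nab _ _ I) (nab_nu_mul _ _ I) (nab_smul _ _ I)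
    (wterm_derivation F.Λ (F.N I) (nab_mul _ _ I) (fun A S => F.d I (F.Λ A S)) (F.Γ I)
      (fun _ _ => nab_bC _ _ I _) (fun J a => nab_dF _ _ I J a) (F.Λ_parallel I)) a b

theorem N_br (I : ι) (a b : Ser ι B) :
    F.N I (br F.Λ a b) = br F.Λ (F.N I a) b + br F.Λ a (F.N I b) := by
  simp only [br, nab_nu_mul, map_sub, N_wk]; ring

/-- The curvature of `∇ + ν⁻¹ ad r`. -/
def curvOf (r : ι → Ser ι B) (I J : ι) : Ser ι B :=
  F.R I J + (F.N I (r J) - F.N J (r I)) + br F.Λ (r I) (r J)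

/-- The equations for the element which defines the Fedosov connection. -/
structure IsFed (r : ι → Ser ι B) : Prop where
  van : ∀ I, Van 0 (r I)
  fil : ∀ I, Fil 2 (r I)
  norm : ∑ I, fX I * r I = 0
  eq : ∀ I J, dF I (r J) - dF J (r I) = F.curvOf r I J

-- The homotopy identity between δ and contraction with ζ: contracting an equation for δa leaves
-- Euler operator plus form degree, acting on `a`, up to the contraction of `a` itself.
omit [Algebra ℂ B] in
theorem sum_fX_dF (a : ι → Ser ι B) (J : ι) :
    ∑ I, (fX I : Ser ι B) * dF J (a I) = dF J (∑ I, (fX I : Ser ι B) * a I) - a J := by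
  classical
  simp [map_sum, dF_mul, dF_fX, Finset.sum_add_distrib]

/-- The Bianchi identity for the connection ∇ + ν⁻¹ ad(r). Its terms without r, linear, quadratic
and cubic in r cancel separately: by the Bianchi identity of ∇, by the formula for the curvature of
∇, by the Leibniz rule for the bracket, and by the Jacobi identity. -/
theorem bianchi (r : ι → Ser ι B) (I J K : ι) :
    F.N K (F.curvOf r I J) + br F.Λ (r K) (F.curvOf r I J) +
    (F.N I (F.curvOf r J K) + br F.Λ (r I) (F.curvOf r J K)) +
    (F.N J (F.curvOf r K I) + br F.Λ (r J) (F.curvOf r K I)) = 0 := by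
  have hs : ∀ x y z : Ser ι B, br F.Λ x (y - z) = br F.Λ x y - br F.Λ x z := fun x y z => by
    simp only [← brHom_apply, map_sub]
  simp only [curvOf, map_add, map_sub, N_br, br_add_right, hs]
  have e1 := F.nab_comm K I (r J)
  have e2 := F.nab_comm I J (r K)
  have e3 := F.nab_comm J K (r I)
  have s1 := br_skew F.Λ (F.R K I) (r J)
  have s2 := br_skew F.Λ (F.R I J) (r K)
  have s3 := br_skew F.Λ (F.R J K) (r I)
  have j1 := br_jacobi F.Λ (r K) (r I) (r J)
  have j2 := br_skew F.Λ (br F.Λ (r K) (r I)) (r J)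
  have j3 := br_skew F.Λ (r K) (r J)
  have j4 : br F.Λ (r I) (br F.Λ (r K) (r J)) = -br F.Λ (r I) (br F.Λ (r J) (r K)) := by
    rw [j3]; simp only [← brHom_apply, map_neg]
  have m1 := br_skew F.Λ (F.N K (r I)) (r J)
  have m2 := br_skew F.Λ (F.N I (r J)) (r K)
  have m3 := br_skew F.Λ (F.N J (r K)) (r I)
  have m4 := br_skew F.Λ (F.N I (r K)) (r J)
  have m5 := br_skew F.Λ (F.N J (r I)) (r K)
  have m6 := br_skew F.Λ (F.N K (r J)) (r I)
  have R := F.R_nab I J K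
  linear_combination (exp := 1) R + e1 + e2 + e3 + s1 + s2 + s3 + j1 + j2 + j4 + m1 + m2 + m3

/-- Covariant derivatives and fibre derivatives commute after antisymmetrization. -/
theorem delta_nab (r : ι → Ser ι B) (I J K : ι) :
    dF K (F.N I (r J) - F.N J (r I)) + dF I (F.N J (r K) - F.N K (r J)) +
      dF J (F.N K (r I) - F.N I (r K)) =
    -(F.N K (dF I (r J) - dF J (r I)) + F.N I (dF J (r K) - dF K (r J)) +
      F.N J (dF K (r I) - dF I (r K))) := by
  simp only [map_sub, nab_dF, F.Γ_symm J I, F.Γ_symm K I, F.Γ_symm K J]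
  ring

theorem delta_br (r : ι → Ser ι B) (I J K : ι) :
    dF K (br F.Λ (r I) (r J)) + dF I (br F.Λ (r J) (r K)) + dF J (br F.Λ (r K) (r I)) =
    -(br F.Λ (r K) (dF I (r J) - dF J (r I)) + br F.Λ (r I) (dF J (r K) - dF K (r J)) +
      br F.Λ (r J) (dF K (r I) - dF I (r K))) := by
  have hs : ∀ x y z : Ser ι B, br F.Λ x (y - z) = br F.Λ x y - br F.Λ x z := fun x y z => by
    simp only [← brHom_apply, map_sub]
  simp only [dF_br, hs]
  linear_combination (exp := 1) br_skew F.Λ (dF K (r I)) (r J) + br_skew F.Λ (dF I (r J)) (r K) +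
    br_skew F.Λ (dF J (r K)) (r I)

/-- The iteration whose fixed points are the solutions of the equations for `r`. -/
def step (r : ι → Ser ι B) (J : ι) : Ser ι B := eulerInv 1 (∑ I, fX I * F.curvOf r I J)

theorem curvOf_skew (r : ι → Ser ι B) (I J : ι) : F.curvOf r I J = -F.curvOf r J I := by
  simp only [curvOf]
  linear_combination (exp := 1) F.R_skew I J + br_skew F.Λ (r I) (r J)

/-- Contracting δr = curvature with ζ turns the left side into (Euler + 1) r, since the contraction
of r itself vanishes by the normalization. -/
theorem IsFed.fixed {r : ι → Ser ι B} (h : F.IsFed r) : F.step r = r := by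
  funext J
  refine (eulerInv_unique one_ne_zero ?_).symm
  simp only [← h.eq, mul_sub, Finset.sum_sub_distrib, sum_fX_dF, h.norm, map_zero]
  simp [euler]

/-- ζ^I ζ^J is symmetric, so the double contraction equals its own negative; scalars from ℂ allow
division by two. -/
theorem sum_fX_sum_fX_skew (A : ι → ι → Ser ι B) (hA : ∀ I J, A I J = -A J I) :
    ∑ J, fX J * ∑ I, fX I * A I J = 0 := by
  have h : ∑ J, fX J * ∑ I, fX I * A I J = -∑ J, fX J * ∑ I, fX I * A I J := by
    simp only [Finset.mul_sum]
    conv_lhs => rw [Finset.sum_comm]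
    rw [← Finset.sum_neg_distrib]
    refine Finset.sum_congr rfl fun I _ => ?_
    rw [← Finset.sum_neg_distrib]
    refine Finset.sum_congr rfl fun J _ => ?_
    rw [hA I J]; ring
  generalize ∑ J, fX J * ∑ I, fX I * A I J = x at h
  have h2 : x + x = 0 := by nth_rewrite 1 [h]; simp
  have h3 : x = bC (algebraMap ℂ B (2⁻¹)) * (x + x) := by
    have h4 : bC (algebraMap ℂ B (2⁻¹)) * (2 : Ser ι B) = 1 := by
      rw [← map_ofNat (bC : B →+* Ser ι B) 2, ← map_ofNat (algebraMap ℂ B) 2, ← map_mul, ← map_mul]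
      simp
    rw [← two_mul, ← mul_assoc, h4, one_mul]
  rw [h3, h2, mul_zero]

/-- Differences are not lowered in degree: the quadratic term splits into brackets of a difference
with an element of degree at least two. The factor ζ in `step` then yields the gain of one degree.
-/
theorem Fil.curvOf_sub {a b : ι → Ser ι B} {e : ℤ} (ha : ∀ I, Fil 2 (a I))
    (hb : ∀ I, Fil 2 (b I)) (h : ∀ I, Fil e (a I - b I)) (I J : ι) :
    Fil e (F.curvOf a I J - F.curvOf b I J) := by
  have h1 : br F.Λ (a I) (a J) - br F.Λ (b I) (b J) =
      br F.Λ (a I - b I) (a J) + br F.Λ (b I) (a J - b J) := by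
    simp only [← brHom_apply, map_sub, AddMonoidHom.sub_apply]; ring
  have h2 : F.curvOf a I J - F.curvOf b I J = (F.N I (a J - b J) - F.N J (a I - b I)) +
      (br F.Λ (a I - b I) (a J) + br F.Λ (b I) (a J - b J)) := by
    rw [← h1]; simp only [curvOf, map_sub]; ring
  rw [h2]
  exact ((Fil.nab _ _ (h J) I).sub (Fil.nab _ _ (h I) J)).add
    (((Fil.br _ (h I) (ha J)).mono (by omega)).add ((Fil.br _ (hb I) (h J)).mono (by omega)))

theorem IsFed.unique {r r' : ι → Ser ι B} (h : F.IsFed r) (h' : F.IsFed r') : r = r' := by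
  funext I
  rw [← sub_eq_zero]
  refine fil_induction (fun I => r I - r' I) 0 (fun I => (h.van I).sub (h'.van I)) ?_ I
  intro e he J
  have : r J - r' J = eulerInv 1 (∑ I, (fX I : Ser ι B) * (F.curvOf r I J - F.curvOf r' I J)) := by
    conv_lhs => rw [← h.fixed, ← h'.fixed]
    simp only [step, ← map_sub, mul_sub, Finset.sum_sub_distrib]
  rw [this]
  exact (WF.sum fun I _ => (WF.fX_mul (Fil.curvOf_sub F h.fil h'.fil he I J) I).mono (by
    simp only [Pi.one_apply]; omega)).eulerInv 1

/-- Fixed points of `step` solve only the contracted equation; that they solve the full one is a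
consequence of the Bianchi identity. The predicate `P` stands for any closed condition preserved by
the iteration, and later carries the order conditions needed for separation of variables. -/
theorem exists_isFed (P : (ι → Ser ι B) → Prop) (P0 : P 0)
    (hP : ∀ a, (∀ I, Van 0 (a I)) → (∀ I, Fil 2 (a I)) → P a → P (F.step a))
    (Pcl : ∀ a, (∀ e, ∃ b, P b ∧ ∀ i, Fil e (a i - b i)) → P a) :
    ∃ r, F.IsFed r ∧ P r := by
  have hvan : ∀ a, (∀ I, Van 0 (a I)) → ∀ I J, Van 0 (F.curvOf a I J) := fun a ha I J =>
    ((F.R_van I J).add (((ha J).nab _ _ I).sub ((ha I).nab _ _ J))).add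
      (((ha I).br _ (ha J)).mono (by simp))
  obtain ⟨r, ⟨hv, hf, hPr⟩, hr⟩ := exists_fixed_point F.step
    (fun a => (∀ I, Van 0 (a I)) ∧ (∀ I, Fil 2 (a I)) ∧ P a) 0
    ⟨fun _ => van_zero _, fun _ => wf_zero, P0⟩
    (fun a ⟨h1, h2, h3⟩ => ⟨fun J => (Van.sum fun I _ => (hvan a h1 I J).fX_mul I).eulerInv 1,
      fun J => (WF.sum fun I _ => (WF.fX_mul (w := 1) (p := 2) (((F.R_fil I J).add
        ((Fil.nab _ _ (h2 J) I).sub (Fil.nab _ _ (h2 I) J))).add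
        ((Fil.br _ (h2 I) (h2 J)).mono (by omega))) I).mono
          (by simp only [Pi.one_apply]; omega)).eulerInv 1, hP a h1 h2 h3⟩)
    (fun a h => h.1)
    (fun a h => ⟨fun I k hk => by
        ext m
        obtain ⟨b, ⟨hb, -⟩, hab⟩ := h (wt 2 1 k m + 1)
        have := hab I k m (by omega)
        rw [cf_sub, sub_eq_zero] at this
        rw [← cf, this, cf, hb I k hk],
      fun I => by
        obtain ⟨b, ⟨-, hb, -⟩, hab⟩ := h 2
        have := (hab I).add (hb I)
        rwa [sub_add_cancel] at this,
      Pcl a fun e => (h e).imp fun b hb => ⟨hb.1.2.2, hb.2⟩⟩)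
    (fun a b e ha hb hab J => by
      simp only [step, ← map_sub, ← Finset.sum_sub_distrib, ← mul_sub]
      exact (WF.sum fun I _ => (WF.fX_mul (Fil.curvOf_sub F ha.2.1 hb.2.1 hab I J) I).mono (by
        simp only [Pi.one_apply]; omega)).eulerInv 1)
  have hE : ∀ J, euler (r J) + r J = ∑ I, (fX I : Ser ι B) * F.curvOf r I J := fun J => by
    have h1 : eulerInv 1 (∑ I, (fX I : Ser ι B) * F.curvOf r I J) = r J := congrFun hr J
    have := euler_eulerInv 1 one_ne_zero (∑ I, (fX I : Ser ι B) * F.curvOf r I J)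
    rwa [h1, Nat.cast_one, one_mul] at this
  -- A second contraction kills the skew curvature and leaves the Euler operator applied to the
  -- contraction `y` of `r`. So `y` has no part of positive fibre degree, and it has no constant
  -- part because each of its terms contains a ζ.
  have hnorm : ∑ I, fX I * r I = 0 := by
    set y := ∑ I, fX I * r I with hy
    have h1 : euler y = 0 := by
      have h0 := sum_fX_sum_fX_skew (F.curvOf r) (F.curvOf_skew r)
      simp only [← hE, mul_add, Finset.sum_add_distrib, ← hy] at h0
      rw [← h0, euler, hy]
      simp only [euler, Finset.mul_sum, map_sum]
      rw [← sub_eq_zero]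
      classical
      simp only [dF_mul, dF_fX, mul_add, Finset.sum_add_distrib]
      simp only [ite_mul, one_mul, zero_mul, mul_ite, mul_zero, Finset.sum_ite_eq,
        Finset.mem_univ, if_true]
      rw [Finset.sum_comm]
      simp only [mul_left_comm (fX _) (fX _)]
      abel
    refine ser_ext fun k m => ?_
    by_cases hm : m = 0
    · subst hm
      classical
      rw [hy, cf_sum]
      exact Finset.sum_eq_zero fun I _ => by rw [cf_fX_mul, if_pos (by simp)]
    · exact cf_eq_zero_of_euler hm (by rw [h1, cf_zero])
  refine ⟨r, ⟨hv, hf, hnorm, fun I J => ?_⟩, hPr⟩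
  rw [← sub_eq_zero]
  -- `A` is the defect of the equation to be proved. It is skew and its contraction with ζ vanishes
  -- by the fixed-point property.
  set A : ι × ι → Ser ι B := fun x => dF x.1 (r x.2) - dF x.2 (r x.1) - F.curvOf r x.1 x.2 with hA
  have hAs : ∀ I J, A (I, J) = -A (J, I) := fun I J => by
    simp only [hA]; rw [F.curvOf_skew r I J]; ring
  have hAz : ∀ J, ∑ I, fX I * A (I, J) = 0 := fun J => by
    simp only [hA, mul_sub, Finset.sum_sub_distrib, sum_fX_dF, hnorm, map_zero, ← hE]
    simp [euler]
  -- Since δδ = 0, only the curvature contributes to δA. Moving δ past ∇ and the bracket replaces r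
  -- by δr, and subtracting the Bianchi identity replaces δr by the defect: δA = ∇A + ν⁻¹[r, A].
  have hcyc : ∀ I J K, dF K (A (I, J)) + dF I (A (J, K)) + dF J (A (K, I)) =
      (F.N K (A (I, J)) + br F.Λ (r K) (A (I, J))) + (F.N I (A (J, K)) + br F.Λ (r I) (A (J, K))) +
      (F.N J (A (K, I)) + br F.Λ (r J) (A (K, I))) := fun I J K => by
    have hs : ∀ x y z : Ser ι B, br F.Λ x (y - z) = br F.Λ x y - br F.Λ x z := fun x y z => by
      simp only [← brHom_apply, map_sub]
    have b1 := F.bianchi r I J K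
    have b2 := F.delta_nab r I J K
    have b3 := F.delta_br r I J K
    have b4 := F.R_delta I J K
    simp only [hA, map_sub, hs] at b2 b3 ⊢
    rw [dF_comm K I (r J), dF_comm K J (r I), dF_comm I J (r K)]
    have hc : ∀ K I J, dF K (F.curvOf r I J) = dF K (F.R I J) +
        (dF K (F.N I (r J)) - dF K (F.N J (r I))) + dF K (br F.Λ (r I) (r J)) := fun K I J => by
      simp only [curvOf, map_add, map_sub]
    rw [hc, hc, hc]
    linear_combination (exp := 1) b1 - b2 - b3 - b4
  refine fil_induction A 0 (fun x => (((hv _).dF _).sub ((hv _).dF _)).sub (hvan r hv _ _)) ?_ (I, J)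
  rintro e he ⟨I, J⟩
  -- Contracting `hcyc` with ζ^K gives Euler + 2, as `A` is a two-form. The right side gains one
  -- degree through ζ^K, so `fil_induction` applies.
  have hsum : euler (A (I, J)) + ((2 : ℕ) : Ser ι B) * A (I, J) = ∑ K, fX K *
      ((F.N K (A (I, J)) + br F.Λ (r K) (A (I, J))) + (F.N I (A (J, K)) + br F.Λ (r I) (A (J, K))) +
      (F.N J (A (K, I)) + br F.Λ (r J) (A (K, I)))) := by
    simp only [← hcyc, mul_add, Finset.sum_add_distrib]
    rw [sum_fX_dF (fun K => A (K, I)) J, hAz]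
    have : ∑ K, fX K * dF I (A (J, K)) = -∑ K, fX K * dF I (A (K, J)) := by
      rw [← Finset.sum_neg_distrib]
      exact Finset.sum_congr rfl fun K _ => by rw [hAs J K, map_neg]; ring
    rw [this, sum_fX_dF (fun K => A (K, J)) I, hAz, hAs J I]
    simp [euler]; ring
  rw [eulerInv_unique two_ne_zero hsum]
  have hD : ∀ K x, Fil e (F.N K (A x) + br F.Λ (r K) (A x)) := fun K x =>
    (Fil.nab _ _ (he x) K).add ((Fil.br _ (hf K) (he x)).mono (by omega))
  exact (WF.sum fun K _ => (WF.fX_mul (((hD K _).add (hD I _)).add (hD J _)) K).mono (by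
    simp only [Pi.one_apply]; omega)).eulerInv 2

end FData

end Abstract

end FedosovWick

end

open scoped Manifold ContDiff Topology ComplexOrder

noncomputable section

namespace FedosovWick

/-! ### The Fedosov derivation and flat lifts of formal functions. -/

section Flat

variable {ι B : Type*} [CommRing B] [Algebra ℂ B] [Fintype ι]

omit [Algebra ℂ B] [Fintype ι] in
theorem coeff_C_liftL [DecidableEq ι] (f : LaurentSeries B) (k : ℤ) (m : ι →₀ ℕ) :
    cf (liftL (MvPowerSeries.C (σ := ι) (R := B) : B →+ MvPowerSeries ι B) f) k m =
      if m = 0 then f.coeff k else 0 := by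
  simp only [cf, coeff_liftL]
  exact MvPowerSeries.coeff_C _ _

/-- Formal functions on the base as elements of the Wick algebra. -/
def cL : LaurentSeries B →+ Ser ι B :=
  liftL (MvPowerSeries.C (σ := ι) (R := B) : B →+ MvPowerSeries ι B)

omit [Algebra ℂ B] [Fintype ι] in
theorem cf_cL_zero (f : LaurentSeries B) (k : ℤ) : cf (cL f : Ser ι B) k 0 = f.coeff k := by
  classical
  rw [cL, coeff_C_liftL, if_pos rfl]

omit [Algebra ℂ B] [Fintype ι] in
theorem cf_cL_of_ne (f : LaurentSeries B) (k : ℤ) {m : ι →₀ ℕ} (hm : m ≠ 0) :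
    cf (cL f : Ser ι B) k m = 0 := by
  classical
  rw [cL, coeff_C_liftL, if_neg hm]

omit [Algebra ℂ B] [Fintype ι] in
theorem dF_cL (I : ι) (f : LaurentSeries B) : dF I (cL f) = 0 := by
  refine ser_ext fun k m => ?_
  rw [cf_dF, cf_cL_of_ne _ _ fun h => ?_, mul_zero, cf_zero]
  have := DFunLike.congr_fun h I
  simp at this

/-- The symbol of an element of the Wick algebra, the part without fibre variables. -/
def symb : Ser ι B →+ LaurentSeries B :=
  liftL (MvPowerSeries.constantCoeff (σ := ι) (R := B) : MvPowerSeries ι B →+ B)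

omit [Algebra ℂ B] [Fintype ι] in
theorem coeff_symb (a : Ser ι B) (k : ℤ) : (symb a).coeff k = cf a k 0 := by
  simp only [cf, symb, coeff_liftL, MvPowerSeries.coeff_zero_eq_constantCoeff]
  rfl

omit [Algebra ℂ B] [Fintype ι] in
theorem Van.symb {p : ℤ} {a : Ser ι B} (ha : Van p a) : Van p (symb a) := ha.liftL _

omit [Algebra ℂ B] [Fintype ι] in
theorem Van.cL {p : ℤ} {f : LaurentSeries B} (hf : Van p f) : Van p (cL f : Ser ι B) := hf.liftL _

namespace FData

variable (F : FData ι B)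

/-- The Fedosov derivation. -/
def D (r : ι → Ser ι B) (I : ι) : Ser ι B →+ Ser ι B :=
  -(dF I : Ser ι B →+ Ser ι B) + F.N I + brHom F.Λ (r I)

theorem D_apply (r : ι → Ser ι B) (I : ι) (w : Ser ι B) :
    F.D r I w = -dF I w + F.N I w + br F.Λ (r I) w := rfl

/-- Flat elements of the Wick algebra. -/
def Flat (r : ι → Ser ι B) (w : Ser ι B) : Prop := ∀ I, F.D r I w = 0

theorem D_wk (r : ι → Ser ι B) (I : ι) (a b : Ser ι B) :
    F.D r I (wk F.Λ a b) = wk F.Λ (F.D r I a) b + wk F.Λ a (F.D r I b) := by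
  simp only [D_apply, dF_wk, N_wk, br_wk, wk_add_left, wk_add_right, wk_neg_left, wk_neg_right]
  ring

variable {F} {r : ι → Ser ι B}

theorem Flat.wk {a b : Ser ι B} (ha : F.Flat r a) (hb : F.Flat r b) :
    F.Flat r (wk F.Λ a b) := fun I => by
  rw [D_wk, ha I, hb I, wk_zero_left, wk_zero_right, add_zero]

theorem Flat.add {a b : Ser ι B} (ha : F.Flat r a) (hb : F.Flat r b) :
    F.Flat r (a + b) := fun I => by rw [map_add, ha I, hb I, add_zero]

theorem Flat.sub {a b : Ser ι B} (ha : F.Flat r a) (hb : F.Flat r b) :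
    F.Flat r (a - b) := fun I => by rw [map_sub, ha I, hb I, sub_zero]

theorem flat_one : F.Flat r 1 := fun I => by
  have h1 : dF I (1 : Ser ι B) = 0 := by rw [← map_one bC, dF_bC]
  have h2 : F.N I (1 : Ser ι B) = 0 := by rw [← map_one bC, nab_bC]; simp
  rw [D_apply, h1, h2, br, wk_one_left, wk_one_right]
  simp

theorem Flat.nu_mul {a : Ser ι B} (ha : F.Flat r a) (k : ℤ) : F.Flat r (nu k * a) := fun I => by
  have h := ha I
  rw [D_apply] at h
  rw [D_apply, dF_nu_mul, nab_nu_mul, br, wk_nu_left, wk_nu_right]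
  rw [br] at h
  linear_combination (exp := 1) nu k * h

/-- The curvature of `D` is the adjoint action of curvature minus δr, divided by ν, and this
difference is zero by the equation for r. -/
theorem IsFed.D_comm (h : F.IsFed r) (I J : ι) (w : Ser ι B) :
    F.D r I (F.D r J w) = F.D r J (F.D r I w) := by
  have hs : ∀ x y z : Ser ι B, br F.Λ x (y - z) = br F.Λ x y - br F.Λ x z := fun x y z => by
    simp only [← brHom_apply, map_sub]
  have hs' : ∀ x y z : Ser ι B, br F.Λ (y - z) x = br F.Λ y x - br F.Λ z x := fun x y z => by
    simp only [← brHom_apply, map_sub, AddMonoidHom.sub_apply]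
  have e := congrArg (br F.Λ · w) (h.eq I J)
  simp only [curvOf, br_add_left, hs'] at e
  have n := F.nab_comm I J w
  have j := br_jacobi F.Λ (r I) (r J) w
  simp only [D_apply, map_add, map_neg, dF_br, nab_dF, N_br,
    F.Γ_symm J I, dF_comm J I w]
  linear_combination (exp := 1) n - e + j

/-- Flatness expresses ∂w/∂ζ^I by terms that do not lower the degree; contraction with ζ^I shows
that the Euler operator raises the degree of `w`. With zero symbol, `w` itself moves up
indefinitely. -/
theorem IsFed.eq_zero_of_flat (h : F.IsFed r) {w : Ser ι B} (hw : F.Flat r w)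
    (h0 : ∀ k, cf w k 0 = 0) : w = 0 := by
  refine fil_induction (fun _ : Unit => w) w.order (fun _ => van_order w) (fun e he _ => ?_) ()
  have hx : Fil (e + 1) (euler w) := WF.sum fun I _ => by
    have : dF I w = F.N I w + br F.Λ (r I) w := by
      have := hw I
      rw [D_apply] at this
      linear_combination (exp := 1) -this
    rw [this]
    exact (((Fil.nab _ _ (he ()) I).add
      ((Fil.br _ (h.fil I) (he ())).mono (by omega))).fX_mul I).mono (by
        simp only [Pi.one_apply]; omega)
  intro k m hk
  by_cases hm : m = 0
  · rw [hm, h0]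
  · exact cf_eq_zero_of_euler hm (hx k m hk)

theorem IsFed.flat_unique (h : F.IsFed r) {w w' : Ser ι B} (hw : F.Flat r w) (hw' : F.Flat r w')
    (h0 : symb w = symb w') : w = w' :=
  sub_eq_zero.1 (h.eq_zero_of_flat (hw.sub hw') fun k => by
    rw [cf_sub, ← coeff_symb, ← coeff_symb, h0, sub_self])

/-- Fedosov's recursion w = f + δ⁻¹(∇w + ν⁻¹[r, w]) is a contraction. Its fixed point satisfies the
contracted flatness equation, and the commuting of the `D I` upgrades this to flatness. -/
theorem IsFed.exists_flat (h : F.IsFed r) {N : ℤ} {f : LaurentSeries B} (hf : Van N f) :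
    ∃ w, F.Flat r w ∧ symb w = f ∧ Van N w := by
  -- In `eulerInv 0` the division by fibre degree zero gives zero, because `0⁻¹ = 0`. Hence the
  -- correction has no symbol and `f` stays the symbol.
  set T : (Unit → Ser ι B) → Unit → Ser ι B := fun w _ =>
    cL f + eulerInv 0 (∑ I, (fX I : Ser ι B) * (F.N I (w ()) + br F.Λ (r I) (w ()))) with hT
  obtain ⟨w, hw, hTw⟩ := exists_fixed_point T (fun w => Van N (w ())) N (van_zero _)
    (fun w hw => hf.cL.add ((Van.sum fun I _ => ((hw.nab _ _ I).add
      (((h.van I).br _ hw).mono (by simp))).fX_mul I).eulerInv 0))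
    (fun w hw _ => hw)
    (fun w hw k hk => by
      ext m
      obtain ⟨b, hb, hab⟩ := hw (wt 2 1 k m + 1)
      have := hab () k m (by omega)
      rw [cf_sub, sub_eq_zero] at this
      rw [← cf, this, cf, hb k hk])
    (fun a b e _ _ hab _ => by
      have : T a () - T b () = eulerInv 0 (∑ I, (fX I : Ser ι B) * (F.N I (a () - b ()) +
          br F.Λ (r I) (a () - b ()))) := by
        simp only [hT, ← brHom_apply, map_sub, mul_add, mul_sub, Finset.sum_add_distrib,
          Finset.sum_sub_distrib, map_add]
        ring
      rw [this]
      exact (WF.sum fun I _ => (((Fil.nab _ _ (hab ()) I).add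
        ((Fil.br _ (h.fil I) (hab ())).mono (by omega))).fX_mul I).mono (by
          simp only [Pi.one_apply]; omega)).eulerInv 0)
  set v := w () with hv
  have hfix : v = cL f + eulerInv 0 (∑ I, (fX I : Ser ι B) * (F.N I v + br F.Λ (r I) v)) :=
    (congrFun hTw ()).symm
  have hsymb : symb v = f := by
    ext k
    rw [coeff_symb, hfix, cf_add, cf_cL_zero, cf_eulerInv]
    simp
  have hE : euler v = ∑ I, (fX I : Ser ι B) * (F.N I v + br F.Λ (r I) v) := by
    refine ser_ext fun k m => ?_
    rw [cf_euler]
    by_cases hm : m = 0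
    · subst hm
      classical
      rw [cf_sum]
      simp [cf_fX_mul]
    · nth_rewrite 1 [hfix]
      have hd : m.degree ≠ 0 := by rwa [Ne, Finsupp.degree_eq_zero_iff]
      rw [cf_add, cf_cL_of_ne _ _ hm, zero_add, cf_eulerInv, Nat.cast_zero, add_zero,
        mul_smul_comm, nat_inv_smul hd]
  -- The one-form Dv is annihilated by contraction with ζ. This plays the role of the normalization
  -- condition in the next homotopy argument.
  have hz : ∑ I, (fX I : Ser ι B) * F.D r I v = 0 := by
    have : ∀ I, (fX I : Ser ι B) * F.D r I v = fX I * (F.N I v + br F.Λ (r I) v) - fX I * dF I v :=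
      fun I => by rw [D_apply]; ring
    simp only [this, Finset.sum_sub_distrib, ← hE]
    simp [euler]
  have hDv : ∀ I, Van N (F.D r I v) := fun I => by
    rw [D_apply]
    exact ((hw.dF I).neg.add (hw.nab _ _ I)).add (((h.van I).br _ hw).mono (by simp))
  refine ⟨v, fun J => ?_, hsymb, hw⟩
  refine fil_induction (fun J => F.D r J v) N hDv (fun e he J => ?_) J
  -- From D(Dv) = 0 one has δ(Dv) = (∇ + ν⁻¹ ad r)(Dv); contraction with ζ gives (Euler + 1) on the
  -- left and a gain of one degree on the right.
  have h1 : euler (F.D r J v) + ((1 : ℕ) : Ser ι B) * F.D r J v =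
      ∑ I, (fX I : Ser ι B) * ((F.N I (F.D r J v) + br F.Λ (r I) (F.D r J v)) -
        (F.N J (F.D r I v) + br F.Λ (r J) (F.D r I v)) ) := by
    have h2 : ∀ I, (F.N I (F.D r J v) + br F.Λ (r I) (F.D r J v)) -
        (F.N J (F.D r I v) + br F.Λ (r J) (F.D r I v)) =
        dF I (F.D r J v) - dF J (F.D r I v) := fun I => by
      have := h.D_comm I J v
      rw [D_apply F r I (F.D r J v), D_apply F r J (F.D r I v)] at this
      linear_combination (exp := 1) this
    simp only [h2, mul_sub, Finset.sum_sub_distrib, sum_fX_dF, hz, map_zero]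
    simp [euler]
  have hD : ∀ I J, Fil e (F.N I (F.D r J v) + br F.Λ (r I) (F.D r J v)) := fun I J =>
    (Fil.nab _ _ (he J) I).add ((Fil.br _ (h.fil I) (he J)).mono (by omega))
  rw [eulerInv_unique one_ne_zero h1]
  exact (WF.sum fun I _ => (((hD I J).sub (hD J I)).fX_mul I).mono (by
    simp only [Pi.one_apply]; omega)).eulerInv 1

/-- The flat element with a given symbol. -/
def IsFed.tau (h : F.IsFed r) (f : LaurentSeries B) : Ser ι B :=
  (h.exists_flat (van_order f)).choose

theorem IsFed.flat_tau (h : F.IsFed r) (f : LaurentSeries B) : F.Flat r (h.tau f) :=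
  (h.exists_flat (van_order f)).choose_spec.1

theorem IsFed.symb_tau (h : F.IsFed r) (f : LaurentSeries B) : symb (h.tau f) = f :=
  (h.exists_flat (van_order f)).choose_spec.2.1

theorem IsFed.eq_tau (h : F.IsFed r) {f : LaurentSeries B} {w : Ser ι B} (hw : F.Flat r w)
    (hf : symb w = f) : w = h.tau f :=
  h.flat_unique hw (h.flat_tau f) (by rw [hf, h.symb_tau])

theorem IsFed.van_tau (h : F.IsFed r) {N : ℤ} {f : LaurentSeries B} (hf : Van N f) :
    Van N (h.tau f) := by
  obtain ⟨w, hw, hs, hv⟩ := h.exists_flat hf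
  rwa [← h.eq_tau hw hs]

end FData

end Flat

end FedosovWick

end

open scoped Manifold ContDiff Topology ComplexOrder

noncomputable section

namespace FedosovWick

/-! ### Peeling off one fibre variable; identities checked on generators. -/

section Decomposition

variable {ι B : Type*} [CommRing B] [Fintype ι]

/-- Every non-constant monomial is assigned to one chosen variable that occurs in it, and is divided
by that variable. Iteration replaces a density argument for polynomials in the fibre variables. -/
theorem ser_decomposition {N : ℤ} {a : Ser ι B} (ha : Van N a) : ∃ g : ι → Ser ι B,
    (∀ A, Van N (g A)) ∧ (∀ A e, Fil e a → Fil (e - 1) (g A)) ∧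
      a = cL (symb a) + ∑ A, fX A * g A := by
  classical
  have hex : ∀ m : ι →₀ ℕ, m ≠ 0 → ∃ I, m I ≠ 0 := fun m hm => by
    by_contra h
    push Not at h
    exact hm (Finsupp.ext h)
  set g : ι → Ser ι B := fun A => HahnSeries.ofSuppBddBelow (fun k m =>
    if h : m + Finsupp.single A 1 ≠ 0 then
      if (hex _ h).choose = A then cf a k (m + Finsupp.single A 1) else 0 else 0)
    ⟨N, fun k hk => by
      by_contra hlt
      refine hk (funext fun m => ?_)
      have h0 : ∀ m, cf a k m = 0 := fun m => by rw [cf, ha k (not_le.1 hlt), map_zero]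
      simp only [h0, ite_self, dite_eq_ite]
      rfl⟩ with hg
  have hcf : ∀ A k m, cf (g A) k m = if h : m + Finsupp.single A 1 ≠ 0 then
      if (hex _ h).choose = A then cf a k (m + Finsupp.single A 1) else 0 else 0 :=
    fun _ _ _ => rfl
  refine ⟨g, fun A k hk => ?_, fun A e he k m hk => ?_, ser_ext fun k m => ?_⟩
  · ext m
    change cf (g A) k m = 0
    have h0 : ∀ m, cf a k m = 0 := fun m => by rw [cf, ha k hk, map_zero]
    rw [hcf]
    simp only [h0, ite_self, dite_eq_ite]
  · have h0 : cf a k (m + Finsupp.single A 1) = 0 := he _ _ (by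
      have := wt_add (2 : ℤ) (1 : ι → ℤ) k 0 m (Finsupp.single A 1)
      rw [wt_single, add_zero, Pi.one_apply] at this
      omega)
    rw [hcf, h0]
    simp
  · rw [cf_add, cf_sum]
    by_cases hm : m = 0
    · subst hm
      rw [cf_cL_zero, coeff_symb, Finset.sum_eq_zero, add_zero]
      intro A _
      rw [cf_fX_mul, if_pos (by simp)]
    · rw [cf_cL_of_ne _ _ hm, zero_add, Finset.sum_eq_single (hex m hm).choose]
      · have h := (hex m hm).choose_spec
        have e : m - Finsupp.single (hex m hm).choose 1 + Finsupp.single (hex m hm).choose 1 = m :=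
          tsub_add_cancel_of_le (by rw [Finsupp.single_le_iff]; omega)
        rw [cf_fX_mul, if_neg h, hcf, dif_pos (by rwa [e])]
        simp only [e, if_true]
      · intro A _ hA
        rw [cf_fX_mul]
        split_ifs with h
        · rfl
        · have e : m - Finsupp.single A 1 + Finsupp.single A 1 = m :=
            tsub_add_cancel_of_le (by rw [Finsupp.single_le_iff]; omega)
          rw [hcf, dif_pos (by rwa [e]), if_neg]
          simp only [e]
          exact fun h => hA h.symm
      · exact fun h => absurd (Finset.mem_univ _) h

/-- A map which vanishes on the base and is linear over multiplication by fibre variables vanishes. -/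
theorem eq_zero_of_fX_linear {B' : Type*} [CommRing B'] (T : Ser ι B' →+ Ser ι B)
    (y : ι → Ser ι B) (hV : ∀ N a, Van N a → Van N (T a)) (h0 : ∀ f, T (cL f) = 0)
    (hX : ∀ A a, T (fX A * a) = y A * T a) (hy : ∀ A, Fil 1 (y A)) (a : Ser ι B') : T a = 0 := by
  refine eq_zero_of_forall_fil (2 * a.order) fun n => ?_
  -- Each decomposition trades a fibre variable for a factor `y A` of degree at least one, so `n`
  -- decompositions raise the degree by `n`.
  have : ∀ (n : ℕ) (N : ℤ) (a : Ser ι B'), Van N a → Fil (2 * N + n) (T a) := by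
    intro n
    induction n with
    | zero => intro N a ha; simpa using (hV N a ha).fil
    | succ n ih =>
      intro N a ha
      obtain ⟨g, hg, -, hag⟩ := ser_decomposition ha
      rw [hag, map_add, h0, zero_add, map_sum]
      refine WF.sum fun A _ => ?_
      rw [hX]
      exact ((hy A).mul (ih N _ (hg A))).mono (by push_cast; omega)
  exact this n _ a (van_order a)

end Decomposition

/-! ### Change of base ring and of linear frame; naturality of Fedosov's construction. -/

section Pull

variable {ι B B' : Type*} [CommRing B] [CommRing B'] [Fintype ι] (φ : B' →+* B) (J : ι → ι → B)

theorem hasSubst_linear :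
    MvPowerSeries.HasSubst (fun A : ι => ∑ K, MvPowerSeries.C (J A K) * MvPowerSeries.X K) :=
  MvPowerSeries.hasSubst_of_constantCoeff_zero fun A => by simp

/-- Change of the coefficient ring together with a linear substitution of the fibre variables. -/
def pullHom : MvPowerSeries ι B' →+* MvPowerSeries ι B :=
  (MvPowerSeries.substAlgHom (R := B) (hasSubst_linear J)).toRingHom.comp (MvPowerSeries.map φ)

theorem pullHom_apply (a : MvPowerSeries ι B') : pullHom φ J a =
    MvPowerSeries.subst (fun A : ι => ∑ K, MvPowerSeries.C (J A K) * MvPowerSeries.X K)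
      (MvPowerSeries.map φ a) := by
  rw [← MvPowerSeries.coe_substAlgHom (hasSubst_linear J)]
  rfl

theorem pullHom_C (b : B') : pullHom φ J (MvPowerSeries.C b) = MvPowerSeries.C (φ b) := by
  rw [pullHom_apply, MvPowerSeries.map_C, MvPowerSeries.subst_C]

theorem pullHom_X (A : ι) : pullHom φ J (MvPowerSeries.X A) =
    ∑ K, MvPowerSeries.C (J A K) * MvPowerSeries.X K := by
  rw [pullHom_apply, MvPowerSeries.map_X, MvPowerSeries.subst_X (hasSubst_linear J)]

theorem constantCoeff_pullHom (a : MvPowerSeries ι B') :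
    MvPowerSeries.constantCoeff (pullHom φ J a) = φ (MvPowerSeries.constantCoeff a) := by
  have h : MvPowerSeries.constantCoeff (pullHom φ J
      (a - MvPowerSeries.C (MvPowerSeries.constantCoeff a))) = 0 := by
    rw [pullHom_apply]
    exact MvPowerSeries.constantCoeff_subst_eq_zero (hasSubst_linear J) (fun A => by simp)
      (by simp)
  rwa [map_sub, map_sub, pullHom_C, MvPowerSeries.constantCoeff_C, sub_eq_zero] at h

/-- The change of frame on the Wick algebra. -/
def pull : Ser ι B' →+ Ser ι B := liftL (pullHom φ J : MvPowerSeries ι B' →+ MvPowerSeries ι B)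

theorem coeff_pull (a : Ser ι B') (k : ℤ) : (pull φ J a).coeff k = pullHom φ J (a.coeff k) := rfl

theorem pull_mul (a b : Ser ι B') : pull φ J (a * b) = pull φ J a * pull φ J b :=
  liftL_mul (pullHom φ J) a b

theorem pull_bC (b : B') : pull φ J (bC b) = bC (φ b) := by
  rw [pull, bC, RingHom.comp_apply, liftL_C]
  change HahnSeries.C (pullHom φ J (MvPowerSeries.C b)) = _
  rw [pullHom_C]
  rfl

theorem pull_fX (A : ι) : pull φ J (fX A) = ∑ K, bC (J A K) * fX K := by
  rw [pull, fX, liftL_C]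
  change HahnSeries.C (pullHom φ J (MvPowerSeries.X A)) = _
  rw [pullHom_X, map_sum]
  simp only [map_mul]
  rfl

theorem pull_nu_mul (k : ℤ) (a : Ser ι B') : pull φ J (nu k * a) = nu k * pull φ J a :=
  liftL_single_mul _ _ _

theorem pull_nu (k : ℤ) : pull φ J (nu k : Ser ι B') = nu k := by
  have h := pull_nu_mul φ J k (bC 1)
  rw [pull_bC, map_one, map_one, map_one] at h
  simpa using h

theorem Van.pull {p : ℤ} {a : Ser ι B'} (ha : Van p a) : Van p (pull φ J a) := ha.liftL _

theorem pull_cL (f : LaurentSeries B') : pull φ J (cL f) = cL (liftL (φ : B' →+ B) f) := by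
  ext k : 2
  simp only [coeff_pull, cL, coeff_liftL]
  exact pullHom_C φ J _

theorem symb_pull (a : Ser ι B') : symb (pull φ J a) = liftL (φ : B' →+ B) (symb a) := by
  ext k
  exact constantCoeff_pullHom φ J (a.coeff k)

theorem fil_fX (A : ι) : Fil 1 (fX A : Ser ι B) := by
  have := (van_bC (1 : B) : Van 0 (bC 1 : Ser ι B)).fil.fX_mul A
  rw [map_one, mul_one] at this
  simpa using this

theorem fil_pull_fX (A : ι) : Fil 1 (pull φ J (fX A : Ser ι B')) := by
  rw [pull_fX]
  exact WF.sum fun K _ => (fil_fX K).bC_mul _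

/-- A linear substitution preserves the fibre degree. As the substitution acts on infinite series,
the bound is proved up to `2 * N + n` by peeling off `n` variables, and `n` is finally taken large
enough to exceed `e`. -/
theorem Fil.pull {e : ℤ} {a : Ser ι B'} (ha : Fil e a) : Fil e (pull φ J a) := by
  have : ∀ (n : ℕ) (N e : ℤ) (a : Ser ι B'), Van N a → Fil e a →
      Fil (min e (2 * N + n)) (FedosovWick.pull φ J a) := by
    intro n
    induction n with
    | zero => intro N e a ha _; exact (ha.pull φ J).fil.mono (by simp)
    | succ n ih =>
      intro N e a ha he
      obtain ⟨g, hg, hgf, hag⟩ := ser_decomposition ha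
      have h0 : Fil e (FedosovWick.pull φ J (cL (symb a))) := by
        intro k m hk
        rw [pull_cL]
        by_cases hm : m = 0
        · subst hm
          rw [cf_cL_zero, coeff_liftL, coeff_symb, he k 0 hk, map_zero]
        · exact cf_cL_of_ne _ _ hm
      rw [hag, map_add, map_sum]
      refine (h0.mono (by simp)).add (WF.sum fun A _ => ?_)
      rw [pull_mul]
      refine ((fil_pull_fX φ J A).mul (ih N (e - 1) _ (hg A) (hgf A e he))).mono ?_
      push_cast; omega
  exact (this (e - 2 * a.order).toNat a.order e a (van_order a) ha).mono (by omega)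

/-- The chain rule for fibre derivatives. -/
theorem dF_pull (I : ι) (a : Ser ι B') :
    dF I (pull φ J a) = ∑ A, bC (J A I) * pull φ J (dF A a) := by
  classical
  have := eq_zero_of_fX_linear
    ((dF I).comp (pull φ J) - ∑ A, (AddMonoidHom.mulLeft (bC (J A I))).comp ((pull φ J).comp (dF A)))
    (fun A => pull φ J (fX A)) (fun N a ha => ?_) (fun f => ?_) (fun A a => ?_)
    (fil_pull_fX φ J) a
  · simpa [sub_eq_zero] using this
  · simp only [AddMonoidHom.sub_apply, AddMonoidHom.comp_apply, AddMonoidHom.finsetSum_apply,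
      AddMonoidHom.coe_mulLeft]
    exact ((ha.pull φ J).dF I).sub (Van.sum fun A _ => ((ha.dF A).pull φ J).bC_mul _)
  · simp [pull_cL, dF_cL]
  · simp only [AddMonoidHom.sub_apply, AddMonoidHom.comp_apply, AddMonoidHom.finsetSum_apply,
      AddMonoidHom.coe_mulLeft, dF_mul, pull_mul, map_add, dF_fX, ite_mul, one_mul, zero_mul,
      Finset.sum_add_distrib]
    have h1 : dF I (pull φ J (fX A : Ser ι B')) = bC (J A I) := by
      simp [pull_fX, dF_fX]
    have h2 : ∀ x, pull φ J (if x = A then a else 0) = if x = A then pull φ J a else 0 := fun x => by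
      split_ifs <;> simp
    simp only [h1, h2, mul_ite, mul_zero, Finset.sum_ite_eq', Finset.mem_univ, if_true, mul_sub,
      Finset.mul_sum, mul_left_comm (bC _) (pull φ J (fX A))]
    ring

theorem sum_comm4 {V : Type*} [AddCommMonoid V] (f : ι → ι → ι → ι → V) :
    ∑ A, ∑ C, ∑ I, ∑ K, f A C I K = ∑ I, ∑ K, ∑ A, ∑ C, f A C I K := by
  calc ∑ A, ∑ C, ∑ I, ∑ K, f A C I K = ∑ x : ι × ι, ∑ y : ι × ι, f x.1 x.2 y.1 y.2 := by
        simp only [Fintype.sum_prod_type]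
    _ = ∑ y : ι × ι, ∑ x : ι × ι, f x.1 x.2 y.1 y.2 := Finset.sum_comm
    _ = _ := by simp only [Fintype.sum_prod_type]

variable {Λ : ι → ι → B} {Λ' : ι → ι → B'}

/-- The chain rule puts a Jacobian on each of the two differentiated factors, and the transformation
law of the contravariant tensor absorbs them. -/
theorem pull_wterm (hΛ : ∀ A C, φ (Λ' A C) = ∑ I, ∑ K, J A I * J C K * Λ I K) (j : ℕ) :
    ∀ a b : Ser ι B', pull φ J (wterm Λ' j a b) = wterm Λ j (pull φ J a) (pull φ J b) := by
  induction j with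
  | zero => exact pull_mul φ J
  | succ j ih =>
    intro a b
    simp only [wterm, map_sum, pull_mul, pull_bC, ih, hΛ, dF_pull, wterm_sum_left, wterm_sum_right,
      wterm_mul_left Λ (fun K => dF_bC K _), wterm_mul_right Λ (fun K => dF_bC K _),
      Finset.sum_mul, Finset.mul_sum]
    rw [sum_comm4]
    refine Finset.sum_congr rfl fun I _ => Finset.sum_congr rfl fun K _ => ?_
    rw [Finset.sum_comm]
    refine Finset.sum_congr rfl fun A _ => Finset.sum_congr rfl fun C _ => ?_
    rw [map_mul, map_mul]
    ring

variable [Algebra ℂ B] [Algebra ℂ B']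

theorem pull_wk (φ : B' →ₐ[ℂ] B)
    (hΛ : ∀ A C, φ (Λ' A C) = ∑ I, ∑ K, J A I * J C K * Λ I K) (a b : Ser ι B') :
    pull (φ : B' →+* B) J (wk Λ' a b) = wk Λ (pull (φ : B' →+* B) J a) (pull (φ : B' →+* B) J b) := by
  obtain ⟨p, ha, hb, -⟩ := exists_van a b b b
  refine eq_of_van_sub (p := p + p) (f := fun M => pull (φ : B' →+* B) J (wkTr Λ' M a b))
    (fun M => ?_) fun M => ?_
  · rw [← map_sub]
    exact (van_wk_sub_wkTr Λ' ha hb M).pull _ J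
  · have : pull (φ : B' →+* B) J (wkTr Λ' M a b) =
        wkTr Λ M (pull (φ : B' →+* B) J a) (pull (φ : B' →+* B) J b) := by
      simp only [wkTr, map_sum, smul_eq_bC_mul, pull_mul, pull_bC, pull_nu]
      refine Finset.sum_congr rfl fun j _ => ?_
      rw [pull_wterm (φ : B' →+* B) J hΛ]
      simp
    rw [this]
    exact van_wk_sub_wkTr Λ (ha.pull _ J) (hb.pull _ J) M

/-- Compatible changes of the base and of the frame. -/
structure FHom (F' : FData ι B') (F : FData ι B) where
  φ : B' →ₐ[ℂ] B
  J : ι → ι → B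
  d_φ : ∀ I b, F.d I (φ b) = ∑ A, J A I * φ (F'.d A b)
  Λ_φ : ∀ A C, φ (F'.Λ A C) = ∑ I, ∑ K, J A I * J C K * F.Λ I K
  d_J : ∀ I K A, F.d I (J A K) = F.d K (J A I)
  Γ_φ : ∀ I K A, ∑ S, J A S * F.Γ I K S =
    F.d I (J A K) + ∑ E, ∑ C, φ (F'.Γ E C A) * J E I * J C K

namespace FHom

variable {F' : FData ι B'} {F : FData ι B} (h : FHom F' F)

/-- The change of frame on the Wick algebra. -/
abbrev P : Ser ι B' →+ Ser ι B := pull (h.φ : B' →+* B) h.J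

theorem P_wk (a b : Ser ι B') : h.P (wk F'.Λ a b) = wk F.Λ (h.P a) (h.P b) :=
  pull_wk h.J h.φ h.Λ_φ a b

theorem P_br (a b : Ser ι B') : h.P (br F'.Λ a b) = br F.Λ (h.P a) (h.P b) := by
  simp only [br, pull_nu_mul, map_sub, P_wk]

theorem nab_cL (F : FData ι B) (I : ι) (f : LaurentSeries B) :
    F.N I (cL f) = cL (liftL ((F.d I : B →ₗ[ℂ] B).toAddMonoidHom) f) := by
  classical
  rw [nab_apply]
  simp only [dF_cL, mul_zero, Finset.sum_const_zero, sub_zero]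
  refine ser_ext fun k m => ?_
  by_cases hm : m = 0
  · subst hm; rw [cf_dB, cf_cL_zero, cf_cL_zero]; rfl
  · rw [cf_dB, cf_cL_of_ne _ _ hm, cf_cL_of_ne _ _ hm, map_zero]

/-- Both sides obey the same Leibniz rule, so it suffices to compare them on base functions, where
the chain rule applies, and on ζ^A, where the inhomogeneous transformation law of the Christoffel
symbols is exactly what is required. -/
theorem nab_P (I : ι) (a : Ser ι B') : F.N I (h.P a) = ∑ A, bC (h.J A I) * h.P (F'.N A a) := by
  classical
  have := eq_zero_of_fX_linear ((F.N I).comp h.P -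
      ∑ A, (AddMonoidHom.mulLeft (bC (h.J A I))).comp (h.P.comp (F'.N A)))
    (fun A => h.P (fX A)) (fun N a ha => ?_) (fun f => ?_) (fun A a => ?_)
    (fil_pull_fX _ h.J) a
  · simpa [sub_eq_zero] using this
  · simp only [AddMonoidHom.sub_apply, AddMonoidHom.comp_apply, AddMonoidHom.finsetSum_apply,
      AddMonoidHom.coe_mulLeft]
    exact ((ha.pull _ h.J).nab _ _ I).sub
      (Van.sum fun A _ => ((ha.nab _ _ A).pull _ h.J).bC_mul _)
  · simp only [AddMonoidHom.sub_apply, AddMonoidHom.comp_apply, AddMonoidHom.finsetSum_apply,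
      AddMonoidHom.coe_mulLeft, pull_cL, nab_cL, sub_eq_zero]
    refine ser_ext fun k m => ?_
    simp only [cf_sum, cf_bC_mul]
    by_cases hm : m = 0
    · subst hm
      simp only [cf_cL_zero, coeff_liftL]
      exact h.d_φ I _
    · simp only [cf_cL_of_ne _ _ hm, mul_zero, Finset.sum_const_zero]
  · simp only [AddMonoidHom.sub_apply, AddMonoidHom.comp_apply, AddMonoidHom.finsetSum_apply,
      AddMonoidHom.coe_mulLeft, nab_mul, pull_mul, map_add, Finset.sum_add_distrib]
    have h1 : F.N I (h.P (fX A)) = ∑ E, bC (h.J E I) * h.P (F'.N E (fX A)) := by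
      have hneg : ∀ x y : Ser ι B, x * -y = -(x * y) := fun x y => by ring
      simp only [pull_fX, map_sum, nab_mul, nab_bC, nab_fX, map_neg, pull_mul, pull_bC, hneg,
        Finset.mul_sum, Finset.sum_add_distrib, Finset.sum_neg_distrib]
      have e := fun K => congrArg (bC : B → Ser ι B) (h.Γ_φ I K A)
      simp only [map_sum, map_add, map_mul] at e
      have e1 : ∑ x, ∑ i, bC (h.J A x) * (bC (F.Γ I i x) * fX i : Ser ι B) =
          ∑ K, (∑ S, bC (h.J A S) * bC (F.Γ I K S)) * fX K := by
        rw [Finset.sum_comm]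
        simp only [Finset.sum_mul, mul_assoc]
      have e2 : ∑ x, ∑ i, ∑ i_1, bC (h.J x I) *
          (bC ((h.φ : B' →+* B) (F'.Γ x i A)) * (bC (h.J i i_1) * fX i_1 : Ser ι B)) =
          ∑ K, (∑ E, ∑ C, bC (h.φ (F'.Γ E C A)) * bC (h.J E I) * bC (h.J C K)) * fX K := by
        simp only [Finset.sum_mul]
        rw [Finset.sum_comm (f := fun K E => ∑ C, bC (h.φ (F'.Γ E C A)) * bC (h.J E I) *
          bC (h.J C K) * (fX K : Ser ι B))]
        refine Finset.sum_congr rfl fun E _ => ?_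
        rw [Finset.sum_comm]
        refine Finset.sum_congr rfl fun K _ => Finset.sum_congr rfl fun C _ => ?_
        simp only [RingHom.coe_coe]
        ring
      rw [e1, e2]
      simp only [e, add_mul, Finset.sum_add_distrib]
      ring
    rw [h1]
    simp only [mul_sub, Finset.mul_sum, Finset.sum_mul, mul_left_comm (bC _) (h.P (fX A)),
      mul_assoc]
    ring

/-- The transformation of one-forms. -/
def oneForm (r : ι → Ser ι B') (I : ι) : Ser ι B := ∑ A, bC (h.J A I) * h.P (r A)

theorem D_P (r : ι → Ser ι B') (I : ι) (w : Ser ι B') :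
    F.D (h.oneForm r) I (h.P w) = ∑ A, bC (h.J A I) * h.P (F'.D r A w) := by
  have hb : br F.Λ (h.oneForm r I) (h.P w) = ∑ A, bC (h.J A I) * br F.Λ (h.P (r A)) (h.P w) := by
    simp only [br, oneForm, wk_sum_left, wk_sum_right, wk_bC_left, wk_bC_right,
      ← Finset.sum_sub_distrib, Finset.mul_sum]
    exact Finset.sum_congr rfl fun A _ => by ring
  simp only [FData.D_apply, dF_pull, nab_P, hb, map_add, map_neg, P_br, mul_add,
    Finset.sum_add_distrib]
  rw [← Finset.sum_neg_distrib]
  congr 3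
  exact funext fun A => by ring

theorem flat_P {r : ι → Ser ι B'} {w : Ser ι B'} (hw : F'.Flat r w) :
    F.Flat (h.oneForm r) (h.P w) := fun I => by
  rw [D_P]
  exact Finset.sum_eq_zero fun A _ => by rw [hw A, map_zero, mul_zero]

/-- In ∇_I r_K - ∇_K r_I the derivatives of the Jacobian cancel by the symmetry `d_J`; all other
terms are tensorial. -/
theorem curvOf_oneForm
    (hR : ∀ I K, F.R I K = ∑ A, ∑ C, bC (h.J A I * h.J C K) * h.P (F'.R A C))
    (r : ι → Ser ι B') (I K : ι) : F.curvOf (h.oneForm r) I K =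
      ∑ A, ∑ C, bC (h.J A I * h.J C K) * h.P (F'.curvOf r A C) := by
  have hb : br F.Λ (h.oneForm r I) (h.oneForm r K) =
      ∑ A, ∑ C, bC (h.J A I * h.J C K) * h.P (br F'.Λ (r A) (r C)) := by
    have hs : ∀ x y z : Ser ι B, x * (y - z) = x * y - x * z := fun x y z => by ring
    simp only [P_br]
    simp only [br, oneForm, wk_sum_left, wk_sum_right, wk_bC_left, wk_bC_right,
      Finset.mul_sum, hs, map_mul, Finset.sum_sub_distrib]
    congr 1
    · rw [Finset.sum_comm]
      exact Finset.sum_congr rfl fun A _ => Finset.sum_congr rfl fun C _ => by ring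
    · exact Finset.sum_congr rfl fun A _ => Finset.sum_congr rfl fun C _ => by ring
  have hN : ∀ I K, F.N I (h.oneForm r K) = ∑ A, bC (F.d I (h.J A K)) * h.P (r A) +
      ∑ A, ∑ C, bC (h.J A I * h.J C K) * h.P (F'.N A (r C)) := fun I K => by
    simp only [oneForm, map_sum, nab_mul, nab_bC, nab_P, Finset.sum_add_distrib, Finset.mul_sum,
      map_mul]
    congr 1
    rw [Finset.sum_comm]
    exact Finset.sum_congr rfl fun A _ => Finset.sum_congr rfl fun C _ => by ring
  have hsw : ∑ A, ∑ C, bC (h.J A K * h.J C I) * h.P (F'.N A (r C)) =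
      ∑ A, ∑ C, bC (h.J A I * h.J C K) * h.P (F'.N C (r A)) := by
    rw [Finset.sum_comm]
    simp only [mul_comm (h.J _ I)]
  simp only [FData.curvOf, hR, hb, hN, map_add, map_sub, mul_add, mul_sub, Finset.sum_add_distrib,
    Finset.sum_sub_distrib, hsw, h.d_J K I]
  ring

theorem isFed_oneForm
    (hR : ∀ I K, F.R I K = ∑ A, ∑ C, bC (h.J A I * h.J C K) * h.P (F'.R A C))
    {r : ι → Ser ι B'} (hr : F'.IsFed r) : F.IsFed (h.oneForm r) where
  van I := Van.sum fun A _ => ((hr.van A).pull _ h.J).bC_mul _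
  fil I := WF.sum fun A _ => ((hr.fil A).pull _ h.J).bC_mul _
  norm := by
    have : ∑ A, h.P (fX A) * h.P (r A) = 0 := by
      simp only [← pull_mul, ← map_sum, hr.norm, map_zero]
    simp only [oneForm, Finset.mul_sum]
    rw [← this, Finset.sum_comm]
    simp only [pull_fX, Finset.sum_mul]
    exact Finset.sum_congr rfl fun A _ => Finset.sum_congr rfl fun C _ => by ring
  eq I K := by
    rw [h.curvOf_oneForm hR]
    simp only [← hr.eq, map_sub, mul_sub, Finset.sum_sub_distrib]
    simp only [oneForm, map_sum, dF_bC_mul, dF_pull, Finset.mul_sum, map_mul]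
    congr 1
    · rw [Finset.sum_comm]
      exact Finset.sum_congr rfl fun A _ => Finset.sum_congr rfl fun C _ => by ring
    · exact Finset.sum_congr rfl fun A _ => Finset.sum_congr rfl fun C _ => by ring

end FHom

end Pull

end FedosovWick

end

open scoped Manifold ContDiff Topology ComplexOrder

noncomputable section

set_option linter.unusedSectionVars false
set_option linter.unusedSimpArgs false

namespace FedosovWick

/-! ### Wick products that stop after the first contraction. -/

section FirstOrder

variable {ι B : Type*} [CommRing B] [Algebra ℂ B] [Fintype ι] (Λ : ι → ι → B)

-- Only second derivatives in directions that `Λ` contracts have to vanish. This admits elements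
-- such as c_{kl} ζ^k ζ̄^l, whose mixed second derivative is nonzero but never occurs.
omit [Algebra ℂ B] in
theorem wterm_eq_zero_left {a : Ser ι B}
    (h : ∀ I J I' J', Λ I J = 0 ∨ Λ I' J' = 0 ∨ dF I' (dF I a) = 0) (j : ℕ) (b : Ser ι B) :
    wterm Λ (j + 2) a b = 0 := by
  simp only [wterm]
  refine Finset.sum_eq_zero fun I _ => Finset.sum_eq_zero fun J _ => ?_
  rw [Finset.mul_sum]
  refine Finset.sum_eq_zero fun I' _ => ?_
  rw [Finset.mul_sum]
  refine Finset.sum_eq_zero fun J' _ => ?_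
  rcases h I J I' J' with h | h | h <;> simp [h, wterm_zero_left]

theorem wk_eq_of_wterm {a b : Ser ι B} (h : ∀ j, wterm Λ (j + 2) a b = 0) :
    wk Λ a b = a * b + nu 1 * ∑ I, ∑ J, bC (Λ I J) * (dF I a * dF J b) := by
  obtain ⟨p, ha, hb, -⟩ := exists_van a b a b
  have key : ∀ M : ℕ, wkTr Λ (M + 2) a b =
      a * b + nu 1 * ∑ I, ∑ J, bC (Λ I J) * (dF I a * dF J b) := by
    intro M
    have h2 : ∑ j ∈ Finset.range (M + 2), ((j.factorial : ℂ)⁻¹) • (nu j * wterm Λ j a b) =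
        ∑ j ∈ Finset.range 2, ((j.factorial : ℂ)⁻¹) • (nu j * wterm Λ j a b) := by
      refine (Finset.sum_subset (Finset.range_mono (by omega)) fun j _ hj => ?_).symm
      obtain ⟨i, rfl⟩ : ∃ i, j = i + 2 := ⟨j - 2, by simp at hj; omega⟩
      rw [h, mul_zero, smul_zero]
    rw [wkTr, h2, Finset.sum_range_succ, Finset.sum_range_one]
    simp [wterm, nu_zero]
  refine eq_of_van_sub (p := p + p) (f := fun M => wkTr Λ (M + 2) a b) (fun M => ?_) fun M => ?_
  · exact (van_wk_sub_wkTr Λ ha hb (M + 2)).mono (by push_cast; omega)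
  · rw [key, sub_self]
    exact van_zero _

end FirstOrder


/-! ### Matrix calculus and the Kähler connection over a ring with derivations. -/

section MatrixDerivation

variable {B : Type*} [CommRing B] [Algebra ℂ B] {m n p : Type*} [Fintype n] [DecidableEq n]

/-- Entrywise application of a derivation to a matrix. -/
def mD (d : Derivation ℂ B B) (A : Matrix m p B) : Matrix m p B := A.map d

theorem mD_apply (d : Derivation ℂ B B) (A : Matrix m p B) (i : m) (j : p) :
    mD d A i j = d (A i j) := rfl

theorem mD_mul (d : Derivation ℂ B B) (A : Matrix m n B) (A' : Matrix n p B) :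
    mD d (A * A') = mD d A * A' + A * mD d A' := by
  ext i j
  simp only [mD_apply, Matrix.mul_apply, Matrix.add_apply, map_sum, Derivation.leibniz,
    smul_eq_mul, Finset.sum_add_distrib]
  rw [add_comm]
  simp only [mul_comm]

theorem mD_one (d : Derivation ℂ B B) : mD d (1 : Matrix n n B) = 0 := by
  ext i j
  rw [mD_apply, Matrix.one_apply]
  split_ifs <;> simp

/-- Leibniz rule applied to the constant matrix `G * H`. -/
theorem mD_inv (d : Derivation ℂ B B) {G H : Matrix n n B} (h : G * H = 1) :
    mD d H = -(H * mD d G * H) := by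
  have h' : H * G = 1 := mul_eq_one_comm.1 h
  have h1 := mD_mul d G H
  rw [h, mD_one] at h1
  calc mD d H = H * G * mD d H := by rw [h', Matrix.one_mul]
    _ = H * (mD d G * H + G * mD d H) - H * mD d G * H := by
      rw [Matrix.mul_add]; simp only [Matrix.mul_assoc]; abel
    _ = _ := by rw [← h1, Matrix.mul_zero, zero_sub]

end MatrixDerivation

/-- The local data of a Kähler metric: a ring of functions with commuting derivations, and an
invertible matrix which satisfies the closedness relations. -/
structure KData (n : ℕ) (B : Type*) [CommRing B] [Algebra ℂ B] where
  d : Idx n → Derivation ℂ B B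
  g : Matrix (Fin n) (Fin n) B
  h : Matrix (Fin n) (Fin n) B
  d_comm : ∀ I J f, d I (d J f) = d J (d I f)
  g_mul_h : g * h = 1
  closed_hol : ∀ i k l, d (Sum.inl i) (g k l) = d (Sum.inl k) (g i l)
  closed_antihol : ∀ j k l, d (Sum.inr j) (g k l) = d (Sum.inr l) (g k j)

namespace KData

variable {n : ℕ} {B : Type*} [CommRing B] [Algebra ℂ B] (K : KData n B)

/-- The Poisson tensor. -/
def Λ : Idx n → Idx n → B
  | Sum.inr l, Sum.inl k => K.h l k
  | _, _ => 0

/-- The Christoffel symbols. -/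
def Γ : Idx n → Idx n → Idx n → B
  | Sum.inl k, Sum.inl i, Sum.inl s => ∑ l, K.h l s * K.d (Sum.inl i) (K.g k l)
  | Sum.inr l, Sum.inr j, Sum.inr t => ∑ k, K.h t k * K.d (Sum.inr j) (K.g k l)
  | _, _, _ => 0

/-- The curvature tensor. -/
def ρ (p q : Fin n) : Matrix (Fin n) (Fin n) B := fun k l =>
  -(∑ t, ∑ s, K.h t s * K.d (Sum.inl p) (K.g k t) * K.d (Sum.inr q) (K.g s l)) +
    K.d (Sum.inl p) (K.d (Sum.inr q) (K.g k l))

/-- Elements `c_{kl} ζ^k ζ̄^l`. -/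
def q11 (c : Matrix (Fin n) (Fin n) B) : Ser (Idx n) B :=
  ∑ k, ∑ l, bC (c k l) * fX (Sum.inl k) * fX (Sum.inr l)

/-- The curvature element. -/
def R : Idx n → Idx n → Ser (Idx n) B
  | Sum.inl p, Sum.inr q => q11 (K.ρ p q)
  | Sum.inr q, Sum.inl p => -q11 (K.ρ p q)
  | _, _ => 0

theorem ρ_eq (p q : Fin n) : K.ρ p q =
    mD (K.d (Sum.inl p)) (mD (K.d (Sum.inr q)) K.g) -
      mD (K.d (Sum.inl p)) K.g * K.h * mD (K.d (Sum.inr q)) K.g := by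
  ext k l
  simp only [ρ, Matrix.sub_apply, mD_apply, Matrix.mul_apply, Finset.sum_mul]
  rw [Finset.sum_comm, neg_add_eq_sub]
  congr 1
  exact Finset.sum_congr rfl fun s _ => Finset.sum_congr rfl fun t _ => by ring

theorem Γ_hol (k i s : Fin n) : K.Γ (Sum.inl k) (Sum.inl i) (Sum.inl s) =
    (mD (K.d (Sum.inl k)) K.g * K.h) i s := by
  simp only [Γ, Matrix.mul_apply, mD_apply]
  exact Finset.sum_congr rfl fun l _ => by rw [K.closed_hol, mul_comm]

theorem Γ_antihol (l j t : Fin n) : K.Γ (Sum.inr l) (Sum.inr j) (Sum.inr t) =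
    (K.h * mD (K.d (Sum.inr l)) K.g) t j := by
  simp only [Γ, Matrix.mul_apply, mD_apply]
  exact Finset.sum_congr rfl fun k _ => by rw [K.closed_antihol]

theorem Γ_ne {I J S : Idx n} (h : K.Γ I J S ≠ 0) :
    (∃ i j s, I = Sum.inl i ∧ J = Sum.inl j ∧ S = Sum.inl s) ∨
    (∃ i j s, I = Sum.inr i ∧ J = Sum.inr j ∧ S = Sum.inr s) := by
  rcases I with i | i <;> rcases J with j | j <;> rcases S with s | s <;> simp_all [Γ]

theorem Γ_symm (I J S : Idx n) : K.Γ I J S = K.Γ J I S := by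
  rcases I with i | i <;> rcases J with j | j <;> rcases S with s | s <;> try rfl
  · rw [Γ_hol]
    simp only [Γ, Matrix.mul_apply, mD_apply]
    exact Finset.sum_congr rfl fun l _ => by rw [mul_comm]
  · rw [Γ_antihol]
    simp only [Γ, Matrix.mul_apply, mD_apply]

/-- Except for trivially vanishing type combinations this is d(g⁻¹) = -g⁻¹ (dg) g⁻¹: the holomorphic
and the antiholomorphic Christoffel matrices are (dg) g⁻¹ and g⁻¹ (dg). -/
theorem Λ_parallel (A I J : Idx n) :
    K.d A (K.Λ I J) + (∑ S, K.Γ A S I * K.Λ S J) + ∑ S, K.Γ A S J * K.Λ I S = 0 := by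
  rw [Fintype.sum_sum_type, Fintype.sum_sum_type]
  rcases A with p | p <;> rcases I with i | i <;> rcases J with j | j
  case inl.inr.inl =>
    have := congrFun (congrFun (mD_inv (K.d (Sum.inl p)) K.g_mul_h) i) j
    rw [mD_apply, Matrix.neg_apply, Matrix.mul_assoc, Matrix.mul_apply] at this
    simp only [Λ, Γ_hol, this]
    simp [Γ, mul_comm]
  case inr.inr.inl =>
    have := congrFun (congrFun (mD_inv (K.d (Sum.inr p)) K.g_mul_h) i) j
    rw [mD_apply, Matrix.neg_apply, Matrix.mul_apply] at this
    simp only [Λ, Γ_antihol, this]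
    simp [Γ]
  all_goals simp [Γ, Λ]

section Quadratic

theorem dF_hol_q11 (c : Matrix (Fin n) (Fin n) B) (p : Fin n) :
    dF (Sum.inl p) (q11 c) = ∑ l, bC (c p l) * fX (Sum.inr l) := by
  simp [q11, mul_assoc, dF_bC_mul, dF_mul, dF_fX]

theorem dF_antihol_q11 (c : Matrix (Fin n) (Fin n) B) (q : Fin n) :
    dF (Sum.inr q) (q11 c) = ∑ k, bC (c k q) * fX (Sum.inl k) := by
  simp [q11, mul_assoc, dF_bC_mul, dF_mul, dF_fX]

theorem dF_hol_hol_q11 (c : Matrix (Fin n) (Fin n) B) (p p' : Fin n) :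
    dF (Sum.inl p') (dF (Sum.inl p) (q11 c)) = 0 := by
  simp [dF_hol_q11, dF_bC_mul, dF_fX]

theorem dF_antihol_antihol_q11 (c : Matrix (Fin n) (Fin n) B) (p p' : Fin n) :
    dF (Sum.inr p') (dF (Sum.inr p) (q11 c)) = 0 := by
  simp [dF_antihol_q11, dF_bC_mul, dF_fX]

/-- The adjoint action of an element which is of degree at most one in `ζ` and in `ζ̄`. -/
theorem br_of_bilinear {x : Ser (Idx n) B}
    (h1 : ∀ p p', dF (Sum.inl p') (dF (Sum.inl p) x) = 0)
    (h2 : ∀ p p', dF (Sum.inr p') (dF (Sum.inr p) x) = 0) (a : Ser (Idx n) B) :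
    br K.Λ x a = ∑ l, ∑ k, bC (K.h l k) *
      (dF (Sum.inr l) x * dF (Sum.inl k) a - dF (Sum.inr l) a * dF (Sum.inl k) x) := by
  have e1 : wk K.Λ x a = x * a + nu 1 * ∑ I, ∑ J, bC (K.Λ I J) * (dF I x * dF J a) := by
    refine wk_eq_of_wterm K.Λ fun j => wterm_eq_zero_left K.Λ (fun I J I' J' => ?_) j a
    rcases I with i | i <;> rcases I' with i' | i' <;> simp [Λ, h1, h2]
  have e2 : wk K.Λ a x = a * x + nu 1 * ∑ I, ∑ J, bC (K.Λ I J) * (dF I a * dF J x) := by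
    refine wk_eq_of_wterm K.Λ fun j => ?_
    rw [← wterm_swap]
    refine wterm_eq_zero_left _ (fun I J I' J' => ?_) j a
    rcases I with i | i <;> rcases I' with i' | i' <;> simp [Λ, h1, h2]
  have e3 : ∀ y z : Ser (Idx n) B, ∑ I, ∑ J, bC (K.Λ I J) * (dF I y * dF J z) =
      ∑ l, ∑ k, bC (K.h l k) * (dF (Sum.inr l) y * dF (Sum.inl k) z) := by
    intro y z
    simp [Fintype.sum_sum_type, Λ]
  have e4 : br K.Λ x a = nu (-1) * (nu 1 * (∑ I, ∑ J, bC (K.Λ I J) * (dF I x * dF J a) -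
      ∑ I, ∑ J, bC (K.Λ I J) * (dF I a * dF J x))) := by
    rw [br, e1, e2]
    congr 1
    ring
  rw [e4, nu_mul_nu_mul, e3, e3]
  simp only [neg_add_cancel, nu_zero, one_mul, mul_sub, Finset.sum_sub_distrib]

/-- Elements which are homogeneous of degree one in `ζ` and in `ζ̄`. -/
structure Bihom (x : Ser (Idx n) B) : Prop where
  hol : x = ∑ k, fX (Sum.inl k) * dF (Sum.inl k) x
  antihol : x = ∑ l, fX (Sum.inr l) * dF (Sum.inr l) x
  hol_hol : ∀ p p', dF (Sum.inl p') (dF (Sum.inl p) x) = 0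
  antihol_antihol : ∀ p p', dF (Sum.inr p') (dF (Sum.inr p) x) = 0

theorem bihom_q11 (c : Matrix (Fin n) (Fin n) B) : Bihom (q11 c) where
  hol := by
    simp only [dF_hol_q11, Finset.mul_sum]
    rw [q11]
    exact Finset.sum_congr rfl fun k _ => Finset.sum_congr rfl fun l _ => by ring
  antihol := by
    simp only [dF_antihol_q11, Finset.mul_sum]
    rw [q11, Finset.sum_comm]
    exact Finset.sum_congr rfl fun k _ => Finset.sum_congr rfl fun l _ => by ring
  hol_hol := dF_hol_hol_q11 c
  antihol_antihol := dF_antihol_antihol_q11 c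

theorem bihom_zero : Bihom (0 : Ser (Idx n) B) := by constructor <;> simp

theorem Bihom.add {x y : Ser (Idx n) B} (hx : Bihom x) (hy : Bihom y) : Bihom (x + y) where
  hol := by
    simp only [map_add, mul_add, Finset.sum_add_distrib, ← hx.hol, ← hy.hol]
  antihol := by
    simp only [map_add, mul_add, Finset.sum_add_distrib, ← hx.antihol, ← hy.antihol]
  hol_hol p p' := by simp only [map_add, hx.hol_hol, hy.hol_hol, add_zero]
  antihol_antihol p p' := by simp only [map_add, hx.antihol_antihol, hy.antihol_antihol, add_zero]

theorem Bihom.bC_mul {x : Ser (Idx n) B} (hx : Bihom x) (f : B) : Bihom (bC f * x) where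
  hol := by
    simp only [dF_bC_mul, mul_left_comm _ (bC f)]
    rw [← Finset.mul_sum, ← hx.hol]
  antihol := by
    simp only [dF_bC_mul, mul_left_comm _ (bC f)]
    rw [← Finset.mul_sum, ← hx.antihol]
  hol_hol p p' := by simp only [dF_bC_mul, hx.hol_hol, mul_zero]
  antihol_antihol p p' := by simp only [dF_bC_mul, hx.antihol_antihol, mul_zero]

theorem Bihom.neg {x : Ser (Idx n) B} (hx : Bihom x) : Bihom (-x) := by
  have h : -x = bC (-1) * x := by rw [map_neg, map_one]; ring
  rw [h]
  exact hx.bC_mul _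

theorem Bihom.sum {κ : Type*} {s : Finset κ} {x : κ → Ser (Idx n) B}
    (hx : ∀ i ∈ s, Bihom (x i)) : Bihom (∑ i ∈ s, x i) := by
  classical
  induction s using Finset.induction_on with
  | empty => simpa using bihom_zero
  | insert a s ha ih =>
    rw [Finset.sum_insert ha]
    exact (hx _ (Finset.mem_insert_self _ _)).add
      (ih fun i hi => hx i (Finset.mem_insert_of_mem hi))

/-- The covariant derivative commutes with the Euler operator of the variables in `s` as long as the
connection does not mix `s` with its complement; the two sums of Christoffel terms are then the same
after exchanging indices. -/
theorem fX_nab (s : Idx n → Prop) [DecidablePred s] (I : Idx n)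
    (hs : ∀ A S, K.Γ I A S ≠ 0 → (s A ↔ s S)) {x : Ser (Idx n) B}
    (hx : x = ∑ A, if s A then fX A * dF A x else 0) :
    nab K.d K.Γ I x = ∑ A, if s A then fX A * dF A (nab K.d K.Γ I x) else 0 := by
  conv_lhs => rw [hx]
  have e : ∀ A, nab K.d K.Γ I (if s A then fX A * dF A x else 0) =
      (if s A then fX A * dF A (nab K.d K.Γ I x) else 0) +
      ((if s A then ∑ S, bC (K.Γ I A S) * fX A * dF S x else 0) -
        (if s A then ∑ S, bC (K.Γ I S A) * fX S * dF A x else 0)) := fun A => by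
    by_cases h : s A
    · simp only [if_pos h]
      have hneg : ∀ y z : Ser (Idx n) B, -y * z = -(y * z) := fun y z => by ring
      rw [nab_mul, nab_fX, nab_dF, mul_add, Finset.mul_sum, hneg, Finset.sum_mul]
      have : ∀ S, fX A * (bC (K.Γ I A S) * dF S x) = bC (K.Γ I A S) * fX A * dF S x := fun S => by
        ring
      simp only [this]
      ring
    · simp only [if_neg h, map_zero, sub_zero, add_zero]
  rw [map_sum, Finset.sum_congr rfl fun A _ => e A, Finset.sum_add_distrib, add_eq_left,
    Finset.sum_sub_distrib, sub_eq_zero]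
  have e1 : ∀ A, (if s A then ∑ S, bC (K.Γ I A S) * fX A * dF S x else 0) =
      ∑ S, if s A then bC (K.Γ I A S) * fX A * dF S x else 0 := fun A => by
    split_ifs <;> simp
  have e2 : ∀ A, (if s A then ∑ S, bC (K.Γ I S A) * fX S * dF A x else 0) =
      ∑ S, if s A then bC (K.Γ I S A) * fX S * dF A x else 0 := fun A => by
    split_ifs <;> simp
  simp only [e1, e2]
  rw [Finset.sum_comm]
  refine Finset.sum_congr rfl fun A _ => Finset.sum_congr rfl fun S _ => ?_
  by_cases h : K.Γ I S A = 0
  · simp [h]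
  · simp only [hs _ _ h]

theorem Bihom.nab {x : Ser (Idx n) B} (hx : Bihom x) (I : Idx n) :
    Bihom (nab K.d K.Γ I x) where
  hol := by
    have := K.fX_nab (fun A => A.isLeft) I (fun A S h => by
      rcases K.Γ_ne h with ⟨i, j, s, rfl, rfl, rfl⟩ | ⟨i, j, s, rfl, rfl, rfl⟩ <;> simp) (x := x)
      (by simpa [Fintype.sum_sum_type] using hx.hol)
    simpa [Fintype.sum_sum_type] using this
  antihol := by
    have := K.fX_nab (fun A => A.isRight) I (fun A S h => by
      rcases K.Γ_ne h with ⟨i, j, s, rfl, rfl, rfl⟩ | ⟨i, j, s, rfl, rfl, rfl⟩ <;> simp) (x := x)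
      (by simpa [Fintype.sum_sum_type] using hx.antihol)
    simpa [Fintype.sum_sum_type] using this
  hol_hol p p' := by
    have h : ∀ J a, dF J (FedosovWick.nab K.d K.Γ I a) =
        FedosovWick.nab K.d K.Γ I (dF J a) - ∑ S, bC (K.Γ I J S) * dF S a := fun J a => by
      rw [nab_dF]; ring
    have h0 : ∀ J S, K.Γ I (Sum.inl J) (Sum.inr S) = 0 := fun J S => by
      rcases I with i | i <;> rfl
    simp [h, h0, map_sub, map_sum, dF_bC_mul, hx.hol_hol, Fintype.sum_sum_type]
  antihol_antihol p p' := by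
    have h : ∀ J a, dF J (FedosovWick.nab K.d K.Γ I a) =
        FedosovWick.nab K.d K.Γ I (dF J a) - ∑ S, bC (K.Γ I J S) * dF S a := fun J a => by
      rw [nab_dF]; ring
    have h0 : ∀ J S, K.Γ I (Sum.inr J) (Sum.inl S) = 0 := fun J S => by
      rcases I with i | i <;> rfl
    simp [h, h0, map_sub, map_sum, dF_bC_mul, hx.antihol_antihol, Fintype.sum_sum_type]

/-- An element of degree `(1, 1)` is determined by its adjoint action on the `ζ^s`. -/
theorem Bihom.eq_zero_of_br {x : Ser (Idx n) B} (hx : Bihom x)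
    (h : ∀ s, br K.Λ x (fX (Sum.inl s)) = 0) : x = 0 := by
  have e : ∀ s, ∑ l, bC (K.h l s) * dF (Sum.inr l) x = 0 := fun s => by
    have := h s
    rw [br_of_bilinear K hx.hol_hol hx.antihol_antihol] at this
    simpa [dF_fX] using this
  have hgh : K.h * K.g = 1 := mul_eq_one_comm.1 K.g_mul_h
  have e' : ∀ m, dF (Sum.inr m) x = 0 := fun m => by
    have : ∑ s, bC (K.g s m) * ∑ l, bC (K.h l s) * dF (Sum.inr l) x = dF (Sum.inr m) x := by
      simp only [Finset.mul_sum]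
      rw [Finset.sum_comm]
      have : ∀ l, ∑ s, bC (K.g s m) * (bC (K.h l s) * dF (Sum.inr l) x) =
          bC ((K.h * K.g) l m) * dF (Sum.inr l) x := fun l => by
        rw [Matrix.mul_apply, map_sum, Finset.sum_mul]
        exact Finset.sum_congr rfl fun s _ => by rw [map_mul]; ring
      simp [this, hgh, Matrix.one_apply]
    rw [← this]
    simp [e]
  rw [hx.antihol]
  simp [e']

end Quadratic

/-! ### Curvature identities of a Kähler metric. -/

section Curvature

theorem R_skew (I J : Idx n) : K.R I J = -K.R J I := by
  rcases I with i | i <;> rcases J with j | j <;> simp [R]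

theorem bihom_R (I J : Idx n) : Bihom (K.R I J) := by
  rcases I with i | i <;> rcases J with j | j
  exacts [bihom_zero, bihom_q11 _, (bihom_q11 _).neg, bihom_zero]

theorem van_q11 (c : Matrix (Fin n) (Fin n) B) : Van 0 (q11 c) :=
  Van.sum fun k _ => Van.sum fun l _ => by
    rw [mul_assoc]
    exact ((van_fX _).fX_mul _).bC_mul _

theorem fil_q11 (c : Matrix (Fin n) (Fin n) B) : Fil 2 (q11 c) :=
  WF.sum fun k _ => WF.sum fun l _ => by
    rw [mul_assoc]
    exact ((fil_fX _).fX_mul _).bC_mul _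

theorem ρ_symm_hol (p q k l : Fin n) : K.ρ p q k l = K.ρ k q p l := by
  simp only [ρ, K.closed_hol p k]
  rw [K.d_comm, K.closed_hol p k, K.d_comm]

theorem ρ_symm_antihol (p q k l : Fin n) : K.ρ p q k l = K.ρ p l k q := by
  simp only [ρ, K.closed_antihol q _ l]

/-- The first Bianchi identity, which for a Kähler metric reduces to the symmetry of the curvature
tensor in its two holomorphic and in its two antiholomorphic indices; both come from closedness of
the metric form. -/
theorem R_delta (I J L : Idx n) :
    dF L (K.R I J) + dF I (K.R J L) + dF J (K.R L I) = 0 := by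
  have h1 : ∀ p q k, dF (Sum.inl k) (q11 (K.ρ p q)) = dF (Sum.inl p) (q11 (K.ρ k q)) := by
    intro p q k
    simp only [dF_hol_q11, K.ρ_symm_hol p q k]
  have h2 : ∀ p q l, dF (Sum.inr l) (q11 (K.ρ p q)) = dF (Sum.inr q) (q11 (K.ρ p l)) := by
    intro p q l
    simp only [dF_antihol_q11, K.ρ_symm_antihol p q _ l]
  rcases I with i | i <;> rcases J with j | j <;> rcases L with l | l <;>
    simp only [R, map_zero, map_neg, add_zero, zero_add]
  · rw [h1 j]; ring
  · rw [h1 i]; ring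
  · rw [h2 i]; ring
  · rw [h1 l]; ring
  · rw [h2 j]; ring
  · rw [h2 l]; ring

/-- The components of the Riemann curvature. -/
theorem Γ_curv (I J E A : Idx n) :
    -K.d I (K.Γ J E A) + K.d J (K.Γ I E A) +
      ∑ C, (K.Γ J C A * K.Γ I E C - K.Γ I C A * K.Γ J E C) = match I, J, E, A with
    | Sum.inl p, Sum.inr q, Sum.inl k, Sum.inl s => (K.ρ p q * K.h) k s
    | Sum.inl p, Sum.inr q, Sum.inr l, Sum.inr t => -(K.h * K.ρ p q) t l
    | Sum.inr q, Sum.inl p, Sum.inl k, Sum.inl s => -(K.ρ p q * K.h) k s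
    | Sum.inr q, Sum.inl p, Sum.inr l, Sum.inr t => (K.h * K.ρ p q) t l
    | _, _, _, _ => 0 := by
  have hH := fun I => mD_inv (K.d I) K.g_mul_h
  have hcomm : ∀ I J, mD (K.d I) (mD (K.d J) K.g) = mD (K.d J) (mD (K.d I) K.g) := fun I J => by
    ext k l
    exact K.d_comm I J _
  -- Curvature arises only from differentiating a connection matrix in the direction of opposite
  -- type.
  have h1 : ∀ p q, mD (K.d (Sum.inr q)) (mD (K.d (Sum.inl p)) K.g * K.h) = K.ρ p q * K.h := by
    intro p q
    rw [mD_mul, hH, K.ρ_eq, hcomm, Matrix.sub_mul, Matrix.mul_neg]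
    simp only [Matrix.mul_assoc, sub_eq_add_neg]
  have h2 : ∀ p q, mD (K.d (Sum.inl p)) (K.h * mD (K.d (Sum.inr q)) K.g) = K.h * K.ρ p q := by
    intro p q
    rw [mD_mul, hH, K.ρ_eq, Matrix.mul_sub, Matrix.neg_mul]
    simp only [Matrix.mul_assoc]
    abel
  -- The matrices (∂_p g) g⁻¹ are pure gauge in the holomorphic directions, so there is no curvature
  -- of type (2,0); `h4` is the conjugate statement.
  have h3 : ∀ p p', -mD (K.d (Sum.inl p)) (mD (K.d (Sum.inl p')) K.g * K.h) +
      mD (K.d (Sum.inl p')) (mD (K.d (Sum.inl p)) K.g * K.h) +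
      (mD (K.d (Sum.inl p)) K.g * K.h * (mD (K.d (Sum.inl p')) K.g * K.h) -
        mD (K.d (Sum.inl p')) K.g * K.h * (mD (K.d (Sum.inl p)) K.g * K.h)) = 0 := by
    intro p p'
    rw [mD_mul, mD_mul, hH, hH, hcomm (Sum.inl p) (Sum.inl p')]
    simp only [Matrix.mul_assoc, Matrix.mul_neg]
    abel
  have h4 : ∀ p p', -mD (K.d (Sum.inr p)) (K.h * mD (K.d (Sum.inr p')) K.g) +
      mD (K.d (Sum.inr p')) (K.h * mD (K.d (Sum.inr p)) K.g) +
      (K.h * mD (K.d (Sum.inr p')) K.g * (K.h * mD (K.d (Sum.inr p)) K.g) -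
        K.h * mD (K.d (Sum.inr p)) K.g * (K.h * mD (K.d (Sum.inr p')) K.g)) = 0 := by
    intro p p'
    rw [mD_mul, mD_mul, hH, hH, hcomm (Sum.inr p) (Sum.inr p')]
    simp only [Matrix.mul_assoc, Matrix.neg_mul]
    abel
  rw [Fintype.sum_sum_type]
  rcases I with i | i <;> rcases J with j | j <;> rcases E with e | e <;> rcases A with a | a
  case inl.inl.inl.inl =>
    have := congrFun (congrFun (h3 i j) e) a
    simp only [Matrix.add_apply, Matrix.neg_apply, Matrix.sub_apply, mD_apply] at this
    rw [Matrix.mul_apply (M := mD (K.d (Sum.inl i)) K.g * K.h),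
      Matrix.mul_apply (M := mD (K.d (Sum.inl j)) K.g * K.h)] at this
    have z : ∀ i j s, K.Γ (Sum.inl i) (Sum.inl j) (Sum.inr s) = 0 := fun _ _ _ => rfl
    simpa [Γ_hol, z, Finset.sum_sub_distrib, mul_comm] using this
  case inr.inr.inr.inr =>
    have := congrFun (congrFun (h4 i j) a) e
    simp only [Matrix.add_apply, Matrix.neg_apply, Matrix.sub_apply, mD_apply] at this
    rw [Matrix.mul_apply (M := K.h * mD (K.d (Sum.inr i)) K.g),
      Matrix.mul_apply (M := K.h * mD (K.d (Sum.inr j)) K.g)] at this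
    have z : ∀ i j s, K.Γ (Sum.inr i) (Sum.inr j) (Sum.inl s) = 0 := fun _ _ _ => rfl
    simpa [Γ_antihol, z, Finset.sum_sub_distrib, mul_comm] using this
  case inl.inr.inl.inl =>
    have := congrFun (congrFun (h1 i j) e) a
    rw [mD_apply, ← Γ_hol] at this
    simp only [this]
    simp [Γ]
  case inl.inr.inr.inr =>
    have := congrFun (congrFun (h2 i j) a) e
    rw [mD_apply, ← Γ_antihol] at this
    simp only [this]
    simp [Γ]
  case inr.inl.inl.inl =>
    have := congrFun (congrFun (h1 j i) e) a
    rw [mD_apply, ← Γ_hol] at this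
    simp only [this]
    simp [Γ]
  case inr.inl.inr.inr =>
    have := congrFun (congrFun (h2 j i) a) e
    rw [mD_apply, ← Γ_antihol] at this
    simp only [this]
    simp [Γ]
  all_goals simp [Γ]

theorem nab_nab_fX (I J A : Idx n) :
    nab K.d K.Γ I (nab K.d K.Γ J (fX A)) - nab K.d K.Γ J (nab K.d K.Γ I (fX A)) =
      ∑ E, bC (-K.d I (K.Γ J E A) + K.d J (K.Γ I E A) +
        ∑ C, (K.Γ J C A * K.Γ I E C - K.Γ I C A * K.Γ J E C)) * fX E := by
  have h : ∀ I J, nab K.d K.Γ I (nab K.d K.Γ J (fX A)) =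
      ∑ E, bC (-K.d I (K.Γ J E A) + ∑ C, K.Γ J C A * K.Γ I E C) * fX E := by
    intro I J
    have hneg : ∀ x y : Ser (Idx n) B, x * -y = -(x * y) := fun x y => by ring
    simp only [nab_fX, map_neg, map_sum, nab_mul, nab_bC, hneg, Finset.sum_add_distrib,
      Finset.sum_neg_distrib, map_add, add_mul, map_mul, neg_add_rev, neg_neg]
    rw [add_comm]
    congr 1
    · rw [← Finset.sum_neg_distrib]
      exact Finset.sum_congr rfl fun E _ => by ring
    · simp only [Finset.mul_sum, Finset.sum_mul, mul_assoc]
      rw [Finset.sum_comm]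
  rw [h, h, ← Finset.sum_sub_distrib]
  refine Finset.sum_congr rfl fun E _ => ?_
  simp only [Finset.sum_sub_distrib, map_add, map_sub, map_neg]
  ring

/-- The right side is also the commutator of covariant derivatives on ζ^A found in `nab_nab_fX`;
this is the check on generators for `nab_comm`. -/
theorem br_R_fX (I J A : Idx n) : br K.Λ (K.R I J) (fX A) =
    ∑ E, bC (-K.d I (K.Γ J E A) + K.d J (K.Γ I E A) +
      ∑ C, (K.Γ J C A * K.Γ I E C - K.Γ I C A * K.Γ J E C)) * fX E := by
  simp only [Γ_curv]
  rw [K.br_of_bilinear (K.bihom_R I J).hol_hol (K.bihom_R I J).antihol_antihol,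
    Fintype.sum_sum_type]
  have e1 : ∀ p q s, ∑ l, ∑ k, bC (K.h l k) *
      (dF (Sum.inr l) (q11 (K.ρ p q)) * dF (Sum.inl k) (fX (Sum.inl s)) -
        dF (Sum.inr l) (fX (Sum.inl s)) * dF (Sum.inl k) (q11 (K.ρ p q))) =
      ∑ k, bC ((K.ρ p q * K.h) k s) * fX (Sum.inl k) := by
    intro p q s
    simp only [dF_antihol_q11, dF_fX, Matrix.mul_apply, map_sum, Finset.sum_mul]
    simp [Finset.mul_sum]
    rw [Finset.sum_comm]
    exact Finset.sum_congr rfl fun k _ => Finset.sum_congr rfl fun l _ => by ring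
  have e2 : ∀ p q s, ∑ l, ∑ k, bC (K.h l k) *
      (dF (Sum.inr l) (q11 (K.ρ p q)) * dF (Sum.inl k) (fX (Sum.inr s)) -
        dF (Sum.inr l) (fX (Sum.inr s)) * dF (Sum.inl k) (q11 (K.ρ p q))) =
      ∑ l, bC (-(K.h * K.ρ p q) s l) * fX (Sum.inr l) := by
    intro p q s
    simp only [dF_hol_q11, dF_fX, Matrix.mul_apply, map_sum, Finset.sum_mul, map_neg]
    have hneg : ∀ x y : Ser (Idx n) B, x * -y = -(x * y) := fun x y => by ring
    simp [Finset.sum_mul, hneg]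
    simp only [Finset.mul_sum]
    rw [Finset.sum_comm, ← Finset.sum_neg_distrib]
    simp only [← Finset.sum_neg_distrib, Finset.sum_mul]
    exact Finset.sum_congr rfl fun k _ => Finset.sum_congr rfl fun l _ => by ring
  have hneg : ∀ (x : Ser (Idx n) B) a, ∑ l, ∑ k, bC (K.h l k) *
      (dF (Sum.inr l) (-x) * dF (Sum.inl k) a - dF (Sum.inr l) a * dF (Sum.inl k) (-x)) =
      -∑ l, ∑ k, bC (K.h l k) *
        (dF (Sum.inr l) x * dF (Sum.inl k) a - dF (Sum.inr l) a * dF (Sum.inl k) x) := by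
    intro x a
    rw [← Finset.sum_neg_distrib]
    refine Finset.sum_congr rfl fun l _ => ?_
    rw [← Finset.sum_neg_distrib]
    refine Finset.sum_congr rfl fun k _ => ?_
    rw [map_neg, map_neg]
    ring
  have hneg' : ∀ (x y : Ser (Idx n) B), -x * y = -(x * y) := fun x y => by ring
  rcases I with i | i <;> rcases J with j | j <;> rcases A with a | a <;>
    simp only [R, hneg, e1, e2] <;>
    simp [hneg']

/-- The commutator of two derivations is a derivation, and the bracket with R is one too, because R
is bilinear in ζ and ζ̄ and higher contractions drop out. Both vanish on base functions and they
agree on the fibre variables. -/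
theorem nab_comm (I J : Idx n) (a : Ser (Idx n) B) :
    nab K.d K.Γ I (nab K.d K.Γ J a) - nab K.d K.Γ J (nab K.d K.Γ I a) =
      br K.Λ (K.R I J) a := by
  have hbr := K.br_of_bilinear (K.bihom_R I J).hol_hol (K.bihom_R I J).antihol_antihol
  have hbm : ∀ a b, br K.Λ (K.R I J) (a * b) = br K.Λ (K.R I J) a * b + a * br K.Λ (K.R I J) b := by
    intro a b
    simp only [hbr, dF_mul, Finset.sum_mul, Finset.mul_sum, ← Finset.sum_add_distrib]
    exact Finset.sum_congr rfl fun k _ => Finset.sum_congr rfl fun l _ => by ring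
  have := eq_zero_of_fX_linear ((nab K.d K.Γ I).comp (nab K.d K.Γ J) -
    (nab K.d K.Γ J).comp (nab K.d K.Γ I) - brHom K.Λ (K.R I J)) fX (fun N a ha => ?_) (fun f => ?_)
    (fun A a => ?_) fil_fX a
  · simpa [sub_eq_zero, brHom_apply] using this
  · simp only [AddMonoidHom.sub_apply, AddMonoidHom.comp_apply, brHom_apply]
    refine (((ha.nab _ _ J).nab _ _ I).sub ((ha.nab _ _ I).nab _ _ J)).sub ?_
    rw [hbr]
    have hv : Van 0 (K.R I J) := by
      rcases I with i | i <;> rcases J with j | j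
      exacts [van_zero _, van_q11 _, (van_q11 _).neg, van_zero _]
    refine Van.sum fun l _ => Van.sum fun k _ => Van.bC_mul (Van.sub ?_ ?_) _
    · simpa using (hv.dF (Sum.inr l)).mul (ha.dF (Sum.inl k))
    · simpa using (ha.dF (Sum.inr l)).mul (hv.dF (Sum.inl k))
  · simp only [AddMonoidHom.sub_apply, AddMonoidHom.comp_apply, brHom_apply]
    rw [hbr]
    have hN : ∀ I f, nab K.d K.Γ I (cL f) =
        cL (liftL ((K.d I : B →ₗ[ℂ] B).toAddMonoidHom) f) := fun I f => by
      rw [nab_apply]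
      simp only [dF_cL, mul_zero, Finset.sum_const_zero, sub_zero]
      refine ser_ext fun k m => ?_
      by_cases hm : m = 0
      · subst hm; rw [cf_dB, cf_cL_zero, cf_cL_zero]; rfl
      · rw [cf_dB, cf_cL_of_ne _ _ hm, cf_cL_of_ne _ _ hm, map_zero]
    have : liftL ((K.d I : B →ₗ[ℂ] B).toAddMonoidHom)
          (liftL ((K.d J : B →ₗ[ℂ] B).toAddMonoidHom) f) =
        liftL ((K.d J : B →ₗ[ℂ] B).toAddMonoidHom)
          (liftL ((K.d I : B →ₗ[ℂ] B).toAddMonoidHom) f) := by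
      ext k
      exact K.d_comm I J _
    simp [hN, this, dF_cL]
  · simp only [AddMonoidHom.sub_apply, AddMonoidHom.comp_apply, brHom_apply, hbm, nab_mul,
      map_add]
    have e := K.nab_nab_fX I J A
    rw [← K.br_R_fX] at e
    linear_combination (exp := 1) a * e

/-- The adjoint action of the left side is a cyclic sum of iterated commutators of covariant
derivatives and vanishes by the Jacobi identity. Being of degree one in ζ and in ζ̄, the element is
detected by its adjoint action. -/
theorem R_nab (I J L : Idx n) : nab K.d K.Γ L (K.R I J) + nab K.d K.Γ I (K.R J L) +
    nab K.d K.Γ J (K.R L I) = 0 := by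
  refine Bihom.eq_zero_of_br K ((((K.bihom_R I J).nab K L).add ((K.bihom_R J L).nab K I)).add
    ((K.bihom_R L I).nab K J)) fun s => ?_
  have hN : ∀ L a b, nab K.d K.Γ L (br K.Λ a b) =
      br K.Λ (nab K.d K.Γ L a) b + br K.Λ a (nab K.d K.Γ L b) := fun L a b => by
    have := wk_derivation K.Λ (nab K.d K.Γ L) (fun _ _ h => h.nab _ _ L) (nab_nu_mul _ _ L)
      (nab_smul _ _ L) (wterm_derivation K.Λ (nab K.d K.Γ L) (nab_mul _ _ L)
      (fun A S => K.d L (K.Λ A S)) (K.Γ L)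
      (fun _ _ => nab_bC _ _ L _) (fun J a => nab_dF _ _ L J a) (K.Λ_parallel L))
    simp only [br, nab_nu_mul, map_sub, this]; ring
  have h : ∀ L I J a, br K.Λ (nab K.d K.Γ L (K.R I J)) a =
      nab K.d K.Γ L (nab K.d K.Γ I (nab K.d K.Γ J a) - nab K.d K.Γ J (nab K.d K.Γ I a)) -
      (nab K.d K.Γ I (nab K.d K.Γ J (nab K.d K.Γ L a)) -
        nab K.d K.Γ J (nab K.d K.Γ I (nab K.d K.Γ L a))) := by
    intro L I J a
    rw [K.nab_comm, K.nab_comm, hN]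
    ring
  simp only [br_add_left, h, map_sub]
  ring

/-- The local data of the Fedosov construction for a Kähler metric. -/
def toFData : FData (Idx n) B where
  d := K.d
  Λ := K.Λ
  Γ := K.Γ
  R := K.R
  d_comm := K.d_comm
  Γ_symm := K.Γ_symm
  Λ_parallel := K.Λ_parallel
  R_van I J := by
    rcases I with i | i <;> rcases J with j | j
    exacts [van_zero _, van_q11 _, (van_q11 _).neg, van_zero _]
  R_fil I J := by
    rcases I with i | i <;> rcases J with j | j
    exacts [wf_zero, fil_q11 _, (fil_q11 _).neg, wf_zero]
  R_skew := K.R_skew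
  R_delta := K.R_delta
  R_nab := K.R_nab
  nab_comm := K.nab_comm

end Curvature

end KData

end FedosovWick

end

open scoped Manifold ContDiff Topology ComplexOrder

noncomputable section

set_option linter.unusedSectionVars false
set_option linter.unusedSimpArgs false

/-! ### Holomorphic changes of coordinates for Kähler data. -/

namespace FedosovWick

/-- Compatible changes of the base ring and of holomorphic frames for Kähler metrics. -/
structure KHom {n : ℕ} {B B' : Type*} [CommRing B] [Algebra ℂ B] [CommRing B'] [Algebra ℂ B']
    (K' : KData n B') (K : KData n B) where
  φ : B' →ₐ[ℂ] B
  J : Idx n → Idx n → B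
  d_φ : ∀ I b, K.d I (φ b) = ∑ A, J A I * φ (K'.d A b)
  J_hol : ∀ p q, J (Sum.inl p) (Sum.inr q) = 0
  J_antihol : ∀ p q, J (Sum.inr p) (Sum.inl q) = 0
  d_J : ∀ I C A, K.d I (J A C) = K.d C (J A I)
  g_φ : ∀ k l, K.g k l = ∑ p, ∑ q, J (Sum.inl p) (Sum.inl k) * J (Sum.inr q) (Sum.inr l) *
    φ (K'.g p q)

namespace KHom

variable {n : ℕ} {B B' : Type*} [CommRing B] [Algebra ℂ B] [CommRing B'] [Algebra ℂ B']
  {K' : KData n B'} {K : KData n B} (F : KHom K' K)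

/-- The holomorphic block of the Jacobian. -/
def j : Matrix (Fin n) (Fin n) B := fun p k => F.J (Sum.inl p) (Sum.inl k)

/-- The antiholomorphic block of the Jacobian. -/
def jbar : Matrix (Fin n) (Fin n) B := fun q l => F.J (Sum.inr q) (Sum.inr l)

/-- The transformed metric. -/
def g' : Matrix (Fin n) (Fin n) B := K'.g.map F.φ

/-- The transformed inverse metric. -/
def h' : Matrix (Fin n) (Fin n) B := K'.h.map F.φ

theorem g'_mul_h' : F.g' * F.h' = 1 := by
  rw [g', h', ← Matrix.map_mul, K'.g_mul_h, Matrix.map_one _ (map_zero _) (map_one _)]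

theorem g_eq : K.g = F.j.transpose * F.g' * F.jbar := by
  ext k l
  simp only [F.g_φ, Matrix.mul_apply, j, jbar, g', Matrix.map_apply, Matrix.transpose_apply,
    Finset.sum_mul]
  rw [Finset.sum_comm]
  exact Finset.sum_congr rfl fun q _ => Finset.sum_congr rfl fun p _ => by ring

theorem j_mul : F.j.transpose * (F.g' * F.jbar * K.h) = 1 := by
  have := K.g_mul_h
  rw [F.g_eq] at this
  simpa only [Matrix.mul_assoc] using this

theorem mul_j : F.g' * F.jbar * K.h * F.j.transpose = 1 := mul_eq_one_comm.1 F.j_mul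

/-- Square matrices over a commutative ring have two-sided inverses, so the transformation law of
the metric can be inverted without assuming that the Jacobian is invertible. -/
theorem h'_eq : F.h' = F.jbar * K.h * F.j.transpose := by
  have h1 := F.mul_j
  have h2 : F.h' * F.g' = 1 := mul_eq_one_comm.1 F.g'_mul_h'
  calc F.h' = F.h' * (F.g' * F.jbar * K.h * F.j.transpose) := by rw [h1, Matrix.mul_one]
    _ = F.h' * F.g' * (F.jbar * K.h * F.j.transpose) := by simp only [Matrix.mul_assoc]
    _ = _ := by rw [h2, Matrix.one_mul]

theorem jbar_mul : F.jbar * (K.h * F.j.transpose * F.g') = 1 := by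
  have : F.h' * F.g' = 1 := mul_eq_one_comm.1 F.g'_mul_h'
  rwa [h'_eq, Matrix.mul_assoc, Matrix.mul_assoc, ← Matrix.mul_assoc K.h] at this

theorem mD_φ (I : Idx n) (M : Matrix (Fin n) (Fin n) B') :
    mD (K.d I) (M.map F.φ) = ∑ A, F.J A I • (mD (K'.d A) M).map F.φ := by
  ext k l
  simp only [mD_apply, Matrix.map_apply, F.d_φ, Matrix.sum_apply, Matrix.smul_apply, smul_eq_mul]

theorem mD_jbar (i : Fin n) : mD (K.d (Sum.inl i)) F.jbar = 0 := by
  ext q l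
  rw [mD_apply, jbar, F.d_J, F.J_antihol, map_zero]
  rfl

theorem mD_j (i : Fin n) : mD (K.d (Sum.inr i)) F.j = 0 := by
  ext q l
  rw [mD_apply, j, F.d_J, F.J_hol, map_zero]
  rfl

/-- Differentiate g = jᵀ g' j̄ in a holomorphic direction: j̄ is constant there, since derivatives
of the Jacobian are symmetric and its mixed blocks vanish. The derivative of jᵀ is the inhomogeneous
term. -/
theorem Γ_hol (i : Fin n) : mD (K.d (Sum.inl i)) K.g * K.h * F.j.transpose =
    mD (K.d (Sum.inl i)) F.j.transpose + F.j.transpose * ∑ e, F.J (Sum.inl e) (Sum.inl i) •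
      (mD (K'.d (Sum.inl e)) K'.g * K'.h).map F.φ := by
  have e1 : mD (K.d (Sum.inl i)) F.g' = ∑ e, F.J (Sum.inl e) (Sum.inl i) •
      (mD (K'.d (Sum.inl e)) K'.g).map F.φ := by
    rw [g', mD_φ, Fintype.sum_sum_type]
    simp [F.J_antihol]
  have e2 : ∑ e, F.J (Sum.inl e) (Sum.inl i) • (mD (K'.d (Sum.inl e)) K'.g * K'.h).map F.φ =
      mD (K.d (Sum.inl i)) F.g' * F.h' := by
    rw [e1, Finset.sum_mul]
    refine Finset.sum_congr rfl fun e _ => ?_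
    rw [Matrix.map_mul, Matrix.smul_mul, h']
  rw [e2]
  conv_lhs => rw [F.g_eq]
  rw [mD_mul, mD_mul, F.mD_jbar, Matrix.mul_zero, add_zero, Matrix.add_mul, Matrix.add_mul,
    Matrix.add_mul]
  congr 1
  · have := F.mul_j
    simp only [Matrix.mul_assoc] at this ⊢
    rw [this, Matrix.mul_one]
  · rw [F.h'_eq]
    simp only [Matrix.mul_assoc]

theorem Γ_antihol (i : Fin n) : F.jbar * (K.h * mD (K.d (Sum.inr i)) K.g) =
    mD (K.d (Sum.inr i)) F.jbar + (∑ e, F.J (Sum.inr e) (Sum.inr i) •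
      (K'.h * mD (K'.d (Sum.inr e)) K'.g).map F.φ) * F.jbar := by
  have e1 : mD (K.d (Sum.inr i)) F.g' = ∑ e, F.J (Sum.inr e) (Sum.inr i) •
      (mD (K'.d (Sum.inr e)) K'.g).map F.φ := by
    rw [g', mD_φ, Fintype.sum_sum_type]
    simp [F.J_hol]
  have e2 : ∑ e, F.J (Sum.inr e) (Sum.inr i) • (K'.h * mD (K'.d (Sum.inr e)) K'.g).map F.φ =
      F.h' * mD (K.d (Sum.inr i)) F.g' := by
    rw [e1, Finset.mul_sum]
    refine Finset.sum_congr rfl fun e _ => ?_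
    rw [Matrix.map_mul, Matrix.mul_smul, h']
  have e3 : mD (K.d (Sum.inr i)) F.j.transpose = 0 := by
    have := F.mD_j i
    ext p q
    exact congrFun (congrFun this q) p
  rw [e2]
  conv_lhs => rw [F.g_eq]
  rw [mD_mul, mD_mul, e3, Matrix.zero_mul, zero_add, Matrix.mul_add, Matrix.mul_add, add_comm]
  congr 1
  · have := F.jbar_mul
    simp only [← Matrix.mul_assoc] at this ⊢
    rw [this, Matrix.one_mul]
  · rw [F.h'_eq]
    simp only [Matrix.mul_assoc]

theorem Λ_φ (A C : Idx n) : F.φ (K'.Λ A C) = ∑ I, ∑ E, F.J A I * F.J C E * K.Λ I E := by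
  simp only [Fintype.sum_sum_type]
  rcases A with a | a <;> rcases C with c | c
  case inr.inl =>
    have := congrFun (congrFun F.h'_eq a) c
    rw [Matrix.mul_apply] at this
    simp only [KData.Λ, F.J_hol, F.J_antihol]
    simp only [h', Matrix.map_apply, Matrix.mul_apply, j, jbar, Matrix.transpose_apply] at this
    rw [this]
    simp only [Finset.sum_mul, zero_mul, mul_zero, Finset.sum_const_zero, zero_add, add_zero]
    rw [Finset.sum_comm]
    exact Finset.sum_congr rfl fun q _ => Finset.sum_congr rfl fun p _ => by ring
  all_goals simp [KData.Λ, F.J_hol, F.J_antihol]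

theorem Γ_φ (I E A : Idx n) : ∑ S, F.J A S * K.Γ I E S =
    K.d I (F.J A E) + ∑ X, ∑ C, F.φ (K'.Γ X C A) * F.J X I * F.J C E := by
  simp only [Fintype.sum_sum_type]
  rcases I with i | i <;> rcases E with e | e <;> rcases A with a | a
  case inl.inl.inl =>
    have z : ∀ i j s, K.Γ (Sum.inl i) (Sum.inl j) (Sum.inr s) = 0 := fun _ _ _ => rfl
    have := congrFun (congrFun (F.Γ_hol i) e) a
    rw [Matrix.mul_apply, Matrix.add_apply, Matrix.mul_apply] at this
    simp only [KData.Γ_hol, F.J_hol, F.J_antihol, zero_mul, mul_zero, Finset.sum_const_zero,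
      add_zero, zero_add]
    simp only [mD_apply, Matrix.sum_apply, Matrix.smul_apply, smul_eq_mul, Matrix.transpose_apply,
      j, Matrix.map_apply, Finset.mul_sum] at this
    rw [Finset.sum_comm (f := fun x c => F.φ ((mD (K'.d (Sum.inl x)) K'.g * K'.h) c a) *
      F.J (Sum.inl x) (Sum.inl i) * F.J (Sum.inl c) (Sum.inl e))]
    convert this using 2
    · exact mul_comm _ _
    · exact Finset.sum_congr rfl fun s _ => Finset.sum_congr rfl fun s _ => by ring
  case inr.inr.inr =>
    have z : ∀ i j s, K.Γ (Sum.inr i) (Sum.inr j) (Sum.inl s) = 0 := fun _ _ _ => rfl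
    have := congrFun (congrFun (F.Γ_antihol i) a) e
    rw [Matrix.mul_apply, Matrix.add_apply, Matrix.mul_apply] at this
    simp only [KData.Γ_antihol, F.J_hol, F.J_antihol, zero_mul, mul_zero, Finset.sum_const_zero,
      add_zero, zero_add]
    simp only [mD_apply, Matrix.sum_apply, Matrix.smul_apply, smul_eq_mul,
      jbar, Matrix.map_apply, Finset.sum_mul] at this
    rw [Finset.sum_comm (f := fun x c => F.φ ((K'.h * mD (K'.d (Sum.inr x)) K'.g) a c) *
      F.J (Sum.inr x) (Sum.inr i) * F.J (Sum.inr c) (Sum.inr e))]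
    convert this using 2
    exact Finset.sum_congr rfl fun s _ => Finset.sum_congr rfl fun s _ => by ring
  case inl.inr.inr => simp [KData.Γ, F.J_hol, F.J_antihol, F.d_J (Sum.inl i)]
  case inr.inl.inl => simp [KData.Γ, F.J_hol, F.J_antihol, F.d_J (Sum.inr i)]
  all_goals simp [KData.Γ, F.J_hol, F.J_antihol]

/-- The induced change of frames for the Fedosov construction. -/
def toFHom : FHom K'.toFData K.toFData where
  φ := F.φ
  J := F.J
  d_φ := F.d_φ
  Λ_φ := F.Λ_φ
  d_J := F.d_J
  Γ_φ := F.Γ_φ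

theorem bihom_P {x : Ser (Idx n) B'} (hx : KData.Bihom x) : KData.Bihom (F.toFHom.P x) where
  hol := by
    conv_lhs => rw [hx.hol]
    simp only [map_sum, pull_mul, pull_fX, dF_pull, Fintype.sum_sum_type]
    simp only [toFHom, F.J_hol, F.J_antihol, map_zero, zero_mul, Finset.sum_const_zero, add_zero,
      Finset.sum_mul, Finset.mul_sum]
    rw [Finset.sum_comm]
    exact Finset.sum_congr rfl fun s _ => Finset.sum_congr rfl fun s _ => by ring
  antihol := by
    conv_lhs => rw [hx.antihol]
    simp only [map_sum, pull_mul, pull_fX, dF_pull, Fintype.sum_sum_type]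
    simp only [toFHom, F.J_hol, F.J_antihol, map_zero, zero_mul, Finset.sum_const_zero, add_zero,
      zero_add, Finset.sum_mul, Finset.mul_sum]
    rw [Finset.sum_comm]
    exact Finset.sum_congr rfl fun s _ => Finset.sum_congr rfl fun s _ => by ring
  hol_hol p p' := by
    have e : F.toFHom.J = F.J := rfl
    simp only [dF_pull, map_sum, Fintype.sum_sum_type, dF_bC_mul]
    simp only [e, F.J_hol, F.J_antihol, map_zero, zero_mul, Finset.sum_const_zero, add_zero, zero_add,
      map_sum, dF_bC_mul, dF_pull, Fintype.sum_sum_type, hx.hol_hol, mul_zero]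
  antihol_antihol p p' := by
    have e : F.toFHom.J = F.J := rfl
    simp only [dF_pull, map_sum, Fintype.sum_sum_type, dF_bC_mul]
    simp only [e, F.J_hol, F.J_antihol, map_zero, zero_mul, Finset.sum_const_zero, add_zero, zero_add,
      map_sum, dF_bC_mul, dF_pull, Fintype.sum_sum_type, hx.antihol_antihol, mul_zero]

/-- The explicit formula for R need not be transformed: the difference of both sides is of degree
one in ζ and in ζ̄, and its adjoint action on pulled-back elements vanishes because commutators of
covariant derivatives are natural. -/
theorem R_P (I E : Idx n) : K.R I E = ∑ A, ∑ C, bC (F.J A I * F.J C E) *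
    F.toFHom.P (K'.R A C) := by
  rw [← sub_eq_zero]
  have hb : KData.Bihom (K.R I E - ∑ A, ∑ C, bC (F.J A I * F.J C E) * F.toFHom.P (K'.R A C)) := by
    rw [sub_eq_add_neg]
    exact (K.bihom_R I E).add (KData.Bihom.sum fun A _ => KData.Bihom.sum fun C _ =>
      (F.bihom_P (K'.bihom_R A C)).bC_mul _).neg
  set x := K.R I E - ∑ A, ∑ C, bC (F.J A I * F.J C E) * F.toFHom.P (K'.R A C) with hx
  have hP : ∀ a, br K.Λ x (F.toFHom.P a) = 0 := by
    intro a
    have h0 : ∀ y z w : Ser (Idx n) B, br K.Λ (y - z) w = br K.Λ y w - br K.Λ z w :=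
      fun y z w => by simp only [← brHom_apply, map_sub, AddMonoidHom.sub_apply]
    have h1 : br K.Λ (K.R I E) (F.toFHom.P a) =
        ∑ A, ∑ C, bC (F.J A I * F.J C E) * F.toFHom.P (br K'.Λ (K'.R A C) a) := by
      have hN : ∀ I a, nab K.d K.Γ I (F.toFHom.P a) =
          ∑ A, bC (F.J A I) * F.toFHom.P (nab K'.d K'.Γ A a) := F.toFHom.nab_P
      rw [← K.nab_comm]
      simp only [hN, map_sum, nab_mul, nab_bC, Finset.sum_add_distrib, F.d_J E I]
      rw [add_sub_add_left_eq_sub]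
      simp only [← K'.nab_comm, map_sub, mul_sub, Finset.sum_sub_distrib, Finset.mul_sum, map_mul]
      congr 1
      · rw [Finset.sum_comm]
        exact Finset.sum_congr rfl fun s _ => Finset.sum_congr rfl fun s _ => by ring
      · exact Finset.sum_congr rfl fun s _ => Finset.sum_congr rfl fun s _ => by ring
    have h2 : br K.Λ (∑ A, ∑ C, bC (F.J A I * F.J C E) * F.toFHom.P (K'.R A C)) (F.toFHom.P a) =
        ∑ A, ∑ C, bC (F.J A I * F.J C E) * F.toFHom.P (br K'.Λ (K'.R A C) a) := by
      have hb : ∀ f y z, br K.Λ (bC f * y) z = bC f * br K.Λ y z := fun f y z => by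
        simp only [br, wk_bC_left, wk_bC_right]; ring
      have hPb : ∀ y z, F.toFHom.P (br K'.Λ y z) = br K.Λ (F.toFHom.P y) (F.toFHom.P z) :=
        F.toFHom.P_br
      simp only [hPb, ← hb]
      simp only [← brHom_apply, map_sum, AddMonoidHom.finsetSum_apply]
    rw [hx, h0, h1, h2, sub_self]
  refine KData.Bihom.eq_zero_of_br K hb fun s => ?_
  have hs : ∀ a, ∑ k, bC (F.j a k) * br K.Λ x (fX (Sum.inl k)) = 0 := fun a => by
    have := hP (fX (Sum.inl a))
    rw [pull_fX, Fintype.sum_sum_type] at this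
    have e : F.toFHom.J = F.J := rfl
    simp only [e, F.J_hol, map_zero, zero_mul, Finset.sum_const_zero, add_zero] at this
    rw [← this, ← brHom_apply, map_sum]
    refine Finset.sum_congr rfl fun k _ => ?_
    simp only [brHom_apply, br, wk_bC_left, wk_bC_right, j]
    ring
  -- The holomorphic Jacobian has an explicit inverse in terms of the metrics. It recovers ζ^s from
  -- the pulled-back variables, on which the bracket is already known to vanish.
  have e : (F.g' * F.jbar * K.h).transpose * F.j = 1 := by
    rw [← Matrix.transpose_transpose F.j, ← Matrix.transpose_mul, F.j_mul, Matrix.transpose_one]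
  have : ∑ a, bC ((F.g' * F.jbar * K.h).transpose s a) *
      ∑ k, bC (F.j a k) * br K.Λ x (fX (Sum.inl k)) = br K.Λ x (fX (Sum.inl s)) := by
    simp only [Finset.mul_sum]
    rw [Finset.sum_comm]
    have : ∀ k, ∑ a, bC ((F.g' * F.jbar * K.h).transpose s a) *
        (bC (F.j a k) * br K.Λ x (fX (Sum.inl k))) =
        bC (((F.g' * F.jbar * K.h).transpose * F.j) s k) * br K.Λ x (fX (Sum.inl k)) := by
      intro k
      rw [Matrix.mul_apply, map_sum, Finset.sum_mul]
      exact Finset.sum_congr rfl fun s _ => by rw [map_mul]; ring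
    rw [Finset.sum_congr rfl fun k _ => this k, e]
    simp [Matrix.one_apply]
  rw [← this]
  simp [hs]

theorem isFed_oneForm {r : Idx n → Ser (Idx n) B'} (hr : K'.toFData.IsFed r) :
    K.toFData.IsFed (F.toFHom.oneForm r) :=
  F.toFHom.isFed_oneForm F.R_P hr

end KHom

end FedosovWick

end

open scoped Manifold ContDiff Topology ComplexOrder

noncomputable section

set_option linter.unusedSectionVars false
set_option linter.unusedSimpArgs false

namespace FedosovWick

/-! ### Orders with respect to a subset of the fibre variables. -/

section Order

variable {ι B : Type*} [CommRing B] [Fintype ι] (s : ι → Prop) [DecidablePred s]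

/-- The weight which counts the fibre variables in `s`. -/
def ind (I : ι) : ℤ := if s I then 1 else 0

theorem ind_nonneg (I : ι) : 0 ≤ ind s I := by unfold ind; split_ifs <;> norm_num

variable {s}

theorem ind_of {I : ι} (h : s I) : ind s I = 1 := if_pos h

theorem ind_of_not {I : ι} (h : ¬s I) : ind s I = 0 := if_neg h

theorem wt_ind_nonneg (k : ℤ) (m : ι →₀ ℕ) : 0 ≤ wt 0 (ind s) k m := by
  rw [wt, zero_mul, zero_add]
  exact Finset.sum_nonneg fun I _ => mul_nonneg (ind_nonneg s I) (by positivity)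

theorem wt_ind_eq_zero (k : ℤ) {m : ι →₀ ℕ} (hm : ∀ I, s I → m I = 0) : wt 0 (ind s) k m = 0 := by
  rw [wt, zero_mul, zero_add]
  refine Finset.sum_eq_zero fun I _ => ?_
  by_cases h : s I
  · rw [hm I h, Nat.cast_zero, mul_zero]
  · rw [ind_of_not h, zero_mul]

/-- All terms of `a` have order at least `p` in the fibre variables from `s`. -/
abbrev Ord (s : ι → Prop) [DecidablePred s] (p : ℤ) (a : Ser ι B) : Prop := WF 0 (ind s) p a

theorem ord_zero (a : Ser ι B) : Ord s 0 a :=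
  fun k m h => absurd h (not_lt.2 (wt_ind_nonneg k m))

theorem Ord.cf_eq_zero {a : Ser ι B} (ha : Ord s 1 a) (k : ℤ) {m : ι →₀ ℕ}
    (hm : ∀ I, s I → m I = 0) : cf a k m = 0 :=
  ha k m (by rw [wt_ind_eq_zero k hm]; norm_num)

theorem Ord.symb_eq_zero {a : Ser ι B} (ha : Ord s 1 a) : symb a = 0 := by
  ext k
  rw [coeff_symb, ha.cf_eq_zero k (fun _ _ => rfl)]
  rfl

theorem Ord.nu_mul {a : Ser ι B} {p : ℤ} (ha : Ord s p a) (k : ℤ) : Ord s p (nu k * a) :=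
  (WF.nu_mul ha k).mono (by simp)

theorem Ord.fX_mul {a : Ser ι B} {p : ℤ} (ha : Ord s p a) (I : ι) : Ord s p (fX I * a) :=
  (WF.fX_mul ha I).mono (by linarith [ind_nonneg s I])

theorem Ord.fX_mul_of {a : Ser ι B} {p : ℤ} (ha : Ord s p a) {I : ι} (hI : s I) :
    Ord s (p + 1) (FedosovWick.fX I * a) :=
  (WF.fX_mul ha I).mono (by rw [ind_of hI]; linarith)

variable {Λ : ι → ι → B}

/-- If the left factor is never differentiated in directions from `s`, none of its variables from
`s` can be lost. This one-sidedness of the Wick product is the source of separation of variables. -/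
theorem Ord.wterm_left (hΛ : ∀ I J, Λ I J ≠ 0 → ¬s I) {p : ℤ} (j : ℕ) : ∀ {a : Ser ι B}
    (_ : Ord s p a) (b : Ser ι B), Ord s p (wterm Λ j a b) := by
  induction j with
  | zero => intro a ha b; simpa [wterm] using WF.mul ha (ord_zero (s := s) b)
  | succ j ih =>
    intro a ha b
    refine WF.sum fun I _ => WF.sum fun J _ => ?_
    by_cases h : Λ I J = 0
    · simpa [h] using wf_zero
    · have := WF.dF ha I
      rw [ind_of_not (hΛ I J h), sub_zero] at this
      exact (ih this _).bC_mul _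

variable [Algebra ℂ B]

theorem Ord.wk_left (hΛ : ∀ I J, Λ I J ≠ 0 → ¬s I) {p : ℤ} {a : Ser ι B}
    (ha : Ord s p a) (b : Ser ι B) : Ord s p (wk Λ a b) :=
  wf_wk_of_wterm Λ fun j => (Ord.wterm_left hΛ j ha b).nu_mul j

theorem Ord.wk_right (hΛ : ∀ I J, Λ I J ≠ 0 → ¬s J) {p : ℤ} {b : Ser ι B}
    (hb : Ord s p b) (a : Ser ι B) : Ord s p (wk Λ a b) := by
  rw [← wk_swap]
  exact Ord.wk_left (fun I J h => hΛ J I h) hb a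

end Order

/-! ### Families of series whose coefficients are differential operators of bounded order. -/

section Differential

variable {ι B : Type*} [CommRing B] [Algebra ℂ B] [Fintype ι] (s : ι → Prop) {X : Type*}
  (𝒟 : ℤ → Submodule B (X → B))

/-- The coefficients of `ν^k ζ^m` in `a` are in `𝒟 (2 k + |m| + t)` if `m` contains no variables
from `s` and `2 k + |m| < d`. -/
def DF (d t : ℤ) (a : X → Ser ι B) : Prop := ∀ k m, (∀ I, s I → m I = 0) → wt 2 1 k m < d →
  (fun x => cf (a x) k m) ∈ 𝒟 (wt 2 1 k m + t)

variable {s 𝒟} {d t : ℤ} {a b : X → Ser ι B}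

theorem DF.add (ha : DF s 𝒟 d t a) (hb : DF s 𝒟 d t b) : DF s 𝒟 d t (fun x => a x + b x) :=
  fun k m hm hk => (𝒟 _).add_mem (ha k m hm hk) (hb k m hm hk)

theorem DF.neg (ha : DF s 𝒟 d t a) : DF s 𝒟 d t (fun x => -a x) :=
  fun k m hm hk => by
    simp only [cf_neg]
    exact (𝒟 _).neg_mem (ha k m hm hk)

theorem DF.sub (ha : DF s 𝒟 d t a) (hb : DF s 𝒟 d t b) : DF s 𝒟 d t (fun x => a x - b x) := by
  simpa only [sub_eq_add_neg] using ha.add hb.neg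

theorem df_zero : DF s 𝒟 d t (fun _ => (0 : Ser ι B)) := fun _ _ _ _ => (𝒟 _).zero_mem

theorem DF.sum {κ : Type*} {u : Finset κ} {a : κ → X → Ser ι B}
    (ha : ∀ i ∈ u, DF s 𝒟 d t (a i)) : DF s 𝒟 d t (fun x => ∑ i ∈ u, a i x) := fun k m hm hk => by
  simp only [cf_sum]
  have : (fun x => ∑ i ∈ u, cf (a i x) k m) = ∑ i ∈ u, fun x => cf (a i x) k m := by
    ext x; simp
  rw [this]
  exact (𝒟 _).sum_mem fun i hi => ha i hi k m hm hk

theorem DF.bC_mul (ha : DF s 𝒟 d t a) (f : B) : DF s 𝒟 d t (fun x => bC f * a x) :=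
  fun k m hm hk => by
    simp only [cf_bC_mul]
    exact (𝒟 _).smul_mem f (ha k m hm hk)

theorem wt_one_single [DecidableEq ι] (k : ℤ) (m : ι →₀ ℕ) (I : ι) :
    wt 2 1 k (m + Finsupp.single I 1) = wt 2 1 k m + 1 := by
  have := wt_add 2 (1 : ι → ℤ) k 0 m (Finsupp.single I 1)
  rwa [add_zero, wt_single, Pi.one_apply] at this

theorem DF.dF (ha : DF s 𝒟 d t a) {I : ι} (hI : ¬s I) :
    DF s 𝒟 (d - 1) (t + 1) (fun x => dF I (a x)) := fun k m hm hk => by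
  classical
  simp only [cf_dF]
  have e := wt_one_single k m I
  have := ha k (m + Finsupp.single I 1) (fun J hJ => by
    have : I ≠ J := fun h => hI (h ▸ hJ)
    rw [Finsupp.add_apply, hm J hJ, Finsupp.single_apply, if_neg this, add_zero]) (by omega)
  rw [e, add_assoc, add_comm 1 t] at this
  exact (𝒟 _).smul_mem ((m I : B) + 1) this

theorem DF.fX_mul (ha : DF s 𝒟 d t a) (I : ι) :
    DF s 𝒟 (d + 1) (t - 1) (fun x => fX I * a x) := fun k m hm hk => by
  classical
  simp only [cf_fX_mul]
  by_cases h : m I = 0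
  · simp only [h, if_true]
    exact (𝒟 _).zero_mem
  · simp only [h, if_false]
    have e : m - Finsupp.single I 1 + Finsupp.single I 1 = m :=
      tsub_add_cancel_of_le (by rw [Finsupp.single_le_iff]; omega)
    have e' := wt_one_single k (m - Finsupp.single I 1) I
    rw [e] at e'
    have := ha k (m - Finsupp.single I 1) (fun J hJ => by
      rw [Finsupp.tsub_apply, hm J hJ, Nat.zero_sub]) (by omega)
    have e2 : wt 2 1 k m + (t - 1) = wt 2 1 k (m - Finsupp.single I 1) + t := by omega
    rwa [e2]

theorem DF.nu_mul (ha : DF s 𝒟 d t a) (j : ℤ) :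
    DF s 𝒟 (d + 2 * j) (t - 2 * j) (fun x => nu j * a x) := fun k m hm hk => by
  simp only [cf_nu_mul]
  have e := wt_add 2 (1 : ι → ℤ) (k - j) j m 0
  rw [sub_add_cancel, add_zero, wt_nu] at e
  have e2 : wt 2 1 k m + (t - 2 * j) = wt 2 1 (k - j) m + t := by omega
  rw [e2]
  exact ha (k - j) m hm (by omega)

theorem DF.mono (ha : DF s 𝒟 d t a) (h𝒟 : Monotone 𝒟) {d' t' : ℤ} (hd : d' ≤ d) (ht : t ≤ t') :
    DF s 𝒟 d' t' a :=
  fun k m hm hk => h𝒟 (by omega) (ha k m hm (by omega))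

/-- A factor of degree at least `e` uses up at least `e` of the total weight, so only lower
coefficients of `a` enter and both the range and the order bound improve by `e`. -/
theorem DF.mul (ha : DF s 𝒟 d t a) (h𝒟 : Monotone 𝒟) {N : ℤ} (hN : ∀ x, Van N (a x)) {e : ℤ}
    {c : Ser ι B} (hc : Fil e c) : DF s 𝒟 (d + e) (t - e) (fun x => a x * c) := fun k m hm hk => by
  classical
  have : (fun x => cf (a x * c) k m) = ∑ i ∈ Finset.Icc N (k - c.order),
      ∑ y ∈ Finset.HasAntidiagonal.antidiagonal m, cf c (k - i) y.2 • fun x => cf (a x) i y.1 := by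
    ext x
    rw [cf_mul (hN x) (van_order c)]
    simp only [Finset.sum_apply, Pi.smul_apply, smul_eq_mul, mul_comm]
  rw [this]
  refine (𝒟 _).sum_mem fun i _ => (𝒟 _).sum_mem fun y hy => ?_
  rw [Finset.HasAntidiagonal.mem_antidiagonal] at hy
  have hw := wt_add 2 (1 : ι → ℤ) i (k - i) y.1 y.2
  rw [hy, add_sub_cancel] at hw
  by_cases h : wt 2 1 (k - i) y.2 < e
  · rw [hc _ _ h, zero_smul]
    exact (𝒟 _).zero_mem
  · refine (𝒟 _).smul_mem _ (h𝒟 ?_ (ha i y.1 (fun I hI => ?_) (by omega)))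
    · omega
    · have := hm I hI
      rw [← hy, Finsupp.add_apply] at this
      omega

theorem DF.wterm (h𝒟 : Monotone 𝒟) {Λ : ι → ι → B} (hΛ : ∀ I J, Λ I J ≠ 0 → ¬s I) {N : ℤ}
    (j : ℕ) : ∀ {d t : ℤ} {a : X → Ser ι B} (_ : DF s 𝒟 d t a) (_ : ∀ x, Van N (a x)) {e : ℤ}
      {c : Ser ι B} (_ : Fil e c),
      DF s 𝒟 (d + e - 2 * j) (t - e + 2 * j) (fun x => wterm Λ j (a x) c) := by
  induction j with
  | zero =>
    intro d t a ha hN e c hc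
    simpa [FedosovWick.wterm] using ha.mul h𝒟 hN hc
  | succ j ih =>
    intro d t a ha hN e c hc
    refine DF.sum fun I _ => DF.sum fun J _ => ?_
    by_cases h : Λ I J = 0
    · simpa [h] using df_zero
    · refine ((ih (ha.dF (hΛ I J h)) (fun x => (hN x).dF I) (hc.dF J)).mono h𝒟 ?_ ?_).bC_mul _
      · simp only [Pi.one_apply]; push_cast; omega
      · simp only [Pi.one_apply]; push_cast; omega

theorem DF.wk (ha : DF s 𝒟 d t a) (h𝒟 : Monotone 𝒟) {Λ : ι → ι → B}
    (hΛ : ∀ I J, Λ I J ≠ 0 → ¬s I) {N : ℤ} (hN : ∀ x, Van N (a x)) {e : ℤ}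
    {c : Ser ι B} (hc : Fil e c) : DF s 𝒟 (d + e) (t - e) (fun x => wk Λ (a x) c) :=
  fun k m hm hk => by
    have : (fun x => cf (FedosovWick.wk Λ (a x) c) k m) =
        ∑ j ∈ Finset.range (k - N - c.order + 1).toNat, algebraMap ℂ B ((j.factorial : ℂ)⁻¹) •
          fun x => cf (nu j * FedosovWick.wterm Λ j (a x) c) k m := by
      ext x
      rw [cf, coeff_wk Λ (hN x) (van_order c) k (k - N - c.order + 1).toNat (by omega), map_sum]
      simp only [Finset.sum_apply, Pi.smul_apply, cf_nu_mul, smul_eq_mul]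
      refine Finset.sum_congr rfl fun j _ => ?_
      have h2 := (MvPowerSeries.coeff m).map_smul_of_tower (R := ℂ) ((j.factorial : ℂ)⁻¹)
        ((FedosovWick.wterm Λ j (a x) c).coeff (k - j))
      rw [h2, Algebra.smul_def]
      rfl
    rw [this]
    refine (𝒟 _).sum_mem fun j _ => (𝒟 _).smul_mem _ ?_
    exact (((ha.wterm h𝒟 hΛ j hN hc).nu_mul j).mono h𝒟 (by omega) (by omega)) k m hm hk

/-- The coefficients without variables from `s` of a family of elements with
`D_q a = 0` modulo terms with variables from `s` are determined by the symbols. -/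
theorem df_of_flat (h𝒟 : Monotone 𝒟) {Λ : ι → ι → B} (hΛ : ∀ I J, Λ I J ≠ 0 → ¬s I)
    {Γ : ι → ι → ι → B} {δ : ι → Derivation ℂ B B} {r : ι → Ser ι B} [DecidablePred s]
    (hΓ : ∀ I A S, ¬s I → Γ I A S ≠ 0 → ¬s S)
    (hδ : ∀ I, ¬s I → ∀ N, ∀ φ ∈ 𝒟 N, (fun x => δ I (φ x)) ∈ 𝒟 (N + 1))
    (hr : ∀ I, ¬s I → Ord s 1 (r I)) (hr2 : ∀ I, Fil 2 (r I))
    {N : ℤ} (hN : ∀ x, Van N (a x))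
    (hD : ∀ I, ¬s I → ∀ x, Ord s 1 (-dF I (a x) + nab δ Γ I (a x) + br Λ (r I) (a x)))
    (h0 : ∀ k, (fun x => cf (a x) k 0) ∈ 𝒟 (2 * k)) (d : ℤ) : DF s 𝒟 d 0 a := by
  classical
  -- Induction over the total degree; below `2 * N` all coefficients vanish.
  have key : ∀ i : ℕ, DF s 𝒟 (2 * N + i) 0 a := by
    intro i
    induction i with
    | zero =>
      intro k m _ hk
      have : (fun x => cf (a x) k m) = 0 := by
        ext x
        exact (hN x).fil k m (by simpa using hk)
      rw [this]
      exact (𝒟 _).zero_mem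
    | succ i ih =>
      intro k m hm hk
      by_cases hm0 : m = 0
      · subst hm0
        rw [wt_nu, add_zero]
        exact h0 k
      obtain ⟨I, hI⟩ : ∃ I, m I ≠ 0 := by
        by_contra h
        push Not at h
        exact hm0 (Finsupp.ext h)
      have hsI : ¬s I := fun h => hI (hm I h)
      obtain ⟨m', rfl⟩ : ∃ m', m = m' + Finsupp.single I 1 :=
        ⟨m - Finsupp.single I 1, (tsub_add_cancel_of_le (by rw [Finsupp.single_le_iff]; omega)).symm⟩
      have hm' : ∀ J, s J → m' J = 0 := fun J hJ => by
        have := hm J hJ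
        rw [Finsupp.add_apply] at this
        omega
      have hwt := wt_one_single k m' I
      -- Half of the bracket suffices: `wk Λ (r I) (a x)` keeps the order of `r I` in the variables
      -- from `s` and is invisible in the coefficients considered. The derivative along `I` of `a x`
      -- thus has the coefficients of `y x`, which involve coefficients of `a x` of lower weight and
      -- at most one further derivation of the base.
      set y : X → Ser ι B := fun x => nab δ Γ I (a x) - nu (-1) * wk Λ (a x) (r I) with hy
      have hDy : DF s 𝒟 (2 * N + i) 1 y := by
        refine DF.sub ?_ ?_
        · have e : (fun x => nab δ Γ I (a x)) = fun x =>
              dB ((δ I : B →ₗ[ℂ] B).toAddMonoidHom) (a x) -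
                ∑ A, ∑ S, bC (Γ I A S) * (fX A * dF S (a x)) := by
            ext1 x
            rw [nab_apply]
            simp only [mul_assoc]
          rw [e]
          refine DF.sub (fun k m hm hk => ?_) (DF.sum fun A _ => DF.sum fun S _ => ?_)
          · have := hδ I hsI _ _ (ih k m hm hk)
            rw [add_zero] at this
            exact this
          · by_cases h : Γ I A S = 0
            · simpa [h] using df_zero
            · exact (((ih.dF (hΓ I A S hsI h)).fX_mul A).mono h𝒟 (by omega) (by omega)).bC_mul _
        · exact (((ih.wk h𝒟 hΛ hN (hr2 I)).nu_mul (-1)).mono h𝒟 (by omega) (by omega))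
      have hcf : ∀ x, ((m' I : B) + 1) * cf (a x) k (m' + Finsupp.single I 1) = cf (y x) k m' := by
        intro x
        have h1 := (hD I hsI x).cf_eq_zero k hm'
        have h2 := (((hr I hsI).wk_left hΛ (a x)).nu_mul (-1)).cf_eq_zero k hm'
        have e : -dF I (a x) + nab δ Γ I (a x) + br Λ (r I) (a x) =
            -dF I (a x) + y x + nu (-1) * wk Λ (r I) (a x) := by
          simp only [hy, br]; ring
        rw [e, cf_add, cf_add, h2, add_zero, cf_neg, cf_dF] at h1
        linear_combination -h1
      have h3 := hDy k m' hm' (by push_cast at hk; omega)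
      have e : (fun x => cf (a x) k (m' + Finsupp.single I 1)) =
          algebraMap ℂ B (((m' I : ℂ) + 1)⁻¹) • fun x => cf (y x) k m' := by
        ext x
        rw [Pi.smul_apply, smul_eq_mul, ← hcf, ← mul_assoc]
        have : algebraMap ℂ B (((m' I : ℂ) + 1)⁻¹) * ((m' I : B) + 1) = 1 := by
          have h : ((m' I : B) + 1) = algebraMap ℂ B ((m' I : ℂ) + 1) := by simp
          rw [h, ← map_mul, inv_mul_cancel₀ (Nat.cast_add_one_ne_zero _), map_one]
        rw [this, one_mul]
      rw [e, hwt, add_zero]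
      exact (𝒟 _).smul_mem _ h3
  exact (key (d - 2 * N).toNat).mono h𝒟 (by omega) le_rfl

end Differential

end FedosovWick

end

open scoped Manifold ContDiff Topology ComplexOrder

noncomputable section

set_option linter.unusedSectionVars false
set_option linter.unusedSimpArgs false

/-! ### Order conditions on r and left and right multiplication operators. -/

namespace FedosovWick

/-- Passing to the opposite product reverses the bracket, and the sign of `a` compensates.
Statements about ζ̄ and right factors thus follow from those about ζ and left factors, with
transposed tensor and r replaced by -r. -/
theorem br_swap {ι B : Type*} [CommRing B] [Algebra ℂ B] [Fintype ι] (Λ : ι → ι → B)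
    (a b : Ser ι B) : br (fun I J => Λ J I) (-a) b = br Λ a b := by
  rw [br, br, wk_swap Λ, wk_swap Λ, wk_neg_left, wk_neg_right]
  ring

/-- The holomorphic directions. -/
abbrev IsHol {n : ℕ} (I : Idx n) : Prop := I.isLeft = true

/-- The antiholomorphic directions. -/
abbrev IsAnti {n : ℕ} (I : Idx n) : Prop := I.isRight = true

/-- The orders in `ζ` and `ζ̄` of the element which defines the Fedosov connection of Wick type. -/
structure Sep {n : ℕ} {B : Type*} [CommRing B] (r : Idx n → Ser (Idx n) B) : Prop where
  anti_hol : ∀ q, Ord IsHol 2 (r (Sum.inr q))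
  anti_anti : ∀ q, Ord IsAnti 1 (r (Sum.inr q))
  hol_hol : ∀ k, Ord IsHol 1 (r (Sum.inl k))
  hol_anti : ∀ k, Ord IsAnti 2 (r (Sum.inl k))

namespace KData

variable {n : ℕ} {B : Type*} [CommRing B] [Algebra ℂ B] (K : KData n B)

theorem Λ_hol {I J : Idx n} (h : K.Λ I J ≠ 0) : ¬IsHol I := by
  rcases I with i | i <;> rcases J with j | j <;> simp_all [Λ]

theorem Λ_anti {I J : Idx n} (h : K.Λ I J ≠ 0) : ¬IsAnti J := by
  rcases I with i | i <;> rcases J with j | j <;> simp_all [Λ]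

theorem ord_nab (s : Idx n → Prop) [DecidablePred s] (I : Idx n)
    (hs : ∀ A S, K.Γ I A S ≠ 0 → (s A ↔ s S)) {p : ℤ} {a : Ser (Idx n) B}
    (ha : Ord s p a) : Ord s p (nab K.d K.Γ I a) :=
  WF.nab _ _ ha I fun A S h => by
    unfold ind
    rw [if_congr (hs A S h) rfl rfl]

theorem ord_hol_nab (I : Idx n) {p : ℤ} {a : Ser (Idx n) B} (ha : Ord IsHol p a) :
    Ord IsHol p (nab K.d K.Γ I a) :=
  K.ord_nab _ I (fun A S h => by
    rcases K.Γ_ne h with ⟨i, j, s, rfl, rfl, rfl⟩ | ⟨i, j, s, rfl, rfl, rfl⟩ <;> simp) ha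

theorem ord_anti_nab (I : Idx n) {p : ℤ} {a : Ser (Idx n) B} (ha : Ord IsAnti p a) :
    Ord IsAnti p (nab K.d K.Γ I a) :=
  K.ord_nab _ I (fun A S h => by
    rcases K.Γ_ne h with ⟨i, j, s, rfl, rfl, rfl⟩ | ⟨i, j, s, rfl, rfl, rfl⟩ <;> simp) ha

theorem ord_hol_wk {p : ℤ} {a : Ser (Idx n) B} (ha : Ord IsHol p a) (b : Ser (Idx n) B) :
    Ord IsHol p (wk K.Λ a b) :=
  Ord.wk_left (s := IsHol) (p := p) (fun _ _ => K.Λ_hol) ha b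

theorem ord_anti_wk {p : ℤ} {b : Ser (Idx n) B} (hb : Ord IsAnti p b) (a : Ser (Idx n) B) :
    Ord IsAnti p (wk K.Λ a b) :=
  Ord.wk_right (s := IsAnti) (p := p) (fun _ _ => K.Λ_anti) hb a

theorem ord_hol_br {p : ℤ} {a b : Ser (Idx n) B} (ha : Ord IsHol p a) (hb : Ord IsHol p b) :
    Ord IsHol p (br K.Λ a b) :=
  Ord.nu_mul (WF.sub (K.ord_hol_wk ha b) (K.ord_hol_wk hb a)) _

theorem ord_anti_br {p : ℤ} {a b : Ser (Idx n) B} (ha : Ord IsAnti p a) (hb : Ord IsAnti p b) :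
    Ord IsAnti p (br K.Λ a b) :=
  Ord.nu_mul (WF.sub (K.ord_anti_wk hb a) (K.ord_anti_wk ha b)) _

theorem ord_q11 (c : Matrix (Fin n) (Fin n) B) : Ord IsHol 1 (q11 c) ∧ Ord IsAnti 1 (q11 c) := by
  constructor <;> refine WF.sum fun k _ => WF.sum fun l _ => ?_
  · have e : bC (c k l) * fX (Sum.inl k) * fX (Sum.inr l) =
        fX (Sum.inl k) * (bC (c k l) * fX (Sum.inr l) : Ser (Idx n) B) := by ring
    rw [e]
    exact (ord_zero _).fX_mul_of rfl
  · rw [mul_comm]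
    exact (ord_zero _).fX_mul_of rfl

theorem ord_R (I J : Idx n) : Ord IsHol 1 (K.R I J) ∧ Ord IsAnti 1 (K.R I J) := by
  rcases I with i | i <;> rcases J with j | j
  exacts [⟨wf_zero, wf_zero⟩, ord_q11 _, ⟨(ord_q11 _).1.neg, (ord_q11 _).2.neg⟩, ⟨wf_zero, wf_zero⟩]

/-- Covariant derivatives preserve the orders in ζ and in ζ̄ separately, and a bracket has at least
the order that both arguments share. It remains to see where the second order comes from in the
components of opposite type. -/
theorem sep_step {r : Idx n → Ser (Idx n) B} (h : Sep r) : Sep (K.toFData.step r) := by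
  have hL : ∀ I, Ord IsHol 1 (r I) := fun I => by
    rcases I with i | i
    exacts [h.hol_hol i, (h.anti_hol i).mono (by norm_num)]
  have hR : ∀ I, Ord IsAnti 1 (r I) := fun I => by
    rcases I with i | i
    exacts [(h.hol_anti i).mono (by norm_num), h.anti_anti i]
  have cL : ∀ I J, Ord IsHol 1 (K.toFData.curvOf r I J) := fun I J =>
    ((K.ord_R I J).1.add ((K.ord_hol_nab I (hL J)).sub (K.ord_hol_nab J (hL I)))).add
      (K.ord_hol_br (hL I) (hL J))
  have cR : ∀ I J, Ord IsAnti 1 (K.toFData.curvOf r I J) := fun I J =>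
    ((K.ord_R I J).2.add ((K.ord_anti_nab I (hR J)).sub (K.ord_anti_nab J (hR I)))).add
      (K.ord_anti_br (hR I) (hR J))
  -- R has no component of type (0,2), and the two components of r that enter are of order two in ζ
  -- already. In the contraction, the mixed curvature component of order one gains its second order
  -- from the factor ζ^p.
  have cLL : ∀ p q, Ord IsHol 2 (K.toFData.curvOf r (Sum.inr p) (Sum.inr q)) := fun p q =>
    (WF.add wf_zero ((K.ord_hol_nab _ (h.anti_hol q)).sub (K.ord_hol_nab _ (h.anti_hol p)))).add
      (K.ord_hol_br (h.anti_hol p) (h.anti_hol q))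
  have cRR : ∀ p q, Ord IsAnti 2 (K.toFData.curvOf r (Sum.inl p) (Sum.inl q)) := fun p q =>
    (WF.add wf_zero ((K.ord_anti_nab _ (h.hol_anti q)).sub (K.ord_anti_nab _ (h.hol_anti p)))).add
      (K.ord_anti_br (h.hol_anti p) (h.hol_anti q))
  constructor
  · refine fun q => (WF.sum fun I _ => ?_).eulerInv 1
    rcases I with p | p
    · exact (cL _ _).fX_mul_of rfl
    · exact (cLL _ _).fX_mul _
  · exact fun q => (WF.sum fun I _ => (cR I _).fX_mul I).eulerInv 1
  · exact fun q => (WF.sum fun I _ => (cL I _).fX_mul I).eulerInv 1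
  · refine fun q => (WF.sum fun I _ => ?_).eulerInv 1
    rcases I with p | p
    · exact (cRR _ _).fX_mul _
    · exact (cR _ _).fX_mul_of rfl

theorem wf_of_limit {w : Idx n → ℤ} {p : ℤ} {a : Ser (Idx n) B}
    (h : ∀ e, ∃ b, WF 0 w p b ∧ Fil e (a - b)) : WF 0 w p a := fun k m hk => by
  obtain ⟨b, hb, hab⟩ := h (wt 2 1 k m + 1)
  have := hab k m (by omega)
  rwa [cf_sub, hb k m hk, sub_zero] at this

/-- The order conditions hold for 0, are kept by the iteration, and pass to limits, because each
coefficient of the limit is a coefficient of some approximation. -/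
theorem exists_isFed_sep : ∃ r, K.toFData.IsFed r ∧ Sep r :=
  K.toFData.exists_isFed Sep ⟨fun _ => wf_zero, fun _ => wf_zero, fun _ => wf_zero, fun _ => wf_zero⟩
    (fun _ _ _ => K.sep_step) fun _ ha =>
    ⟨fun q => wf_of_limit fun e => (ha e).imp' (fun b => b (Sum.inr q)) fun _ hb =>
        ⟨hb.1.anti_hol q, hb.2 _⟩,
      fun q => wf_of_limit fun e => (ha e).imp' (fun b => b (Sum.inr q)) fun _ hb =>
        ⟨hb.1.anti_anti q, hb.2 _⟩,
      fun q => wf_of_limit fun e => (ha e).imp' (fun b => b (Sum.inl q)) fun _ hb =>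
        ⟨hb.1.hol_hol q, hb.2 _⟩,
      fun q => wf_of_limit fun e => (ha e).imp' (fun b => b (Sum.inl q)) fun _ hb =>
        ⟨hb.1.hol_anti q, hb.2 _⟩⟩

/-- The element which defines the Fedosov connection. -/
def fed : Idx n → Ser (Idx n) B := K.exists_isFed_sep.choose

theorem isFed : K.toFData.IsFed K.fed := K.exists_isFed_sep.choose_spec.1

theorem sep : Sep K.fed := K.exists_isFed_sep.choose_spec.2

/-- The flat element with a given symbol. -/
def tau (f : LaurentSeries B) : Ser (Idx n) B := K.isFed.tau f

theorem symb_tau (f : LaurentSeries B) : symb (K.tau f) = f := K.isFed.symb_tau f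

theorem tau_flat (f : LaurentSeries B) (I : Idx n) :
    -dF I (K.tau f) + nab K.d K.Γ I (K.tau f) + br K.Λ (K.fed I) (K.tau f) = 0 :=
  K.isFed.flat_tau f I

/-- The Fedosov star-product of Wick type. -/
def star (f g : LaurentSeries B) : LaurentSeries B := symb (wk K.Λ (K.tau f) (K.tau g))

theorem symb_nab (I : Idx n) (a : Ser (Idx n) B) :
    symb (nab K.d K.Γ I a) = liftL ((K.d I : B →ₗ[ℂ] B).toAddMonoidHom) (symb a) := by
  ext k
  rw [coeff_symb, coeff_liftL, coeff_symb, nab_apply, cf_sub, cf_dB, cf_sum]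
  rw [Finset.sum_eq_zero, sub_zero]
  intro A _
  rw [cf_sum]
  refine Finset.sum_eq_zero fun S _ => ?_
  classical
  rw [mul_assoc, cf_bC_mul, cf_fX_mul, if_pos (by simp), mul_zero]

/-- The first Taylor coefficients of a flat element. -/
theorem symb_dF_tau (I : Idx n) (f : LaurentSeries B) :
    symb (dF I (K.tau f)) = liftL ((K.d I : B →ₗ[ℂ] B).toAddMonoidHom) f := by
  have h := congrArg symb (K.tau_flat f I)
  -- All components of r have order at least one both in ζ and in ζ̄: as a left factor r is
  -- invisible to the symbol because of ζ, as a right factor because of ζ̄.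
  have hb : symb (br K.Λ (K.fed I) (K.tau f)) = 0 := by
    have h1 : symb (wk K.Λ (K.fed I) (K.tau f)) = 0 := by
      refine (K.ord_hol_wk (p := 1) ?_ _).symb_eq_zero
      rcases I with i | i
      exacts [K.sep.hol_hol i, (K.sep.anti_hol i).mono (by norm_num)]
    have h2 : symb (wk K.Λ (K.tau f) (K.fed I)) = 0 := by
      refine (K.ord_anti_wk (p := 1) ?_ _).symb_eq_zero
      rcases I with i | i
      exacts [(K.sep.hol_anti i).mono (by norm_num), K.sep.anti_anti i]
    ext k
    have h1' := congrArg (fun a => a.coeff (k - -1)) h1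
    have h2' := congrArg (fun a => a.coeff (k - -1)) h2
    simp only [coeff_symb] at h1' h2'
    rw [coeff_symb, br, cf_nu_mul, cf_sub, h1', h2']
    simp
  rw [map_add, map_add, map_neg, hb, symb_nab, symb_tau, map_zero, add_zero, neg_add_eq_zero] at h
  exact h

/-- An element with the symbol of a flat element which is flat in antiholomorphic directions up to
terms with holomorphic variables. -/
theorem ord_hol_tau_sub {u : LaurentSeries B} {y : Ser (Idx n) B} (h0 : symb y = u)
    (h : ∀ q, Ord IsHol 1 (-dF (Sum.inr q) y + nab K.d K.Γ (Sum.inr q) y +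
      br K.Λ (K.fed (Sum.inr q)) y)) : Ord IsHol 1 (K.tau u - y) := by
  -- With only the zero family admitted as coefficients, `df_of_flat` becomes a uniqueness
  -- statement: zero symbol and flatness modulo ζ force all coefficients without ζ to vanish.
  have := df_of_flat (X := Unit) (s := IsHol) (𝒟 := fun _ => (⊥ : Submodule B (Unit → B)))
    monotone_const (Λ := K.Λ) (fun _ _ => K.Λ_hol) (Γ := K.Γ) (δ := K.d) (r := K.fed)
    (a := fun _ => K.tau u - y) ?_ ?_ ?_ K.isFed.fil (fun _ => van_order (K.tau u - y)) ?_ ?_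
  · intro k m hk
    have hm : ∀ I : Idx n, IsHol I → m I = 0 := by
      intro I hI
      by_contra hne
      refine not_le.2 hk ?_
      rw [wt, zero_mul, zero_add]
      have h1 : (1 : ℤ) ≤ ind IsHol I * m I := by
        rw [ind_of hI, one_mul]
        exact_mod_cast Nat.one_le_iff_ne_zero.2 hne
      exact h1.trans (Finset.single_le_sum (f := fun I : Idx n => ind IsHol I * (m I : ℤ))
        (fun J _ => mul_nonneg (ind_nonneg _ J) (by positivity)) (Finset.mem_univ I))
    exact congrFun ((Submodule.mem_bot _).1 (this (wt 2 1 k m + 1) k m hm (by omega))) ()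
  · intro I A S hI h
    rcases K.Γ_ne h with ⟨i, j, s, rfl, rfl, rfl⟩ | ⟨i, j, s, rfl, rfl, rfl⟩ <;> simp_all
  · intro I _ N φ hφ
    rw [Submodule.mem_bot] at hφ ⊢
    ext x
    simp [hφ]
  · intro I hI
    rcases I with i | i
    · simp at hI
    · exact (K.sep.anti_hol i).mono (by norm_num)
  · rintro (q | q) hI -
    · simp at hI
    · have e : -dF (Sum.inr q) (K.tau u - y) + nab K.d K.Γ (Sum.inr q) (K.tau u - y) +
          br K.Λ (K.fed (Sum.inr q)) (K.tau u - y) =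
          (-dF (Sum.inr q) (K.tau u) + nab K.d K.Γ (Sum.inr q) (K.tau u) +
          br K.Λ (K.fed (Sum.inr q)) (K.tau u)) -
          (-dF (Sum.inr q) y + nab K.d K.Γ (Sum.inr q) y + br K.Λ (K.fed (Sum.inr q)) y) := by
        have : br K.Λ (K.fed (Sum.inr q)) (K.tau u - y) =
          br K.Λ (K.fed (Sum.inr q)) (K.tau u) - br K.Λ (K.fed (Sum.inr q)) y := by
          simp only [← brHom_apply, map_sub]
        rw [this, map_sub, map_sub]
        ring
      rw [e, K.tau_flat, zero_sub]
      exact (h q).neg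
  · intro k
    rw [Submodule.mem_bot]
    ext x
    rw [cf_sub, ← coeff_symb, ← coeff_symb, symb_tau, h0, sub_self]
    rfl

/-- An element with the symbol of a flat element which is flat in holomorphic directions up to
terms with antiholomorphic variables. -/
theorem ord_anti_tau_sub {u : LaurentSeries B} {y : Ser (Idx n) B} (h0 : symb y = u)
    (h : ∀ q, Ord IsAnti 1 (-dF (Sum.inl q) y + nab K.d K.Γ (Sum.inl q) y +
      br K.Λ (K.fed (Sum.inl q)) y)) : Ord IsAnti 1 (K.tau u - y) := by
  -- The mirror image of the holomorphic case, for the opposite product: transposed tensor and -r.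
  have := df_of_flat (X := Unit) (s := IsAnti) (𝒟 := fun _ => (⊥ : Submodule B (Unit → B)))
    monotone_const (Λ := fun I J => K.Λ J I) (fun _ _ => K.Λ_anti) (Γ := K.Γ) (δ := K.d)
    (r := fun I => -K.fed I)
    (a := fun _ => K.tau u - y) ?_ ?_ ?_ (fun I => (K.isFed.fil I).neg)
    (fun _ => van_order (K.tau u - y)) ?_ ?_
  · intro k m hk
    have hm : ∀ I : Idx n, IsAnti I → m I = 0 := by
      intro I hI
      by_contra hne
      refine not_le.2 hk ?_
      rw [wt, zero_mul, zero_add]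
      have h1 : (1 : ℤ) ≤ ind IsAnti I * m I := by
        rw [ind_of hI, one_mul]
        exact_mod_cast Nat.one_le_iff_ne_zero.2 hne
      exact h1.trans (Finset.single_le_sum (f := fun I : Idx n => ind IsAnti I * (m I : ℤ))
        (fun J _ => mul_nonneg (ind_nonneg _ J) (by positivity)) (Finset.mem_univ I))
    exact congrFun ((Submodule.mem_bot _).1 (this (wt 2 1 k m + 1) k m hm (by omega))) ()
  · intro I A S hI h
    rcases K.Γ_ne h with ⟨i, j, s, rfl, rfl, rfl⟩ | ⟨i, j, s, rfl, rfl, rfl⟩ <;> simp_all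
  · intro I _ N φ hφ
    rw [Submodule.mem_bot] at hφ ⊢
    ext x
    simp [hφ]
  · intro I hI
    rcases I with i | i
    · exact ((K.sep.hol_anti i).mono (by norm_num)).neg
    · simp at hI
  · rintro (q | q) hI -
    · rw [br_swap]
      have e : -dF (Sum.inl q) (K.tau u - y) + nab K.d K.Γ (Sum.inl q) (K.tau u - y) +
          br K.Λ (K.fed (Sum.inl q)) (K.tau u - y) =
          (-dF (Sum.inl q) (K.tau u) + nab K.d K.Γ (Sum.inl q) (K.tau u) +
          br K.Λ (K.fed (Sum.inl q)) (K.tau u)) -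
          (-dF (Sum.inl q) y + nab K.d K.Γ (Sum.inl q) y + br K.Λ (K.fed (Sum.inl q)) y) := by
        have : br K.Λ (K.fed (Sum.inl q)) (K.tau u - y) =
          br K.Λ (K.fed (Sum.inl q)) (K.tau u) - br K.Λ (K.fed (Sum.inl q)) y := by
          simp only [← brHom_apply, map_sub]
        rw [this, map_sub, map_sub]
        ring
      rw [e, K.tau_flat, zero_sub]
      exact (h q).neg
    · simp at hI
  · intro k
    rw [Submodule.mem_bot]
    ext x
    rw [cf_sub, ← coeff_symb, ← coeff_symb, symb_tau, h0, sub_self]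
    rfl

/-- In a left factor terms with ζ survive all contractions and vanish in the symbol, so the exact
lift may be replaced by any approximation modulo ζ. -/
theorem star_eq_left {u : LaurentSeries B} {y : Ser (Idx n) B} (h : Ord IsHol 1 (K.tau u - y))
    (f : LaurentSeries B) : K.star u f = symb (wk K.Λ y (K.tau f)) := by
  have := (K.ord_hol_wk h (K.tau f)).symb_eq_zero
  rwa [wk_sub_left, map_sub, sub_eq_zero] at this

theorem star_eq_right {u : LaurentSeries B} {y : Ser (Idx n) B} (h : Ord IsAnti 1 (K.tau u - y))
    (f : LaurentSeries B) : K.star f u = symb (wk K.Λ (K.tau f) y) := by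
  have := (K.ord_anti_wk h (K.tau f)).symb_eq_zero
  rwa [wk_sub_right, map_sub, sub_eq_zero] at this

theorem symb_mul (a b : Ser (Idx n) B) : symb (a * b) = symb a * symb b :=
  liftL_mul (MvPowerSeries.constantCoeff (σ := Idx n) (R := B)) a b

theorem symb_cL (u : LaurentSeries B) : symb (cL u : Ser (Idx n) B) = u := by
  ext k
  rw [coeff_symb, cf_cL_zero]

theorem symb_bC_mul (f : B) (a : Ser (Idx n) B) :
    symb (bC f * a) = HahnSeries.C f * symb a := by
  ext k
  rw [coeff_symb, cf_bC_mul, HahnSeries.C_apply, HahnSeries.coeff_single_zero_mul, coeff_symb]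

theorem symb_nu_mul (k : ℤ) (a : Ser (Idx n) B) :
    symb (nu k * a) = HahnSeries.single k 1 * symb a := liftL_single_mul _ k a

theorem symb_fX (I : Idx n) : symb (fX I : Ser (Idx n) B) = 0 := by
  have h : Ord (fun J => J = I) 1 (fX I : Ser (Idx n) B) := by
    have := (ord_zero (s := fun J => J = I) (1 : Ser (Idx n) B)).fX_mul_of (I := I) rfl
    rwa [mul_one] at this
  exact h.symb_eq_zero

theorem br_cL (r : Ser (Idx n) B) (u : LaurentSeries B) : br K.Λ r (cL u) = 0 := by
  rw [br, wk_const_left _ (fun I => dF_cL I u), wk_const_right _ (fun I => dF_cL I u), sub_self,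
    mul_zero]

theorem nab_cL (I : Idx n) (f : LaurentSeries B) :
    nab K.d K.Γ I (cL f) = cL (liftL ((K.d I : B →ₗ[ℂ] B).toAddMonoidHom) f) :=
  FHom.nab_cL K.toFData I f

/-- A holomorphic `u`, taken without fibre variables, is already flat in the antiholomorphic
directions and may serve as its own lift modulo ζ. -/
theorem star_hol_left {u : LaurentSeries B}
    (hu : ∀ q, liftL ((K.d (Sum.inr q) : B →ₗ[ℂ] B).toAddMonoidHom) u = 0) (f : LaurentSeries B) :
    K.star u f = u * f := by
  rw [K.star_eq_left (y := cL u) (K.ord_hol_tau_sub (symb_cL u) fun q => ?_),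
    wk_const_left _ (fun I => dF_cL I u), symb_mul, symb_cL, symb_tau]
  rw [dF_cL, nab_cL, hu, br_cL]
  simpa using wf_zero

theorem star_anti_right {u : LaurentSeries B}
    (hu : ∀ q, liftL ((K.d (Sum.inl q) : B →ₗ[ℂ] B).toAddMonoidHom) u = 0) (f : LaurentSeries B) :
    K.star f u = u * f := by
  rw [K.star_eq_right (y := cL u) (K.ord_anti_tau_sub (symb_cL u) fun q => ?_),
    wk_const_right _ (fun I => dF_cL I u), symb_mul, symb_cL, symb_tau]
  rw [dF_cL, nab_cL, hu, br_cL]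
  simpa using wf_zero

/-- Products with elements which are linear in the fibre variables. -/
theorem wk_fX_left (I : Idx n) (b : Ser (Idx n) B) :
    wk K.Λ (fX I) b = fX I * b + nu 1 * ∑ J, bC (K.Λ I J) * dF J b := by
  rw [wk_eq_of_wterm K.Λ fun j => wterm_eq_zero_left K.Λ (fun E J E' J' => ?_) j b]
  · simp [dF_fX]
  · right; right
    rw [dF_fX]
    split_ifs
    · rw [← map_one bC, dF_bC]
    · exact map_zero _

theorem wk_fX_right (I : Idx n) (b : Ser (Idx n) B) :
    wk K.Λ b (fX I) = fX I * b + nu 1 * ∑ J, bC (K.Λ J I) * dF J b := by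
  rw [← wk_swap, wk_eq_of_wterm _ fun j => wterm_eq_zero_left _ (fun E J E' J' => ?_) j b]
  · simp [dF_fX]
  · right; right
    rw [dF_fX]
    split_ifs
    · rw [← map_one bC, dF_bC]
    · exact map_zero _

/-- Modulo ζ the lift of `u` is u + ν⁻¹ g_{kl} ζ̄^l. Left multiplication by the second summand
contracts once, and g cancels g⁻¹, leaving ∂/∂ζ^k; on lifts its symbol is ∂/∂z^k by `symb_dF_tau`.
-/
theorem star_potential_left {u : LaurentSeries B} {k : Fin n}
    (hu : ∀ q, liftL ((K.d (Sum.inr q) : B →ₗ[ℂ] B).toAddMonoidHom) u =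
      HahnSeries.single (-1) (K.g k q)) (f : LaurentSeries B) :
    K.star u f = u * f + liftL ((K.d (Sum.inl k) : B →ₗ[ℂ] B).toAddMonoidHom) f := by
  set y : Ser (Idx n) B := ∑ l, bC (K.g k l) * fX (Sum.inr l) with hy
  have hsum : ∀ b : Ser (Idx n) B, wk K.Λ y b = y * b + nu 1 * dF (Sum.inl k) b := by
    intro b
    have h1 : ∀ l, wk K.Λ (bC (K.g k l) * fX (Sum.inr l)) b =
        bC (K.g k l) * fX (Sum.inr l) * b +
          nu 1 * ∑ m, bC (K.g k l) * (bC (K.h l m) * dF (Sum.inl m) b) := fun l => by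
      rw [wk_bC_left, wk_fX_left, Fintype.sum_sum_type]
      simp only [Λ, map_zero, zero_mul, Finset.sum_const_zero, add_zero, Finset.mul_sum]
      rw [mul_add, Finset.mul_sum, mul_assoc]
      congr 1
      exact Finset.sum_congr rfl fun m _ => by ring
    rw [hy, wk_sum_left, Finset.sum_mul, Finset.sum_congr rfl fun l _ => h1 l,
      Finset.sum_add_distrib, ← Finset.mul_sum, Finset.sum_comm]
    congr 2
    have h2 : ∀ m, ∑ l, bC (K.g k l) * (bC (K.h l m) * dF (Sum.inl m) b) =
        bC ((K.g * K.h) k m) * dF (Sum.inl m) b := fun m => by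
      rw [Matrix.mul_apply, map_sum, Finset.sum_mul]
      exact Finset.sum_congr rfl fun l _ => by rw [map_mul, mul_assoc]
    rw [Finset.sum_congr rfl fun m _ => h2 m, K.g_mul_h]
    simp [Matrix.one_apply]
  -- The covariant derivative of the metric vanishes: the derivative of g_{kl} cancels against g
  -- times the Christoffel matrix g⁻¹ (∂̄g).
  have hnab : ∀ q, nab K.d K.Γ (Sum.inr q) y = 0 := by
    intro q
    have h1 : ∀ l, nab K.d K.Γ (Sum.inr q) (bC (K.g k l) * fX (Sum.inr l)) =
        bC (K.d (Sum.inr q) (K.g k l)) * fX (Sum.inr l) -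
          ∑ m, bC (K.g k l * (K.h * mD (K.d (Sum.inr q)) K.g) l m) * fX (Sum.inr m) := fun l => by
      rw [nab_mul, nab_bC, nab_fX, Fintype.sum_sum_type]
      have z : ∀ j, K.Γ (Sum.inr q) (Sum.inl j) (Sum.inr l) = 0 := fun _ => rfl
      have hneg : ∀ a b : Ser (Idx n) B, a * -b = -(a * b) := fun a b => by ring
      simp only [z, map_zero, zero_mul, Finset.sum_const_zero, zero_add, Γ_antihol, hneg, map_mul,
        Finset.mul_sum, mul_assoc, ← sub_eq_add_neg]
    rw [hy, map_sum, Finset.sum_congr rfl fun l _ => h1 l, Finset.sum_sub_distrib, sub_eq_zero,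
      Finset.sum_comm]
    refine Finset.sum_congr rfl fun m _ => ?_
    rw [← Finset.sum_mul, ← map_sum]
    congr 2
    have := congrFun (congrFun (Matrix.mul_assoc K.g K.h (mD (K.d (Sum.inr q)) K.g)) k) m
    rw [K.g_mul_h, Matrix.one_mul, mD_apply, Matrix.mul_apply] at this
    exact this
  have hsy : symb y = 0 := by
    rw [hy, map_sum]
    exact Finset.sum_eq_zero fun l _ => by rw [symb_bC_mul, symb_fX, mul_zero]
  have hdy : ∀ q, dF (Sum.inr q) y = bC (K.g k q) := by
    intro q
    simp [hy, dF_fX]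
  have hord : Ord IsHol 1 (K.tau u - (cL u + nu (-1) * y)) := by
    refine K.ord_hol_tau_sub ?_ fun q => ?_
    · rw [map_add, symb_cL, symb_nu_mul, hsy, mul_zero, add_zero]
    · have e1 : cL (HahnSeries.single (-1) (K.g k q)) = (nu (-1) * bC (K.g k q) : Ser (Idx n) B) := by
        refine ser_ext fun j m => ?_
        classical
        rw [cf_nu_mul, cf_bC]
        by_cases hm : m = 0
        · subst hm
          rw [cf_cL_zero, HahnSeries.coeff_single]
          by_cases hj : j = -1
          · subst hj; simp
          · rw [if_neg hj, if_neg fun h => hj (by omega)]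
        · rw [cf_cL_of_ne _ _ hm]
          simp [hm]
      have e : -dF (Sum.inr q : Idx n) (cL u + nu (-1) * y : Ser (Idx n) B) +
          -- The derivative ∂̄_q u = ν⁻¹ g_{kq} cancels -δ of the linear term, so only the bracket
          -- of r with `y` remains.
          nab K.d K.Γ (Sum.inr q) (cL u + nu (-1) * y) +
          br K.Λ (K.fed (Sum.inr q)) (cL u + nu (-1) * y) =
          nu (-1) * br K.Λ (K.fed (Sum.inr q)) y := by
        rw [map_add, map_add, dF_cL, dF_nu_mul, hdy, nab_cL, hu, e1, nab_nu_mul, hnab, br_add_right,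
          br_cL, br, wk_nu_left, wk_nu_right]
        rw [br]
        ring
      rw [e, br]
      refine Ord.nu_mul (Ord.nu_mul (WF.sub ?_ ?_) _) _
      · exact K.ord_hol_wk ((K.sep.anti_hol q).mono (by norm_num)) y
      · rw [hsum]
        refine WF.add ?_ (Ord.nu_mul ?_ _)
        · have := WF.mul (ord_zero (s := IsHol) y) ((K.sep.anti_hol q).mono (by norm_num : (1 : ℤ) ≤ 2))
          rwa [zero_add] at this
        -- Here order two in ζ is indispensable: one order is lost to ∂/∂ζ^k and one has to remain.
        · have := WF.dF (K.sep.anti_hol q) (Sum.inl k)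
          rw [ind_of (s := IsHol) rfl] at this
          exact this
  rw [K.star_eq_left hord, wk_add_left, wk_nu_left, hsum, wk_const_left _ (fun I => dF_cL I u)]
  have e : cL u * K.tau f + nu (-1) * (y * K.tau f + nu 1 * dF (Sum.inl k) (K.tau f)) =
      cL u * K.tau f + nu (-1) * (y * K.tau f) + dF (Sum.inl k) (K.tau f) := by
    rw [mul_add, nu_mul_nu_mul, neg_add_cancel, nu_zero, one_mul, add_assoc]
  rw [e, map_add, map_add, symb_mul, symb_cL, symb_tau, symb_nu_mul, symb_mul, hsy, symb_dF_tau]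
  simp

/-- Conjugate to `star_potential_left`: modulo ζ̄ the lift of `u` is u + ν⁻¹ g_{kl} ζ^k, and the
second order of the holomorphic components of r in ζ̄ is used. -/
theorem star_potential_right {u : LaurentSeries B} {l : Fin n}
    (hu : ∀ q, liftL ((K.d (Sum.inl q) : B →ₗ[ℂ] B).toAddMonoidHom) u =
      HahnSeries.single (-1) (K.g q l)) (f : LaurentSeries B) :
    K.star f u = u * f + liftL ((K.d (Sum.inr l) : B →ₗ[ℂ] B).toAddMonoidHom) f := by
  set y : Ser (Idx n) B := ∑ k, bC (K.g k l) * fX (Sum.inl k) with hy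
  have hhg : K.h * K.g = 1 := mul_eq_one_comm.1 K.g_mul_h
  have hsum : ∀ b : Ser (Idx n) B, wk K.Λ b y = y * b + nu 1 * dF (Sum.inr l) b := by
    intro b
    have h1 : ∀ k, wk K.Λ b (bC (K.g k l) * fX (Sum.inl k)) =
        bC (K.g k l) * fX (Sum.inl k) * b +
          nu 1 * ∑ m, bC (K.g k l) * (bC (K.h m k) * dF (Sum.inr m) b) := fun k => by
      rw [wk_bC_right, wk_fX_right, Fintype.sum_sum_type]
      simp only [Λ, map_zero, zero_mul, Finset.sum_const_zero, zero_add, Finset.mul_sum]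
      rw [mul_add, Finset.mul_sum, mul_assoc]
      congr 1
      exact Finset.sum_congr rfl fun m _ => by ring
    rw [hy, wk_sum_right, Finset.sum_mul, Finset.sum_congr rfl fun l _ => h1 l,
      Finset.sum_add_distrib, ← Finset.mul_sum, Finset.sum_comm]
    congr 2
    have h2 : ∀ m, ∑ k, bC (K.g k l) * (bC (K.h m k) * dF (Sum.inr m) b) =
        bC ((K.h * K.g) m l) * dF (Sum.inr m) b := fun m => by
      rw [Matrix.mul_apply, map_sum, Finset.sum_mul]
      exact Finset.sum_congr rfl fun l _ => by rw [map_mul]; ring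
    rw [Finset.sum_congr rfl fun m _ => h2 m, hhg]
    simp [Matrix.one_apply]
  have hnab : ∀ q, nab K.d K.Γ (Sum.inl q) y = 0 := by
    intro q
    have h1 : ∀ k, nab K.d K.Γ (Sum.inl q) (bC (K.g k l) * fX (Sum.inl k)) =
        bC (K.d (Sum.inl q) (K.g k l)) * fX (Sum.inl k) -
          ∑ m, bC (K.g k l * (mD (K.d (Sum.inl q)) K.g * K.h) m k) * fX (Sum.inl m) := fun k => by
      rw [nab_mul, nab_bC, nab_fX, Fintype.sum_sum_type]
      have z : ∀ j, K.Γ (Sum.inl q) (Sum.inr j) (Sum.inl k) = 0 := fun _ => rfl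
      have hneg : ∀ a b : Ser (Idx n) B, a * -b = -(a * b) := fun a b => by ring
      simp only [z, map_zero, zero_mul, Finset.sum_const_zero, add_zero, Γ_hol, hneg, map_mul,
        Finset.mul_sum, mul_assoc, ← sub_eq_add_neg]
    rw [hy, map_sum, Finset.sum_congr rfl fun l _ => h1 l, Finset.sum_sub_distrib, sub_eq_zero,
      Finset.sum_comm]
    refine Finset.sum_congr rfl fun m _ => ?_
    rw [← Finset.sum_mul, ← map_sum]
    congr 2
    have := congrFun (congrFun (Matrix.mul_assoc (mD (K.d (Sum.inl q)) K.g) K.h K.g) m) l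
    rw [hhg, Matrix.mul_one, mD_apply, Matrix.mul_apply] at this
    rw [← this]
    exact Finset.sum_congr rfl fun k _ => mul_comm _ _
  have hsy : symb y = 0 := by
    rw [hy, map_sum]
    exact Finset.sum_eq_zero fun l _ => by rw [symb_bC_mul, symb_fX, mul_zero]
  have hdy : ∀ q, dF (Sum.inl q) y = bC (K.g q l) := by
    intro q
    simp [hy, dF_fX]
  have hord : Ord IsAnti 1 (K.tau u - (cL u + nu (-1) * y)) := by
    refine K.ord_anti_tau_sub ?_ fun q => ?_
    · rw [map_add, symb_cL, symb_nu_mul, hsy, mul_zero, add_zero]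
    · have e1 : cL (HahnSeries.single (-1) (K.g q l)) = (nu (-1) * bC (K.g q l) : Ser (Idx n) B) := by
        refine ser_ext fun j m => ?_
        classical
        rw [cf_nu_mul, cf_bC]
        by_cases hm : m = 0
        · subst hm
          rw [cf_cL_zero, HahnSeries.coeff_single]
          by_cases hj : j = -1
          · subst hj; simp
          · rw [if_neg hj, if_neg fun h => hj (by omega)]
        · rw [cf_cL_of_ne _ _ hm]
          simp [hm]
      have e : -dF (Sum.inl q : Idx n) (cL u + nu (-1) * y : Ser (Idx n) B) +
          nab K.d K.Γ (Sum.inl q) (cL u + nu (-1) * y) +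
          br K.Λ (K.fed (Sum.inl q)) (cL u + nu (-1) * y) =
          nu (-1) * br K.Λ (K.fed (Sum.inl q)) y := by
        rw [map_add, map_add, dF_cL, dF_nu_mul, hdy, nab_cL, hu, e1, nab_nu_mul, hnab, br_add_right,
          br_cL, br, wk_nu_left, wk_nu_right]
        rw [br]
        ring
      rw [e, br]
      refine Ord.nu_mul (Ord.nu_mul (WF.sub ?_ ?_) _) _
      · rw [hsum]
        refine WF.add ?_ (Ord.nu_mul ?_ _)
        · have := WF.mul (ord_zero (s := IsAnti) y)
            ((K.sep.hol_anti q).mono (by norm_num : (1 : ℤ) ≤ 2))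
          rwa [zero_add] at this
        · have := WF.dF (K.sep.hol_anti q) (Sum.inr l)
          rw [ind_of (s := IsAnti) rfl] at this
          exact this
      · exact K.ord_anti_wk ((K.sep.hol_anti q).mono (by norm_num)) y
  rw [K.star_eq_right hord, wk_add_right, wk_nu_right, hsum, wk_const_right _ (fun I => dF_cL I u)]
  have e : cL u * K.tau f + nu (-1) * (y * K.tau f + nu 1 * dF (Sum.inr l) (K.tau f)) =
      cL u * K.tau f + nu (-1) * (y * K.tau f) + dF (Sum.inr l) (K.tau f) := by
    rw [mul_add, nu_mul_nu_mul, neg_add_cancel, nu_zero, one_mul, add_assoc]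
  rw [e, map_add, map_add, symb_mul, symb_cL, symb_tau, symb_nu_mul, symb_mul, hsy, symb_dF_tau]
  simp

end KData

end FedosovWick

end

open scoped Manifold ContDiff Topology ComplexOrder

noncomputable section

set_option linter.unusedSectionVars false
set_option linter.unusedSimpArgs false

/-! ### Algebraic properties of the star-product over a ring, and the shape of its cochains. -/

namespace FedosovWick

namespace KData

variable {n : ℕ} {B : Type*} [CommRing B] [Algebra ℂ B] (K : KData n B)

theorem flat_tau (f : LaurentSeries B) : K.toFData.Flat K.fed (K.tau f) := K.isFed.flat_tau f

theorem eq_tau {w : Ser (Idx n) B} (hw : K.toFData.Flat K.fed w) : w = K.tau (symb w) :=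
  K.isFed.eq_tau hw rfl

theorem tau_star (f g : LaurentSeries B) :
    K.tau (K.star f g) = wk K.Λ (K.tau f) (K.tau g) :=
  (K.eq_tau ((K.flat_tau f).wk (K.flat_tau g))).symm

theorem star_assoc (f g h : LaurentSeries B) :
    K.star (K.star f g) h = K.star f (K.star g h) := by
  have e1 : K.star (K.star f g) h = symb (wk K.Λ (K.tau (K.star f g)) (K.tau h)) := rfl
  have e2 : K.star f (K.star g h) = symb (wk K.Λ (K.tau f) (K.tau (K.star g h))) := rfl
  rw [e1, e2, tau_star, tau_star, wk_assoc]

theorem tau_one : K.tau 1 = 1 := by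
  have := K.eq_tau FData.flat_one
  have h : symb (1 : Ser (Idx n) B) = 1 := by
    have e : (cL (1 : LaurentSeries B) : Ser (Idx n) B) = 1 := by
      have e1 : (1 : LaurentSeries B) = HahnSeries.C 1 := (map_one _).symm
      rw [e1, cL, liftL_C]
      simp
    rw [← e, symb_cL]
  rw [h] at this
  exact this.symm

theorem one_star (f : LaurentSeries B) : K.star 1 f = f := by
  rw [star, tau_one, wk_one_left, symb_tau]

theorem star_one (f : LaurentSeries B) : K.star f 1 = f := by
  rw [star, tau_one, wk_one_right, symb_tau]

theorem tau_add (f g : LaurentSeries B) : K.tau (f + g) = K.tau f + K.tau g := by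
  have := K.eq_tau ((K.flat_tau f).add (K.flat_tau g))
  rw [map_add, symb_tau, symb_tau] at this
  exact this.symm

theorem tau_nu_mul (k : ℤ) (f : LaurentSeries B) :
    K.tau (HahnSeries.single k 1 * f) = nu k * K.tau f := by
  have := K.eq_tau ((K.flat_tau f).nu_mul k)
  rw [symb_nu_mul, symb_tau] at this
  exact this.symm

theorem star_add_left (f g h : LaurentSeries B) :
    K.star (f + g) h = K.star f h + K.star g h := by
  simp only [star, tau_add, wk_add_left, map_add]

theorem star_add_right (f g h : LaurentSeries B) :
    K.star f (g + h) = K.star f g + K.star f h := by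
  simp only [star, tau_add, wk_add_right, map_add]

theorem star_nu_left (k : ℤ) (f g : LaurentSeries B) :
    K.star (HahnSeries.single k 1 * f) g = HahnSeries.single k 1 * K.star f g := by
  simp only [star, tau_nu_mul, wk_nu_left, symb_nu_mul]

theorem star_nu_right (k : ℤ) (f g : LaurentSeries B) :
    K.star f (HahnSeries.single k 1 * g) = HahnSeries.single k 1 * K.star f g := by
  simp only [star, tau_nu_mul, wk_nu_right, symb_nu_mul]

theorem van_tau {p : ℤ} {f : LaurentSeries B} (hf : Van p f) : Van p (K.tau f) :=
  K.isFed.van_tau hf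

theorem van_star {p q : ℤ} {f g : LaurentSeries B} (hf : Van p f) (hg : Van q g) :
    Van (p + q) (K.star f g) := ((K.van_tau hf).wk _ (K.van_tau hg)).symb

theorem coeff_zero_star (f g : B) :
    (K.star (HahnSeries.C f) (HahnSeries.C g)).coeff 0 = f * g := by
  have hf := K.van_tau (van_C f)
  have hg := K.van_tau (van_C g)
  have h := congrArg MvPowerSeries.constantCoeff (coeff_wk K.Λ hf hg 0 1 (by norm_num))
  simp only [Finset.sum_range_one, Nat.factorial_zero, Nat.cast_one, inv_one, one_smul,
    Nat.cast_zero, sub_zero, wterm] at h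
  have h2 : (K.star (HahnSeries.C f) (HahnSeries.C g)).coeff 0 =
      (symb (K.tau (HahnSeries.C f) * K.tau (HahnSeries.C g))).coeff 0 := h
  rw [h2, symb_mul, symb_tau, symb_tau, ← map_mul]
  simp

/-- The uncontracted product of the lifts has symbol `f * g`, without a term in ν. So only the first
contraction counts, and it sees the first Taylor coefficients of the lifts. -/
theorem coeff_one_star (f g : B) : (K.star (HahnSeries.C f) (HahnSeries.C g)).coeff 1 =
    ∑ l, ∑ k, K.h l k * (K.d (Sum.inr l) f * K.d (Sum.inl k) g) := by
  have hf := K.van_tau (van_C f)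
  have hg := K.van_tau (van_C g)
  have h := congrArg MvPowerSeries.constantCoeff (coeff_wk K.Λ hf hg 1 2 (by norm_num))
  simp only [Finset.sum_range_succ, Finset.sum_range_zero, zero_add, Nat.factorial_zero,
    Nat.factorial_one, Nat.cast_one, inv_one, one_smul,
    Nat.cast_zero, sub_zero, sub_self, wterm, map_add] at h
  have h2 : (K.star (HahnSeries.C f) (HahnSeries.C g)).coeff 1 =
      (symb (K.tau (HahnSeries.C f) * K.tau (HahnSeries.C g))).coeff 1 +
      (symb (∑ I : Idx n, ∑ J : Idx n, (bC (K.Λ I J) : Ser (Idx n) B) *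
        ((dF I (K.tau (HahnSeries.C f)) : Ser (Idx n) B) *
          (dF J (K.tau (HahnSeries.C g)) : Ser (Idx n) B)))).coeff 0 := h
  have h3 : ∀ I (f : B), liftL ((K.d I : B →ₗ[ℂ] B).toAddMonoidHom) (HahnSeries.C f) =
      HahnSeries.C (K.d I f) := fun I f => liftL_C _ _
  rw [h2, symb_mul, symb_tau, symb_tau, ← map_mul, map_sum]
  simp only [map_sum, symb_bC_mul, symb_mul, symb_dF_tau, h3, ← map_mul]
  rw [HahnSeries.C_apply, HahnSeries.coeff_single_of_ne one_ne_zero, zero_add]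
  have h4 : ∀ b : B, (symb (bC b : Ser (Idx n) B)).coeff 0 = b := fun b => by
    simp [coeff_symb, cf, bC]
  simp [Fintype.sum_sum_type, Λ, HahnSeries.coeff_sum, h4]

section Differential

/-- Iterated derivatives. -/
def dl (L : List (Idx n)) (f : B) : B := L.foldr (fun I h => K.d I h) f

/-- Differential operators of order at most `N` in directions from the range of `p`. -/
def diffOp (p : Fin n → Idx n) (N : ℤ) : Submodule B (B → B) :=
  Submodule.span B {φ | ∃ L : List (Fin n), (L.length : ℤ) ≤ N ∧ φ = fun f => K.dl (L.map p) f}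

theorem diffOp_mono (p : Fin n → Idx n) : Monotone (K.diffOp p) := fun _ _ h =>
  Submodule.span_mono fun _ ⟨L, hL, e⟩ => ⟨L, hL.trans h, e⟩

theorem diffOp_d (p : Fin n → Idx n) (i : Fin n) (N : ℤ) (φ : B → B) (hφ : φ ∈ K.diffOp p N) :
    (fun f => K.d (p i) (φ f)) ∈ K.diffOp p (N + 1) := by
  induction hφ using Submodule.span_induction with
  | mem φ hφ =>
    obtain ⟨L, hL, rfl⟩ := hφ
    exact Submodule.subset_span ⟨i :: L, by simpa using hL, rfl⟩
  | zero =>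
    simp only [Pi.zero_apply, map_zero]
    exact Submodule.zero_mem _
  | add φ ψ _ _ h1 h2 =>
    simp only [Pi.add_apply, map_add]
    exact Submodule.add_mem _ h1 h2
  | smul b φ hφ h =>
    simp only [Pi.smul_apply, smul_eq_mul, Derivation.leibniz]
    exact Submodule.add_mem _ (Submodule.smul_mem _ b h) (by
      have := Submodule.smul_mem _ (K.d (p i) b) (K.diffOp_mono p (by omega : N ≤ N + 1) hφ)
      convert this using 1
      ext f
      simp [mul_comm])

/-- Lists of bounded length. -/
def lists (n m : ℕ) : Finset (List (Fin n)) := (List.finite_length_le (Fin n) m).toFinset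

theorem mem_lists {m : ℕ} {L : List (Fin n)} : L ∈ lists n m ↔ L.length ≤ m := by
  simp [lists]

theorem exists_of_mem_diffOp {p : Fin n → Idx n} {m : ℕ} {φ : B → B} (hφ : φ ∈ K.diffOp p m) :
    ∃ c : List (Fin n) → B, ∀ f, φ f = ∑ L ∈ lists n m, c L * K.dl (L.map p) f := by
  classical
  induction hφ using Submodule.span_induction with
  | mem φ hφ =>
    obtain ⟨L, hL, rfl⟩ := hφ
    refine ⟨fun L' => if L' = L then 1 else 0, fun f => ?_⟩
    rw [Finset.sum_eq_single L]
    · simp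
    · intro L' _ h; simp [h]
    · exact fun h => absurd (mem_lists.2 (by exact_mod_cast hL)) h
  | zero => exact ⟨0, fun f => by simp⟩
  | add φ ψ _ _ h1 h2 =>
    obtain ⟨c, hc⟩ := h1
    obtain ⟨c', hc'⟩ := h2
    exact ⟨c + c', fun f => by simp [hc, hc', add_mul, Finset.sum_add_distrib]⟩
  | smul b φ _ h =>
    obtain ⟨c, hc⟩ := h
    exact ⟨fun L => b * c L, fun f => by simp [hc, Finset.mul_sum, mul_assoc]⟩

/-- The recursion starts from the symbol `f`, an operator of order zero, and differentiates only in
antiholomorphic directions as long as coefficients without ζ are concerned. The bound grows with the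
total degree. -/
theorem df_hol_tau (d : ℤ) : DF IsHol (K.diffOp Sum.inr) d 0
    (fun f : B => K.tau (HahnSeries.C f)) := by
  refine df_of_flat (K.diffOp_mono _) (Λ := K.Λ) (fun _ _ => K.Λ_hol) (Γ := K.Γ) (δ := K.d)
    (r := K.fed) ?_ ?_ ?_ K.isFed.fil (fun f => K.van_tau (van_C f)) ?_ ?_ d
  · intro I A S hI h
    rcases K.Γ_ne h with ⟨i, j, s, rfl, rfl, rfl⟩ | ⟨i, j, s, rfl, rfl, rfl⟩ <;> simp_all
  · rintro (i | i) hI N φ hφ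
    · simp at hI
    · exact K.diffOp_d _ i N φ hφ
  · rintro (i | i) hI
    · simp at hI
    · exact (K.sep.anti_hol i).mono (by norm_num)
  · intro I _ f
    rw [K.tau_flat]
    exact wf_zero
  · intro k
    simp only [← coeff_symb, symb_tau]
    by_cases hk : k = 0
    · subst hk
      simp only [HahnSeries.C_apply, HahnSeries.coeff_single_same]
      exact Submodule.subset_span ⟨[], by simp, rfl⟩
    · simp only [HahnSeries.C_apply, HahnSeries.coeff_single_of_ne hk]
      exact Submodule.zero_mem _

theorem df_anti_tau (d : ℤ) : DF IsAnti (K.diffOp Sum.inl) d 0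
    (fun f : B => K.tau (HahnSeries.C f)) := by
  refine df_of_flat (K.diffOp_mono _) (Λ := fun I J => K.Λ J I) (fun _ _ => K.Λ_anti) (Γ := K.Γ)
    (δ := K.d) (r := fun I => -K.fed I) ?_ ?_ ?_ (fun I => (K.isFed.fil I).neg)
    (fun f => K.van_tau (van_C f)) ?_ ?_ d
  · intro I A S hI h
    rcases K.Γ_ne h with ⟨i, j, s, rfl, rfl, rfl⟩ | ⟨i, j, s, rfl, rfl, rfl⟩ <;> simp_all
  · rintro (i | i) hI N φ hφ
    · exact K.diffOp_d _ i N φ hφ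
    · simp at hI
  · rintro (i | i) hI
    · exact ((K.sep.hol_anti i).mono (by norm_num)).neg
    · simp at hI
  · intro I _ f
    rw [br_swap, K.tau_flat]
    exact wf_zero
  · intro k
    simp only [← coeff_symb, symb_tau]
    by_cases hk : k = 0
    · subst hk
      simp only [HahnSeries.C_apply, HahnSeries.coeff_single_same]
      exact Submodule.subset_span ⟨[], by simp, rfl⟩
    · simp only [HahnSeries.C_apply, HahnSeries.coeff_single_of_ne hk]
      exact Submodule.zero_mem _

/-- Bidifferential operators with separation of variables. -/
def bidiffOp (N : ℤ) : Submodule B (B × B → B) :=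
  Submodule.span B {C | ∃ φ ∈ K.diffOp Sum.inr N, ∃ ψ ∈ K.diffOp Sum.inl N,
    C = fun x => φ x.1 * ψ x.2}

/-- The tensor contracts ζ̄ on the left with ζ on the right, so the symbol involves only
coefficients without ζ of `a` and without ζ̄ of `b`. Each contraction raises the order bound by one
on both sides, which the hypotheses on `N` budget for. -/
theorem cf_wterm_mem {N : ℤ} (j : ℕ) : ∀ {a b : B → Ser (Idx n) B} {t t' : ℤ} (k : ℤ)
    (_ : ∀ d, DF IsHol (K.diffOp Sum.inr) d t a) (_ : ∀ d, DF IsAnti (K.diffOp Sum.inl) d t' b)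
    (_ : ∀ f, Van 0 (a f)) (_ : ∀ f, Van 0 (b f)) (_ : 2 * k + t + j ≤ N) (_ : 2 * k + t' + j ≤ N),
    (fun x : B × B => cf (wterm K.Λ j (a x.1) (b x.2)) k 0) ∈ K.bidiffOp N := by
  induction j with
  | zero =>
    intro a b t t' k ha hb hav hbv h1 h2
    have : (fun x : B × B => cf (wterm K.Λ 0 (a x.1) (b x.2)) k 0) =
        ∑ i ∈ Finset.Icc 0 k, fun x : B × B => cf (a x.1) i 0 * cf (b x.2) (k - i) 0 := by
      ext x
      classical
      rw [wterm, cf_mul (hav _) (hbv _)]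
      simp
    rw [this]
    refine Submodule.sum_mem _ fun i hi => Submodule.subset_span ?_
    rw [Finset.mem_Icc] at hi
    have e1 := ha (2 * i + 1) i 0 (fun _ _ => rfl) (by rw [wt_nu]; omega)
    have e2 := hb (2 * (k - i) + 1) (k - i) 0 (fun _ _ => rfl) (by rw [wt_nu]; omega)
    rw [wt_nu] at e1 e2
    exact ⟨_, K.diffOp_mono _ (by omega) e1, _, K.diffOp_mono _ (by omega) e2, rfl⟩
  | succ j ih =>
    intro a b t t' k ha hb hav hbv h1 h2
    have : (fun x : B × B => cf (wterm K.Λ (j + 1) (a x.1) (b x.2)) k 0) =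
        ∑ I, ∑ J, K.Λ I J • fun x : B × B => cf (wterm K.Λ j (dF I (a x.1)) (dF J (b x.2))) k 0 := by
      ext x
      simp [wterm]
    rw [this]
    refine Submodule.sum_mem _ fun I _ => Submodule.sum_mem _ fun J _ => ?_
    by_cases h : K.Λ I J = 0
    · rw [h, zero_smul]
      exact Submodule.zero_mem _
    · refine Submodule.smul_mem _ _ (ih (t := t + 1) (t' := t' + 1) k (fun d => ?_) (fun d => ?_)
        (fun f => (hav f).dF I) (fun f => (hbv f).dF J) (by push_cast at h1; omega)
        (by push_cast at h2; omega))
      · have := (ha (d + 1)).dF (K.Λ_hol h)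
        rwa [add_sub_cancel_right] at this
      · have := (hb (d + 1)).dF (K.Λ_anti h)
        rwa [add_sub_cancel_right] at this

/-- The cochains of the star-product are bidifferential operators which separate the variables. -/
theorem exists_star_coeff (r : ℕ) : ∃ c : List (Fin n) → List (Fin n) → B, ∀ f g : B,
    (K.star (HahnSeries.C f) (HahnSeries.C g)).coeff r = ∑ a ∈ lists n (2 * r),
      ∑ b ∈ lists n (2 * r), c a b * K.dl (a.map Sum.inr) f * K.dl (b.map Sum.inl) g := by
  have hmem : (fun x : B × B => (K.star (HahnSeries.C x.1) (HahnSeries.C x.2)).coeff r) ∈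
      K.bidiffOp (2 * r : ℕ) := by
    have : (fun x : B × B => (K.star (HahnSeries.C x.1) (HahnSeries.C x.2)).coeff r) =
        ∑ j ∈ Finset.range (r + 1), algebraMap ℂ B ((j.factorial : ℂ)⁻¹) •
          fun x : B × B => cf (wterm K.Λ j (K.tau (HahnSeries.C x.1)) (K.tau (HahnSeries.C x.2)))
            (r - j) 0 := by
      ext x
      rw [star, coeff_symb, cf, coeff_wk K.Λ (K.van_tau (van_C _)) (K.van_tau (van_C _)) r (r + 1)
        (by push_cast; omega), map_sum]
      simp only [Finset.sum_apply, Pi.smul_apply, smul_eq_mul]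
      refine Finset.sum_congr rfl fun j _ => ?_
      have h2 := (MvPowerSeries.coeff (R := B) (0 : Idx n →₀ ℕ)).map_smul_of_tower (R := ℂ)
        ((j.factorial : ℂ)⁻¹)
        ((wterm K.Λ j (K.tau (HahnSeries.C x.1)) (K.tau (HahnSeries.C x.2))).coeff (r - j))
      rw [h2, Algebra.smul_def]
      rfl
    rw [this]
    refine Submodule.sum_mem _ fun j hj => Submodule.smul_mem _ _ ?_
    have hj' : j ≤ r := by simpa [Nat.lt_succ_iff] using hj
    -- With `j` contractions the remaining power of ν is `r - j`, and the order is at most `2 * (r -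
    -- j) + j ≤ 2 * r`.
    exact K.cf_wterm_mem j _ K.df_hol_tau K.df_anti_tau (fun f => K.van_tau (van_C f))
      (fun f => K.van_tau (van_C f)) (by push_cast; omega) (by push_cast; omega)
  have : ∀ C ∈ K.bidiffOp (2 * r : ℕ), ∃ c : List (Fin n) → List (Fin n) → B, ∀ f g : B,
      C (f, g) = ∑ a ∈ lists n (2 * r),
        ∑ b ∈ lists n (2 * r), c a b * K.dl (a.map Sum.inr) f * K.dl (b.map Sum.inl) g := by
    intro C hC
    induction hC using Submodule.span_induction with
    | mem C hC =>
      obtain ⟨φ, hφ, ψ, hψ, rfl⟩ := hC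
      obtain ⟨c, hc⟩ := K.exists_of_mem_diffOp hφ
      obtain ⟨c', hc'⟩ := K.exists_of_mem_diffOp hψ
      refine ⟨fun a b => c a * c' b, fun f g => ?_⟩
      simp only [hc, hc', Finset.sum_mul_sum]
      exact Finset.sum_congr rfl fun a _ => Finset.sum_congr rfl fun b _ => by ring
    | zero => exact ⟨0, fun f g => by simp⟩
    | add C C' _ _ h1 h2 =>
      obtain ⟨c, hc⟩ := h1
      obtain ⟨c', hc'⟩ := h2
      refine ⟨c + c', fun f g => ?_⟩
      simp only [Pi.add_apply, hc, hc', add_mul, Finset.sum_add_distrib]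
    | smul b C _ h =>
      obtain ⟨c, hc⟩ := h
      exact ⟨fun L L' => b * c L L', fun f g => by simp [hc, Finset.mul_sum, mul_assoc]⟩
  exact this _ hmem

end Differential

end KData

/-! ### Naturality of r, of the flat lift and of the star-product. -/

namespace KHom

variable {n : ℕ} {B B' : Type*} [CommRing B] [Algebra ℂ B] [CommRing B'] [Algebra ℂ B']
  {K' : KData n B'} {K : KData n B} (F : KHom K' K)

/-- The induced map of sections of the bundle of Wick algebras. -/
abbrev P : Ser (Idx n) B' →+ Ser (Idx n) B := F.toFHom.P

/-- No formula for r is compared: the transformed element solves the transformed equations, and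
their solution is unique. -/
theorem oneForm_fed : F.toFHom.oneForm K'.fed = K.fed :=
  (F.isFed_oneForm K'.isFed).unique K.toFData K.isFed

theorem P_tau (f : LaurentSeries B') :
    F.P (K'.tau f) = K.tau (liftL ((F.φ : B' →+* B) : B' →+ B) f) := by
  have h := F.toFHom.flat_P (K'.flat_tau f)
  rw [oneForm_fed] at h
  have h2 := K.eq_tau h
  have h3 : symb (F.P (K'.tau f)) = liftL ((F.φ : B' →+* B) : B' →+ B) f := by
    rw [P, FHom.P, symb_pull, K'.symb_tau]
    rfl
  rw [h3] at h2
  exact h2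

theorem star_φ (f g : LaurentSeries B') : liftL ((F.φ : B' →+* B) : B' →+ B) (K'.star f g) =
    K.star (liftL ((F.φ : B' →+* B) : B' →+ B) f) (liftL ((F.φ : B' →+* B) : B' →+ B) g) := by
  rw [KData.star, KData.star, ← P_tau, ← P_tau]
  have : wk K.Λ (F.P (K'.tau f)) (F.P (K'.tau g)) = F.P (wk K'.Λ (K'.tau f) (K'.tau g)) :=
    (F.toFHom.P_wk _ _).symm
  rw [this, P, FHom.P, symb_pull]
  rfl

end KHom

/-! ### ν-adic continuity and the expansion into cochains. -/

section Expansion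

variable {A : Type*} [CommRing A]

/-- A product which is biadditive, compatible with multiplication by powers of `ν`, and
`ν`-adically continuous is determined by its values on series without `ν`. -/
theorem coeff_star_eq_finsum (star : LaurentSeries A → LaurentSeries A → LaurentSeries A)
    (hl : ∀ a b c, star (a + b) c = star a c + star b c)
    (hr : ∀ a b c, star a (b + c) = star a b + star a c)
    (hνl : ∀ k a b, star (HahnSeries.single k 1 * a) b = HahnSeries.single k 1 * star a b)
    (hνr : ∀ k a b, star a (HahnSeries.single k 1 * b) = HahnSeries.single k 1 * star a b)
    (hv : ∀ p q a b, Van p a → Van q b → Van (p + q) (star a b)) (f g : LaurentSeries A) (m : ℤ) :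
    (star f g).coeff m = ∑ᶠ p : ℕ × ℤ, (star (HahnSeries.C (f.coeff p.2))
      (HahnSeries.C (g.coeff (m - p.1 - p.2)))).coeff p.1 := by
  have hl0 : ∀ b, star 0 b = 0 := fun b => by
    have := hl 0 0 b
    rw [add_zero] at this
    exact left_eq_add.1 this
  have hr0 : ∀ b, star b 0 = 0 := fun b => by
    have := hr b 0 0
    rw [add_zero] at this
    exact left_eq_add.1 this
  have hls : ∀ (s : Finset ℤ) (a : ℤ → LaurentSeries A) b,
      star (∑ i ∈ s, a i) b = ∑ i ∈ s, star (a i) b := fun s a b =>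
    map_sum (AddMonoidHom.mk' (fun a => star a b) fun a a' => hl a a' b) a s
  have hrs : ∀ (s : Finset ℤ) (a : ℤ → LaurentSeries A) b,
      star b (∑ i ∈ s, a i) = ∑ i ∈ s, star b (a i) := fun s a b =>
    map_sum (AddMonoidHom.mk' (fun a => star b a) fun a a' => hr b a a') a s
  -- The cutoffs `N` and `N'` are chosen so that the discarded tails only affect coefficients beyond
  -- ν^m.
  have htr : ∀ {p : ℤ} {a : LaurentSeries A} (_ : Van p a) (N : ℤ),
      Van N (a - ∑ i ∈ Finset.Ico p N, HahnSeries.single i 1 * HahnSeries.C (a.coeff i)) := by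
    intro p a ha N k hk
    rw [HahnSeries.coeff_sub, HahnSeries.coeff_sum, sub_eq_zero]
    by_cases hp : k < p
    · rw [ha k hp, Finset.sum_eq_zero]
      intro i hi
      rw [Finset.mem_Ico] at hi
      rw [HahnSeries.C_apply, HahnSeries.single_mul_single, HahnSeries.coeff_single_of_ne (by omega)]
    · rw [Finset.sum_eq_single k]
      · rw [HahnSeries.C_apply, HahnSeries.single_mul_single, add_zero,
          HahnSeries.coeff_single_same, one_mul]
      · intro i _ hi
        rw [HahnSeries.C_apply, HahnSeries.single_mul_single,
          HahnSeries.coeff_single_of_ne (by omega)]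
      · exact fun h => absurd (Finset.mem_Ico.2 ⟨not_lt.1 hp, hk⟩) h
  obtain ⟨p, hp⟩ : ∃ p, Van p f := ⟨_, van_order f⟩
  obtain ⟨q, hq⟩ : ∃ q, Van q g := ⟨_, van_order g⟩
  set N := m + 1 - q with hN
  set N' := m + 1 - p with hN'
  have e1 : (star f g).coeff m =
      ∑ i ∈ Finset.Ico p N, ∑ j ∈ Finset.Ico q N',
        (star (HahnSeries.C (f.coeff i)) (HahnSeries.C (g.coeff j))).coeff (m - i - j) := by
    have h1 : (star f g).coeff m = (star (∑ i ∈ Finset.Ico p N,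
        HahnSeries.single i 1 * HahnSeries.C (f.coeff i)) g).coeff m := by
      have := hv _ _ _ _ (htr hp N) hq m (by omega)
      have h2 := hl (f - ∑ i ∈ Finset.Ico p N, HahnSeries.single i 1 * HahnSeries.C (f.coeff i))
        (∑ i ∈ Finset.Ico p N, HahnSeries.single i 1 * HahnSeries.C (f.coeff i)) g
      rw [sub_add_cancel] at h2
      rw [h2, HahnSeries.coeff_add, this, zero_add]
    rw [h1, hls, HahnSeries.coeff_sum]
    refine Finset.sum_congr rfl fun i hi => ?_
    rw [Finset.mem_Ico] at hi
    rw [hνl, HahnSeries.coeff_single_mul, one_mul]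
    have h1 : (star (HahnSeries.C (f.coeff i)) g).coeff (m - i) =
        (star (HahnSeries.C (f.coeff i)) (∑ j ∈ Finset.Ico q N',
          HahnSeries.single j 1 * HahnSeries.C (g.coeff j))).coeff (m - i) := by
      have := hv _ _ _ _ (van_C (f.coeff i)) (htr hq N') (m - i) (by omega)
      have h2 := hr (HahnSeries.C (f.coeff i))
        (g - ∑ i ∈ Finset.Ico q N', HahnSeries.single i 1 * HahnSeries.C (g.coeff i))
        (∑ i ∈ Finset.Ico q N', HahnSeries.single i 1 * HahnSeries.C (g.coeff i))
      rw [sub_add_cancel] at h2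
      rw [h2, HahnSeries.coeff_add, this, zero_add]
    rw [h1, hrs, HahnSeries.coeff_sum]
    refine Finset.sum_congr rfl fun j hj => ?_
    rw [hνr, HahnSeries.coeff_single_mul, one_mul]
  rw [e1, ← Finset.sum_product']
  set F : ℤ × ℤ → A := fun x =>
    (star (HahnSeries.C (f.coeff x.1)) (HahnSeries.C (g.coeff x.2))).coeff (m - x.1 - x.2) with hF
  set G : ℕ × ℤ → A := fun p => (star (HahnSeries.C (f.coeff p.2))
      (HahnSeries.C (g.coeff (m - p.1 - p.2)))).coeff p.1 with hG
  -- `ψ` converts (order of the cochain, index in `f`) into the pair of indices in `f` and `g`.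
  -- Pairs outside its range would need a cochain of negative order, and these vanish.
  set ψ : ℕ × ℤ → ℤ × ℤ := fun p => (p.2, m - p.1 - p.2) with hψ
  have hinj : Function.Injective ψ := by
    rintro ⟨a, b⟩ ⟨c, d⟩ h
    simp only [hψ, Prod.mk.injEq] at h
    obtain ⟨rfl, h⟩ := h
    have : a = c := by omega
    rw [this]
  have hFψ : ∀ p, F (ψ p) = G p := fun p => by
    simp only [hF, hG, hψ]
    congr 1
    omega
  have hFs : Function.support F ⊆ Set.range ψ := by
    rintro ⟨i, j⟩ h
    by_contra hne
    refine h (hv 0 0 _ _ (van_C _) (van_C _) _ ?_)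
    by_contra hlt
    exact hne ⟨((m - i - j).toNat, i), by simp only [hψ, Prod.mk.injEq, true_and]; omega⟩
  have hFs' : Function.support F ⊆ (Finset.Ico p N ×ˢ Finset.Ico q N' : Finset (ℤ × ℤ)) := by
    rintro ⟨i, j⟩ h
    have hi : p ≤ i := by
      by_contra hlt
      exact h (by simp only [hF, hp i (not_le.1 hlt), map_zero, hl0]; rfl)
    have hj : q ≤ j := by
      by_contra hlt
      exact h (by simp only [hF, hq j (not_le.1 hlt), map_zero, hr0]; rfl)
    have hij : i + j ≤ m := by
      by_contra hlt
      exact h (hv 0 0 _ _ (van_C _) (van_C _) _ (by simp only; omega))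
    simp only [Finset.coe_product, Finset.coe_Ico, Set.mem_prod, Set.mem_Ico]
    omega
  have h1 : ∑ᶠ x, F x = ∑ᶠ p, G p := by
    rw [← finsum_mem_univ, ← finsum_mem_univ (f := G)]
    have : ∑ᶠ x ∈ Set.range ψ, F x = ∑ᶠ p, F (ψ p) := finsum_mem_range hinj
    rw [finsum_mem_univ, finsum_mem_univ, ← finsum_congr hFψ, ← this, ← finsum_mem_univ]
    rw [finsum_mem_univ]
    refine finsum_congr fun x => ?_
    classical
    by_cases hx : x ∈ Set.range ψ
    · rw [finsum_eq_if, if_pos hx]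
    · rw [finsum_eq_if, if_neg hx]
      by_contra h
      exact hx (hFs h)
  rw [← h1, finsum_eq_sum_of_support_subset _ hFs']

end Expansion

end FedosovWick

end

open scoped Manifold ContDiff Topology ComplexOrder

noncomputable section

set_option linter.unusedSectionVars false
set_option linter.unusedSimpArgs false

namespace FedosovWick

/-! ### Wirtinger calculus on `ℂⁿ` -/

section Wirtinger

variable {n : ℕ}

/-- The Wirtinger components of a real linear form. -/
def wd (I : Idx n) : ((Fin n → ℂ) →L[ℝ] ℂ) →L[ℝ] ℂ :=
  let ev (v : Fin n → ℂ) : ((Fin n → ℂ) →L[ℝ] ℂ) →L[ℝ] ℂ := ContinuousLinearMap.apply ℝ ℂ v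
  match I with
  | Sum.inl k => (2⁻¹ : ℂ) • (ev (Pi.single k 1) - Complex.I • ev (Pi.single k Complex.I))
  | Sum.inr k => (2⁻¹ : ℂ) • (ev (Pi.single k 1) + Complex.I • ev (Pi.single k Complex.I))

theorem wd_inl (k : Fin n) (L : (Fin n → ℂ) →L[ℝ] ℂ) : wd (Sum.inl k) L =
    (L (Pi.single k 1) - Complex.I * L (Pi.single k Complex.I)) / 2 := by
  simp [wd]; ring

theorem wd_inr (k : Fin n) (L : (Fin n → ℂ) →L[ℝ] ℂ) : wd (Sum.inr k) L =
    (L (Pi.single k 1) + Complex.I * L (Pi.single k Complex.I)) / 2 := by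
  simp [wd]; ring

theorem wd_smul (I : Idx n) (c : ℂ) (L : (Fin n → ℂ) →L[ℝ] ℂ) : wd I (c • L) = c * wd I L := by
  rcases I with k | k
  · simp [wd_inl]; ring
  · simp [wd_inr]; ring

/-- The coordinates and their conjugates as real linear forms. -/
def cc (I : Idx n) : (Fin n → ℂ) →L[ℝ] ℂ :=
  match I with
  | Sum.inl k => ContinuousLinearMap.proj (R := ℝ) (φ := fun _ : Fin n => ℂ) k
  | Sum.inr k => (Complex.conjCLE : ℂ →L[ℝ] ℂ).comp
      (ContinuousLinearMap.proj (R := ℝ) (φ := fun _ : Fin n => ℂ) k)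

@[simp] theorem cc_inl (k : Fin n) (u : Fin n → ℂ) : cc (Sum.inl k) u = u k := rfl

@[simp] theorem cc_inr (k : Fin n) (u : Fin n → ℂ) :
    cc (Sum.inr k) u = (starRingEnd ℂ) (u k) := rfl

theorem eq_sum_wd (L : (Fin n → ℂ) →L[ℝ] ℂ) : L = ∑ A, wd A L • cc A := by
  ext u
  have h : ∀ k, L (Pi.single k (u k)) =
      (u k).re * L (Pi.single k 1) + (u k).im * L (Pi.single k Complex.I) := fun k => by
    have e : (Pi.single k (u k) : Fin n → ℂ) =
        (u k).re • (Pi.single k 1 : Fin n → ℂ) + (u k).im • (Pi.single k Complex.I : Fin n → ℂ) := by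
      rw [← Pi.single_smul, ← Pi.single_smul, ← Pi.single_add]
      congr 1
      simp [Complex.re_add_im]
    rw [e, map_add, map_smul, map_smul]
    simp
  have hu : u = ∑ k, Pi.single k (u k) := (Finset.univ_sum_single u).symm
  conv_lhs => rw [hu, map_sum]
  rw [Fintype.sum_sum_type, ← Finset.sum_add_distrib, sum_apply']
  refine Finset.sum_congr rfl fun k _ => ?_
  rw [h]
  simp only [_root_.add_apply, _root_.smul_apply, cc_inl, cc_inr,
    smul_eq_mul, wd_inl, wd_inr]
  conv_rhs => rw [← Complex.re_add_im (u k)]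
  simp only [map_add, map_mul, Complex.conj_ofReal, Complex.conj_I]
  linear_combination ((u k).im * L (Pi.single k Complex.I) : ℂ) * Complex.I_mul_I
where
  sum_apply' {f : Fin n → ((Fin n → ℂ) →L[ℝ] ℂ)} {u : Fin n → ℂ} :
      (∑ k, f k) u = ∑ k, f k u := by simp

theorem wd_comp (I : Idx n) (L : (Fin n → ℂ) →L[ℝ] ℂ) (T : (Fin n → ℂ) →L[ℝ] (Fin n → ℂ)) :
    wd I (L.comp T) = ∑ A, wd I ((cc A).comp T) * wd A L := by
  conv_lhs => rw [eq_sum_wd L]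
  have : (∑ A, wd A L • cc A).comp T = ∑ A, wd A L • (cc A).comp T := by
    ext u; simp
  rw [this, map_sum]
  exact Finset.sum_congr rfl fun A _ => by rw [wd_smul, mul_comm]

/-- Cauchy–Riemann equations for a complex linear map; applied to transition maps this gives the
vanishing mixed Jacobian blocks. -/
theorem wd_antihol (p q : Fin n) (T : (Fin n → ℂ) →L[ℂ] (Fin n → ℂ)) :
    wd (Sum.inr q) ((cc (Sum.inl p)).comp (T.restrictScalars ℝ)) = 0 := by
  have : (Pi.single q Complex.I : Fin n → ℂ) = Complex.I • Pi.single q 1 := by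
    rw [← Pi.single_smul]; simp
  rw [wd_inr, this]
  simp only [ContinuousLinearMap.comp_apply, ContinuousLinearMap.coe_restrictScalars', map_smul,
    cc_inl, Pi.smul_apply, smul_eq_mul]
  linear_combination (T (Pi.single q 1) p / 2) * Complex.I_mul_I

theorem wd_hol (p q : Fin n) (T : (Fin n → ℂ) →L[ℂ] (Fin n → ℂ)) :
    wd (Sum.inl q) ((cc (Sum.inr p)).comp (T.restrictScalars ℝ)) = 0 := by
  have : (Pi.single q Complex.I : Fin n → ℂ) = Complex.I • Pi.single q 1 := by
    rw [← Pi.single_smul]; simp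
  rw [wd_inl, this]
  simp only [ContinuousLinearMap.comp_apply, ContinuousLinearMap.coe_restrictScalars', map_smul,
    cc_inr, Pi.smul_apply, smul_eq_mul, map_mul, Complex.conj_I]
  linear_combination ((starRingEnd ℂ) (T (Pi.single q 1) p) / 2) * Complex.I_mul_I

theorem wd_cc (A I : Idx n) : wd I (cc A) = if A = I then 1 else 0 := by
  rcases A with p | p <;> rcases I with q | q <;> by_cases h : p = q <;>
    simp [wd_inl, wd_inr, h, Pi.single_apply]

/-- The Wirtinger derivatives of a function on `ℂⁿ`. -/
def wirt (I : Idx n) (F : (Fin n → ℂ) → ℂ) (z : Fin n → ℂ) : ℂ := wd I (fderiv ℝ F z)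

theorem contDiffOn_wirt (I : Idx n) {F : (Fin n → ℂ) → ℂ} {W : Set (Fin n → ℂ)} (hW : IsOpen W)
    (hF : ContDiffOn ℝ ∞ F W) : ContDiffOn ℝ ∞ (wirt I F) W :=
  (wd I).contDiff.comp_contDiffOn (hF.fderiv_of_isOpen hW (by norm_num))

theorem wirt_comm (I J : Idx n) {F : (Fin n → ℂ) → ℂ} {W : Set (Fin n → ℂ)} (hW : IsOpen W)
    (hF : ContDiffOn ℝ ∞ F W) {z : Fin n → ℂ} (hz : z ∈ W) :
    wirt I (wirt J F) z = wirt J (wirt I F) z := by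
  have hd : DifferentiableAt ℝ (fderiv ℝ F) z :=
    ((hF.fderiv_of_isOpen hW (m := ∞) (by norm_num)).contDiffAt (hW.mem_nhds hz)).differentiableAt
      (by norm_num)
  have hs : ∀ u v, fderiv ℝ (fderiv ℝ F) z u v = fderiv ℝ (fderiv ℝ F) z v u :=
    (hF.contDiffAt (hW.mem_nhds hz)).isSymmSndFDerivAt (by
      simpa using (WithTop.coe_le_coe.2 le_top : ((2 : ℕ∞) : WithTop ℕ∞) ≤ ((⊤ : ℕ∞) : WithTop ℕ∞)))
  have e : ∀ J, fderiv ℝ (wirt J F) z = (wd J).comp (fderiv ℝ (fderiv ℝ F) z) := fun J => by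
    have := (wd J).hasFDerivAt.comp z hd.hasFDerivAt
    exact this.fderiv
  rw [wirt, wirt, e, e]
  rcases I with i | i <;> rcases J with j | j <;>
    simp only [wd_inl, wd_inr, ContinuousLinearMap.comp_apply] <;>
    rw [hs (Pi.single i 1) (Pi.single j 1), hs (Pi.single i 1) (Pi.single j Complex.I),
      hs (Pi.single i Complex.I) (Pi.single j 1),
      hs (Pi.single i Complex.I) (Pi.single j Complex.I)] <;> ring

theorem wirt_chain (I : Idx n) {F : (Fin n → ℂ) → ℂ} {T : (Fin n → ℂ) → (Fin n → ℂ)}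
    {z : Fin n → ℂ} (hF : DifferentiableAt ℝ F (T z)) (hT : DifferentiableAt ℝ T z) :
    wirt I (F ∘ T) z = ∑ A, wirt I (fun y => cc A (T y)) z * wirt A F (T z) := by
  rw [wirt, fderiv_comp z hF hT, wd_comp]
  refine Finset.sum_congr rfl fun A _ => ?_
  rw [wirt, wirt]
  congr 2
  exact ((cc A).hasFDerivAt.comp z hT.hasFDerivAt).fderiv.symm

theorem wirt_mul (I : Idx n) {F G : (Fin n → ℂ) → ℂ} {z : Fin n → ℂ}
    (hF : DifferentiableAt ℝ F z) (hG : DifferentiableAt ℝ G z) :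
    wirt I (fun y => F y * G y) z = F z * wirt I G z + G z * wirt I F z := by
  rw [wirt, fderiv_fun_mul hF hG, map_add, wd_smul, wd_smul, wirt, wirt]

theorem wirt_add (I : Idx n) {F G : (Fin n → ℂ) → ℂ} {z : Fin n → ℂ}
    (hF : DifferentiableAt ℝ F z) (hG : DifferentiableAt ℝ G z) :
    wirt I (fun y => F y + G y) z = wirt I F z + wirt I G z := by
  rw [wirt, fderiv_fun_add hF hG, map_add, wirt, wirt]

theorem wirt_const (I : Idx n) (c : ℂ) (z : Fin n → ℂ) : wirt I (fun _ => c) z = 0 := by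
  rw [wirt, fderiv_const_apply, map_zero]

theorem wirt_congr (I : Idx n) {F G : (Fin n → ℂ) → ℂ} {z : Fin n → ℂ} (h : F =ᶠ[𝓝 z] G) :
    wirt I F z = wirt I G z := by
  rw [wirt, h.fderiv_eq, wirt]

theorem wirt_cc (I A : Idx n) (z : Fin n → ℂ) :
    wirt I (fun y => cc A y) z = if A = I then 1 else 0 := by
  rw [wirt, ← wd_cc]
  congr 1
  exact (cc A).fderiv

end Wirtinger

/-! ### Wirtinger derivatives in charts -/

section Charts

variable {n : ℕ} {M : Type*} [TopologicalSpace M] [ChartedSpace (Fin n → ℂ) M]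

theorem pd_apply (e : HolChart n M) (I : Idx n) (f : M → ℂ) (x : M) :
    pd e I f x = wirt I (fun z => f (e.1.symm z)) (e.1 x) := by
  rcases I with k | k
  · rw [wirt, wd_inl]; rfl
  · rw [wirt, wd_inr]; rfl

theorem coord_eq (e : HolChart n M) (A : Idx n) (x : M) : coord e A x = cc A (e.1 x) := by
  rcases A with k | k <;> rfl

theorem pd_congr (e : HolChart n M) (I : Idx n) {V : Set M} (hV : IsOpen V)
    (hVe : V ⊆ e.1.source) {f g : M → ℂ} (h : ∀ y ∈ V, f y = g y) {x : M} (hx : x ∈ V) :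
    pd e I f x = pd e I g x := by
  rw [pd_apply, pd_apply]
  refine wirt_congr I ?_
  have h1 : ∀ᶠ z in 𝓝 (e.1 x), e.1.symm z ∈ V := by
    have hc : ContinuousAt e.1.symm (e.1 x) := e.1.continuousAt_symm (e.1.map_source (hVe hx))
    refine hc.eventually_mem (hV.mem_nhds ?_)
    rwa [e.1.left_inv (hVe hx)]
  exact h1.mono fun z hz => h _ hz

theorem contDiffGroupoid_real {T : OpenPartialHomeomorph (Fin n → ℂ) (Fin n → ℂ)}
    (h : T ∈ contDiffGroupoid ω 𝓘(ℂ, Fin n → ℂ)) : T ∈ contDiffGroupoid ∞ 𝓘(ℝ, Fin n → ℂ) := by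
  rw [contDiffGroupoid, mem_groupoid_of_pregroupoid] at h ⊢
  constructor
  · have h1 : ContDiffOn ℂ ω _ _ := h.1
    exact (h1.restrict_scalars ℝ).of_le le_top
  · have h1 : ContDiffOn ℂ ω _ _ := h.2
    exact (h1.restrict_scalars ℝ).of_le le_top

variable [IsManifold 𝓘(ℂ, Fin n → ℂ) ω M]

/-- The same atlas viewed over ℝ: complex analytic transition maps are real smooth. -/
instance : IsManifold 𝓘(ℝ, Fin n → ℂ) ∞ M where
  compatible he he' := contDiffGroupoid_real (StructureGroupoid.compatible _ he he')

theorem mem_maximalAtlas_real (e : HolChart n M) :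
    e.1 ∈ IsManifold.maximalAtlas 𝓘(ℝ, Fin n → ℂ) ∞ M := by
  rw [IsManifold.mem_maximalAtlas_iff, mem_maximalAtlas_iff]
  intro e' he'
  have h := e.2
  rw [IsManifold.mem_maximalAtlas_iff, mem_maximalAtlas_iff] at h
  exact ⟨contDiffGroupoid_real (h e' he').1, contDiffGroupoid_real (h e' he').2⟩

/-- The chart `chartAt`. -/
def cat (x : M) : HolChart n M := ⟨chartAt (Fin n → ℂ) x, IsManifold.chart_mem_maximalAtlas x⟩

theorem mem_cat (x : M) : x ∈ (cat x : HolChart n M).1.source := mem_chart_source _ x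

theorem isOpen_image (e : HolChart n M) {V : Set M} (hV : IsOpen V) (hVe : V ⊆ e.1.source) :
    IsOpen (e.1 '' V) := e.1.isOpen_image_of_subset_source hV hVe

theorem smoothOn_iff (e : HolChart n M) {V : Set M} (hVe : V ⊆ e.1.source) (f : M → ℂ) :
    SmoothOn n f V ↔ ContDiffOn ℝ ∞ (fun z => f (e.1.symm z)) (e.1 '' V) := by
  rw [SmoothOn, contMDiffOn_iff_of_mem_maximalAtlas' (mem_maximalAtlas_real e)
    (IsManifold.chart_mem_maximalAtlas (I := 𝓘(ℝ, ℂ)) (0 : ℂ)) hVe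
    (fun _ _ => by simp only [chartAt_self_eq]; trivial)]
  simp only [mfld_simps, chartAt_self_eq]
  rfl

theorem SmoothOn.pd {e : HolChart n M} {V : Set M} (hV : IsOpen V) (hVe : V ⊆ e.1.source)
    {f : M → ℂ} (hf : SmoothOn n f V) (I : Idx n) : SmoothOn n (pd e I f) V := by
  rw [smoothOn_iff e hVe] at hf ⊢
  refine (contDiffOn_wirt I (isOpen_image e hV hVe) hf).congr ?_
  rintro _ ⟨x, hx, rfl⟩
  rw [pd_apply, e.1.left_inv (hVe hx)]

theorem SmoothOn.differentiableAt {e : HolChart n M} {V : Set M} (hV : IsOpen V)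
    (hVe : V ⊆ e.1.source) {f : M → ℂ} (hf : SmoothOn n f V) {x : M} (hx : x ∈ V) :
    DifferentiableAt ℝ (fun z => f (e.1.symm z)) (e.1 x) :=
  (((smoothOn_iff e hVe f).1 hf).contDiffAt
    ((isOpen_image e hV hVe).mem_nhds ⟨x, hx, rfl⟩)).differentiableAt (by norm_num)

theorem pd_mul {e : HolChart n M} {V : Set M} (hV : IsOpen V) (hVe : V ⊆ e.1.source)
    {f g : M → ℂ} (hf : SmoothOn n f V) (hg : SmoothOn n g V) (I : Idx n) {x : M} (hx : x ∈ V) :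
    pd e I (f * g) x = f x * pd e I g x + g x * pd e I f x := by
  have := wirt_mul I (hf.differentiableAt hV hVe hx) (hg.differentiableAt hV hVe hx)
  simp only [e.1.left_inv (hVe hx)] at this
  rw [pd_apply, pd_apply, pd_apply, ← this]
  rfl

theorem pd_add {e : HolChart n M} {V : Set M} (hV : IsOpen V) (hVe : V ⊆ e.1.source)
    {f g : M → ℂ} (hf : SmoothOn n f V) (hg : SmoothOn n g V) (I : Idx n) {x : M} (hx : x ∈ V) :
    pd e I (f + g) x = pd e I f x + pd e I g x := by
  have := wirt_add I (hf.differentiableAt hV hVe hx) (hg.differentiableAt hV hVe hx)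
  rw [pd_apply, pd_apply, pd_apply, ← this]
  rfl

theorem pd_const (e : HolChart n M) (I : Idx n) (c : ℂ) (x : M) : pd e I (fun _ => c) x = 0 := by
  rw [pd_apply, wirt_const]

theorem pd_comm {e : HolChart n M} {V : Set M} (hV : IsOpen V) (hVe : V ⊆ e.1.source)
    {f : M → ℂ} (hf : SmoothOn n f V) (I J : Idx n) {x : M} (hx : x ∈ V) :
    pd e I (pd e J f) x = pd e J (pd e I f) x := by
  have hf' := (smoothOn_iff e hVe f).1 hf
  have hW := isOpen_image e hV hVe
  have hz : e.1 x ∈ e.1 '' V := ⟨x, hx, rfl⟩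
  have key : ∀ I J, pd e I (pd e J f) x = wirt I (wirt J (fun z => f (e.1.symm z))) (e.1 x) := by
    intro I J
    rw [pd_apply]
    refine wirt_congr I ?_
    filter_upwards [hW.mem_nhds hz] with z hz
    obtain ⟨y, hy, rfl⟩ := hz
    rw [pd_apply, e.1.left_inv (hVe hy)]
  rw [key, key, wirt_comm I J hW hf' hz]

theorem smoothOn_coord (e : HolChart n M) (A : Idx n) : SmoothOn n (coord e A) e.1.source := by
  rw [smoothOn_iff e subset_rfl]
  refine (cc A).contDiff.contDiffOn.congr ?_
  rintro _ ⟨x, hx, rfl⟩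
  rw [coord_eq, e.1.left_inv hx]

theorem pd_coord (e : HolChart n M) (I A : Idx n) {x : M} (hx : x ∈ e.1.source) :
    pd e I (coord e A) x = if A = I then 1 else 0 := by
  rw [pd_apply, ← wirt_cc I A (e.1 x)]
  refine wirt_congr I ?_
  filter_upwards [e.1.open_target.mem_nhds (e.1.map_source hx)] with z hz
  rw [coord_eq, e.1.right_inv hz]

theorem transition_differentiableAt (e e' : HolChart n M) {x : M} (hx : x ∈ e.1.source)
    (hx' : x ∈ e'.1.source) : DifferentiableAt ℂ (fun z => e'.1 (e.1.symm z)) (e.1 x) := by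
  have h := IsManifold.compatible_of_mem_maximalAtlas e.2 e'.2
  rw [contDiffGroupoid, mem_groupoid_of_pregroupoid] at h
  have h1 : ContDiffOn ℂ ω (fun z => e'.1 (e.1.symm z)) _ := h.1
  refine (h1.contDiffAt ?_).differentiableAt (by norm_num)
  simp only [mfld_simps]
  exact (e.1.symm.trans e'.1).open_source.mem_nhds (by simp [hx, hx'])

/-- The real chain rule for the transition map, written in the complexified frame in which the `jac`
are the matrix entries. -/
theorem pd_chain (e e' : HolChart n M) {V : Set M} (hV : IsOpen V) (hVe : V ⊆ e.1.source)
    (hVe' : V ⊆ e'.1.source) {f : M → ℂ} (hf : SmoothOn n f V) (I : Idx n) {x : M} (hx : x ∈ V) :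
    pd e I f x = ∑ A, jac e e' A I x * pd e' A f x := by
  have hT := (transition_differentiableAt e e' (hVe hx) (hVe' hx)).restrictScalars ℝ
  have hF := hf.differentiableAt hV hVe' hx
  have := wirt_chain I (F := fun z => f (e'.1.symm z)) (T := fun z => e'.1 (e.1.symm z))
    (z := e.1 x) (by simpa only [e.1.left_inv (hVe hx)] using hF) hT
  simp only [e.1.left_inv (hVe hx)] at this
  rw [pd_apply]
  simp only [jac, pd_apply, coord_eq]
  rw [← this]
  refine wirt_congr I ?_
  have h1 : ∀ᶠ z in 𝓝 (e.1 x), e.1.symm z ∈ V := by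
    have hc : ContinuousAt e.1.symm (e.1 x) := e.1.continuousAt_symm (e.1.map_source (hVe hx))
    refine hc.eventually_mem (hV.mem_nhds ?_)
    rwa [e.1.left_inv (hVe hx)]
  filter_upwards [h1] with z hz
  simp only [Function.comp_apply, e'.1.left_inv (hVe' hz)]

theorem jac_mixed (e e' : HolChart n M) {x : M} (hx : x ∈ e.1.source) (hx' : x ∈ e'.1.source)
    (p q : Fin n) : jac e e' (Sum.inl p) (Sum.inr q) x = 0 ∧
      jac e e' (Sum.inr p) (Sum.inl q) x = 0 := by
  have hT := transition_differentiableAt e e' hx hx'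
  have key : ∀ A I, jac e e' A I x = wd I ((cc A).comp
      ((fderiv ℂ (fun z => e'.1 (e.1.symm z)) (e.1 x)).restrictScalars ℝ)) := fun A I => by
    rw [jac, pd_apply, wirt]
    congr 1
    have h := (cc A).hasFDerivAt.comp (e.1 x) (hT.hasFDerivAt.restrictScalars ℝ)
    rw [← h.fderiv]
    congr 1
    ext z
    rw [coord_eq]; rfl
  rw [key, key]
  exact ⟨wd_antihol _ _ _, wd_hol _ _ _⟩

end Charts

end FedosovWick

end

open scoped Manifold ContDiff Topology ComplexOrder

noncomputable section

set_option linter.unusedSectionVars false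
set_option linter.unusedSimpArgs false

namespace FedosovWick

/-! ### The rings of smooth functions on open subsets of chart domains -/

section Loc

variable {n : ℕ} {M : Type*} [TopologicalSpace M] [ChartedSpace (Fin n → ℂ) M]

open Classical in
/-- Extension by zero. -/
def zext {V : Set M} (f : V → ℂ) : M → ℂ := fun x => if h : x ∈ V then f ⟨x, h⟩ else 0

theorem zext_apply {V : Set M} (f : V → ℂ) (x : V) : zext f x = f x := by simp [zext]

theorem zext_of_notMem {V : Set M} (f : V → ℂ) {x : M} (hx : x ∉ V) : zext f x = 0 := by
  simp [zext, hx]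

theorem SmoothOn.congr {V : Set M} {f g : M → ℂ} (hf : SmoothOn n f V) (h : ∀ x ∈ V, g x = f x) :
    SmoothOn n g V := ContMDiffOn.congr hf h

theorem SmoothOn.mono {V W : Set M} {f : M → ℂ} (hf : SmoothOn n f V) (h : W ⊆ V) :
    SmoothOn n f W := ContMDiffOn.mono hf h

theorem smoothOn_const (V : Set M) (c : ℂ) : SmoothOn n (fun _ => c) V := contMDiffOn_const

theorem SmoothOn.mul {V : Set M} {f g : M → ℂ} (hf : SmoothOn n f V) (hg : SmoothOn n g V) :
    SmoothOn n (f * g) V := ContMDiffOn.mul hf hg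

theorem SmoothOn.add {V : Set M} {f g : M → ℂ} (hf : SmoothOn n f V) (hg : SmoothOn n g V) :
    SmoothOn n (f + g) V := ContMDiffOn.add hf hg

variable (n) in
/-- The subalgebra of smooth functions on `V`. -/
def locAlg (V : Set M) : Subalgebra ℂ (V → ℂ) where
  carrier := {f | SmoothOn n (zext f) V}
  mul_mem' hf hg := (SmoothOn.mul hf hg).congr fun x hx => by
    simp [zext_apply _ (⟨x, hx⟩ : V), zext, hx]
  add_mem' hf hg := (SmoothOn.add hf hg).congr fun x hx => by
    simp [zext_apply _ (⟨x, hx⟩ : V), zext, hx]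
  algebraMap_mem' c := (smoothOn_const V c).congr fun x hx => by simp [zext, hx]

variable (n) in
/-- The ring of smooth functions on `V`. -/
def Loc (V : Set M) : Type _ := locAlg n V

instance (V : Set M) : CommRing (Loc n V) := inferInstanceAs (CommRing (locAlg n V))

instance (V : Set M) : Algebra ℂ (Loc n V) := inferInstanceAs (Algebra ℂ (locAlg n V))

variable (n) in
/-- The values of a smooth function. -/
def locVal (V : Set M) : Loc n V →ₐ[ℂ] (V → ℂ) := (locAlg n V).val

section

variable {V : Set M} (f g : Loc n V)

@[simp] theorem Loc.val_mul : (f * g).1 = f.1 * g.1 := rfl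

@[simp] theorem Loc.val_add : (f + g).1 = f.1 + g.1 := rfl

@[simp] theorem Loc.val_smul (c : ℂ) : (c • f).1 = c • f.1 := rfl

@[simp] theorem Loc.val_one : (1 : Loc n V).1 = 1 := rfl

@[simp] theorem Loc.val_zero : (0 : Loc n V).1 = 0 := rfl

@[simp] theorem Loc.val_algebraMap (c : ℂ) : (algebraMap ℂ (Loc n V) c).1 = fun _ => c := rfl

end

theorem sm {V : Set M} (f : Loc n V) : SmoothOn n (zext f.1) V := f.2

/-- The restriction of a smooth function. -/
def mkLoc {V : Set M} (f : M → ℂ) (hf : SmoothOn n f V) : Loc n V :=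
  ⟨fun x => f x, hf.congr fun x hx => zext_apply _ ⟨x, hx⟩⟩

@[simp] theorem mkLoc_apply {V : Set M} (f : M → ℂ) (hf : SmoothOn n f V) (x : V) :
    (mkLoc f hf).1 x = f x := rfl

theorem Loc.ext' {V : Set M} {f g : Loc n V} (h : ∀ x : V, f.1 x = g.1 x) : f = g :=
  Subtype.ext (funext h)

/-- Evaluation at a point. -/
def evL {V : Set M} (x : V) : Loc n V →+* ℂ :=
  (Pi.evalRingHom (fun _ : V => ℂ) x).comp (locVal n V).toRingHom

@[simp] theorem evL_apply {V : Set M} (x : V) (f : Loc n V) : evL x f = f.1 x := rfl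

/-- `V` is an open subset of the domain of the chart `e`. -/
def IsSub (e : HolChart n M) (V : Set M) : Prop := IsOpen V ∧ V ⊆ e.1.source

theorem isSub_source (e : HolChart n M) : IsSub e e.1.source := ⟨e.1.open_source, subset_rfl⟩

variable [IsManifold 𝓘(ℂ, Fin n → ℂ) ω M]

/-- Applied to the determinant of the metric, this puts the inverse matrix into the ring of smooth
functions itself, as the algebraic Kähler data demand. -/
theorem Loc.isUnit {e : HolChart n M} {V : Set M} (h : IsSub e V) {f : Loc n V}
    (hf : ∀ x : V, f.1 x ≠ 0) : IsUnit f := by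
  have hs : SmoothOn n (fun x => (zext f.1 x)⁻¹) V := by
    rw [smoothOn_iff e h.2]
    refine ((smoothOn_iff e h.2 _).1 (sm f)).inv ?_
    rintro _ ⟨x, hx, rfl⟩
    rw [e.1.left_inv (h.2 hx), zext_apply _ (⟨x, hx⟩ : V)]
    exact hf _
  refine IsUnit.of_mul_eq_one (mkLoc _ hs) (Loc.ext' fun x => ?_)
  change f.1 x * (zext f.1 x)⁻¹ = 1
  rw [zext_apply, mul_inv_cancel₀ (hf x)]

/-- The Wirtinger derivatives as derivations. -/
def dLoc {e : HolChart n M} {V : Set M} (h : IsSub e V) (I : Idx n) :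
    Derivation ℂ (Loc n V) (Loc n V) :=
  Derivation.mk'
    { toFun := fun f => mkLoc (pd e I (zext f.1)) ((sm f).pd h.1 h.2 I)
      map_add' := fun f g => Loc.ext' fun x => by
        refine (pd_congr e I h.1 h.2 (fun y hy => ?_) x.2).trans
          (pd_add h.1 h.2 (sm f) (sm g) I x.2)
        simp [zext, hy]
      map_smul' := fun c f => Loc.ext' fun x => by
        have := pd_mul h.1 h.2 (smoothOn_const V c) (sm f) I x.2
        rw [pd_const, mul_zero, add_zero] at this
        refine (pd_congr e I h.1 h.2 (fun y hy => ?_) x.2).trans this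
        simp [zext, hy] }
    fun f g => Loc.ext' fun x => by
      refine (pd_congr e I h.1 h.2 (fun y hy => ?_) x.2).trans
          ((pd_mul h.1 h.2 (sm f) (sm g) I x.2).trans ?_)
      · simp [zext, hy]
      · simp only [zext_apply]; rfl

theorem dLoc_apply {e : HolChart n M} {V : Set M} (h : IsSub e V) (I : Idx n) (f : Loc n V)
    (x : V) : (dLoc h I f).1 x = pd e I (zext f.1) x := rfl

theorem dLoc_of_eq {e : HolChart n M} {V : Set M} (h : IsSub e V) (I : Idx n) (f : Loc n V)
    {F : M → ℂ} (hF : ∀ x : V, F x = f.1 x) (x : V) : (dLoc h I f).1 x = pd e I F x := by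
  rw [dLoc_apply]
  exact pd_congr e I h.1 h.2 (fun y hy => (zext_apply _ ⟨y, hy⟩).trans (hF ⟨y, hy⟩).symm) x.2

theorem zext_dLoc {e : HolChart n M} {V : Set M} (h : IsSub e V) (I : Idx n) (f : Loc n V)
    {F : M → ℂ} (hF : ∀ x : V, F x = f.1 x) (x : V) : pd e I F x = (dLoc h I f).1 x :=
  (dLoc_of_eq h I f hF x).symm

theorem dLoc_comm {e : HolChart n M} {V : Set M} (h : IsSub e V) (I J : Idx n) (f : Loc n V) :
    dLoc h I (dLoc h J f) = dLoc h J (dLoc h I f) := Loc.ext' fun x => by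
  have key : ∀ I J, (dLoc h I (dLoc h J f)).1 x = pd e I (pd e J (zext f.1)) x := fun I J =>
    dLoc_of_eq h I _ (fun y => (dLoc_apply h J f y).symm) x
  rw [key, key, pd_comm h.1 h.2 (sm f) I J x.2]

end Loc

section Data

variable {n : ℕ} {M : Type*} [TopologicalSpace M] [ChartedSpace (Fin n → ℂ) M]
  [IsManifold 𝓘(ℂ, Fin n → ℂ) ω M] (K : KahlerForm n M)

/-- The metric on an open subset of a chart domain. -/
def gLoc {e : HolChart n M} {V : Set M} (h : IsSub e V) : Matrix (Fin n) (Fin n) (Loc n V) :=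
  fun k l => mkLoc (K.g e k l) ((K.isClosedForm.smooth e k l).mono h.2)

theorem gLoc_map {e : HolChart n M} {V : Set M} (h : IsSub e V) (x : V) :
    (gLoc K h).map (evL x) = Matrix.of fun k l => K.g e k l x := rfl

theorem isUnit_det_gLoc {e : HolChart n M} {V : Set M} (h : IsSub e V) :
    IsUnit (gLoc K h).det := Loc.isUnit h fun x => by
  rw [← evL_apply, RingHom.map_det, RingHom.mapMatrix_apply, gLoc_map]
  exact (K.posDef e x (h.2 x.2)).det_pos.ne'

theorem gLoc_inv_apply {e : HolChart n M} {V : Set M} (h : IsSub e V) (l k : Fin n) (x : V) :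
    ((gLoc K h)⁻¹ l k).1 x = K.ginv e l k x := by
  have h1 : (gLoc K h).map (evL x) * (gLoc K h)⁻¹.map (evL x) = 1 := by
    rw [← Matrix.map_mul, Matrix.mul_nonsing_inv _ (isUnit_det_gLoc K h),
      Matrix.map_one _ (map_zero _) (map_one _)]
  rw [gLoc_map] at h1
  rw [KahlerForm.ginv, Matrix.inv_eq_right_inv h1]
  rfl

/-- The Kähler data on an open subset of a chart domain. -/
def kd {e : HolChart n M} {V : Set M} (h : IsSub e V) : KData n (Loc n V) where
  d := dLoc h
  g := gLoc K h
  h := (gLoc K h)⁻¹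
  d_comm := dLoc_comm h
  g_mul_h := Matrix.mul_nonsing_inv _ (isUnit_det_gLoc K h)
  closed_hol i k l := Loc.ext' fun x => by
    rw [dLoc_of_eq h _ _ (F := K.g e k l) (fun _ => rfl),
      dLoc_of_eq h _ _ (F := K.g e i l) (fun _ => rfl)]
    exact K.isClosedForm.closed_hol e i k l x (h.2 x.2)
  closed_antihol j k l := Loc.ext' fun x => by
    rw [dLoc_of_eq h _ _ (F := K.g e k l) (fun _ => rfl),
      dLoc_of_eq h _ _ (F := K.g e k j) (fun _ => rfl)]
    exact K.isClosedForm.closed_antihol e j k l x (h.2 x.2)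

/-- Restriction to a smaller subset. -/
def resL {V V' : Set M} (hV : V ⊆ V') : Loc n V' →ₐ[ℂ] Loc n V where
  toFun f := mkLoc (zext f.1) ((sm f).mono hV)
  map_one' := Loc.ext' fun x => by simp [zext, hV x.2]
  map_mul' f g := Loc.ext' fun x => by simp [zext, hV x.2]
  map_zero' := Loc.ext' fun x => by simp [zext]
  map_add' f g := Loc.ext' fun x => by simp [zext, hV x.2]
  commutes' c := Loc.ext' fun x => by simp [zext, hV x.2]

theorem resL_apply {V V' : Set M} (hV : V ⊆ V') (f : Loc n V') (x : V) :
    (resL hV f).1 x = f.1 ⟨x, hV x.2⟩ := zext_apply f.1 ⟨x, hV x.2⟩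

theorem smoothOn_jac {e e' : HolChart n M} {V : Set M} (h : IsSub e V) (h' : V ⊆ e'.1.source)
    (A I : Idx n) : SmoothOn n (jac e e' A I) V :=
  ((smoothOn_coord e' A).mono h').pd h.1 h.2 I

/-- Change of charts and restriction. -/
def homL {e e' : HolChart n M} {V V' : Set M} (h : IsSub e V) (h' : IsSub e' V') (hV : V ⊆ V') :
    KHom (kd K h') (kd K h) where
  φ := resL hV
  J A I := mkLoc (jac e e' A I) (smoothOn_jac h (hV.trans h'.2) A I)
  d_φ I b := Loc.ext' fun x => by
    have h1 : ((kd K h).d I (resL hV b)).1 x = pd e I (zext b.1) x :=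
      dLoc_of_eq h I _ (fun y => rfl) x
    rw [h1, pd_chain e e' h.1 h.2 (hV.trans h'.2) ((sm b).mono hV) I x.2, ← evL_apply, map_sum]
    refine Finset.sum_congr rfl fun A _ => ?_
    rw [map_mul, evL_apply, evL_apply, resL_apply]
    rfl
  J_hol p q := Loc.ext' fun x => (jac_mixed e e' (h.2 x.2) (h'.2 (hV x.2)) p q).1
  J_antihol p q := Loc.ext' fun x => (jac_mixed e e' (h.2 x.2) (h'.2 (hV x.2)) p q).2
  d_J I C A := Loc.ext' fun x => by
    have h1 : ∀ I C, ((kd K h).d I (mkLoc (jac e e' A C) (smoothOn_jac h (hV.trans h'.2) A C))).1 x =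
      pd e I (pd e C (coord e' A)) x := fun I C => dLoc_of_eq h I _ (fun y => rfl) x
    rw [h1, h1, pd_comm h.1 h.2 ((smoothOn_coord e' A).mono (hV.trans h'.2)) I C x.2]
  g_φ k l := Loc.ext' fun x => by
    have h1 := K.isClosedForm.transform e e' k l x ⟨h.2 x.2, h'.2 (hV x.2)⟩
    refine h1.trans ?_
    rw [← evL_apply]
    simp only [map_sum, map_mul, evL_apply, resL_apply, mkLoc_apply]
    rfl

theorem jac_self (e : HolChart n M) (A I : Idx n) {x : M} (hx : x ∈ e.1.source) :
    jac e e A I x = if A = I then 1 else 0 := pd_coord e I A hx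

end Data

end FedosovWick

end

open scoped Manifold ContDiff Topology ComplexOrder

noncomputable section

set_option linter.unusedSectionVars false
set_option linter.unusedSimpArgs false

namespace FedosovWick

/-! ### Coefficientwise application of ring homomorphisms -/

section MapS

variable {ι B B' : Type*} [CommRing B] [CommRing B'] [Fintype ι] [DecidableEq ι]

/-- Coefficientwise application of a ring homomorphism. -/
def mapS (φ : B' →+* B) : Ser ι B' →+ Ser ι B := pull φ (fun A K => if A = K then 1 else 0)

theorem coeff_mapS (φ : B' →+* B) (a : Ser ι B') (k : ℤ) :
    (mapS φ a).coeff k = MvPowerSeries.map φ (a.coeff k) := by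
  rw [mapS, coeff_pull, pullHom_apply]
  have : (fun A : ι => ∑ K, MvPowerSeries.C (if A = K then (1 : B) else 0) * MvPowerSeries.X K) =
      MvPowerSeries.X := by
    funext A
    rw [Finset.sum_eq_single A]
    · simp
    · intro K _ hK; simp [Ne.symm hK]
    · simp
  rw [this, MvPowerSeries.subst_self]
  rfl

theorem cf_mapS (φ : B' →+* B) (a : Ser ι B') (k : ℤ) (m : ι →₀ ℕ) :
    cf (mapS φ a) k m = φ (cf a k m) := by
  rw [cf, coeff_mapS, MvPowerSeries.coeff_map, cf]

theorem mapS_mul (φ : B' →+* B) (a b : Ser ι B') : mapS φ (a * b) = mapS φ a * mapS φ b :=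
  pull_mul _ _ _ _

theorem mapS_bC (φ : B' →+* B) (b : B') : mapS φ (bC b : Ser ι B') = bC (φ b) := pull_bC _ _ _

theorem mapS_fX (φ : B' →+* B) (A : ι) : mapS φ (fX A : Ser ι B') = fX A := by
  rw [mapS, pull_fX, Finset.sum_eq_single A]
  · simp
  · intro K _ hK; simp [Ne.symm hK]
  · simp

theorem mapS_nu_mul (φ : B' →+* B) (k : ℤ) (a : Ser ι B') : mapS φ (nu k * a) = nu k * mapS φ a :=
  pull_nu_mul _ _ _ _

theorem mapS_dF (φ : B' →+* B) (I : ι) (a : Ser ι B') : mapS φ (dF I a) = dF I (mapS φ a) := by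
  rw [mapS, dF_pull, Finset.sum_eq_single I]
  · simp
  · intro K _ hK; simp [hK]
  · simp

theorem mapS_wk [Algebra ℂ B] [Algebra ℂ B'] (φ : B' →ₐ[ℂ] B) {Λ' : ι → ι → B'} {Λ : ι → ι → B}
    (h : ∀ I J, φ (Λ' I J) = Λ I J) (a b : Ser ι B') :
    mapS (φ : B' →+* B) (wk Λ' a b) = wk Λ (mapS (φ : B' →+* B) a) (mapS (φ : B' →+* B) b) :=
  pull_wk _ φ (fun A C => by simp [h]) a b

end MapS

/-! ### Sections over open subsets of chart domains -/

section Rep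

variable {n : ℕ} {M : Type*} [TopologicalSpace M] [ChartedSpace (Fin n → ℂ) M]

/-- Restriction of functions. -/
def resA (V : Set M) : (M → ℂ) →ₐ[ℂ] (V → ℂ) where
  toFun f x := f x
  map_one' := rfl
  map_mul' _ _ := rfl
  map_zero' := rfl
  map_add' _ _ := rfl
  commutes' _ := rfl

/-- The local expression `a` is given over `V` by a series with smooth coefficients. -/
def Rep {V : Set M} (a : WLoc n M) (b : Ser (Idx n) (Loc n V)) : Prop :=
  mapS (resA V : (M → ℂ) →+* (V → ℂ)) a = mapS ((locVal n V) : Loc n V →+* (V → ℂ)) b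

variable {V : Set M} {a a' : WLoc n M} {b b' : Ser (Idx n) (Loc n V)}

theorem rep_iff : Rep a b ↔ ∀ k m (x : V), wcoeff a k m x = (cf b k m).1 x := by
  constructor
  · intro h k m x
    have := congrFun (congrArg (fun s => cf s k m) h) x
    simp only [cf_mapS] at this
    exact this
  · intro h
    refine ser_ext fun k m => funext fun x => ?_
    rw [cf_mapS, cf_mapS]
    exact h k m x

theorem Rep.eqOver_iff (h : Rep a b) (h' : Rep a' b') : EqOver V a a' ↔ b = b' := by
  rw [rep_iff] at h h'
  constructor
  · intro he
    refine ser_ext fun k m => Loc.ext' fun x => ?_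
    rw [← h, ← h', he k m x x.2]
  · rintro rfl k m x hx
    rw [h k m ⟨x, hx⟩, h' k m ⟨x, hx⟩]

theorem rep_zero : Rep (0 : WLoc n M) (0 : Ser (Idx n) (Loc n V)) := by
  simp only [Rep, map_zero]

theorem Rep.add (h : Rep a b) (h' : Rep a' b') : Rep (a + a') (b + b') := by
  simp only [Rep, map_add] at *; rw [h, h']

theorem Rep.sub (h : Rep a b) (h' : Rep a' b') : Rep (a - a') (b - b') := by
  simp only [Rep, map_sub] at *; rw [h, h']

theorem Rep.neg (h : Rep a b) : Rep (-a) (-b) := by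
  simp only [Rep, map_neg] at *; rw [h]

theorem Rep.mul (h : Rep a b) (h' : Rep a' b') : Rep (a * a') (b * b') := by
  simp only [Rep, mapS_mul] at *; rw [h, h']

theorem Rep.sum {κ : Type*} {s : Finset κ} {a : κ → WLoc n M} {b : κ → Ser (Idx n) (Loc n V)}
    (h : ∀ i, Rep (a i) (b i)) : Rep (∑ i ∈ s, a i) (∑ i ∈ s, b i) := by
  simp only [Rep, map_sum] at *
  exact Finset.sum_congr rfl fun i _ => h i

theorem rep_baseC {f : M → ℂ} {f' : Loc n V} (h : ∀ x : V, f x = f'.1 x) :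
    Rep (baseC f : WLoc n M) (bC f') := by
  have e : (baseC f : WLoc n M) = bC f := rfl
  rw [Rep, e, mapS_bC, mapS_bC]
  congr 1
  exact funext h

theorem rep_fibX (I : Idx n) : Rep (fibX I : WLoc n M) (fX I : Ser (Idx n) (Loc n V)) := by
  have e : (fibX I : WLoc n M) = fX I := rfl
  rw [Rep, e, mapS_fX, mapS_fX]

theorem Rep.nuInv_mul (h : Rep a b) : Rep (nuInv * a) (nu (-1) * b) := by
  have e : (nuInv : WLoc n M) = nu (-1) := rfl
  rw [Rep, e, mapS_nu_mul, mapS_nu_mul, h]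

theorem Rep.dfib (h : Rep a b) (I : Idx n) : Rep (dfib I a) (dF I b) := by
  have e : FedosovWick.dfib I a = dF I a := rfl
  rw [Rep, e, mapS_dF, mapS_dF, h]

/-- Extension by zero of the coefficients. -/
def extS (b : Ser (Idx n) (Loc n V)) : WLoc n M :=
  liftL
    { toFun := fun p m => zext (MvPowerSeries.coeff m p).1
      map_zero' := funext fun m => funext fun x => by simp [zext]
      map_add' := fun p q => funext fun m => funext fun x => by
        change zext _ x = zext _ x + zext _ x
        by_cases hx : x ∈ V <;> simp [zext, hx] } b

theorem wcoeff_extS (b : Ser (Idx n) (Loc n V)) (k : ℤ) (m : Idx n →₀ ℕ) :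
    wcoeff (extS b) k m = zext (cf b k m).1 := rfl

theorem rep_extS (b : Ser (Idx n) (Loc n V)) : Rep (extS b) b :=
  rep_iff.2 fun k m x => by rw [wcoeff_extS, zext_apply]

theorem Van.extS {p : ℤ} (h : Van p b) : Van p (extS b) := Van.liftL _ h

theorem Rep.eq_extS (h : Rep a b) (h0 : ∀ r m, ∀ x ∉ V, wcoeff a r m x = 0) : a = extS b :=
  ser_ext fun k m => funext fun x => by
    by_cases hx : x ∈ V
    · exact (rep_iff.1 h k m ⟨x, hx⟩).trans (rep_iff.1 (rep_extS b) k m ⟨x, hx⟩).symm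
    · exact (h0 k m x hx).trans (zext_of_notMem _ hx).symm

theorem exists_rep (h : ∀ k m, SmoothOn n (wcoeff a k m) V) :
    ∃ b : Ser (Idx n) (Loc n V), Rep a b := by
  refine ⟨HahnSeries.ofSuppBddBelow (fun k m => mkLoc (wcoeff a k m) (h k m)) ⟨a.order, ?_⟩,
    rep_iff.2 fun k m x => rfl⟩
  intro k hk
  by_contra hlt
  refine hk (funext fun m => Loc.ext' fun x => ?_)
  change MvPowerSeries.coeff m (a.coeff k) x = 0
  rw [van_order a k (not_le.1 hlt)]
  rfl

theorem Rep.van {p : ℤ} (h : Rep a b) (ha : Van p a) : Van p b := fun k hk => by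
  refine MvPowerSeries.ext fun m => Loc.ext' fun x => (rep_iff.1 h k m x).symm.trans ?_
  rw [wcoeff, ha k hk]
  rfl

theorem evalAt_coeff (h : Rep a b) (x : V) (k : ℤ) :
    evalAt (n := n) x.1 (a.coeff k) = MvPowerSeries.map (evL x) (b.coeff k) := by
  ext m
  rw [evalAt, MvPowerSeries.coeff_map, MvPowerSeries.coeff_map]
  exact rep_iff.1 h k m x

theorem eq_of_map_evL (h : ∀ (x : V) k, MvPowerSeries.map (evL x) (b.coeff k) =
    MvPowerSeries.map (evL x) (b'.coeff k)) : b = b' :=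
  ser_ext fun k m => Loc.ext' fun x => by
    have := congrArg (MvPowerSeries.coeff m) (h x k)
    rwa [MvPowerSeries.coeff_map, MvPowerSeries.coeff_map] at this

variable [IsManifold 𝓘(ℂ, Fin n → ℂ) ω M] (K : KahlerForm n M)

/-- The Poisson tensor in a chart. -/
def tensorΛ (e : HolChart n M) : Idx n → Idx n → M → ℂ
  | Sum.inr l, Sum.inl k => K.ginv e l k
  | _, _ => 0

theorem wickTerm_eq (e : HolChart n M) (j : ℕ) : ∀ a b : WLoc n M,
    wickTerm K e j a b = wterm (tensorΛ K e) j a b := by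
  induction j with
  | zero => intro a b; rfl
  | succ j ih =>
    intro a b
    simp only [wickTerm, wterm, ih, Fintype.sum_sum_type, tensorΛ, map_zero, zero_mul,
      Finset.sum_const_zero, zero_add, add_zero]
    rfl

/-- The Wick product of the statement is an instance of the abstract one, over the ring of all
functions on `M`. Restriction to an open set is then a ring homomorphism, and naturality of `wk`
relates it to smooth coefficients. -/
theorem wick_eq (e : HolChart n M) (a b : WLoc n M) : wick K e a b = wk (tensorΛ K e) a b := by
  ext k : 2
  change ∑ᶠ j : ℕ, _ = ∑ᶠ j : ℕ, _
  simp only [wickTerm_eq]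

variable {e : HolChart n M} (hV : IsSub e V)

theorem Rep.wick (h : Rep a b) (h' : Rep a' b') :
    Rep (wick K e a a') (wk (kd K hV).Λ b b') := by
  have e1 : ∀ I J, resA V (tensorΛ K e I J) = (locVal n V) ((kd K hV).Λ I J) := by
    intro I J
    rcases I with l | l <;> rcases J with k | k
    · rfl
    · rfl
    · funext x
      exact (gLoc_inv_apply K hV l k x).symm
    · rfl
  rw [Rep, wick_eq, mapS_wk (resA V) (Λ := fun I J => resA V (tensorΛ K e I J)) (fun _ _ => rfl),
    mapS_wk (locVal n V) (fun I J => (e1 I J).symm), h, h']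

theorem Rep.dbase (h : Rep a b) (I : Idx n) :
    Rep (dbase e I a) (dB (((kd K hV).d I : Loc n V →ₗ[ℂ] Loc n V).toAddMonoidHom) b) :=
  rep_iff.2 fun k m x => zext_dLoc hV I (cf b k m) (fun y => rep_iff.1 h k m y) x

theorem christoffel_eq (I A S : Idx n) (x : V) :
    K.christoffel e I A S x = ((kd K hV).Γ I A S).1 x := by
  rcases I with i | i <;> rcases A with j | j <;> rcases S with s | s
  case inl.inl.inl =>
    rw [KData.Γ, ← evL_apply, map_sum]
    refine Finset.sum_congr rfl fun l _ => ?_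
    rw [map_mul, evL_apply, evL_apply]
    exact congrArg₂ _ (gLoc_inv_apply K hV l s x).symm
      (zext_dLoc hV (Sum.inl j) (gLoc K hV i l) (fun _ => rfl) x)
  case inr.inr.inr =>
    rw [KData.Γ, ← evL_apply, map_sum]
    refine Finset.sum_congr rfl fun l _ => ?_
    rw [map_mul, evL_apply, evL_apply]
    exact congrArg₂ _ (gLoc_inv_apply K hV s l x).symm
      (zext_dLoc hV (Sum.inr j) (gLoc K hV l i) (fun _ => rfl) x)
  all_goals rfl

theorem Rep.nabla (h : Rep a b) (I : Idx n) :
    Rep (nabla K e I a) (nab (kd K hV).d (kd K hV).Γ I b) := by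
  rw [nab_apply]
  exact (h.dbase K hV I).sub (Rep.sum fun A => Rep.sum fun S =>
    ((rep_baseC (christoffel_eq K hV I A S)).mul (rep_fibX A)).mul (h.dfib S))

theorem rep_curvPQ (p q : Fin n) : Rep (KahlerForm.curv.curvPQ K e p q)
    (KData.q11 ((kd K hV).ρ p q)) := by
  refine Rep.sum fun k => Rep.sum fun l => ((rep_baseC fun x => ?_).mul (rep_fibX _)).mul
    (rep_fibX _)
  rw [KData.ρ, ← evL_apply]
  simp only [map_add, map_neg, map_sum, map_mul, evL_apply, Pi.add_apply, Pi.neg_apply,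
    Finset.sum_apply, Pi.mul_apply]
  have h1 : ∀ I k l (x : V), pd e I (K.g e k l) x = ((kd K hV).d I ((kd K hV).g k l)).1 x :=
    fun I k l x => zext_dLoc hV I (gLoc K hV k l) (fun _ => rfl) x
  have h2 : pd e (Sum.inl p) (pd e (Sum.inr q) (K.g e k l)) x =
      ((kd K hV).d (Sum.inl p) ((kd K hV).d (Sum.inr q) ((kd K hV).g k l))).1 x :=
    zext_dLoc hV _ _ (fun y => h1 _ _ _ y) x
  have h3 : ∀ t s, K.ginv e t s x = ((kd K hV).h t s).1 x := fun t s =>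
    (gLoc_inv_apply K hV t s x).symm
  rw [h2]
  congr 2
  exact Finset.sum_congr rfl fun t _ => Finset.sum_congr rfl fun s _ => by rw [h1, h1, h3]

theorem rep_curv (I J : Idx n) : Rep (K.curv e I J) ((kd K hV).R I J) := by
  rcases I with i | i <;> rcases J with j | j
  exacts [rep_zero, rep_curvPQ K hV i j, (rep_curvPQ K hV j i).neg, rep_zero]

theorem Rep.fedosovD {r : Idx n → WLoc n M} {s : Idx n → Ser (Idx n) (Loc n V)}
    (hr : ∀ I, Rep (r I) (s I)) (h : Rep a b) (I : Idx n) :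
    Rep (fedosovD K e r I a) ((kd K hV).toFData.D s I b) := by
  rw [FData.D_apply]
  exact ((h.dfib I).neg.add (h.nabla K hV I)).add
    (((hr I).wick K hV h).sub (h.wick K hV (hr I))).nuInv_mul

/-- The equations of the Fedosov element in a chart and over the ring of smooth functions. -/
theorem isFed_of_rep {r : Idx n → WLoc n M} {s : Idx n → Ser (Idx n) (Loc n V)}
    (hr : ∀ I, Rep (r I) (s I)) (h1 : ∀ I, ∀ k < 0, (r I).coeff k = 0)
    (h2 : ∀ I (k : ℤ) (m : Idx n →₀ ℕ), 2 * k + m.degree < 2 → wcoeff (r I) k m = 0)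
    (h3 : EqOver V (deltaInv r) 0)
    (h4 : ∀ I J, EqOver V (delta₁ r I J)
      (K.curv e I J + nabla₁ K e r I J + nuInv * wickSq₁ K e r I J)) :
    (kd K hV).toFData.IsFed s where
  van I := (hr I).van (h1 I)
  fil I k m hm := Loc.ext' fun x => by
    rw [← rep_iff.1 (hr I) k m x, h2 I k m]
    · rfl
    · simpa [wt, Finsupp.degree_eq_sum] using hm
  norm := by
    classical
    have hR : Rep (∑ I, fibX I * r I) (∑ I, fX I * s I) :=
      Rep.sum fun I => (rep_fibX I).mul (hr I)
    refine ser_ext fun k m => Loc.ext' fun x => ?_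
    -- The operator δ⁻¹ divides by the fibre degree, so its vanishing says nothing in degree zero;
    -- there the contraction with ζ vanishes anyway.
    by_cases hm : m = 0
    · subst hm
      rw [cf_sum]
      simp only [cf_fX_mul, Finsupp.coe_zero, Pi.zero_apply, if_true, Finset.sum_const_zero]
      rfl
    · have h5 : ((m.degree : ℂ)⁻¹) • wcoeff (∑ I, fibX I * r I) k m x.1 = 0 := h3 k m x.1 x.2
      rw [smul_eq_mul, mul_eq_zero, inv_eq_zero, Nat.cast_eq_zero,
        Finsupp.degree_eq_zero_iff] at h5
      exact (rep_iff.1 hR k m x).symm.trans (h5.resolve_left hm)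
  eq I J := by
    have hL := ((hr J).dfib I).sub ((hr I).dfib J)
    have hR := ((rep_curv K hV I J).add (((hr J).nabla K hV I).sub ((hr I).nabla K hV J))).add
      (((hr I).wick K hV (hr J)).sub ((hr J).wick K hV (hr I))).nuInv_mul
    exact (hL.eqOver_iff hR).1 (h4 I J)

theorem isFed_rep {r : Idx n → WLoc n M} {s : Idx n → Ser (Idx n) (Loc n V)}
    (hr : ∀ I, Rep (r I) (s I)) (hs : (kd K hV).toFData.IsFed s) :
    EqOver V (deltaInv r) 0 ∧ ∀ I J, EqOver V (delta₁ r I J)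
      (K.curv e I J + nabla₁ K e r I J + nuInv * wickSq₁ K e r I J) := by
  constructor
  · have hR : Rep (∑ I, fibX I * r I) (∑ I, fX I * s I) :=
      Rep.sum fun I => (rep_fibX I).mul (hr I)
    rw [hs.norm] at hR
    intro k m x hx
    have h5 : wcoeff (∑ I, fibX I * r I) k m x = 0 := rep_iff.1 hR k m ⟨x, hx⟩
    change ((m.degree : ℂ)⁻¹) • wcoeff (∑ I, fibX I * r I) k m x = 0
    rw [h5, smul_zero]
  · intro I J
    have hL := ((hr J).dfib I).sub ((hr I).dfib J)
    have hR := ((rep_curv K hV I J).add (((hr J).nabla K hV I).sub ((hr I).nabla K hV J))).add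
      (((hr I).wick K hV (hr J)).sub ((hr J).wick K hV (hr I))).nuInv_mul
    exact (hL.eqOver_iff hR).2 (hs.eq I J)

variable {V' : Set M} {e' : HolChart n M} (hV' : IsSub e' V') (hVV : V ⊆ V')

theorem pullback_map_evL (b : Ser (Idx n) (Loc n V')) (k : ℤ) (x : V) :
    pullback e e' x (MvPowerSeries.map (evL ⟨x.1, hVV x.2⟩) (b.coeff k)) =
      MvPowerSeries.map (evL x) (((homL K hV hV' hVV).P b).coeff k) := by
  rw [KHom.P, FHom.P, coeff_pull, pullHom_apply,
    MvPowerSeries.map_subst (hasSubst_linear _)]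
  have e1 : MvPowerSeries.map (evL x) (MvPowerSeries.map
      ((homL K hV hV' hVV).toFHom.φ : Loc n V' →+* Loc n V) (b.coeff k)) =
      MvPowerSeries.map (evL ⟨x.1, hVV x.2⟩) (b.coeff k) := by
    ext m
    simp only [MvPowerSeries.coeff_map]
    exact resL_apply hVV _ x
  rw [e1, pullback]
  congr 1
  funext A
  simp only [map_sum, map_mul, MvPowerSeries.map_C, MvPowerSeries.map_X]
  rfl

/-- Pointwise transformation rules become one identity over the ring of functions on the overlap, so
that the naturality of the algebraic constructions delivers global sections. -/
theorem transform_iff {b' : Ser (Idx n) (Loc n V')} (h : Rep a b) (h' : Rep a' b') :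
    (∀ x ∈ V, ∀ k, evalAt x (a.coeff k) = pullback e e' x (evalAt x (a'.coeff k))) ↔
      b = (homL K hV hV' hVV).P b' := by
  have key : ∀ (x : V) k, pullback e e' x (evalAt (n := n) x.1 (a'.coeff k)) =
      MvPowerSeries.map (evL x) (((homL K hV hV' hVV).P b').coeff k) := fun x k => by
    rw [← pullback_map_evL, evalAt_coeff h' ⟨x.1, hVV x.2⟩]
  constructor
  · intro ht
    refine eq_of_map_evL fun x k => ?_
    rw [← evalAt_coeff h, ht x x.2, key]
  · rintro rfl x hx k
    rw [evalAt_coeff h ⟨x, hx⟩]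
    exact (key ⟨x, hx⟩ k).symm

theorem transform_oneForm_iff {r r' : Idx n → WLoc n M} {s : Idx n → Ser (Idx n) (Loc n V)}
    {s' : Idx n → Ser (Idx n) (Loc n V')} (h : ∀ I, Rep (r I) (s I)) (h' : ∀ I, Rep (r' I) (s' I)) :
    (∀ x ∈ V, ∀ J k, evalAt x ((r J).coeff k) =
      ∑ I, MvPowerSeries.C (jac e e' I J x) * pullback e e' x (evalAt x ((r' I).coeff k))) ↔
      s = (homL K hV hV' hVV).toFHom.oneForm s' := by
  have key : ∀ (x : V) J k, ∑ I, MvPowerSeries.C (jac e e' I J x) *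
      pullback e e' x (evalAt (n := n) x.1 ((r' I).coeff k)) =
      MvPowerSeries.map (evL x) (((homL K hV hV' hVV).toFHom.oneForm s' J).coeff k) := fun x J k => by
    rw [FHom.oneForm, HahnSeries.coeff_sum, map_sum]
    refine Finset.sum_congr rfl fun I _ => ?_
    have e1 : ∀ (c : Loc n V) (d : Ser (Idx n) (Loc n V)), (bC c * d).coeff k =
        MvPowerSeries.C c * d.coeff k := fun c d => by
      rw [bC, RingHom.comp_apply, HahnSeries.C_apply, HahnSeries.coeff_single_zero_mul]
    rw [e1, map_mul, MvPowerSeries.map_C, ← pullback_map_evL, evalAt_coeff (h' I) ⟨x.1, hVV x.2⟩]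
    rfl
  constructor
  · intro ht
    refine funext fun J => eq_of_map_evL fun x k => ?_
    rw [← evalAt_coeff (h J), ht x x.2, key]
  · rintro rfl x hx J k
    rw [evalAt_coeff (h J) ⟨x, hx⟩]
    exact (key ⟨x, hx⟩ J k).symm

end Rep

end FedosovWick

end

open scoped Manifold ContDiff Topology ComplexOrder

noncomputable section

set_option linter.unusedSectionVars false
set_option linter.unusedSimpArgs false

namespace FedosovWick

/-! ### Restriction of formal functions and gluing -/

section Glue

variable {n : ℕ} {M : Type*} [TopologicalSpace M] [ChartedSpace (Fin n → ℂ) M]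

theorem smoothFun_smoothOn (f : SmoothFun n M) (V : Set M) : SmoothOn n f V :=
  f.contMDiff.contMDiffOn

/-- Restriction of smooth functions. -/
def resSm (V : Set M) : SmoothFun n M →+* Loc n V where
  toFun f := mkLoc f (smoothFun_smoothOn f V)
  map_one' := rfl
  map_mul' _ _ := rfl
  map_zero' := rfl
  map_add' _ _ := rfl

/-- Restriction of formal functions. -/
def rs (V : Set M) : FormalFun n M →+ LaurentSeries (Loc n V) :=
  liftL ((resSm V : SmoothFun n M →+* Loc n V) : SmoothFun n M →+ Loc n V)

theorem rs_coeff (V : Set M) (f : FormalFun n M) (k : ℤ) (x : V) :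
    ((rs V f).coeff k).1 x = f.coeff k x := rfl

theorem rs_C (V : Set M) (f : SmoothFun n M) :
    rs V (HahnSeries.C f) = HahnSeries.C (resSm V f) := liftL_C _ _

theorem rs_one (V : Set M) : rs V (1 : FormalFun n M) = 1 := by
  have e1 : (1 : FormalFun n M) = HahnSeries.C 1 := (map_one _).symm
  rw [e1, rs_C, map_one, map_one]

theorem rs_single_mul (V : Set M) (k : ℤ) (f : FormalFun n M) :
    rs V (HahnSeries.single k 1 * f) = HahnSeries.single k 1 * rs V f := liftL_single_mul _ _ _

theorem Van.rs {p : ℤ} {f : FormalFun n M} (hf : Van p f) (V : Set M) : Van p (rs V f) := hf.liftL _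

variable [IsManifold 𝓘(ℂ, Fin n → ℂ) ω M]

theorem formalFun_ext {f g : FormalFun n M}
    (h : ∀ e : HolChart n M, rs e.1.source f = rs e.1.source g) : f = g := by
  ext k : 2
  refine ContMDiffMap.ext fun x => ?_
  have := congrArg (fun t => (HahnSeries.coeff t k).1 ⟨x, mem_cat x⟩) (h (cat x))
  exact this

theorem van_of_rs {p : ℤ} {f : FormalFun n M}
    (h : ∀ e : HolChart n M, Van p (rs e.1.source f)) : Van p f := fun k hk =>
  ContMDiffMap.ext fun x => by
    have := congrArg (fun t : Loc n _ => t.1 ⟨x, mem_cat x⟩) (h (cat x) k hk)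
    exact this

/-- Formal functions on all chart domains which agree on the overlaps define a formal function. -/
theorem exists_glue {t : ∀ e : HolChart n M, LaurentSeries (Loc n e.1.source)} {N : ℤ}
    (hN : ∀ e, Van N (t e)) (h : ∀ e e' k x (hx : x ∈ e.1.source) (hx' : x ∈ e'.1.source),
      ((t e).coeff k).1 ⟨x, hx⟩ = ((t e').coeff k).1 ⟨x, hx'⟩) :
    ∃ f : FormalFun n M, ∀ e : HolChart n M, rs e.1.source f = t e := by
  -- The value at a point is taken from its preferred chart; near that point the function coincides
  -- with a single smooth local expression.
  have hs : ∀ k, ContMDiff 𝓘(ℝ, Fin n → ℂ) 𝓘(ℝ, ℂ) ∞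
      (fun x : M => ((t (cat x)).coeff k).1 ⟨x, mem_cat x⟩) := fun k x => by
    have h1 : SmoothOn n (fun x : M => ((t (cat x)).coeff k).1 ⟨x, mem_cat x⟩)
        (cat x : HolChart n M).1.source := (sm ((t (cat x)).coeff k)).congr fun y hy => by
      rw [zext_apply _ (⟨y, hy⟩ : (cat x : HolChart n M).1.source)]
      exact h _ _ _ _ _ _
    exact ContMDiffOn.contMDiffAt h1 ((cat x).1.open_source.mem_nhds (mem_cat x))
  refine ⟨HahnSeries.ofSuppBddBelow (fun k => (⟨_, hs k⟩ : SmoothFun n M)) ⟨N, fun k hk => ?_⟩,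
    fun e => ?_⟩
  · by_contra hlt
    refine hk (ContMDiffMap.ext fun x => ?_)
    change ((t (cat x)).coeff k).1 ⟨x, mem_cat x⟩ = 0
    rw [hN _ k (not_le.1 hlt)]
    rfl
  · ext k : 2
    refine Loc.ext' fun x => ?_
    exact h _ _ _ _ _ _

end Glue

section Restriction

variable {n : ℕ} {M : Type*} [TopologicalSpace M] [ChartedSpace (Fin n → ℂ) M]
  [IsManifold 𝓘(ℂ, Fin n → ℂ) ω M] (K : KahlerForm n M)

theorem resL_rs {V V' : Set M} (hVV : V ⊆ V') (f : FormalFun n M) :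
    liftL ((resL (n := n) hVV : Loc n V' →+* Loc n V) : Loc n V' →+ Loc n V) (rs V' f) = rs V f := by
  ext k : 2
  exact Loc.ext' fun x => resL_apply hVV _ x

variable {e e' : HolChart n M} {V V' : Set M} (hV : IsSub e V) (hV' : IsSub e' V') (hVV : V ⊆ V')

theorem star_rs (f g : FormalFun n M) :
    liftL ((resL (n := n) hVV : Loc n V' →+* Loc n V) : Loc n V' →+ Loc n V)
      ((kd K hV').star (rs V' f) (rs V' g)) = (kd K hV).star (rs V f) (rs V g) := by
  have := (homL K hV hV' hVV).star_φ (rs V' f) (rs V' g)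
  have e1 : (homL K hV hV' hVV).φ = resL hVV := rfl
  rw [e1, resL_rs, resL_rs] at this
  exact this

theorem P_tau_rs (f : FormalFun n M) :
    (homL K hV hV' hVV).P ((kd K hV').tau (rs V' f)) = (kd K hV).tau (rs V f) := by
  rw [KHom.P_tau]
  have e1 : (homL K hV hV' hVV).φ = resL hVV := rfl
  rw [e1, resL_rs]

theorem homL_self_J (hV' : IsSub e V') (A I : Idx n) :
    (homL K hV hV' hVV).toFHom.J A I = if A = I then 1 else 0 := by
  refine Loc.ext' fun x => (jac_self e A I (hV.2 x.2)).trans ?_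
  split_ifs <;> rfl

theorem homL_self_P (hV' : IsSub e V') (b : Ser (Idx n) (Loc n V')) :
    (homL K hV hV' hVV).P b = mapS (resL (n := n) hVV : Loc n V' →+* Loc n V) b := by
  rw [KHom.P, FHom.P, mapS]
  congr 2
  funext A I
  exact homL_self_J K hV hVV hV' A I

theorem Rep.restrict (hV' : IsSub e V') {a : WLoc n M} {b : Ser (Idx n) (Loc n V')}
    (h : Rep a b) : Rep a ((homL K hV hV' hVV).P b) := by
  rw [homL_self_P]
  refine rep_iff.2 fun k m x => ?_
  rw [cf_mapS]
  exact (rep_iff.1 h k m ⟨x, hVV x.2⟩).trans (resL_apply hVV _ x).symm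

/-- The Fedosov element in a chart. -/
def fedLoc (e : HolChart n M) (I : Idx n) : WLoc n M := extS ((kd K (isSub_source e)).fed I)

/-- Restriction within one chart is a change of frame with identity Jacobian, so naturality
identifies the restricted element with the one constructed over the smaller set. -/
theorem rep_fedLoc (I : Idx n) : Rep (fedLoc K e I) ((kd K hV).fed I) := by
  have h := (rep_extS ((kd K (isSub_source e)).fed I)).restrict K hV hV.2 (isSub_source e)
  have h2 := congrFun (homL K hV (isSub_source e) hV.2).oneForm_fed I
  rw [FHom.oneForm, Finset.sum_eq_single I] at h2
  · rw [homL_self_J, if_pos rfl, map_one, one_mul] at h2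
    rwa [h2] at h
  · intro A _ hA
    rw [homL_self_J, if_neg hA, map_zero, zero_mul]
  · simp

/-- The flat lift of a formal function in a chart. -/
def tauLoc (e : HolChart n M) (f : FormalFun n M) : WLoc n M :=
  extS ((kd K (isSub_source e)).tau (rs e.1.source f))

theorem rep_tauLoc (f : FormalFun n M) : Rep (tauLoc K e f) ((kd K hV).tau (rs V f)) := by
  have h := (rep_extS ((kd K (isSub_source e)).tau (rs e.1.source f))).restrict K hV hV.2
    (isSub_source e)
  rwa [P_tau_rs] at h

theorem isSub_inter (e e' : HolChart n M) : IsSub e (e.1.source ∩ e'.1.source) :=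
  ⟨e.1.open_source.inter e'.1.open_source, Set.inter_subset_left⟩

/-- The global element which defines the Fedosov connection. -/
def fedForm : WOneForm n M where
  loc := fedLoc K
  bounded := ⟨0, fun e I => ((kd K (isSub_source e)).isFed.van I).extS⟩
  smooth e I r m := by
    rw [fedLoc, wcoeff_extS]
    exact sm _
  zero_off e I r m x hx := zext_of_notMem _ hx
  transform e e' := (transform_oneForm_iff K (isSub_inter e e') (isSub_source e')
    Set.inter_subset_right (fun I => rep_fedLoc K (isSub_inter e e') I)
    (fun I => rep_fedLoc K (isSub_source e') I)).2 (KHom.oneForm_fed _).symm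

theorem isFedosovElement_fedForm : IsFedosovElement K (fedForm K) where
  nonneg e I := ((kd K (isSub_source e)).isFed.van I).extS
  degree e I k m hm := by
    change wcoeff (fedLoc K e I) k m = 0
    rw [fedLoc, wcoeff_extS, (kd K (isSub_source e)).isFed.fil I k m]
    · funext x
      simp [zext]
    · simpa [wt, Finsupp.degree_eq_sum] using hm
  deltaInv_eq e := (isFed_rep K (isSub_source e) (rep_fedLoc K (isSub_source e))
    (kd K (isSub_source e)).isFed).1
  delta_eq e := (isFed_rep K (isSub_source e) (rep_fedLoc K (isSub_source e))
    (kd K (isSub_source e)).isFed).2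

/-- In each chart a solution is represented by a series with smooth coefficients, to which the
algebraic uniqueness applies; vanishing outside the chart domain fixes the remaining values. -/
theorem eq_fedForm {r : WOneForm n M} (hr : IsFedosovElement K r) : r = fedForm K := by
  refine WOneForm.ext (funext fun e => ?_)
  choose s hs using fun I => exists_rep (r.smooth e I)
  have h1 := isFed_of_rep K (isSub_source e) hs (hr.nonneg e) (hr.degree e) (hr.deltaInv_eq e)
    (hr.delta_eq e)
  have h2 : s = (kd K (isSub_source e)).fed := h1.unique _ (kd K (isSub_source e)).isFed
  funext I
  rw [(hs I).eq_extS (r.zero_off e I), h2]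
  rfl

/-- The flat section with a given symbol. -/
def tauSec (f : FormalFun n M) : WSection n M where
  loc e := tauLoc K e f
  bounded := ⟨f.order, fun e =>
    ((kd K (isSub_source e)).van_tau ((van_order f).rs e.1.source)).extS⟩
  smooth e r m := by
    rw [tauLoc, wcoeff_extS]
    exact sm _
  zero_off e r m x hx := zext_of_notMem _ hx
  transform e e' := (transform_iff K (isSub_inter e e') (isSub_source e') Set.inter_subset_right
    (rep_tauLoc K (isSub_inter e e') f) (rep_tauLoc K (isSub_source e') f)).2
    (P_tau_rs K _ _ _ f).symm

theorem isFlat_tauSec (f : FormalFun n M) : IsFlat K (fedForm K) (tauSec K f) := fun e I =>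
  ((Rep.fedosovD K (isSub_source e) (rep_fedLoc K (isSub_source e))
    (rep_tauLoc K (isSub_source e) f) I).eqOver_iff rep_zero).2
    ((kd K (isSub_source e)).flat_tau _ I)

theorem isSymbol_iff {w : WSection n M} {f : FormalFun n M}
    {b : ∀ e : HolChart n M, Ser (Idx n) (Loc n e.1.source)} (hb : ∀ e, Rep (w.loc e) (b e)) :
    IsSymbol w f ↔ ∀ e : HolChart n M, symb (b e) = rs e.1.source f := by
  constructor
  · intro h e
    ext k : 2
    refine Loc.ext' fun x => ?_
    rw [coeff_symb, rs_coeff, ← h e k x x.2, rep_iff.1 (hb e)]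
  · intro h e k x hx
    have := rep_iff.1 (hb e) k 0 ⟨x, hx⟩
    rw [this, ← coeff_symb, h, rs_coeff]

theorem isSymbol_tauSec (f : FormalFun n M) : IsSymbol (tauSec K f) f :=
  by
  refine (isSymbol_iff (b := fun e => (kd K (isSub_source e)).tau (rs e.1.source f))
    fun e => ?_).2 fun _ => KData.symb_tau _ _
  exact rep_tauLoc K (isSub_source e) f

theorem eq_tauSec {w : WSection n M} {f : FormalFun n M} (hw : IsFlat K (fedForm K) w)
    (hf : IsSymbol w f) : w = tauSec K f := by
  choose b hb using fun e => exists_rep (w.smooth e)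
  refine WSection.ext (funext fun e => ?_)
  have h1 : (kd K (isSub_source e)).toFData.Flat (kd K (isSub_source e)).fed (b e) := fun I =>
    ((Rep.fedosovD K (isSub_source e) (rep_fedLoc K (isSub_source e)) (hb e) I).eqOver_iff
      rep_zero).1 (hw e I)
  rw [(hb e).eq_extS (w.zero_off e), KData.eq_tau _ h1, (isSymbol_iff hb).1 hf e]
  rfl

theorem exists_isSymbol (K : KahlerForm n M) (w : WSection n M) : ∃! f : FormalFun n M, IsSymbol w f := by
  choose b hb using fun e => exists_rep (w.smooth e)
  obtain ⟨N, hN⟩ := w.bounded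
  obtain ⟨f, hf⟩ := exists_glue (t := fun e => symb (b e)) (N := N)
    (fun e => ((hb e).van (hN e)).symb) fun e e' k x hx hx' => by
      have h3 := (transform_iff K (V := e.1.source ∩ e'.1.source) (isSub_inter e e')
        (isSub_source e') Set.inter_subset_right ((hb e).restrict K (isSub_inter e e')
          Set.inter_subset_left (isSub_source e)) (hb e')).1 (w.transform e e')
      have h4 := congrArg (fun a => ((symb a).coeff k).1 ⟨x, hx, hx'⟩) h3
      simp only [KHom.P, FHom.P, symb_pull] at h4
      have h5 := resL_apply (Set.inter_subset_left : e.1.source ∩ e'.1.source ⊆ e.1.source)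
        ((symb (b e)).coeff k) ⟨x, hx, hx'⟩
      have h6 := resL_apply (Set.inter_subset_right : e.1.source ∩ e'.1.source ⊆ e'.1.source)
        ((symb (b e')).coeff k) ⟨x, hx, hx'⟩
      exact h5.symm.trans (h4.trans h6)
  refine ⟨f, (isSymbol_iff hb).2 fun e => (hf e).symm, fun g hg => formalFun_ext fun e => ?_⟩
  rw [← (isSymbol_iff hb).1 hg e, hf e]

/-- The products computed in two charts both restrict on the overlap to the product computed there,
by naturality. -/
theorem exists_fStar (f g : FormalFun n M) : ∃ t : FormalFun n M, ∀ e : HolChart n M,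
    rs e.1.source t = (kd K (isSub_source e)).star (rs e.1.source f) (rs e.1.source g) :=
  exists_glue (N := f.order + g.order)
    (fun e => (kd K (isSub_source e)).van_star ((van_order f).rs _) ((van_order g).rs _))
    fun e e' k x hx hx' => by
      have h1 := star_rs K (isSub_inter e e') (isSub_source e) Set.inter_subset_left f g
      have h2 := star_rs K (isSub_inter e e') (isSub_source e') Set.inter_subset_right f g
      have h3 := congrArg (fun a => (HahnSeries.coeff a k).1 ⟨x, hx, hx'⟩) (h1.trans h2.symm)
      exact (resL_apply Set.inter_subset_left _ ⟨x, hx, hx'⟩).symm.trans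
        (h3.trans (resL_apply Set.inter_subset_right _ ⟨x, hx, hx'⟩))

/-- The Fedosov star-product of Wick type. -/
def fStar (f g : FormalFun n M) : FormalFun n M := (exists_fStar K f g).choose

theorem rs_source_fStar (e : HolChart n M) (f g : FormalFun n M) : rs e.1.source (fStar K f g) =
    (kd K (isSub_source e)).star (rs e.1.source f) (rs e.1.source g) :=
  (exists_fStar K f g).choose_spec e

theorem rs_fStar (f g : FormalFun n M) :
    rs V (fStar K f g) = (kd K hV).star (rs V f) (rs V g) := by
  rw [← resL_rs hV.2, rs_source_fStar, star_rs K hV]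

theorem isFedosovProduct_fStar : IsFedosovProduct K (fedForm K) (fStar K) where
  symbol w _ := exists_isSymbol K w
  lift f := ⟨tauSec K f, ⟨isFlat_tauSec K f, isSymbol_tauSec K f⟩, fun w hw =>
    eq_tauSec K hw.1 hw.2⟩
  mul u v f h hu hv huf hvh := by
    refine ⟨tauSec K (fStar K f h), isFlat_tauSec K _, fun e => ?_, isSymbol_tauSec K _⟩
    rw [eq_tauSec K hu huf, eq_tauSec K hv hvh]
    refine ((rep_tauLoc K (isSub_source e) _).eqOver_iff (Rep.wick K (isSub_source e)
      (rep_tauLoc K (isSub_source e) f) (rep_tauLoc K (isSub_source e) h))).2 ?_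
    rw [rs_source_fStar, KData.tau_star]

end Restriction

end FedosovWick

end

open scoped Manifold ContDiff Topology ComplexOrder

noncomputable section

set_option linter.unusedSectionVars false
set_option linter.unusedSimpArgs false

namespace FedosovWick

/-! ### The Fedosov product is a star-product with separation of variables -/

section StarProduct

variable {n : ℕ} {M : Type*} [TopologicalSpace M] [ChartedSpace (Fin n → ℂ) M]
  [IsManifold 𝓘(ℂ, Fin n → ℂ) ω M] (K : KahlerForm n M)

theorem fStar_assoc (f g h : FormalFun n M) :
    fStar K (fStar K f g) h = fStar K f (fStar K g h) :=
  formalFun_ext fun e => by simp only [rs_source_fStar, KData.star_assoc]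

theorem one_fStar (f : FormalFun n M) : fStar K 1 f = f :=
  formalFun_ext fun e => by rw [rs_source_fStar, rs_one, KData.one_star]

theorem fStar_one (f : FormalFun n M) : fStar K f 1 = f :=
  formalFun_ext fun e => by rw [rs_source_fStar, rs_one, KData.star_one]

theorem fStar_add_left (f g h : FormalFun n M) :
    fStar K (f + g) h = fStar K f h + fStar K g h :=
  formalFun_ext fun e => by simp only [map_add, rs_source_fStar, KData.star_add_left]

theorem fStar_add_right (f g h : FormalFun n M) :
    fStar K f (g + h) = fStar K f g + fStar K f h :=
  formalFun_ext fun e => by simp only [map_add, rs_source_fStar, KData.star_add_right]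

theorem fStar_nu_left (k : ℤ) (f g : FormalFun n M) :
    fStar K (HahnSeries.single k 1 * f) g = HahnSeries.single k 1 * fStar K f g :=
  formalFun_ext fun e => by simp only [rs_source_fStar, rs_single_mul, KData.star_nu_left]

theorem fStar_nu_right (k : ℤ) (f g : FormalFun n M) :
    fStar K f (HahnSeries.single k 1 * g) = HahnSeries.single k 1 * fStar K f g :=
  formalFun_ext fun e => by simp only [rs_source_fStar, rs_single_mul, KData.star_nu_right]

theorem van_fStar (p q : ℤ) (f g : FormalFun n M) (hf : Van p f) (hg : Van q g) :
    Van (p + q) (fStar K f g) :=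
  van_of_rs fun e => by
    rw [rs_source_fStar]
    exact KData.van_star _ (hf.rs _) (hg.rs _)

theorem cochain_fStar_apply (r : ℕ) (f g : SmoothFun n M) (e : HolChart n M) (x : e.1.source) :
    cochain (fStar K) r f g x = (((kd K (isSub_source e)).star
      (HahnSeries.C (resSm e.1.source f)) (HahnSeries.C (resSm e.1.source g))).coeff r).1 x := by
  rw [← rs_C, ← rs_C, ← rs_source_fStar]
  rfl

theorem pdList_eq {e : HolChart n M} {V : Set M} (hV : IsSub e V) (L : List (Idx n))
    {F : M → ℂ} {f : Loc n V} (h : ∀ x : V, F x = f.1 x) :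
    ∀ x : V, pdList e L F x = ((kd K hV).dl L f).1 x := by
  induction L with
  | nil => exact h
  | cons I L ih => exact fun x => zext_dLoc hV I _ ih x

theorem exists_bidiff (r : ℕ) (e : HolChart n M) : ∃ c : List (Fin n) → List (Fin n) → M → ℂ,
    (∀ a b, SmoothOn n (c a b) e.1.source) ∧ ∀ (f h : SmoothFun n M), ∀ x ∈ e.1.source,
      cochain (fStar K) r f h x = ∑ a ∈ KData.lists n (2 * r), ∑ b ∈ KData.lists n (2 * r),
        c a b x * pdList e (a.map Sum.inr) f x * pdList e (b.map Sum.inl) h x := by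
  obtain ⟨c, hc⟩ := (kd K (isSub_source e)).exists_star_coeff r
  refine ⟨fun a b => zext (c a b).1, fun a b => sm _, fun f h x hx => ?_⟩
  rw [cochain_fStar_apply K r f h e ⟨x, hx⟩, hc, ← evL_apply]
  simp only [map_sum, map_mul, evL_apply]
  refine Finset.sum_congr rfl fun a _ => Finset.sum_congr rfl fun b _ => ?_
  rw [pdList_eq K (isSub_source e) (a.map Sum.inr) (F := f) (f := resSm _ f) (fun _ => rfl) ⟨x, hx⟩,
    pdList_eq K (isSub_source e) (b.map Sum.inl) (F := h) (f := resSm _ h) (fun _ => rfl) ⟨x, hx⟩,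
    zext_apply _ (⟨x, hx⟩ : e.1.source)]

theorem separation_fStar : HasSeparationOfVariables (fStar K) := fun r =>
  ⟨KData.lists n (2 * r), KData.lists n (2 * r), exists_bidiff K r⟩

theorem bidifferential_fStar (r : ℕ) :
    IsBidifferential (id : Idx n → Idx n) id (cochain (fStar K) r) := by
  classical
  refine ⟨(KData.lists n (2 * r)).image (List.map Sum.inr), (KData.lists n (2 * r)).image (List.map Sum.inl),
    fun e => ?_⟩
  obtain ⟨c, hc, h⟩ := exists_bidiff K r e
  -- The lists of one type are recovered from their images among all lists of directions by
  -- forgetting the tags.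
  refine ⟨fun a b => c (a.filterMap Sum.getRight?) (b.filterMap Sum.getLeft?), fun a b => hc _ _,
    fun f g x hx => ?_⟩
  have h1 : ∀ a : List (Fin n), (a.map (Sum.inr : Fin n → Idx n)).filterMap Sum.getRight? = a :=
    fun a => by simp [List.filterMap_map, Function.comp_def]
  have h2 : ∀ a : List (Fin n), (a.map (Sum.inl : Fin n → Idx n)).filterMap Sum.getLeft? = a :=
    fun a => by simp [List.filterMap_map, Function.comp_def]
  rw [h f g x hx, Finset.sum_image (List.map_injective_iff.2 Sum.inr_injective).injOn]
  refine Finset.sum_congr rfl fun a _ => ?_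
  rw [Finset.sum_image (List.map_injective_iff.2 Sum.inl_injective).injOn]
  refine Finset.sum_congr rfl fun b _ => ?_
  simp only [h1, h2, List.map_id]

theorem isStarProduct_fStar : IsStarProduct K (fStar K) where
  bidifferential := bidifferential_fStar K
  expansion f h m := coeff_star_eq_finsum (fStar K) (fStar_add_left K) (fStar_add_right K)
    (fStar_nu_left K) (fStar_nu_right K) (van_fStar K) f h m
  cochain_zero f h := ContMDiffMap.ext fun x => by
    rw [cochain_fStar_apply K 0 f h (cat x) ⟨x, mem_cat x⟩]
    exact congrArg (fun t : Loc n _ => t.1 ⟨x, mem_cat x⟩) (KData.coeff_zero_star _ _ _)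
  cochain_one f h e x hx := by
    rw [cochain_fStar_apply K 1 f h e ⟨x, hx⟩, cochain_fStar_apply K 1 h f e ⟨x, hx⟩]
    have e1 := fun f g => (kd K (isSub_source e)).coeff_one_star f g
    rw [Nat.cast_one, e1, e1, ← evL_apply, ← evL_apply]
    simp only [map_sum, map_mul, evL_apply]
    have e2 : ∀ l k, ((kd K (isSub_source e)).h l k).1 ⟨x, hx⟩ = K.ginv e l k x :=
      fun l k => gLoc_inv_apply K _ l k ⟨x, hx⟩
    have e3 : ∀ I (f : SmoothFun n M), ((kd K (isSub_source e)).d I (resSm _ f)).1 ⟨x, hx⟩ =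
        pd e I f x := fun I f => dLoc_of_eq (isSub_source e) I _ (fun _ => rfl) _
    simp only [e2, e3, KahlerForm.poisson]
    -- The factor `I` of the commutator meets the factor `I` inside the Poisson bracket, which
    -- produces the sign of the antisymmetrized first cochain.
    rw [← mul_assoc, Complex.I_mul_I, neg_one_mul, ← Finset.sum_neg_distrib,
      ← Finset.sum_sub_distrib]
    refine Finset.sum_congr rfl fun l _ => ?_
    rw [← Finset.sum_neg_distrib, ← Finset.sum_sub_distrib]
    exact Finset.sum_congr rfl fun k _ => by ring
  assoc := fStar_assoc K
  one_mul := one_fStar K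
  mul_one := fStar_one K

end StarProduct

/-! ### Local formal functions -/

section Local

variable {n : ℕ} {M : Type*} [TopologicalSpace M] [ChartedSpace (Fin n → ℂ) M]

/-- The local formal function `u` is given over `V` by a series with smooth coefficients. -/
def RepL {V : Set M} (u : LaurentSeries (M → ℂ)) (v : LaurentSeries (Loc n V)) : Prop :=
  ∀ k (x : V), u.coeff k x = (v.coeff k).1 x

variable {V : Set M} {u u' : LaurentSeries (M → ℂ)} {v v' : LaurentSeries (Loc n V)}

theorem RepL.mul (h : RepL u v) (h' : RepL u' v') : RepL (u * u') (v * v') := by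
  have key : ∀ {u v}, RepL (n := n) (V := V) u v ↔
      liftL ((resA V : (M → ℂ) →+* (V → ℂ)) : (M → ℂ) →+ (V → ℂ)) u =
      liftL ((locVal n V : Loc n V →+* (V → ℂ)) : Loc n V →+ (V → ℂ)) v := by
    intro u v
    constructor
    · intro h
      ext k x
      exact h k x
    · intro h k x
      exact congrArg (fun t : LaurentSeries (V → ℂ) => t.coeff k x) h
  rw [key] at *
  rw [liftL_mul, liftL_mul, h, h']

theorem RepL.add (h : RepL u v) (h' : RepL u' v') : RepL (u + u') (v + v') := fun k x => by
  rw [HahnSeries.coeff_add, HahnSeries.coeff_add, Pi.add_apply, h k x, h' k x]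
  rfl

theorem RepL.unique (h : RepL u v) (h' : RepL u v') : v = v' := by
  ext k : 2
  exact Loc.ext' fun x => (h k x).symm.trans (h' k x)

theorem RepL.congr (h : RepL u v) (h' : ∀ k, ∀ x ∈ V, u'.coeff k x = u.coeff k x) : RepL u' v :=
  fun k x => (h' k x x.2).trans (h k x)

theorem repL_single {f : M → ℂ} {g : Loc n V} (k : ℤ) (h : ∀ x : V, f x = g.1 x) :
    RepL (HahnSeries.single k f) (HahnSeries.single k g) := fun r x => by
  by_cases hr : r = k
  · subst hr
    rw [HahnSeries.coeff_single_same, HahnSeries.coeff_single_same, h]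
  · rw [HahnSeries.coeff_single_of_ne hr, HahnSeries.coeff_single_of_ne hr]
    rfl

theorem exists_repL (h : FormalSmoothOn n u V) : ∃ v : LaurentSeries (Loc n V), RepL u v :=
  ⟨HahnSeries.ofSuppBddBelow (fun k => mkLoc (u.coeff k) (h k)) ⟨u.order, fun k hk => by
    by_contra hlt
    refine hk (Loc.ext' fun x => ?_)
    change u.coeff k x = 0
    rw [van_order u k (not_le.1 hlt)]
    rfl⟩, fun _ _ => rfl⟩

theorem repL_rs {F : FormalFun n M} (h : ∀ k, ∀ x ∈ V, F.coeff k x = u.coeff k x) :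
    RepL u (rs V F) := fun k x => (h k x x.2).symm

variable [IsManifold 𝓘(ℂ, Fin n → ℂ) ω M] (K : KahlerForm n M) {e : HolChart n M} (hV : IsSub e V)

theorem RepL.pdF (h : RepL u v) (I : Idx n) : RepL (pdF e I u)
    (liftL (((kd K hV).d I : Loc n V →ₗ[ℂ] Loc n V).toAddMonoidHom) v) :=
  fun k x => zext_dLoc hV I (v.coeff k) (h k) x

/-- To compute a local product it suffices to compute it over small open sets. -/
theorem isLocalProduct_of_repL {u f t : LaurentSeries (M → ℂ)}
    (h : ∀ {V : Set M} (hV : IsSub e V) {u' f' : LaurentSeries (Loc n V)}, RepL u u' → RepL f f' →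
      RepL t ((kd K hV).star u' f')) : IsLocalProduct (fStar K) e.1.source u f t := by
  intro x hx F H hF hH k
  obtain ⟨V, hVs, hVo, hxV⟩ := mem_nhds_iff.1 (Filter.inter_mem (Filter.inter_mem hF hH)
    (e.1.open_source.mem_nhds hx))
  have hV : IsSub e V := ⟨hVo, fun y hy => (hVs hy).2⟩
  have h1 := h hV (repL_rs fun k x hx => (hVs hx).1.1 k) (repL_rs fun k x hx => (hVs hx).1.2 k)
  rw [← rs_fStar] at h1
  exact (h1 k ⟨x, hxV⟩).symm

theorem liftL_d_coord (A I : Idx n) (hAI : A ≠ I) {v : LaurentSeries (Loc n V)}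
    (hv : RepL (HahnSeries.C (coord e A)) v) :
    liftL (((kd K hV).d I : Loc n V →ₗ[ℂ] Loc n V).toAddMonoidHom) v = 0 := by
  refine (hv.pdF K hV I).unique fun k x => ?_
  change pd e I ((HahnSeries.C (coord e A) : LaurentSeries (M → ℂ)).coeff k) x = 0
  by_cases hk : k = 0
  · subst hk
    rw [HahnSeries.C_apply, HahnSeries.coeff_single_same, pd_coord e I A (hV.2 x.2), if_neg hAI]
  · rw [HahnSeries.C_apply, HahnSeries.coeff_single_of_ne hk, map_zero]
    rfl

/-- The mixed second derivatives of the potential are ν⁻¹ g_{kl}. Since they commute, one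
computation gives the hypothesis of both `star_potential_left` and `star_potential_right`. -/
theorem repL_potential {Φ : LaurentSeries (M → ℂ)}
    (hΦ : IsFormalPotential (trivialDeformation K) e Φ) (k l : Fin n)
    {a b : LaurentSeries (Loc n V)} (ha : RepL (pdF e (Sum.inl k) Φ) a)
    (hb : RepL (pdF e (Sum.inr l) Φ) b) :
    liftL (((kd K hV).d (Sum.inr l) : Loc n V →ₗ[ℂ] Loc n V).toAddMonoidHom) a =
      HahnSeries.single (-1) ((kd K hV).g k l) ∧
    liftL (((kd K hV).d (Sum.inl k) : Loc n V →ₗ[ℂ] Loc n V).toAddMonoidHom) b =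
      HahnSeries.single (-1) ((kd K hV).g k l) := by
  obtain ⟨φ, hφ⟩ := exists_repL (V := V) fun k => (hΦ.smooth k).mono hV.2
  rw [ha.unique (hφ.pdF K hV _), hb.unique (hφ.pdF K hV _)]
  have h1 : liftL (((kd K hV).d (Sum.inl k) : Loc n V →ₗ[ℂ] Loc n V).toAddMonoidHom)
      (liftL (((kd K hV).d (Sum.inr l) : Loc n V →ₗ[ℂ] Loc n V).toAddMonoidHom) φ) =
      HahnSeries.single (-1) ((kd K hV).g k l) := by
    refine ((hφ.pdF K hV (Sum.inr l)).pdF K hV (Sum.inl k)).unique ?_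
    refine RepL.congr (repL_single (-1) (f := K.g e k l) (g := gLoc K hV k l) fun _ => rfl) ?_
    exact fun r x hx => hΦ.potential k l r x (hV.2 hx)
  refine ⟨Eq.trans ?_ h1, h1⟩
  ext r : 2
  exact (kd K hV).d_comm _ _ _

theorem exists_repL_pdF (hV : IsSub e V) {Φ : LaurentSeries (M → ℂ)}
    (hΦ : IsFormalPotential (trivialDeformation K) e Φ) (I : Idx n) :
    ∃ a : LaurentSeries (Loc n V), RepL (pdF e I Φ) a := by
  obtain ⟨φ, hφ⟩ := exists_repL (V := V) fun k => (hΦ.smooth k).mono hV.2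
  exact ⟨_, hφ.pdF K hV I⟩

theorem relations_fStar {Φ : LaurentSeries (M → ℂ)}
    (hΦ : IsFormalPotential (trivialDeformation K) e Φ) : KarabegovRelations (fStar K) e Φ where
  left_coord k f _ := isLocalProduct_of_repL K fun hV u' f' hu hf => by
    rw [KData.star_hol_left _ fun q => liftL_d_coord K hV _ _ (by simp) hu]
    exact hu.mul hf
  left_potential k f _ := isLocalProduct_of_repL K fun hV u' f' hu hf => by
    rw [KData.star_potential_left (k := k) _ fun q => ?_]
    · exact (hu.mul hf).add (hf.pdF K hV _)
    · obtain ⟨b, hb⟩ := exists_repL_pdF K hV hΦ (Sum.inr q)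
      exact (repL_potential K hV hΦ k q hu hb).1
  right_coord l f _ := isLocalProduct_of_repL K fun hV f' u' hf hu => by
    rw [KData.star_anti_right _ fun q => liftL_d_coord K hV _ _ (by simp) hu]
    exact hu.mul hf
  right_potential l f _ := isLocalProduct_of_repL K fun hV f' u' hf hu => by
    rw [KData.star_potential_right (l := l) _ fun q => ?_]
    · exact (hu.mul hf).add (hf.pdF K hV _)
    · obtain ⟨b, hb⟩ := exists_repL_pdF K hV hΦ (Sum.inl q)
      exact (repL_potential K hV hΦ q l hb hu).2

theorem correspondsTo_fStar : CorrespondsTo (trivialDeformation K) (fStar K) where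
  isStarProduct := isStarProduct_fStar K
  separation := separation_fStar K
  relations _ _ hΦ := relations_fStar K hΦ

end Local

end FedosovWick

end

open scoped Manifold ContDiff Topology ComplexOrder

noncomputable section

set_option linter.unusedSectionVars false
set_option linter.unusedSimpArgs false

namespace FedosovWick

/-! ### Functionals supported at a point -/

section Functional

variable {n : ℕ} {B : Type*} [CommRing B] [Algebra ℂ B] (d : Fin n → Derivation ℂ B B)
  (χ : B →ₐ[ℂ] ℂ)

/-- Elements which vanish to the order `m` at a point in the directions of the derivations. -/
def Vanishes : ℕ → B → Prop
  | 0, _ => True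
  | m + 1, h => χ h = 0 ∧ ∀ j, Vanishes m (d j h)

theorem vanishes_one {h : B} : Vanishes d χ 1 h ↔ χ h = 0 := by simp [Vanishes]

variable {d χ}

theorem Vanishes.add {m : ℕ} : ∀ {h h' : B}, Vanishes d χ m h → Vanishes d χ m h' →
    Vanishes d χ m (h + h') := by
  induction m with
  | zero => intros; trivial
  | succ m ih => exact fun a b => ⟨by rw [map_add, a.1, b.1, add_zero], fun j => by
      rw [map_add]; exact ih (a.2 j) (b.2 j)⟩

theorem vanishes_zero (m : ℕ) : Vanishes d χ m 0 := by
  induction m with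
  | zero => trivial
  | succ m ih => exact ⟨map_zero _, fun j => by rwa [map_zero]⟩

theorem Vanishes.sum {κ : Type*} {m : ℕ} {s : Finset κ} {h : κ → B}
    (hh : ∀ i ∈ s, Vanishes d χ m (h i)) : Vanishes d χ m (∑ i ∈ s, h i) := by
  classical
  induction s using Finset.induction_on with
  | empty => exact vanishes_zero m
  | insert i s hi ih =>
    rw [Finset.sum_insert hi]
    exact (hh i (by simp)).add (ih fun j hj => hh j (by simp [hj]))

theorem Vanishes.pred {m : ℕ} : ∀ {h : B}, Vanishes d χ (m + 1) h → Vanishes d χ m h := by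
  induction m with
  | zero => intros; trivial
  | succ m ih => exact fun a => ⟨a.1, fun j => ih (a.2 j)⟩

theorem Vanishes.mul {m : ℕ} : ∀ (c : B) {h : B}, Vanishes d χ m h → Vanishes d χ m (c * h) := by
  induction m with
  | zero => intros; trivial
  | succ m ih => exact fun c h a => ⟨by rw [map_mul, a.1, mul_zero], fun j => by
      rw [Derivation.leibniz, smul_eq_mul, smul_eq_mul, mul_comm h]
      exact (ih c (a.2 j)).add (ih _ a.pred)⟩

theorem Vanishes.mul_one {m : ℕ} : ∀ {c h : B}, Vanishes d χ 1 c → Vanishes d χ m h →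
    Vanishes d χ (m + 1) (c * h) := by
  induction m with
  | zero => exact fun hc _ => vanishes_one d χ |>.2 (by rw [map_mul, hc.1, zero_mul])
  | succ m ih => exact fun {c h} hc a => ⟨by rw [map_mul, hc.1, zero_mul], fun j => by
      rw [Derivation.leibniz, smul_eq_mul, smul_eq_mul, mul_comm h]
      exact (ih hc (a.2 j)).add (a.mul _)⟩

theorem Vanishes.neg {m : ℕ} {h : B} (a : Vanishes d χ m h) : Vanishes d χ m (-h) := by
  rw [neg_eq_neg_one_mul]
  exact a.mul _

/-- The `ψ k` are coordinates to first order, so Σ ψ_k d_k acts on the leading Taylor term of order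
`m` as multiplication by `m`. The difference loses this term. -/
theorem Vanishes.euler (hd : ∀ i j h, d i (d j h) = d j (d i h)) {ψ : Fin n → B}
    (hψ : ∀ k, χ (ψ k) = 0) (hψd : ∀ j k, χ (d j (ψ k)) = if j = k then 1 else 0) {m : ℕ} :
    ∀ {h : B}, Vanishes d χ m h → Vanishes d χ (m + 1) (m • h - ∑ k, ψ k * d k h) := by
  induction m with
  | zero =>
    intro h _
    rw [vanishes_one]
    simp [hψ]
  | succ m ih =>
    intro h a
    refine ⟨by simp [hψ, a.1], fun j => ?_⟩
    have e : d j ((m + 1) • h - ∑ k, ψ k * d k h) = (m • d j h - ∑ k, ψ k * d k (d j h)) +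
        -∑ k, (d j (ψ k) - if j = k then 1 else 0) * d k h := by
      rw [map_sub, map_nsmul, map_sum, add_smul, one_smul]
      simp only [sub_mul, Finset.sum_sub_distrib, Derivation.leibniz, smul_eq_mul,
        Finset.sum_add_distrib, hd j, ite_mul, one_mul, zero_mul, Finset.sum_ite_eq,
        Finset.mem_univ, if_true, mul_comm (d _ h)]
      ring
    rw [e]
    refine (ih (a.2 j)).add (Vanishes.neg (Vanishes.sum fun k _ => Vanishes.mul_one ?_ (a.2 k)))
    rw [vanishes_one, map_sub, hψd]
    split_ifs <;> simp

/-- A functional of finite order which is multiplicative over coordinates vanishes if it vanishes on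
constants. -/
theorem functional_eq_zero (hd : ∀ i j h, d i (d j h) = d j (d i h)) (A : B →ₗ[ℂ] ℂ) {N : ℕ}
    (hA : ∀ h, Vanishes d χ N h → A h = 0) {φ : Fin n → B}
    (hφ : ∀ l h, A (h * φ l) = χ (φ l) * A h) {g h : Matrix (Fin n) (Fin n) ℂ} (hgh : g * h = 1)
    (hg : ∀ i l, χ (d i (φ l)) = g i l) (h1 : A 1 = 0) : A = 0 := by
  -- Subtracting the values and multiplying by the inverse of the matrix of first derivatives turns
  -- the `φ l` into coordinates centred at the point; the functional kills every multiple of them.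
  set ψ : Fin n → B := fun k => ∑ l, h l k • (φ l - algebraMap ℂ B (χ (φ l))) with hψ
  have hψ0 : ∀ k, χ (ψ k) = 0 := fun k => by
    simp only [hψ, map_sum, map_smul, map_sub, AlgHom.commutes, Algebra.algebraMap_self,
      RingHom.id_apply, sub_self, smul_zero, Finset.sum_const_zero]
  have hψd : ∀ j k, χ (d j (ψ k)) = if j = k then 1 else 0 := fun j k => by
    rw [← Matrix.one_apply, ← hgh, Matrix.mul_apply]
    simp only [hψ, map_sum, Derivation.map_smul, map_smul, map_sub, Derivation.map_algebraMap,
      sub_zero, hg, smul_eq_mul]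
    exact Finset.sum_congr rfl fun l _ => mul_comm _ _
  have hAψ : ∀ k b, A (ψ k * b) = 0 := fun k b => by
    simp only [hψ, Finset.sum_mul, map_sum, smul_mul_assoc, map_smul, sub_mul, map_sub]
    refine Finset.sum_eq_zero fun l _ => ?_
    rw [mul_comm (φ l), hφ, ← Algebra.smul_def, map_smul]
    simp only [smul_eq_mul, sub_self, mul_zero]
  -- Descending induction on the order of vanishing. For `b` vanishing to order m', m' b is a
  -- multiple of coordinates plus an element vanishing to order m' + 1, and m' ≠ 0 can be cancelled.
  -- The case where the truncated subtraction has reached zero is stationary.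
  have key : ∀ m, ∀ b, Vanishes d χ (N - m + 1) b → A b = 0 := by
    intro m
    induction m with
    | zero => exact fun b hb => hA b (Vanishes.pred hb)
    | succ m ih =>
      intro b hb
      by_cases hm : N - m = 0
      · rw [show N - (m + 1) = N - m by omega] at hb
        exact ih b hb
      · have h2 : N - (m + 1) + 1 = N - m := by omega
        rw [h2] at hb
        have h3 := ih _ (hb.euler hd hψ0 hψd)
        rw [map_sub, map_nsmul, map_sum, Finset.sum_eq_zero fun k _ => hAψ k _, sub_zero,
          nsmul_eq_mul, mul_eq_zero, Nat.cast_eq_zero] at h3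
        exact h3.resolve_left hm
  ext b
  have h2 := key N (b - algebraMap ℂ B (χ b)) (by
    rw [Nat.sub_self, zero_add, vanishes_one]
    simp)
  rw [map_sub, sub_eq_zero, Algebra.algebraMap_eq_smul_one, map_smul, h1, smul_zero] at h2
  exact h2

end Functional

end FedosovWick

end

open scoped Manifold ContDiff Topology ComplexOrder

noncomputable section

set_option linter.unusedSectionVars false
set_option linter.unusedSimpArgs false

namespace FedosovWick

/-! ### Localization of star-products -/

section Localization

variable {n : ℕ} {M : Type*} [TopologicalSpace M] [ChartedSpace (Fin n → ℂ) M]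

theorem pdList_congr {e : HolChart n M} {V : Set M} (hV : IsSub e V) (L : List (Idx n))
    {f g : M → ℂ} (h : ∀ y ∈ V, f y = g y) : ∀ y ∈ V, pdList e L f y = pdList e L g y := by
  induction L with
  | nil => exact h
  | cons I L ih => exact fun y hy => pd_congr e I hV.1 hV.2 ih hy

theorem pdList_zero (e : HolChart n M) (L : List (Idx n)) : pdList e L (0 : M → ℂ) = 0 := by
  induction L with
  | nil => rfl
  | cons I L ih =>
    change pd e I (pdList e L 0) = 0
    rw [ih, map_zero]

/-- The values of a formal function. -/
def loc (f : FormalFun n M) : LaurentSeries (M → ℂ) :=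
  liftL (ContMDiffMap.coeFnAddMonoidHom : SmoothFun n M →+ (M → ℂ)) f

theorem loc_coeff (f : FormalFun n M) (k : ℤ) : (loc f).coeff k = ⇑(f.coeff k) := rfl

theorem agreeNear_loc (f : FormalFun n M) (x : M) : AgreeNear f (loc f) x :=
  Filter.Eventually.of_forall fun _ _ => rfl

theorem formalSmoothOn_loc (f : FormalFun n M) (U : Set M) : FormalSmoothOn n (loc f) U :=
  fun k => smoothFun_smoothOn (f.coeff k) U

variable [IsManifold 𝓘(ℂ, Fin n → ℂ) ω M]

/-- Multiplication by a bump function supported in `V`. The neighbourhood `W` does not depend on the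
function, so that infinitely many coefficients can be extended simultaneously. -/
theorem exists_smoothFun_eq [T2Space M] {V : Set M} (hV : IsOpen V) {x : M} (hx : x ∈ V) :
    ∃ W : Set M, IsOpen W ∧ x ∈ W ∧ W ⊆ V ∧ ∀ F : M → ℂ, SmoothOn n F V →
      ∃ G : SmoothFun n M, ∀ y ∈ W, G y = F y := by
  obtain ⟨χ, -, hχ⟩ := (SmoothBumpFunction.nhds_basis_tsupport
    (I := 𝓘(ℝ, Fin n → ℂ)) x).mem_iff.1 (hV.mem_nhds hx)
  obtain ⟨W, hW, hWo, hxW⟩ := mem_nhds_iff.1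
    (Filter.inter_mem χ.eventuallyEq_one (hV.mem_nhds hx))
  refine ⟨W, hWo, hxW, fun y hy => (hW hy).2, fun F hF => ⟨⟨fun y => χ y • F y, ?_⟩, ?_⟩⟩
  · refine contMDiff_of_tsupport fun y hy => ?_
    have hy' : y ∈ V := hχ (tsupport_smul_subset_left χ F hy)
    exact χ.contMDiff.contMDiffAt.smul (ContMDiffOn.contMDiffAt hF (hV.mem_nhds hy'))
  · intro y hy
    have h1 : χ y = 1 := (hW hy).1
    change χ y • F y = F y
    rw [h1, one_smul]

variable {K : KahlerForm n M} {s s' : FormalFun n M → FormalFun n M → FormalFun n M}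

namespace IsStarProduct

theorem cochain_zero_left (hs : IsStarProduct K s) (r : ℕ) (f : SmoothFun n M) :
    cochain s r 0 f = 0 := ContMDiffMap.ext fun x => by
  obtain ⟨S, T, h⟩ := hs.bidifferential r
  obtain ⟨c, -, h⟩ := h (cat x)
  rw [h _ _ x (mem_cat x)]
  refine Finset.sum_eq_zero fun a _ => Finset.sum_eq_zero fun b _ => ?_
  rw [ContMDiffMap.coe_zero, pdList_zero]
  simp

theorem cochain_zero_right (hs : IsStarProduct K s) (r : ℕ) (f : SmoothFun n M) :
    cochain s r f 0 = 0 := ContMDiffMap.ext fun x => by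
  obtain ⟨S, T, h⟩ := hs.bidifferential r
  obtain ⟨c, -, h⟩ := h (cat x)
  rw [h _ _ x (mem_cat x)]
  refine Finset.sum_eq_zero fun a _ => Finset.sum_eq_zero fun b _ => ?_
  rw [ContMDiffMap.coe_zero, pdList_zero]
  simp

/-- Bidifferential operators are local; this permits replacing local potentials by global functions
that agree with them near the point. -/
theorem cochain_congr (hs : IsStarProduct K s) (r : ℕ) (f : SmoothFun n M) {h h' : SmoothFun n M}
    {W : Set M} (hW : IsOpen W) {x : M} (hx : x ∈ W) (hh : ∀ y ∈ W, h y = h' y) :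
    cochain s r f h x = cochain s r f h' x := by
  obtain ⟨S, T, H⟩ := hs.bidifferential r
  obtain ⟨c, -, H⟩ := H (cat x)
  rw [H _ _ x (mem_cat x), H _ _ x (mem_cat x)]
  refine Finset.sum_congr rfl fun a _ => Finset.sum_congr rfl fun b _ => ?_
  rw [pdList_congr (V := W ∩ (cat x : HolChart n M).1.source)
    ⟨hW.inter (cat x).1.open_source, Set.inter_subset_right⟩ _ (fun y hy => hh y hy.1) x
    ⟨hx, mem_cat x⟩]

/-- The first argument contains only ν⁰ and the second one is bounded below, so finitely many
cochains contribute. -/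
theorem coeff_C_left (hs : IsStarProduct K s) (f : SmoothFun n M) {w : FormalFun n M} {N : ℤ}
    (hw : Van N w) {m : ℤ} {L : ℕ} (hL : m < N + L) : (s (HahnSeries.C f) w).coeff m =
      ∑ a ∈ Finset.range L, cochain s a f (w.coeff (m - a)) := by
  rw [hs.expansion, finsum_eq_sum_of_support_subset (s := (Finset.range L).map
    ⟨fun a => (a, (0 : ℤ)), fun a b h => (Prod.mk.inj h).1⟩), Finset.sum_map]
  · refine Finset.sum_congr rfl fun a _ => ?_
    change cochain s a ((HahnSeries.single 0 f).coeff 0) (w.coeff (m - a - 0)) = _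
    rw [HahnSeries.coeff_single_same, sub_zero]
  · rintro ⟨a, i⟩ h
    rw [Function.mem_support] at h
    simp only [Finset.coe_map, Function.Embedding.coeFn_mk, Set.mem_image, Finset.coe_range,
      Set.mem_Iio, Prod.mk.injEq]
    have hi : i = 0 := by
      by_contra hi
      refine h ?_
      simp only [HahnSeries.C_apply, HahnSeries.coeff_single_of_ne hi]
      exact hs.cochain_zero_left _ _
    subst hi
    refine ⟨a, ?_, rfl⟩
    by_contra ha
    refine h ?_
    simp only [sub_zero]
    rw [hw _ (by omega)]
    exact hs.cochain_zero_right _ _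

theorem van_C_C (hs : IsStarProduct K s) (f h : SmoothFun n M) :
    Van 0 (s (HahnSeries.C f) (HahnSeries.C h)) := fun m hm => by
  rw [hs.coeff_C_left f (van_C h) (L := 0) (by simpa using hm)]
  rfl

theorem cochain_one_right (hs : IsStarProduct K s) (r : ℕ) (f : SmoothFun n M) :
    cochain s r f 1 = (HahnSeries.C f : FormalFun n M).coeff r := by
  rw [cochain, map_one, hs.mul_one]

/-- Formal functions which agree with a local one on a neighbourhood of a point. -/
theorem exists_formalFun_eq [T2Space M] {V : Set M} (hV : IsOpen V) {x : M} (hx : x ∈ V) :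
    ∃ W : Set M, IsOpen W ∧ x ∈ W ∧ W ⊆ V ∧
      (∀ F : M → ℂ, SmoothOn n F V → ∃ G : SmoothFun n M, ∀ y ∈ W, G y = F y) ∧
      ∀ u : LaurentSeries (M → ℂ), FormalSmoothOn n u V →
        ∃ G : FormalFun n M, ∀ y ∈ W, ∀ k, G.coeff k y = u.coeff k y := by
  obtain ⟨W, hW, hxW, hWV, h⟩ := exists_smoothFun_eq (n := n) hV hx
  refine ⟨W, hW, hxW, hWV, h, fun u hu => ?_⟩
  choose G hG using fun k => h (u.coeff k) (hu k)
  refine ⟨HahnSeries.ofSuppBddBelow (fun k => if k < u.order then 0 else G k)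
    ⟨u.order, fun k hk => ?_⟩, fun y hy k => ?_⟩
  · by_contra hlt
    exact hk (if_pos (not_le.1 hlt))
  · change (if k < u.order then 0 else G k : SmoothFun n M) y = _
    split_ifs with hk
    · rw [van_order u k hk]
      rfl
    · exact hG k y hy

/-- The product with a derivative of the potential relates cochains of consecutive orders. -/
theorem cochain_mul_potential (hs : IsStarProduct K s) (hs' : IsStarProduct K s')
    {e : HolChart n M} {u : LaurentSeries (M → ℂ)} (hu : Van (-1) u) {I : Idx n}
    (hr : RightMulEq s e.1.source u fun f => u * f + pdF e I f)
    (hr' : RightMulEq s' e.1.source u fun f => u * f + pdF e I f) {r : ℕ}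
    (ih : ∀ a < r, cochain s a = cochain s' a) {W : Set M} (hW : IsOpen W) (hWe : W ⊆ e.1.source)
    {x : M} (hx : x ∈ W) {G : FormalFun n M} (hG : ∀ y ∈ W, ∀ k, G.coeff k y = u.coeff k y)
    (f h : SmoothFun n M) :
    cochain s' r f (h * G.coeff (-1)) x - cochain s r f (h * G.coeff (-1)) x =
      u.coeff (-1) x * (cochain s' r f h x - cochain s r f h x) := by
  have hGu : ∀ y ∈ W, AgreeNear G u y := fun y hy =>
    Filter.mem_of_superset (hW.mem_nhds hy) fun z hz => hG z hz
  have key : ∀ {s : FormalFun n M → FormalFun n M → FormalFun n M}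
      (_ : RightMulEq s e.1.source u fun f => u * f + pdF e I f) (T : FormalFun n M) (y : M)
      (_ : y ∈ W) (k : ℤ), (s T G).coeff k y = (u * loc T + pdF e I (loc T)).coeff k y :=
    fun hr T y hy k => hr (loc T) (formalSmoothOn_loc T _) y (hWe hy) T G (agreeNear_loc T y)
      (hGu y hy) k
  set P := s (HahnSeries.C h) G with hP
  set P' := s' (HahnSeries.C h) G with hP'
  -- Both products multiply from the right by the potential derivative in the same way, so `h ∗ u`
  -- is the same near the point for both, with leading term ν⁻¹ u₋₁ h.
  have hPP : ∀ k, ∀ y ∈ W, P.coeff k y = P'.coeff k y := fun k y hy => by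
    rw [hP, hP', key hr _ y hy, key hr' _ y hy]
  have hloc : loc (HahnSeries.C h) = HahnSeries.C ⇑h := liftL_C _ _
  have hP0 : ∀ k < -1, ∀ y ∈ W, P.coeff k y = 0 := fun k hk y hy => by
    rw [hP, key hr _ y hy, hloc]
    have h1 := (hu.mul (van_C (⇑h))) k (by omega)
    rw [HahnSeries.coeff_add, h1, pdF]
    simp [HahnSeries.C_apply, HahnSeries.coeff_single_of_ne (show k ≠ 0 by omega)]
  have hP1 : ∀ y ∈ W, P.coeff (-1) y = (h * G.coeff (-1)) y := fun y hy => by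
    rw [hP, key hr _ y hy, hloc]
    have h1 : (u * HahnSeries.C ⇑h).coeff (-1) = u.coeff (-1) * ⇑h := by
      rw [HahnSeries.C_apply, HahnSeries.coeff_mul_single_zero]
    rw [HahnSeries.coeff_add, h1, pdF]
    simp [HahnSeries.C_apply, HahnSeries.coeff_single_of_ne (show (-1 : ℤ) ≠ 0 by omega),
      hG y hy, mul_comm]
  obtain ⟨N, hN, hN'⟩ : ∃ N, Van N P ∧ Van N P' :=
    ⟨min P.order P'.order, (van_order P).mono (min_le_left _ _),
      (van_order P').mono (min_le_right _ _)⟩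
  obtain ⟨L, hL, hrL⟩ : ∃ L : ℕ, (r : ℤ) - 1 < N + L ∧ r < L :=
    ⟨(r - N).toNat + r + 1, by omega, by omega⟩
  -- Coefficient of ν^(r-1) in f ∗ (h ∗ u): cochains of order below `r` agree by induction, those
  -- above `r` meet vanishing coefficients, and order `r` meets the leading one.
  have e1 : (s' (HahnSeries.C f) P').coeff (r - 1) x - (s (HahnSeries.C f) P).coeff (r - 1) x =
      cochain s' r f (h * G.coeff (-1)) x - cochain s r f (h * G.coeff (-1)) x := by
    rw [hs.coeff_C_left f hN hL, hs'.coeff_C_left f hN' hL]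
    have hsum : ∀ (F : ℕ → SmoothFun n M), (∑ a ∈ Finset.range L, F a) x =
        ∑ a ∈ Finset.range L, F a x := fun F =>
      congrFun (map_sum (ContMDiffMap.coeFnAddMonoidHom : SmoothFun n M →+ (M → ℂ)) F _) x |>.trans
        (Finset.sum_apply _ _ _)
    rw [hsum, hsum, ← Finset.sum_sub_distrib, Finset.sum_eq_single r]
    · have e2 : (r : ℤ) - 1 - r = -1 := by ring
      rw [e2, hs.cochain_congr r f hW hx hP1,
        hs'.cochain_congr r f hW hx fun y hy => (hPP _ y hy).symm.trans (hP1 y hy)]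
    · intro a _ ha
      rcases lt_or_gt_of_ne ha with h1 | h1
      · rw [ih a h1, hs'.cochain_congr a f hW hx (hPP _), sub_self]
      · have h2 : ∀ y ∈ W, P.coeff (r - 1 - a) y = (0 : SmoothFun n M) y :=
          fun y hy => hP0 _ (by omega) y hy
        rw [hs.cochain_congr a f hW hx h2,
          hs'.cochain_congr a f hW hx fun y hy => (hPP _ y hy).symm.trans (h2 y hy),
          hs.cochain_zero_right, hs'.cochain_zero_right, sub_self]
    · exact fun h => absurd (Finset.mem_range.2 hrL) h
  -- By associativity the same coefficient comes from (f ∗ h) ∗ u. The two products `f ∗ h` agree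
  -- below ν^r, so the derivative term cancels and only u₋₁ times the difference of the r-th
  -- cochains remains.
  rw [← e1, hP, hP', ← hs.assoc, ← hs'.assoc, key hr _ x hx, key hr' _ x hx]
  set T := s (HahnSeries.C f) (HahnSeries.C h) with hT
  set T' := s' (HahnSeries.C f) (HahnSeries.C h) with hT'
  have hTT : ∀ k < (r : ℤ), T'.coeff k = T.coeff k := fun k hk => by
    by_cases h0 : k < 0
    · rw [hs.van_C_C f h k h0, hs'.van_C_C f h k h0]
    · obtain ⟨a, rfl⟩ := Int.eq_ofNat_of_zero_le (not_lt.1 h0)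
      have := congrFun (congrFun (ih a (by exact_mod_cast hk)) f) h
      exact this.symm
  have hΔ : Van r (loc T' - loc T) := fun k hk => by
    rw [HahnSeries.coeff_sub, loc_coeff, loc_coeff, hTT k hk, sub_self]
  have h1 : (u * loc T').coeff ((r : ℤ) - 1) - (u * loc T).coeff ((r : ℤ) - 1) =
      u.coeff (-1) * (loc T' - loc T).coeff r := by
    rw [← HahnSeries.coeff_sub, ← mul_sub, coeff_mul_of_van hu hΔ]
    have e2 : (r : ℤ) - 1 - r = -1 := by ring
    rw [e2, Finset.Icc_self, Finset.sum_singleton]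
    congr 2
    ring
  have h2 : (pdF e I (loc T')).coeff ((r : ℤ) - 1) = (pdF e I (loc T)).coeff ((r : ℤ) - 1) := by
    change pd e I ((loc T').coeff _) = pd e I ((loc T).coeff _)
    rw [loc_coeff, loc_coeff, hTT _ (by omega)]
  have h3 := congrFun h1 x
  rw [HahnSeries.coeff_add, HahnSeries.coeff_add, h2, Pi.add_apply, Pi.add_apply]
  simp only [Pi.sub_apply, Pi.mul_apply, HahnSeries.coeff_sub, loc_coeff] at h3
  rw [add_sub_add_right_eq_sub, h3]
  rfl

end IsStarProduct

end Localization

end FedosovWick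

end

open scoped Manifold ContDiff Topology ComplexOrder

noncomputable section

set_option linter.unusedSectionVars false
set_option linter.unusedSimpArgs false

namespace FedosovWick

/-! ### Uniqueness of the star-product -/

section Uniqueness

variable {n : ℕ} {M : Type*} [TopologicalSpace M] [ChartedSpace (Fin n → ℂ) M]
  [IsManifold 𝓘(ℂ, Fin n → ℂ) ω M] {K : KahlerForm n M}

/-- Evaluation at a point. -/
def evA {V : Set M} (x : V) : Loc n V →ₐ[ℂ] ℂ := (Pi.evalAlgHom ℂ _ x).comp (locVal n V)

/-- Iterated derivatives as linear maps. -/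
def dlLin {B : Type*} [CommRing B] [Algebra ℂ B] (D : KData n B) (L : List (Idx n)) : B →ₗ[ℂ] B where
  toFun := D.dl L
  map_add' f g := by
    induction L with
    | nil => rfl
    | cons I L ih =>
      change D.d I (D.dl L (f + g)) = D.d I (D.dl L f) + D.d I (D.dl L g)
      rw [ih, map_add]
  map_smul' c f := by
    induction L with
    | nil => rfl
    | cons I L ih =>
      change D.d I (D.dl L (c • f)) = c • D.d I (D.dl L f)
      rw [ih, RingHom.id_apply, Derivation.map_smul]

theorem Vanishes.dl {B : Type*} [CommRing B] [Algebra ℂ B] (D : KData n B) {χ : B →ₐ[ℂ] ℂ}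
    (L : List (Fin n)) : ∀ {m : ℕ} {h : B},
    Vanishes (fun j => D.d (Sum.inl j)) χ (m + L.length) h →
      Vanishes (fun j => D.d (Sum.inl j)) χ m (D.dl (L.map Sum.inl) h) := by
  induction L with
  | nil => exact fun a => a
  | cons j L ih =>
    intro m h a
    have h1 := ih (m := m + 1) (h := h) (by
      rwa [add_assoc, add_comm 1, ← List.length_cons (a := j)])
    exact h1.2 j

/-- Operators with separation of variables give functionals of finite order. -/
theorem exists_functional {C : SmoothFun n M → SmoothFun n M → SmoothFun n M}
    (hC : IsBidifferential (Sum.inr : Fin n → Idx n) (Sum.inl : Fin n → Idx n) C) {e : HolChart n M}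
    (x : e.1.source) (f : SmoothFun n M) : ∃ (A : Loc n e.1.source →ₗ[ℂ] ℂ) (N : ℕ),
      (∀ h, C f h x = A (resSm _ h)) ∧
      (∀ N' ≥ N, ∀ h, Vanishes (fun j => (kd K (isSub_source e)).d (Sum.inl j)) (evA x) N' h →
        A h = 0) ∧
      ∀ (W : Set M) (_ : IsOpen W) (_ : W ⊆ e.1.source) (_ : x.1 ∈ W) (h h' : Loc n e.1.source),
        (∀ y ∈ W, zext h.1 y = zext h'.1 y) → A h = A h' := by
  obtain ⟨S, T, H⟩ := hC
  obtain ⟨c, -, H⟩ := H e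
  set D := kd K (isSub_source e) with hD
  have hval : ∀ (b : List (Fin n)) (h : Loc n e.1.source), evA x (D.dl (b.map Sum.inl) h) =
      pdList e (b.map Sum.inl) (zext h.1) x := fun b h =>
    (pdList_eq K (isSub_source e) (b.map Sum.inl) (F := zext h.1) (f := h)
      (fun y => zext_apply _ y) x).symm
  refine ⟨∑ b ∈ T, (∑ a ∈ S, c a b x * pdList e (a.map Sum.inr) f x) •
    (evA x).toLinearMap.comp (dlLin D (b.map Sum.inl)), T.sup List.length + 1,
    fun h => ?_, fun N' hN' h hh => ?_, fun W hW hWe hxW h h' hhh => ?_⟩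
  · rw [H f h x x.2, Finset.sum_comm, LinearMap.sum_apply]
    refine Finset.sum_congr rfl fun b _ => ?_
    rw [LinearMap.smul_apply, Finset.sum_smul]
    refine Finset.sum_congr rfl fun a _ => ?_
    rw [smul_eq_mul]
    congr 1
    refine Eq.trans ?_ (hval b (resSm _ h)).symm
    exact pdList_congr (isSub_source e) _ (fun y hy => (zext_apply (resSm _ h).1 ⟨y, hy⟩).symm) x x.2
  · rw [LinearMap.sum_apply]
    refine Finset.sum_eq_zero fun b hb => ?_
    rw [LinearMap.smul_apply]
    have hlen : b.length ≤ T.sup List.length := Finset.le_sup (f := List.length) hb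
    have h1 := Vanishes.dl D b (m := N' - b.length - 1 + 1) (h := h) (χ := evA x) (by
      rwa [show N' - b.length - 1 + 1 + b.length = N' by omega])
    have h2 : ((evA x).toLinearMap.comp (dlLin D (b.map Sum.inl))) h = 0 := h1.1
    rw [h2, smul_zero]
  · rw [LinearMap.sum_apply, LinearMap.sum_apply]
    refine Finset.sum_congr rfl fun b _ => ?_
    rw [LinearMap.smul_apply, LinearMap.smul_apply]
    congr 1
    refine (hval b h).trans (Eq.trans ?_ (hval b h').symm)
    exact pdList_congr ⟨hW, hWe⟩ _ hhh x hxW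

variable [T2Space M] {s s' : FormalFun n M → FormalFun n M → FormalFun n M}

/-- For fixed `f` and point `x`, the difference of the r-th cochains is a functional of the
holomorphic jet of `h`. It is multiplicative over the functions ∂Φ₋₁/∂z̄^l, whose holomorphic
derivatives form the invertible matrix g, and it vanishes at 1 because 1 is a unit for both
products. -/
theorem cochain_eq_of_relations (hs : IsStarProduct K s) (hs' : IsStarProduct K s')
    (hsep : HasSeparationOfVariables s) (hsep' : HasSeparationOfVariables s') {e : HolChart n M}
    {Φ : LaurentSeries (M → ℂ)} (hΦ : IsFormalPotential (trivialDeformation K) e Φ)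
    (hr : KarabegovRelations s e Φ) (hr' : KarabegovRelations s' e Φ) {r : ℕ}
    (ih : ∀ a < r, cochain s a = cochain s' a) (x : e.1.source) (f h : SmoothFun n M) :
    cochain s r f h x = cochain s' r f h x := by
  obtain ⟨A, N, hA, hAN, hAW⟩ := exists_functional (K := K) (hsep r) x f
  obtain ⟨A', N', hA', hAN', hAW'⟩ := exists_functional (K := K) (hsep' r) x f
  have hφs : ∀ l : Fin n, SmoothOn n (pd e (Sum.inr l) (Φ.coeff (-1))) e.1.source := fun l =>
    (hΦ.smooth (-1)).pd e.1.open_source subset_rfl _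
  have hu : ∀ l : Fin n, Van (-1) (pdF e (Sum.inr l) Φ) := fun l k hk => by
    change pd e (Sum.inr l) (Φ.coeff k) = 0
    rw [hΦ.coeff_lt k hk, map_zero]
  have hdet : IsUnit (Matrix.of fun k l => K.g e k l x.1).det :=
    (K.posDef e x x.2).det_pos.ne'.isUnit
  obtain ⟨W, hW, hxW, hWe, hsm, hfm⟩ :=
    IsStarProduct.exists_formalFun_eq (n := n) e.1.open_source x.2
  have key : A' - A = 0 := by
    refine functional_eq_zero (d := fun j => (kd K (isSub_source e)).d (Sum.inl j)) (χ := evA x)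
      (fun i j h => (kd K (isSub_source e)).d_comm _ _ h) (A' - A) (N := max N N') (fun h hh => ?_)
      (φ := fun l => mkLoc _ (hφs l)) (fun l h => ?_) (Matrix.mul_nonsing_inv _ hdet)
      (fun i l => ?_) ?_
    · rw [LinearMap.sub_apply, hAN _ (le_max_left _ _) h hh, hAN' _ (le_max_right _ _) h hh,
        sub_self]
    -- The relation was proved for global functions. Both `h` and the potential derivative are
    -- replaced by global functions that agree with them near `x`, which the functionals do not
    -- notice.
    · obtain ⟨H, hH⟩ := hsm (zext h.1) (sm h)
      obtain ⟨G, hG⟩ := hfm (pdF e (Sum.inr l) Φ) fun k =>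
        (hΦ.smooth k).pd e.1.open_source subset_rfl _
      have h1 := IsStarProduct.cochain_mul_potential hs hs' (hu l) (hr.right_potential l)
        (hr'.right_potential l) ih hW hWe hxW hG f H
      have h2 : ∀ y ∈ W, zext h.1 y = zext (resSm e.1.source H).1 y := fun y hy => by
        rw [zext_apply (resSm e.1.source H).1 ⟨y, hWe hy⟩]
        exact (hH y hy).symm
      have h3 : ∀ y ∈ W, zext (h * mkLoc _ (hφs l)).1 y =
          zext (resSm e.1.source (H * G.coeff (-1))).1 y := fun y hy => by
        rw [zext_apply (resSm e.1.source (H * G.coeff (-1))).1 ⟨y, hWe hy⟩,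
          zext_apply (h * mkLoc _ (hφs l)).1 ⟨y, hWe hy⟩]
        change h.1 ⟨y, hWe hy⟩ * pd e (Sum.inr l) (Φ.coeff (-1)) y = H y * G.coeff (-1) y
        rw [hH y hy, hG y hy, zext_apply h.1 ⟨y, hWe hy⟩]
        rfl
      rw [hA, hA, hA', hA', ← hAW W hW hWe hxW _ _ h2, ← hAW' W hW hWe hxW _ _ h2,
        ← hAW W hW hWe hxW _ _ h3, ← hAW' W hW hWe hxW _ _ h3] at h1
      exact h1
    · refine (dLoc_of_eq (isSub_source e) (Sum.inl i) (mkLoc _ (hφs l))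
        (F := pd e (Sum.inr l) (Φ.coeff (-1)))
        (fun _ => rfl) x).trans ?_
      refine (hΦ.potential i l (-1) x x.2).trans ?_
      change (HahnSeries.single (-1) (K.g e i l)).coeff (-1) x.1 = _
      rw [HahnSeries.coeff_single_same]
      rfl
    · have h1 : (1 : Loc n e.1.source) = resSm _ 1 := rfl
      rw [LinearMap.sub_apply, h1, ← hA, ← hA', hs.cochain_one_right, hs'.cochain_one_right,
        sub_self]
  rw [hA, hA', ← sub_eq_zero, ← neg_eq_zero, neg_sub, ← LinearMap.sub_apply, key,
    LinearMap.zero_apply]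

/-- A star-product is determined by its cochains, and these agree by strong induction on the order,
one point and one chart at a time. -/
theorem star_eq_of_relations (hs : IsStarProduct K s) (hs' : IsStarProduct K s')
    (hsep : HasSeparationOfVariables s) (hsep' : HasSeparationOfVariables s')
    (h : ∀ x : M, ∃ (e : HolChart n M) (Φ : LaurentSeries (M → ℂ)), x ∈ e.1.source ∧
      IsFormalPotential (trivialDeformation K) e Φ ∧ KarabegovRelations s e Φ ∧
        KarabegovRelations s' e Φ) : s = s' := by
  have hc : ∀ r, cochain s r = cochain s' r := fun r => by
    induction r using Nat.strong_induction_on with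
    | _ r ih =>
      funext f g
      refine ContMDiffMap.ext fun x => ?_
      obtain ⟨e, Φ, hx, hΦ, hr, hr'⟩ := h x
      exact cochain_eq_of_relations hs hs' hsep hsep' hΦ hr hr' ih ⟨x, hx⟩ f g
  funext f g
  ext m : 2
  simp only [hs.expansion, hs'.expansion, hc]

end Uniqueness

end FedosovWick

end
theorem mainTheorem1 {n : ℕ} {M : Type*} [TopologicalSpace M] [T2Space M]
    [ChartedSpace (Fin n → ℂ) M] [IsManifold 𝓘(ℂ, Fin n → ℂ) ω M] (K : KahlerForm n M) :
    ∃ (r : WOneForm n M) (star : FormalFun n M → FormalFun n M → FormalFun n M),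
      (IsFedosovElement K r ∧ ∀ r', IsFedosovElement K r' → r' = r) ∧
      IsFedosovProduct K r star ∧
      CorrespondsTo (trivialDeformation K) star ∧
      ∀ star' : FormalFun n M → FormalFun n M → FormalFun n M,
        IsStarProduct K star' → HasSeparationOfVariables star' →
        (∀ x : M, ∃ (e : HolChart n M) (Φ : LaurentSeries (M → ℂ)), x ∈ e.1.source ∧
          IsFormalPotential (trivialDeformation K) e Φ ∧ KarabegovRelations star' e Φ) →
        star' = star := by
  refine ⟨fedForm K, fStar K, ⟨isFedosovElement_fedForm K, fun r' hr' => eq_fedForm K hr'⟩,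
    isFedosovProduct_fStar K, correspondsTo_fStar K, fun star' hs' hsep' h => ?_⟩
  refine star_eq_of_relations hs' (isStarProduct_fStar K) hsep' (separation_fStar K) fun x => ?_
  obtain ⟨e, Φ, hx, hΦ, hr⟩ := h x
  exact ⟨e, Φ, hx, hΦ, hr, relations_fStar K hΦ⟩
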